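/- Let $d\in\mathbb N$, let $\mu,\gamma,\beta>0$, let $V\in C^\infty(\mathbb R^d;\mathbb R)$, and put $H(\boldsymbol p,\boldsymbol q)=\|\boldsymbol p\|^2/(2\mu)+V(\boldsymbol q)$. Assume that $Z=\int_{\mathbb R^{2d}}e^{-\beta H}\,d\boldsymbol p\,d\boldsymbol q<\infty$, and put $\rho_{eq}=Z^{-1}e^{-\beta H}$. Suppose that 1. for every multi-index $\alpha$ with $|\alpha|\ge 1$ there is $C_\alpha>0$ with $|\partial^\alpha V(\boldsymbol q)|\le C_\alpha\sqrt{1+\|\nabla V(\boldsymbol q)\|^2}$ for all $\boldsymbol q\in\mathbb R^d$; 2. there are an integer $M\ge1$ and $C\ge 1$ with $C^{-1}(1+\|\boldsymbol q\|^2)^{1/(2M)}\le\sqrt{1+\|\nabla V(\boldsymbol q)\|^2}\le C(1+\|\boldsymbol q\|^2)^{M/2}$ for all $\boldsymbol q\in\mathbb R^d$. Consider the (negative) Langevin Kolmogorov operator $$\mathcal K=-\frac{\boldsymbol p}{\mu}\cdot\nabla_{\boldsymbol q}+\nabla V(\boldsymbol q)\cdot\nabla_{\boldsymbol p}+\gamma\Big(\frac{\boldsymbol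 p}{\mu}\cdot\nabla_{\boldsymbol p}-\frac1\beta\Delta_{\boldsymbol p}\Big)$$ in $L^2(\mathbb R^{2d};\rho_{eq})$ and $$\tilde{\mathcal K}=-\frac{\boldsymbol p}{\mu}\cdot\nabla_{\boldsymbol q}+\nabla V(\boldsymbol q)\cdot\nabla_{\boldsymbol p}+\frac\gamma\beta\Big(-\nabla_{\boldsymbol p}+\frac{\beta}{2\mu}\boldsymbol p\Big)\cdot\Big(\nabla_{\boldsymbol p}+\frac{\beta}{2\mu}\boldsymbol p\Big)$$ in $L^2(\mathbb R^{2d})$, both understood as the closures of these differential operators on $C_c^\infty(\mathbb R^{2d};\mathbb C)$. All $L^2$ spaces are complex, and $\langle f,g\rangle_{\rho_{eq}}=\int f\,\overline g\,\rho_{eq}$. Let $\mathcal U:L^2(\mathbb R^{2d})\to L^2(\mathbb R^{2d};\rho_{eq})$, $\mathcal Ug=\sqrt Z\,e^{\beta H/2}g$, be the unitary transformation between the two spaces. For an orthogonal projection $\mathcal P$ on $L^2(\mathbb R^{2d};\rho_{eq})$ put $\tilde{\mathcal P}=\mathcal U^{-1}\mathcal P\,\mathcal U$ and $\tilde{\mathcal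 Q}=I-\tilde{\mathcal P}$, and give $\tilde{\mathcal Q}\tilde{\mathcal K}\tilde{\mathcal Q}$ its natural domain $\{u:\tilde{\mathcal Q}u\in D(\tilde{\mathcal K})\}$. (i) Let $v_1,\dots,v_m\in L^2(\mathbb R^{2d};\rho_{eq})$ be orthonormal with $\int v_i\,\rho_{eq}=0$ for all $i$, and let $\mathcal P=\sum_{i=1}^m\langle\,\cdot\,,v_i\rangle_{\rho_{eq}}v_i$. If $w_1,\dots,w_m\in D(\mathcal K)$ satisfy $\langle w_j,v_i\rangle_{\rho_{eq}}=0$ for all $i,j$ and $\mathcal Kw_j=v_j$ for all $j$, then $$\mathrm{Ker}(\tilde{\mathcal Q}\tilde{\mathcal K}\tilde{\mathcal Q})=\mathrm{Ker}(\tilde{\mathcal K})+\mathrm{Ran}(\tilde{\mathcal P})+\mathrm{Span}\{w_je^{-\beta H/2}\}_{j=1}^m ,$$ where $+$ is the sum of linear subspaces. (ii) For every $j\in\{1,\dots,d\}$ the function $v=\sqrt{\beta/\mu}\,p_j$ is a unit vector of $L^2(\mathbb R^{2d};\rho_{eq})$, and if $\mathcal P=\langle\,\cdot\,,v\rangle_{\rho_{eq}}v$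 is the orthogonal projection onto the span of $p_j$, then $$\sigma(\tilde{\mathcal Q}\tilde{\mathcal K}\tilde{\mathcal Q})\cap i\mathbb R\subseteq\{0\}.$$ -/

import Mathlib

open MeasureTheory
open scoped ENNReal ContDiff Gradient

noncomputable section

/-! ### Unbounded operators on a Hilbert space -/

section Unbounded

variable {H : Type*} [NormedAddCommGroup H] [InnerProductSpace ℂ H]

/-- The kernel of a partially defined operator, as a subspace of the ambient space. -/
def pmapKer (T : H →ₗ.[ℂ] H) : Submodule ℂ H :=
  (LinearMap.ker T.toFun).map T.domain.subtype

/-- The composition `Q T Q` of an unbounded operator `T` with a bounded operator `Q`, on its natural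
domain `{u | Q u ∈ D(T)}`. -/
def pmapSandwich (Q : H →L[ℂ] H) (T : H →ₗ.[ℂ] H) : H →ₗ.[ℂ] H where
  domain := T.domain.comap (Q : H →ₗ[ℂ] H)
  toFun := (Q : H →ₗ[ℂ] H) ∘ₗ T.toFun ∘ₗ
    ((Q : H →ₗ[ℂ] H).restrict (p := T.domain.comap (Q : H →ₗ[ℂ] H)) (q := T.domain)
      fun _ hu => hu)

/-- The resolvent set of an unbounded operator: those `z` for which `T - z` is a bijection from
`D(T)` onto the whole space with an everywhere defined bounded inverse `R`. -/
def pmapResolventSet (T : H →ₗ.[ℂ] H) : Set ℂ :=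
  {z | ∃ R : H →L[ℂ] H,
    (∀ f : H, ∃ h : R f ∈ T.domain, T ⟨R f, h⟩ - z • R f = f) ∧
    ∀ u : T.domain, R (T u - z • (u : H)) = u}

/-- The spectrum of an unbounded operator. -/
def pmapSpectrum (T : H →ₗ.[ℂ] H) : Set ℂ := (pmapResolventSet T)ᶜ

/-- The projection `P h = ∑ i, ⟨h, v i⟩ v i` (Mathlib's inner product is linear in its second
argument, hence the order of the arguments). -/
def moriProjection {m : ℕ} (v : Fin m → H) : H →L[ℂ] H :=
  ∑ i, (innerSL ℂ (v i)).smulRight (v i)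

end Unbounded

/-! ### Phase space, test functions, minimal realizations -/

/-- Phase space `ℝ^d × ℝ^d`; a point is written `x = (q, p)`, so `x.1 = q` is the position and
`x.2 = p` the momentum. -/
abbrev Phase (d : ℕ) : Type := EuclideanSpace ℝ (Fin d) × EuclideanSpace ℝ (Fin d)

variable {d : ℕ}

/-- Smooth compactly supported complex functions on phase space. -/
def IsTest (φ : Phase d → ℂ) : Prop := ContDiff ℝ ∞ φ ∧ HasCompactSupport φ

/-- The partial derivative `∂φ/∂q_i`. -/
def dq (i : Fin d) (φ : Phase d → ℂ) (x : Phase d) : ℂ :=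
  fderiv ℝ φ x (EuclideanSpace.single i 1, 0)

/-- The partial derivative `∂φ/∂p_i`. -/
def dp (i : Fin d) (φ : Phase d → ℂ) (x : Phase d) : ℂ :=
  fderiv ℝ φ x (0, EuclideanSpace.single i 1)

/-- `A` acts linearly on smooth functions. -/
def LinearOnSmooth (A : (Phase d → ℂ) → Phase d → ℂ) : Prop :=
  (∀ φ ψ, ContDiff ℝ ∞ φ → ContDiff ℝ ∞ ψ → A (φ + ψ) = A φ + A ψ) ∧
  ∀ (c : ℂ) (φ), ContDiff ℝ ∞ φ → A (c • φ) = c • A φ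

/-- The graph `{(φ, A φ) | φ ∈ C_c^∞}` in `L²(ν) × L²(ν)` of a linear differential expression `A`. -/
def testGraph (ν : Measure (Phase d)) (A : (Phase d → ℂ) → Phase d → ℂ) (hA : LinearOnSmooth A) :
    Submodule ℂ (Lp ℂ 2 ν × Lp ℂ 2 ν) where
  carrier := {uf | ∃ φ, IsTest φ ∧ uf.1 =ᵐ[ν] φ ∧ uf.2 =ᵐ[ν] A φ}
  add_mem' := by
    rintro ⟨u, f⟩ ⟨u', f'⟩ ⟨φ, hφ, h1, h2⟩ ⟨ψ, hψ, h3, h4⟩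
    refine ⟨φ + ψ, ⟨hφ.1.add hψ.1, hφ.2.add hψ.2⟩, ?_, ?_⟩
    · exact (Lp.coeFn_add u u').trans (h1.add h3)
    · rw [hA.1 φ ψ hφ.1 hψ.1]
      exact (Lp.coeFn_add f f').trans (h2.add h4)
  zero_mem' := by
    have h0 : A 0 = 0 := by
      have := hA.2 0 0 contDiff_const
      simpa using this
    refine ⟨0, ⟨contDiff_const, HasCompactSupport.zero⟩, ?_, ?_⟩
    · exact Lp.coeFn_zero ℂ 2 ν
    · rw [h0]
      exact Lp.coeFn_zero ℂ 2 ν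
  smul_mem' := by
    rintro c ⟨u, f⟩ ⟨φ, hφ, h1, h2⟩
    refine ⟨c • φ, ⟨hφ.1.const_smul c, hφ.2.mono (Function.support_const_smul_subset c φ)⟩, ?_, ?_⟩
    · exact (Lp.coeFn_smul c u).trans (h1.const_smul c)
    · rw [hA.2 c φ hφ.1]
      exact (Lp.coeFn_smul c f).trans (h2.const_smul c)

/-- The closed operator on `L²(ν)` whose graph is the closure of `{(φ, A φ) | φ ∈ C_c^∞}`. (The
expressions used below have a formal adjoint on `C_c^∞`, so this closure is again a graph.) -/
def closedRealization (ν : Measure (Phase d)) (A : (Phase d → ℂ) → Phase d → ℂ)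
    (hA : LinearOnSmooth A) : Lp ℂ 2 ν →ₗ.[ℂ] Lp ℂ 2 ν :=
  (testGraph ν A hA).topologicalClosure.toLinearPMap

/-! ### Multiplication by a positive weight as a unitary map -/

section Weight

variable {α : Type*} [MeasurableSpace α] {ν : Measure α}

theorem eLpNorm_weight {ρ η : α → ℝ} (hρ : Measurable ρ)
    (h : ∀ x, ENNReal.ofReal (ρ x) * ‖η x‖ₑ ^ 2 = 1) (g : α → ℂ) :
    eLpNorm (fun x => (η x : ℂ) * g x) 2 (ν.withDensity fun x => ENNReal.ofReal (ρ x))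
      = eLpNorm g 2 ν := by
  rw [eLpNorm_eq_lintegral_rpow_enorm_toReal (by norm_num) (by norm_num),
    eLpNorm_eq_lintegral_rpow_enorm_toReal (by norm_num) (by norm_num),
    lintegral_withDensity_eq_lintegral_mul_non_measurable _ hρ.ennreal_ofReal
      (Filter.Eventually.of_forall fun x => ENNReal.ofReal_lt_top)]
  congr 1
  refine lintegral_congr fun x => ?_
  have e : ‖(η x : ℂ)‖ₑ = ‖η x‖ₑ := by
    rw [← ofReal_norm, ← ofReal_norm, Complex.norm_real]
  simp only [Pi.mul_apply, enorm_mul, ENNReal.toReal_ofNat, ENNReal.rpow_ofNat, e, mul_pow,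
    ← mul_assoc, h x, one_mul]

theorem withDensity_ac' {ρ : α → ℝ} (hρ : Measurable ρ) (hpos : ∀ x, 0 < ρ x) :
    ν ≪ ν.withDensity fun x => ENNReal.ofReal (ρ x) :=
  withDensity_absolutelyContinuous' hρ.ennreal_ofReal.aemeasurable
    (Filter.Eventually.of_forall fun x => by simpa using hpos x)

/-- For `ρ η² = 1`, multiplication by `η` is a unitary map from `L²(ν)` onto `L²(ρ ν)`. -/
def weightUnitary (ν : Measure α) (ρ η : α → ℝ) (hρ : Measurable ρ) (hw : Measurable η)
    (hpos : ∀ x, 0 < ρ x) (hwpos : ∀ x, 0 < η x)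
    (h : ∀ x, ENNReal.ofReal (ρ x) * ‖η x‖ₑ ^ 2 = 1) :
    Lp ℂ 2 ν ≃ₗᵢ[ℂ] Lp ℂ 2 (ν.withDensity fun x => ENNReal.ofReal (ρ x)) :=
  have hac : (ν.withDensity fun x => ENNReal.ofReal (ρ x)) ≪ ν :=
    withDensity_absolutelyContinuous _ _
  have hac' := withDensity_ac' (ν := ν) hρ hpos
  have hm : ∀ g : Lp ℂ 2 ν, MemLp (fun x => (η x : ℂ) * g x) 2
      (ν.withDensity fun x => ENNReal.ofReal (ρ x)) := fun g =>
    ⟨(Complex.measurable_ofReal.comp hw).aestronglyMeasurable.mul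
      ((Lp.aestronglyMeasurable g).mono_ac hac), by
      rw [eLpNorm_weight hρ h]; exact Lp.eLpNorm_lt_top g⟩
  have hm' : ∀ f : Lp ℂ 2 (ν.withDensity fun x => ENNReal.ofReal (ρ x)),
      MemLp (fun x => ((η x)⁻¹ : ℂ) * f x) 2 ν := fun f =>
    ⟨((Complex.measurable_ofReal.comp hw).inv).aestronglyMeasurable.mul
      ((Lp.aestronglyMeasurable f).mono_ac hac'), by
      rw [← eLpNorm_weight hρ h]
      have : (fun x => (η x : ℂ) * (((η x)⁻¹ : ℂ) * f x)) = f := by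
        funext x
        rw [mul_inv_cancel_left₀ (Complex.ofReal_ne_zero.mpr (hwpos x).ne')]
      rw [this]; exact Lp.eLpNorm_lt_top f⟩
  { toFun := fun g => (hm g).toLp
    invFun := fun f => (hm' f).toLp
    map_add' := fun g g' => by
      refine Lp.ext ?_
      filter_upwards [(hm (g + g')).coeFn_toLp, (hm g).coeFn_toLp, (hm g').coeFn_toLp,
        Lp.coeFn_add (hm g).toLp (hm g').toLp, hac.ae_le (Lp.coeFn_add g g')] with x h1 h2 h3 h4 h5
      rw [h1, h4, Pi.add_apply, h2, h3, h5, Pi.add_apply, mul_add]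
    map_smul' := fun c g => by
      refine Lp.ext ?_
      filter_upwards [(hm (c • g)).coeFn_toLp, (hm g).coeFn_toLp,
        Lp.coeFn_smul c (hm g).toLp, hac.ae_le (Lp.coeFn_smul c g)] with x h1 h2 h3 h4
      rw [h1, RingHom.id_apply, h3, Pi.smul_apply, h2, h4, Pi.smul_apply, smul_eq_mul,
        smul_eq_mul]
      ring
    left_inv := fun g => by
      refine Lp.ext ?_
      filter_upwards [(hm' (hm g).toLp).coeFn_toLp, hac'.ae_le (hm g).coeFn_toLp] with x h1 h2
      rw [h1, h2, inv_mul_cancel_left₀ (Complex.ofReal_ne_zero.mpr (hwpos x).ne')]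
    right_inv := fun f => by
      refine Lp.ext ?_
      filter_upwards [(hm (hm' f).toLp).coeFn_toLp, hac.ae_le (hm' f).coeFn_toLp] with x h1 h2
      rw [h1, h2, mul_inv_cancel_left₀ (Complex.ofReal_ne_zero.mpr (hwpos x).ne')]
    norm_map' := fun g => by
      change ‖(hm g).toLp‖ = ‖g‖
      rw [Lp.norm_toLp, eLpNorm_weight hρ h, Lp.norm_def] }

end Weight

/-! ### The Langevin system -/

/-- The Hamiltonian `|p|²/(2μ) + V(q)`. -/
def hamiltonian (mass : ℝ) (V : EuclideanSpace ℝ (Fin d) → ℝ) (x : Phase d) : ℝ :=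
  ‖x.2‖ ^ 2 / (2 * mass) + V x.1

/-- The data of the Langevin equation: positive mass `μ`, friction `γ` and inverse temperature `β`,
and a smooth potential `V` for which the Gibbs measure exists (finite partition function). -/
structure LangevinSystem (d : ℕ) where
  mass : ℝ
  friction : ℝ
  invTemp : ℝ
  potential : EuclideanSpace ℝ (Fin d) → ℝ
  mass_pos : 0 < mass
  friction_pos : 0 < friction
  invTemp_pos : 0 < invTemp
  smooth : ContDiff ℝ ∞ potential
  integrable_gibbs : Integrable fun x : Phase d =>
    Real.exp (-invTemp * hamiltonian mass potential x)

/-- The growth hypothesis on the potential. The index `i : Fin n → Fin d` encodes the partial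
derivative `∂_{i 0} ⋯ ∂_{i (n-1)}` of order `n ≥ 1`. -/
def WeaklyElliptic (V : EuclideanSpace ℝ (Fin d) → ℝ) : Prop :=
  (∀ n : ℕ, 1 ≤ n → ∀ i : Fin n → Fin d, ∃ C : ℝ, 0 < C ∧ ∀ q,
    |iteratedFDeriv ℝ n V q (fun k => EuclideanSpace.single (i k) 1)|
      ≤ C * √(1 + ‖∇ V q‖ ^ 2)) ∧
  ∃ M : ℕ, 0 < M ∧ ∃ C : ℝ, 1 ≤ C ∧ ∀ q,
    C⁻¹ * (1 + ‖q‖ ^ 2) ^ (1 / (2 * M : ℝ)) ≤ √(1 + ‖∇ V q‖ ^ 2) ∧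
    √(1 + ‖∇ V q‖ ^ 2) ≤ C * (1 + ‖q‖ ^ 2) ^ ((M : ℝ) / 2)

namespace LangevinSystem

variable (S : LangevinSystem d)

/-- The Hamiltonian of the system. -/
def energy (x : Phase d) : ℝ := hamiltonian S.mass S.potential x

/-- The partition function `Z = ∫ e^{-βH}`. -/
def partition : ℝ := ∫ x : Phase d, Real.exp (-S.invTemp * S.energy x)

/-- The Gibbs density `ρ_eq = e^{-βH} / Z`. -/
def density (x : Phase d) : ℝ := Real.exp (-S.invTemp * S.energy x) / S.partition

/-- The Gibbs measure `ρ_eq dq dp`. -/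
def gibbs : Measure (Phase d) := volume.withDensity fun x => ENNReal.ofReal (S.density x)

/-- The weight `√Z e^{βH/2}`. -/
def weight (x : Phase d) : ℝ := √S.partition * Real.exp (S.invTemp * S.energy x / 2)

theorem continuous_energy : Continuous S.energy := by
  have := S.smooth.continuous
  unfold energy hamiltonian
  fun_prop

theorem partition_pos : 0 < S.partition :=
  integral_exp_pos S.integrable_gibbs

theorem density_mul_weight (x : Phase d) :
    ENNReal.ofReal (S.density x) * ‖S.weight x‖ₑ ^ 2 = 1 := by
  have hZ := S.partition_pos
  have hw : 0 ≤ S.weight x := by unfold weight; positivity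
  have hd : 0 ≤ S.density x := by unfold density; positivity
  rw [Real.enorm_eq_ofReal hw, ← ENNReal.ofReal_pow hw, ← ENNReal.ofReal_mul hd,
    ← ENNReal.ofReal_one]
  congr 1
  unfold weight density
  have e : Real.exp (S.invTemp * S.energy x / 2) ^ 2 = Real.exp (S.invTemp * S.energy x) := by
    rw [sq, ← Real.exp_add, add_halves]
  rw [mul_pow, Real.sq_sqrt hZ.le, e, neg_mul, Real.exp_neg]
  field_simp

/-- The unitary map `U : L²(ℝ^{2d}) → L²(ρ_eq)`, `U g = √Z e^{βH/2} g`. -/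
def U : Lp ℂ 2 (volume : Measure (Phase d)) ≃ₗᵢ[ℂ] Lp ℂ 2 S.gibbs :=
  weightUnitary volume S.density S.weight
    (((S.continuous_energy.const_mul _).rexp.div_const _).measurable)
    ((((S.continuous_energy.const_mul _).div_const _).rexp.const_mul _).measurable)
    (fun _ => div_pos (Real.exp_pos _) S.partition_pos)
    (fun _ => mul_pos (Real.sqrt_pos.mpr S.partition_pos) (Real.exp_pos _))
    S.density_mul_weight

/-- The (negative) Kolmogorov operator as a differential expression:
`-(p/μ)·∇_q + ∇V(q)·∇_p + γ ((p/μ)·∇_p - (1/β) Δ_p)`. -/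
def kolmogorovExpr (φ : Phase d → ℂ) (x : Phase d) : ℂ :=
  ∑ i, (-((x.2 i / S.mass : ℝ) : ℂ) * dq i φ x + ((∇ S.potential x.1 i : ℝ) : ℂ) * dp i φ x
    + (S.friction : ℂ) * (((x.2 i / S.mass : ℝ) : ℂ) * dp i φ x
      - ((1 / S.invTemp : ℝ) : ℂ) * dp i (dp i φ) x))

/-- The annihilation-type operator `∂_{p_i} + (β/2μ) p_i`. -/
def annihilation (i : Fin d) (φ : Phase d → ℂ) (x : Phase d) : ℂ :=
  dp i φ x + ((S.invTemp / (2 * S.mass) * x.2 i : ℝ) : ℂ) * φ x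

/-- The creation-type operator `-∂_{p_i} + (β/2μ) p_i`. -/
def creation (i : Fin d) (φ : Phase d → ℂ) (x : Phase d) : ℂ :=
  -dp i φ x + ((S.invTemp / (2 * S.mass) * x.2 i : ℝ) : ℂ) * φ x

/-- The transformed Kolmogorov operator as a differential expression:
`-(p/μ)·∇_q + ∇V(q)·∇_p + (γ/β) (-∇_p + (β/2μ) p)·(∇_p + (β/2μ) p)`. -/
def flatKolmogorovExpr (φ : Phase d → ℂ) (x : Phase d) : ℂ :=
  ∑ i, (-((x.2 i / S.mass : ℝ) : ℂ) * dq i φ x + ((∇ S.potential x.1 i : ℝ) : ℂ) * dp i φ x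
    + ((S.friction / S.invTemp : ℝ) : ℂ) * S.creation i (S.annihilation i φ) x)

end LangevinSystem

section Linear

variable {φ ψ : Phase d → ℂ}

theorem dq_add (hφ : Differentiable ℝ φ) (hψ : Differentiable ℝ ψ) (i : Fin d) :
    dq i (φ + ψ) = dq i φ + dq i ψ := by
  funext x; simp [dq, fderiv_add (hφ x) (hψ x)]

theorem dp_add (hφ : Differentiable ℝ φ) (hψ : Differentiable ℝ ψ) (i : Fin d) :
    dp i (φ + ψ) = dp i φ + dp i ψ := by
  funext x; simp [dp, fderiv_add (hφ x) (hψ x)]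

theorem dq_smul (hφ : Differentiable ℝ φ) (c : ℂ) (i : Fin d) :
    dq i (c • φ) = c • dq i φ := by
  funext x; simp [dq, fderiv_const_smul (hφ x) c]

theorem dp_smul (hφ : Differentiable ℝ φ) (c : ℂ) (i : Fin d) :
    dp i (c • φ) = c • dp i φ := by
  funext x; simp [dp, fderiv_const_smul (hφ x) c]

theorem contDiff_dp (hφ : ContDiff ℝ ∞ φ) (i : Fin d) : ContDiff ℝ ∞ (dp i φ) :=
  (hφ.fderiv_right (m := ∞) (by simp)).clm_apply contDiff_const

end Linear

namespace LangevinSystem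

variable (S : LangevinSystem d)

theorem contDiff_annihilation {φ : Phase d → ℂ} (hφ : ContDiff ℝ ∞ φ) (i : Fin d) :
    ContDiff ℝ ∞ (S.annihilation i φ) := by
  have h1 := contDiff_dp hφ i
  have h2 : ContDiff ℝ ∞ fun x : Phase d => ((S.invTemp / (2 * S.mass) * x.2 i : ℝ) : ℂ) :=
    Complex.ofRealCLM.contDiff.comp (contDiff_const.mul
      ((EuclideanSpace.proj (𝕜 := ℝ) i).contDiff.comp contDiff_snd))
  exact h1.add (h2.mul hφ)

theorem kolmogorovExpr_linear : LinearOnSmooth S.kolmogorovExpr := by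
  have ht : (∞ : WithTop ℕ∞) ≠ 0 := by simp
  refine ⟨fun φ ψ hφ hψ => ?_, fun c φ hφ => ?_⟩
  · funext x
    simp only [kolmogorovExpr, Pi.add_apply, ← Finset.sum_add_distrib]
    refine Finset.sum_congr rfl fun i _ => ?_
    rw [dq_add (hφ.differentiable ht) (hψ.differentiable ht),
      dp_add (hφ.differentiable ht) (hψ.differentiable ht),
      dp_add ((contDiff_dp hφ i).differentiable ht) ((contDiff_dp hψ i).differentiable ht)]
    simp only [Pi.add_apply]
    ring
  · funext x
    simp only [kolmogorovExpr, Pi.smul_apply, smul_eq_mul, Finset.mul_sum]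
    refine Finset.sum_congr rfl fun i _ => ?_
    rw [dq_smul (hφ.differentiable ht), dp_smul (hφ.differentiable ht),
      dp_smul ((contDiff_dp hφ i).differentiable ht)]
    simp only [Pi.smul_apply, smul_eq_mul]
    ring

theorem flatKolmogorovExpr_linear : LinearOnSmooth S.flatKolmogorovExpr := by
  have ht : (∞ : WithTop ℕ∞) ≠ 0 := by simp
  refine ⟨fun φ ψ hφ hψ => ?_, fun c φ hφ => ?_⟩
  · funext x
    simp only [flatKolmogorovExpr, Pi.add_apply, ← Finset.sum_add_distrib]
    refine Finset.sum_congr rfl fun i _ => ?_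
    have e : S.annihilation i (φ + ψ) = S.annihilation i φ + S.annihilation i ψ := by
      funext y
      simp only [annihilation, dp_add (hφ.differentiable ht) (hψ.differentiable ht), Pi.add_apply]
      ring
    rw [dq_add (hφ.differentiable ht) (hψ.differentiable ht),
      dp_add (hφ.differentiable ht) (hψ.differentiable ht), e]
    simp only [creation, dp_add ((S.contDiff_annihilation hφ i).differentiable ht)
      ((S.contDiff_annihilation hψ i).differentiable ht), Pi.add_apply]
    ring
  · funext x
    simp only [flatKolmogorovExpr, Pi.smul_apply, smul_eq_mul, Finset.mul_sum]
    refine Finset.sum_congr rfl fun i _ => ?_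
    have e : S.annihilation i (c • φ) = c • S.annihilation i φ := by
      funext y
      simp only [annihilation, dp_smul (hφ.differentiable ht), Pi.smul_apply, smul_eq_mul]
      ring
    rw [dq_smul (hφ.differentiable ht), dp_smul (hφ.differentiable ht), e]
    simp only [creation, dp_smul ((S.contDiff_annihilation hφ i).differentiable ht),
      Pi.smul_apply, smul_eq_mul]
    ring

/-- The Kolmogorov operator `K` in `L²(ρ_eq)`. -/
def kolmogorov : Lp ℂ 2 S.gibbs →ₗ.[ℂ] Lp ℂ 2 S.gibbs :=
  closedRealization S.gibbs S.kolmogorovExpr S.kolmogorovExpr_linear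

/-- The transformed Kolmogorov operator `K̃` in the flat space `L²(ℝ^{2d})`. -/
def flatKolmogorov :
    Lp ℂ 2 (volume : Measure (Phase d)) →ₗ.[ℂ] Lp ℂ 2 (volume : Measure (Phase d)) :=
  closedRealization volume S.flatKolmogorovExpr S.flatKolmogorovExpr_linear

/-- The transform `Ã = U⁻¹ A U` of a bounded operator `A` on `L²(ρ_eq)`. -/
def flatten (A : Lp ℂ 2 S.gibbs →L[ℂ] Lp ℂ 2 S.gibbs) :
    Lp ℂ 2 (volume : Measure (Phase d)) →L[ℂ] Lp ℂ 2 (volume : Measure (Phase d)) :=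
  (S.U.symm.toContinuousLinearEquiv : Lp ℂ 2 S.gibbs →L[ℂ] Lp ℂ 2 (volume : Measure (Phase d)))
    ∘L A ∘L
  (S.U.toContinuousLinearEquiv : Lp ℂ 2 (volume : Measure (Phase d)) →L[ℂ] Lp ℂ 2 S.gibbs)

/-- The operator `Q̃ K̃ Q̃` with `Q = 1 - P`. -/
def orthogonalGenerator (P : Lp ℂ 2 S.gibbs →L[ℂ] Lp ℂ 2 S.gibbs) :
    Lp ℂ 2 (volume : Measure (Phase d)) →ₗ.[ℂ] Lp ℂ 2 (volume : Measure (Phase d)) :=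
  pmapSandwich (S.flatten (1 - P)) S.flatKolmogorov

end LangevinSystem

end

/-! Notation: `c = β/2μ`, `κ = γ/β`, `g(p) = exp(-c|p|²/2)`, `a_i = ∂_{p_i} + c p_i` with adjoint
`a_i*`, and `α_i = ∂_{q_i} + (β/2) ∂_i V` with adjoint `α_i*`. The flat operator is `X + κ Σ a_i*
a_i`, where the Hamiltonian transport `X` is antisymmetric and equals `-β⁻¹ Σ (a_i* α_i - α_i*
a_i)`. Hence `Re ⟨u, K̃u⟩ = κ Σ ‖a_i u‖²`: the operator is accretive and dissipates exactly through
the `a_i`.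

Closed realization. An `L²` weak solution of the equation shifted by a large `l` vanishes
(`energy_estimate_weak`, `real_eq_zero_of_weak`): mollify, control the Friedrichs commutator, then
remove cutoffs whose momentum scale is adapted to the force on the position scale. Consequently `K̃
+ l` is onto (`exists_mem_flatGraph_add`), and every `L²` function whose weak image is in `L²` lies
in the domain (`mem_flatGraph_of_weak`).

Part (i). If `u` is in the kernel of `K̃`, the energy identity gives `a_i u = 0` weakly, then `Xu =
0`, and the bracket of `∂_{p_i}` with `X` yields the position derivatives. So `e^{βH/2} u` is
constant (`exists_ae_eq_of_mem_kernel`), and `u` is orthogonal to functions of zero mean. The rest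
is linear algebra: `QKQu = 0` says that `K(Qu)` is a combination of the `v_i = K w_i`.

Part (ii). Set `v = √(β/μ) p_j`, transported to the flat space. Since `∂_j V e^{-βV/2}` is in `L²`,
`v` lies in the domains of `K̃` and of its adjoint, so `Q̃K̃Q̃` is a finite rank perturbation of
`K̃` on `D(K̃)`. It is again accretive and onto after large shifts, so an imaginary `z` is in the
resolvent set as soon as `Q̃K̃Q̃ - z` is bounded below (`mem_pmapResolventSet_sandwich`). Otherwise
there are unit vectors `u_n` with `(Q̃K̃Q̃ - z) u_n → 0`. For `z ≠ 0` they are asymptotically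
orthogonal to `v`, which reduces matters to `K̃u_n - z u_n - a_n v → 0` with bounded scalars `a_n`.

A hypocoercive argument without compactness shows that such `u_n` tend to zero
(`Quasimode.null_modes`). Energy gives `a_i u_n → 0`, and the Gaussian Poincaré inequality leaves
only the momentum average `k_n(q)` times `g(p)`. Solve `(l + Σ α_i* α_i) φ_n ≈ k_n` approximately.
Testing the equation with `φ_n g` gives `z ⟨φ_n, k_n⟩ → 0`, because `g` and `p_j g` are orthogonal,
whence `α_i φ_n → 0`. Testing with `α_i φ_n p_i g` gives `⟨α_i* α_i φ_n, k_n⟩ → 0`, with the second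
order bounds of elliptic regularity controlling the remainder. Adding up, `‖k_n‖² → 0`. The analytic
input on `V` is that its Hessian is bounded by a multiple of `√(1 + |∇V|²)`. -/

noncomputable section

/-! ### Convergence in `L²` -/

section LTwo

open Filter Topology

variable {α 𝕜 : Type*} [MeasurableSpace α] {ν : Measure α} [RCLike 𝕜]

/-- Weak formulations below use the bilinear pairing, which integrates by parts without conjugates;
starring the first factor turns it into the inner product. -/
theorem integral_mul_eq_inner {f g : α → 𝕜} (hf : MemLp f 2 ν) (hg : MemLp g 2 ν) :
    ∫ x, f x * g x ∂ν = inner 𝕜 (hf.star.toLp (star f)) (hg.toLp g) := by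
  rw [L2.inner_def]
  refine integral_congr_ae ?_
  filter_upwards [hf.star.coeFn_toLp, hg.coeFn_toLp] with x h1 h2
  rw [h1, h2]
  simp [mul_comm]

/-- Carries integral identities from test functions over to limits in `L²`, in particular to
elements of a graph closure. -/
theorem tendsto_integral_mul {ι : Type*} {l : Filter ι} {f g : α → 𝕜} {F G : ι → α → 𝕜}
    (hf : MemLp f 2 ν) (hg : MemLp g 2 ν) (hF : ∀ n, MemLp (F n) 2 ν) (hG : ∀ n, MemLp (G n) 2 ν)
    (h1 : Tendsto (fun n => eLpNorm (F n - f) 2 ν) l (𝓝 0))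
    (h2 : Tendsto (fun n => eLpNorm (G n - g) 2 ν) l (𝓝 0)) :
    Tendsto (fun n => ∫ x, F n x * G n x ∂ν) l (𝓝 (∫ x, f x * g x ∂ν)) := by
  rw [integral_mul_eq_inner hf hg]
  simp only [fun n => integral_mul_eq_inner (hF n) (hG n)]
  refine Tendsto.inner ?_ ?_
  · rw [Lp.tendsto_Lp_iff_tendsto_eLpNorm'' (fun n => star (F n)) (fun n => (hF n).star) (star f)]
    have : ∀ n, eLpNorm (star (F n) - star f) 2 ν = eLpNorm (F n - f) 2 ν := fun n => by
      rw [← star_sub, eLpNorm_star]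
    simpa only [this] using h1
  · rwa [Lp.tendsto_Lp_iff_tendsto_eLpNorm'' G hG g]

end LTwo

/-! ### Mollification -/

section Mollify

open Filter Topology

variable {E : Type*} [NormedAddCommGroup E] [NormedSpace ℝ E] [FiniteDimensional ℝ E]
  [MeasurableSpace E] [BorelSpace E] {μ : Measure E} [μ.IsAddHaarMeasure]

/-- Translations act continuously on `L²`: this is continuity of composition with a continuous
family of measure preserving maps. -/
theorem tendsto_eLpNorm_translate {f : E → ℝ} (hf : MemLp f 2 μ) :
    Tendsto (fun y : E => eLpNorm (fun x => f (x - y) - f x) 2 μ) (𝓝 0) (𝓝 0) := by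
  have hgm : ∀ y : E, MeasurePreserving (fun x => x - y) μ μ := fun y =>
    measurePreserving_sub_right μ y
  let T : E → C(E, E) := fun y => ⟨fun x => x - y, by fun_prop⟩
  have hT : Continuous T :=
    ContinuousMap.continuous_of_continuous_uncurry _ (by
      change Continuous fun p : E × E => p.2 - p.1
      fun_prop)
  have hc : Continuous fun y => Lp.compMeasurePreserving (T y) (hgm y) (hf.toLp f) :=
    continuous_const.compMeasurePreservingLp hT hgm (by norm_num)
  have h0 := hc.tendsto 0
  rw [Lp.tendsto_Lp_iff_tendsto_eLpNorm'] at h0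
  refine h0.congr fun y => eLpNorm_congr_ae ?_
  have e1 : Lp.compMeasurePreserving (T y) (hgm y) (hf.toLp f) =ᵐ[μ] fun x => f (x - y) :=
    (Lp.coeFn_compMeasurePreserving _ (hgm y)).trans
      ((hgm y).quasiMeasurePreserving.ae_eq_comp hf.coeFn_toLp)
  have e2 : Lp.compMeasurePreserving (T 0) (hgm 0) (hf.toLp f) =ᵐ[μ] fun x => f (x - 0) :=
    (Lp.coeFn_compMeasurePreserving _ (hgm 0)).trans
      ((hgm 0).quasiMeasurePreserving.ae_eq_comp hf.coeFn_toLp)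
  filter_upwards [e1, e2] with x h1 h2
  rw [Pi.sub_apply, h1, h2, sub_zero]

/-- The average of `|f(x - t) - f(x)|` over the ball of radius `ε`, up to a constant factor. -/
def ballOscillation (μ : Measure E) (f : E → ℝ) (ε : ℝ) (x : E) : ℝ≥0∞ :=
  (μ (Metric.closedBall 0 ε))⁻¹ * ∫⁻ t in Metric.closedBall 0 ε, ‖f (x - t) - f x‖ₑ ∂μ

/-- The square of a ball average is at most the average of the squares. Tonelli then leaves an
average over `‖t‖ ≤ ε` of `‖f(· - t) - f‖²`, which is small by continuity of translations. -/
theorem tendsto_lintegral_oscillation_sq {f : E → ℝ} (hf : MemLp f 2 μ)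
    (hfm : StronglyMeasurable f) :
    Tendsto (fun ε : ℝ => ∫⁻ x, ballOscillation μ f ε x ^ 2 ∂μ) (𝓝[>] 0) (𝓝 0) := by
  rw [ENNReal.tendsto_nhds_zero]
  intro δ hδ
  have h1 : Tendsto (fun y : E => ∫⁻ x, ‖f (x - y) - f x‖ₑ ^ 2 ∂μ) (𝓝 0) (𝓝 0) := by
    have := ENNReal.Tendsto.pow (n := 2) (tendsto_eLpNorm_translate hf)
    rw [zero_pow two_ne_zero] at this
    refine this.congr fun y => ?_
    rw [eLpNorm_eq_lintegral_rpow_enorm_toReal (by norm_num) (by norm_num), ← ENNReal.rpow_natCast,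
      ← ENNReal.rpow_mul]
    norm_num
  rw [ENNReal.tendsto_nhds_zero] at h1
  obtain ⟨r, hr, hball⟩ := Metric.eventually_nhds_iff.mp (h1 δ hδ)
  filter_upwards [Ioo_mem_nhdsGT hr] with ε hε
  have hpos : μ (Metric.closedBall (0:E) ε) ≠ 0 :=
    (Metric.measure_closedBall_pos μ 0 hε.1).ne'
  have hfin : μ (Metric.closedBall (0:E) ε) ≠ ⊤ := measure_closedBall_lt_top.ne
  set ν := μ.restrict (Metric.closedBall (0:E) ε) with hν
  have hνu : ν Set.univ = μ (Metric.closedBall (0:E) ε) := by simp [hν]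
  set c := μ (Metric.closedBall (0:E) ε) with hc
  have hm2 : Measurable fun p : E × E => ‖f (p.1 - p.2) - f p.1‖ₑ := by
    have := hfm.measurable
    fun_prop
  have hCS : ∀ x, ballOscillation μ f ε x ^ 2 ≤ c⁻¹ * ∫⁻ t, ‖f (x - t) - f x‖ₑ ^ 2 ∂ν := by
    intro x
    have hm : AEMeasurable (fun t => ‖f (x - t) - f x‖ₑ) ν := by
      have := hfm.measurable
      fun_prop
    have h := ENNReal.lintegral_mul_le_Lp_mul_Lq ν (Real.HolderConjugate.two_two) hm
      (aemeasurable_const (b := (1 : ℝ≥0∞)))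
    simp only [Pi.mul_apply, mul_one, ENNReal.one_rpow, lintegral_const, hνu, one_mul] at h
    have h2 := pow_le_pow_left' h 2
    have hs : ∀ a : ℝ≥0∞, (a ^ (1 / 2 : ℝ)) ^ 2 = a := fun a => by
      rw [← ENNReal.rpow_natCast, ← ENNReal.rpow_mul]
      norm_num
    simp only [mul_pow, hs, ENNReal.rpow_ofNat] at h2
    unfold ballOscillation
    rw [mul_pow]
    calc _ ≤ c⁻¹ ^ 2 * ((∫⁻ t, ‖f (x - t) - f x‖ₑ ^ 2 ∂ν) * c) := by gcongr
      _ = c⁻¹ * (c⁻¹ * c) * ∫⁻ t, ‖f (x - t) - f x‖ₑ ^ 2 ∂ν := by ring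
      _ = _ := by rw [ENNReal.inv_mul_cancel hpos hfin, mul_one]
  calc ∫⁻ x, ballOscillation μ f ε x ^ 2 ∂μ
      ≤ ∫⁻ x, c⁻¹ * ∫⁻ t, ‖f (x - t) - f x‖ₑ ^ 2 ∂ν ∂μ := lintegral_mono hCS
    _ = c⁻¹ * ∫⁻ t, ∫⁻ x, ‖f (x - t) - f x‖ₑ ^ 2 ∂μ ∂ν := by
        rw [lintegral_const_mul' _ _ (by simpa using hpos), lintegral_lintegral_swap]
        exact (hm2.pow_const 2).aemeasurable
    _ ≤ c⁻¹ * ∫⁻ t, δ ∂ν := by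
        gcongr c⁻¹ * ?_
        refine lintegral_mono_ae ?_
        filter_upwards [ae_restrict_mem Metric.isClosed_closedBall.measurableSet] with t ht
        refine hball ?_
        simp only [Metric.mem_closedBall] at ht
        exact ht.trans_lt hε.2
    _ = δ := by
        rw [lintegral_const, hνu, mul_comm δ, ← mul_assoc, ENNReal.inv_mul_cancel hpos hfin, one_mul]

end Mollify

/-! ### Test functions and directional derivatives -/

section TestFunctions

variable {E F : Type*} [NormedAddCommGroup E] [NormedSpace ℝ E]
  [NormedAddCommGroup F] [NormedSpace ℝ F]

/-- Smooth compactly supported functions. -/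
def TestFn (φ : E → F) : Prop := ContDiff ℝ ∞ φ ∧ HasCompactSupport φ

/-- The directional derivative. -/
def dirD (e : E) (φ : E → F) (x : E) : F := fderiv ℝ φ x e

theorem ContDiff.differentiable_of_smooth {φ : E → F} (h : ContDiff ℝ ∞ φ) : Differentiable ℝ φ :=
  h.differentiable (by simp)

theorem ContDiff.dirD {φ : E → F} (h : ContDiff ℝ ∞ φ) (e : E) : ContDiff ℝ ∞ (dirD e φ) :=
  (h.fderiv_right (m := ∞) (by simp)).clm_apply contDiff_const

theorem HasCompactSupport.dirD {φ : E → F} (h : HasCompactSupport φ) (e : E) :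
    HasCompactSupport (dirD e φ) :=
  (h.fderiv (𝕜 := ℝ)).comp_left (g := fun L : E →L[ℝ] F => L e) rfl

theorem TestFn.dirD {φ : E → F} (h : TestFn φ) (e : E) : TestFn (dirD e φ) :=
  ⟨h.1.dirD e, h.2.dirD e⟩

theorem TestFn.add {φ ψ : E → F} (h : TestFn φ) (h' : TestFn ψ) : TestFn fun x => φ x + ψ x :=
  ⟨h.1.add h'.1, h.2.add h'.2⟩

theorem TestFn.neg {φ : E → F} (h : TestFn φ) : TestFn fun x => -φ x :=
  ⟨h.1.neg, h.2.comp_left (g := fun y : F => -y) neg_zero⟩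

theorem TestFn.sub {φ ψ : E → F} (h : TestFn φ) (h' : TestFn ψ) : TestFn fun x => φ x - ψ x := by
  simpa [sub_eq_add_neg] using h.add h'.neg

theorem TestFn.zero : TestFn fun _ : E => (0 : F) :=
  ⟨contDiff_const, HasCompactSupport.zero⟩

theorem TestFn.sum {ι : Type*} (s : Finset ι) {φ : ι → E → F} (h : ∀ i, TestFn (φ i)) :
    TestFn fun x => ∑ i ∈ s, φ i x := by
  classical
  induction s using Finset.induction_on with
  | empty => simpa using TestFn.zero
  | insert i s hi ih => simpa [Finset.sum_insert hi] using (h i).add ih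

theorem TestFn.continuous {φ : E → F} (h : TestFn φ) : Continuous φ := h.1.continuous

section Algebra

variable {A : Type*} [NormedRing A] [NormedAlgebra ℝ A]

theorem TestFn.smooth_mul {φ ψ : E → A} (h : TestFn φ) (h' : ContDiff ℝ ∞ ψ) :
    TestFn fun x => ψ x * φ x :=
  ⟨h'.mul h.1, h.2.mul_left (f := ψ)⟩

theorem TestFn.mul_smooth {φ ψ : E → A} (h : TestFn φ) (h' : ContDiff ℝ ∞ ψ) :
    TestFn fun x => φ x * ψ x :=
  ⟨h.1.mul h', h.2.mul_right (f' := ψ)⟩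

theorem TestFn.const_mul {φ : E → A} (h : TestFn φ) (c : A) : TestFn fun x => c * φ x :=
  h.smooth_mul contDiff_const

end Algebra

theorem dirD_add {φ ψ : E → F} (h : ContDiff ℝ ∞ φ) (h' : ContDiff ℝ ∞ ψ) (e x : E) :
    dirD e (fun y => φ y + ψ y) x = dirD e φ x + dirD e ψ x := by
  simp [dirD, fderiv_fun_add (h.differentiable_of_smooth x) (h'.differentiable_of_smooth x)]

theorem dirD_neg (φ : E → F) (e x : E) : dirD e (fun y => -φ y) x = -dirD e φ x := by
  simp [dirD, fderiv_fun_neg]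

theorem dirD_sum {ι : Type*} (s : Finset ι) {φ : ι → E → F} (h : ∀ i, ContDiff ℝ ∞ (φ i))
    (e x : E) : dirD e (fun y => ∑ i ∈ s, φ i y) x = ∑ i ∈ s, dirD e (φ i) x := by
  unfold dirD
  rw [fderiv_fun_sum fun i _ => (h i).differentiable_of_smooth x]
  simp

theorem dirD_mul {A : Type*} [NormedCommRing A] [NormedAlgebra ℝ A] {φ ψ : E → A}
    (h : ContDiff ℝ ∞ φ) (h' : ContDiff ℝ ∞ ψ) (e x : E) :
    dirD e (fun y => φ y * ψ y) x = φ x * dirD e ψ x + ψ x * dirD e φ x := by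
  simp [dirD, fderiv_fun_mul (h.differentiable_of_smooth x) (h'.differentiable_of_smooth x)]

theorem dirD_const_mul {A : Type*} [NormedCommRing A] [NormedAlgebra ℝ A] {φ : E → A}
    (h : ContDiff ℝ ∞ φ) (c : A) (e x : E) :
    dirD e (fun y => c * φ y) x = c * dirD e φ x := by
  simp [dirD, fderiv_const_mul (h.differentiable_of_smooth x)]

theorem dirD_comm {φ : E → F} (h : ContDiff ℝ ∞ φ) (e e' x : E) :
    dirD e (dirD e' φ) x = dirD e' (dirD e φ) x := by
  have hd : DifferentiableAt ℝ (fderiv ℝ φ) x :=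
    (h.fderiv_right (m := ∞) (by simp)).differentiable_of_smooth x
  have key : ∀ a b : E, dirD a (dirD b φ) x = fderiv ℝ (fderiv ℝ φ) x a b := by
    intro a b
    unfold dirD
    rw [fderiv_clm_apply hd (differentiableAt_const b)]
    simp
  rw [key, key]
  exact (h.contDiffAt.isSymmSndFDerivAt (by
    simpa using WithTop.coe_le_coe.2 (le_top : (2 : ℕ∞) ≤ ⊤))).eq e e'

end TestFunctions

/-! ### Integrability and integration by parts for test functions. -/

section Integration

variable {E 𝕜 : Type*} [NormedAddCommGroup E] [NormedSpace ℝ E] [RCLike 𝕜]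
  [MeasurableSpace E] [BorelSpace E] {μ : Measure E}

theorem TestFn.integrable [IsFiniteMeasureOnCompacts μ] {φ : E → 𝕜} (h : TestFn φ) : Integrable φ μ :=
  h.continuous.integrable_of_hasCompactSupport h.2

theorem TestFn.memLp [IsFiniteMeasureOnCompacts μ] {φ : E → 𝕜} (h : TestFn φ) (p : ℝ≥0∞) : MemLp φ p μ :=
  h.continuous.memLp_of_hasCompactSupport h.2

variable [FiniteDimensional ℝ E] [μ.IsAddHaarMeasure]

theorem integral_mul_dirD {f g : E → 𝕜} (hf : TestFn f) (hg : ContDiff ℝ ∞ g) (e : E) :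
    ∫ x, f x * dirD e g x ∂μ = -∫ x, dirD e f x * g x ∂μ :=
  integral_mul_fderiv_eq_neg_fderiv_mul_of_integrable
    ((hf.dirD e).mul_smooth hg).integrable (hf.mul_smooth (hg.dirD e)).integrable
    (hf.mul_smooth hg).integrable (fun x _ => hf.1.differentiable_of_smooth x)
    (fun x _ => hg.differentiable_of_smooth x)

theorem integral_mul_dirD' {f g : E → 𝕜} (hf : ContDiff ℝ ∞ f) (hg : TestFn g) (e : E) :
    ∫ x, f x * dirD e g x ∂μ = -∫ x, dirD e f x * g x ∂μ :=
  integral_mul_fderiv_eq_neg_fderiv_mul_of_integrable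
    (hg.smooth_mul (hf.dirD e)).integrable ((hg.dirD e).smooth_mul hf).integrable
    (hg.smooth_mul hf).integrable (fun x _ => hf.differentiable_of_smooth x)
    (fun x _ => hg.1.differentiable_of_smooth x)

theorem integral_dirD {f : E → 𝕜} (hf : TestFn f) (e : E) : ∫ x, dirD e f x ∂μ = 0 := by
  have := integral_mul_dirD' (μ := μ) (f := fun _ => (1 : 𝕜)) contDiff_const hf e
  simpa [dirD] using this

end Integration

/-! ### Mollifiers -/

section Mollifier

variable {E : Type*} [NormedAddCommGroup E] [NormedSpace ℝ E] [FiniteDimensional ℝ E]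
  [MeasurableSpace E] [BorelSpace E] (μ : Measure E) [μ.IsAddHaarMeasure]

/-- A fixed smooth function of integral one, supported in the unit ball. -/
def baseMollifier : E → ℝ :=
  ContDiffBump.normed (⟨1 / 2, 1, by norm_num, by norm_num⟩ : ContDiffBump (0 : E)) μ

theorem testFn_baseMollifier : TestFn (baseMollifier μ) :=
  ⟨ContDiffBump.contDiff_normed _, ContDiffBump.hasCompactSupport_normed _⟩

/-- The rescaled mollifier `ε⁻ⁿ ρ(x / ε)`. -/
def mollifier (ε : ℝ) (x : E) : ℝ :=
  (ε ^ Module.finrank ℝ E)⁻¹ * baseMollifier μ (ε⁻¹ • x)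

variable {μ} {ε : ℝ}

theorem testFn_mollifier (hε : 0 < ε) : TestFn (mollifier μ ε) := by
  refine TestFn.const_mul (φ := fun x => baseMollifier μ (ε⁻¹ • x)) ⟨?_, ?_⟩ _
  · exact (testFn_baseMollifier μ).1.comp (contDiff_const_smul _)
  · exact (testFn_baseMollifier μ).2.comp_smul (inv_ne_zero hε.ne')

theorem integral_mollifier (hε : 0 < ε) : ∫ x, mollifier μ ε x ∂μ = 1 := by
  unfold mollifier
  rw [integral_const_mul, Measure.integral_comp_inv_smul_of_nonneg μ _ hε.le]
  have : ∫ x, baseMollifier μ x ∂μ = 1 := ContDiffBump.integral_normed _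
  rw [this, smul_eq_mul, mul_one, inv_mul_cancel₀ (pow_pos hε _).ne']

theorem baseMollifier_eq_zero {x : E} (hx : 1 < ‖x‖) : baseMollifier μ x = 0 := by
  have : x ∉ Function.support (baseMollifier μ) := by
    unfold baseMollifier
    rw [ContDiffBump.support_normed_eq]
    simpa using hx.le
  simpa using this

theorem mollifier_eq_zero (hε : 0 < ε) {x : E} (hx : ε < ‖x‖) : mollifier μ ε x = 0 := by
  unfold mollifier
  rw [baseMollifier_eq_zero, mul_zero]
  rw [norm_smul, norm_inv, Real.norm_of_nonneg hε.le, ← div_eq_inv_mul, one_lt_div hε]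
  exact hx

theorem fderiv_mollifier (x : E) :
    fderiv ℝ (mollifier μ ε) x
      = (ε ^ Module.finrank ℝ E)⁻¹ • ε⁻¹ • fderiv ℝ (baseMollifier μ) (ε⁻¹ • x) := by
  have hd := (testFn_baseMollifier μ).1.differentiable_of_smooth
  have h1 : fderiv ℝ (fun y => baseMollifier μ (ε⁻¹ • y)) x
      = ε⁻¹ • fderiv ℝ (baseMollifier μ) (ε⁻¹ • x) := fderiv_comp_smul _
  have h2 : DifferentiableAt ℝ (fun y => baseMollifier μ (ε⁻¹ • y)) x :=
    (hd _).comp x (differentiableAt_id.const_smul _)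
  have := fderiv_const_mul h2 ((ε ^ Module.finrank ℝ E)⁻¹)
  rw [h1] at this
  exact this

theorem fderiv_mollifier_eq_zero (hε : 0 < ε) {x : E} (hx : ε < ‖x‖) :
    fderiv ℝ (mollifier μ ε) x = 0 := by
  have : mollifier μ ε =ᶠ[nhds x] fun _ => 0 := by
    filter_upwards [(isOpen_lt continuous_const continuous_norm).mem_nhds hx] with y hy
    exact mollifier_eq_zero hε hy
  rw [this.fderiv_eq]
  simp

/-- Scaling: the ball of radius `ε` has volume `εⁿ` times that of the unit ball, so `ε⁻ⁿ` is an
inverse volume up to a constant, and a derivative costs one more `ε⁻¹`. Bounds in terms of the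
inverse volume match the normalization of `ballOscillation`. -/
theorem exists_mollifier_bounds (μ : Measure E) [μ.IsAddHaarMeasure] :
    ∃ C : ℝ, 0 ≤ C ∧ ∀ ε : ℝ, 0 < ε → ∀ x : E,
    |mollifier μ ε x| ≤ C * (μ.real (Metric.closedBall 0 ε))⁻¹ ∧
    ‖fderiv ℝ (mollifier μ ε) x‖ ≤ C * (μ.real (Metric.closedBall 0 ε))⁻¹ * ε⁻¹ := by
  obtain ⟨C₁, h₁⟩ := (testFn_baseMollifier μ).2.exists_bound_of_continuous
    (testFn_baseMollifier μ).continuous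
  obtain ⟨C₂, h₂⟩ := ((testFn_baseMollifier μ).2.fderiv (𝕜 := ℝ)).exists_bound_of_continuous
    ((testFn_baseMollifier μ).1.continuous_fderiv (by simp))
  set v := μ.real (Metric.closedBall (0 : E) 1)
  have hC₁ : 0 ≤ C₁ := (norm_nonneg _).trans (h₁ 0)
  have hC₂ : 0 ≤ C₂ := (norm_nonneg _).trans (h₂ 0)
  have hv : 0 < v := ENNReal.toReal_pos (Metric.measure_closedBall_pos μ 0 one_pos).ne' measure_closedBall_lt_top.ne
  refine ⟨max C₁ C₂ * v, by positivity, fun ε hε x => ?_⟩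
  have hball : μ.real (Metric.closedBall (0 : E) ε) = ε ^ Module.finrank ℝ E * v := by
    rw [Measure.real, Measure.addHaar_closedBall' μ _ hε.le, ENNReal.toReal_mul,
      ENNReal.toReal_ofReal (by positivity)]
    rfl
  have hp : 0 < ε ^ Module.finrank ℝ E := by positivity
  have e : max C₁ C₂ * v * (μ.real (Metric.closedBall (0 : E) ε))⁻¹
      = (ε ^ Module.finrank ℝ E)⁻¹ * max C₁ C₂ := by
    rw [hball]; field_simp
  rw [e]
  constructor
  · rw [mollifier, abs_mul, abs_of_pos (inv_pos.mpr hp)]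
    gcongr
    exact (h₁ _).trans (le_max_left _ _)
  · rw [fderiv_mollifier, norm_smul, norm_smul, Real.norm_of_nonneg (inv_pos.mpr hp).le,
      Real.norm_of_nonneg (inv_pos.mpr hε).le, mul_comm ε⁻¹, ← mul_assoc]
    gcongr
    exact (h₂ _).trans (le_max_right _ _)

end Mollifier

/-! ### Energy estimate for weak solutions -/

section Energy

open Filter Topology

variable {E : Type*} [NormedAddCommGroup E] [NormedSpace ℝ E]

theorem TestFn.comp_const_sub {η : E → ℝ} (hη : TestFn η) (x : E) : TestFn fun y => η (x - y) :=
  ⟨hη.1.comp (contDiff_const.sub contDiff_id),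
    hη.2.comp_homeomorph (Homeomorph.subLeft x)⟩

theorem dirD_comp_const_sub {η : E → ℝ} (hη : ContDiff ℝ ∞ η) (x e : E) :
    dirD e (fun y => η (x - y)) = fun y => -dirD e η (x - y) := by
  funext y
  unfold dirD
  have h := ((hη.differentiable_of_smooth (x - y)).hasFDerivAt.comp y
    ((hasFDerivAt_const x y).sub (hasFDerivAt_id y))).fderiv
  simp only [Function.comp_def] at h
  rw [h]
  simp

theorem contDiff_fderiv_apply {F : E → ℝ} {b : E → E} (hF : ContDiff ℝ ∞ F)
    (hb : ContDiff ℝ ∞ b) : ContDiff ℝ ∞ fun x => fderiv ℝ F x (b x) :=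
  (hF.fderiv_right (m := ∞) (by simp)).clm_apply hb

variable {ι : Type*} [Fintype ι]

/-- The differential expression `-κ ∑ D_k² + D_b + m`. -/
def driftExpr (κ : ℝ) (e : ι → E) (b : E → E) (m : E → ℝ) (F : E → ℝ) (x : E) : ℝ :=
  -κ * ∑ k, dirD (e k) (dirD (e k) F) x + fderiv ℝ F x (b x) + m x * F x

theorem contDiff_driftExpr {κ : ℝ} {e : ι → E} {b : E → E} {m F : E → ℝ}
    (hb : ContDiff ℝ ∞ b) (hm : ContDiff ℝ ∞ m) (hF : ContDiff ℝ ∞ F) :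
    ContDiff ℝ ∞ (driftExpr κ e b m F) := by
  unfold driftExpr
  have h1 := contDiff_fderiv_apply hF hb
  have h2 : ContDiff ℝ ∞ fun x => ∑ k, dirD (e k) (dirD (e k) F) x :=
    ContDiff.sum fun k _ => (hF.dirD (e k)).dirD (e k)
  fun_prop

variable [MeasurableSpace E] [BorelSpace E] {μ : Measure E}

/-- The convolution `x ↦ ∫ f(y) η(x - y) dy`. -/
def mollify (μ : Measure E) (η f : E → ℝ) (x : E) : ℝ := ∫ y, f y * η (x - y) ∂μ

theorem contDiff_mollify {η f : E → ℝ} (hη : TestFn η) (hf : LocallyIntegrable f μ) :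
    ContDiff ℝ ∞ (mollify μ η f) :=
  hη.2.contDiff_convolution_right (ContinuousLinearMap.mul ℝ ℝ) hf hη.1

variable [FiniteDimensional ℝ E] [μ.IsAddHaarMeasure]

theorem fderiv_mollify {η f : E → ℝ} (hη : TestFn η) (hf : LocallyIntegrable f μ) (x e : E) :
    fderiv ℝ (mollify μ η f) x e = mollify μ (dirD e η) f x := by
  have h := hη.2.hasFDerivAt_convolution_right (ContinuousLinearMap.mul ℝ ℝ) hf
    (hη.1.of_le (by simp)) x
  have h2 := convolution_precompR_apply (ContinuousLinearMap.mul ℝ ℝ) hf (hη.2.fderiv (𝕜 := ℝ))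
    (hη.1.continuous_fderiv (by simp)) x e
  have h3 : fderiv ℝ (mollify μ η f) x = _ := h.fderiv
  rw [h3]
  exact h2

theorem dirD_mollify {η f : E → ℝ} (hη : TestFn η) (hf : LocallyIntegrable f μ) (e : E) :
    dirD e (mollify μ η f) = mollify μ (dirD e η) f :=
  funext fun x => fderiv_mollify hη hf x e

/-- Pair the expression with `χ² F`. In second order, `-∂(χ²F) ∂F = (∂χ)² F² - (∂(χF))²`, and the
negative square is dropped. In first order, `D_b (χF)²` integrates to zero because `b` is divergence
free, which moves the drift onto the cutoff. -/
theorem energy_estimate_smooth {κ : ℝ} (hκ : 0 ≤ κ) (e : ι → E) {b : E → E} {m F χ : E → ℝ}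
    (hb : ContDiff ℝ ∞ b) (hm : ContDiff ℝ ∞ m)
    (hdiv : ∀ φ : E → ℝ, TestFn φ → ∫ x, fderiv ℝ φ x (b x) ∂μ = 0)
    (hF : ContDiff ℝ ∞ F) (hχ : TestFn χ) :
    ∫ x, χ x ^ 2 * m x * F x ^ 2 ∂μ ≤
      ∫ x, (χ x * F x) * (χ x * driftExpr κ e b m F x) ∂μ +
      ∫ x, (κ * ∑ k, dirD (e k) χ x ^ 2 + χ x * fderiv ℝ χ x (b x)) * F x ^ 2 ∂μ := by
  have tχF : TestFn fun x => χ x * F x := hχ.mul_smooth hF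
  have tχ2F : TestFn fun x => χ x * (χ x * F x) := hχ.mul_smooth tχF.1
  have tsq : TestFn fun x => (χ x * F x) * (χ x * F x) := tχF.mul_smooth tχF.1
  have hD : ∀ k, ContDiff ℝ ∞ (dirD (e k) (dirD (e k) F)) := fun k => (hF.dirD _).dirD _
  -- second order part
  have h1 : ∀ k, ∫ x, (χ x * (χ x * F x)) * dirD (e k) (dirD (e k) F) x ∂μ
      ≤ ∫ x, dirD (e k) χ x ^ 2 * F x ^ 2 ∂μ := by
    intro k
    rw [integral_mul_dirD tχ2F (hF.dirD _), ← integral_neg]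
    have i1 : Integrable (fun x => dirD (e k) χ x ^ 2 * F x ^ 2) μ := by
      have := ((hχ.dirD (e k)).mul_smooth (((hχ.dirD (e k)).1).mul (hF.mul hF))).integrable (μ := μ)
      refine this.congr (.of_forall fun x => ?_)
      simp only; ring
    refine integral_mono (((tχ2F.dirD (e k)).mul_smooth (hF.dirD _)).neg).integrable i1 fun x => ?_
    have e1 := dirD_mul hχ.1 tχF.1 (e k) x
    have e2 := dirD_mul hχ.1 hF (e k) x
    simp only [e1, e2]
    have := sq_nonneg (χ x * dirD (e k) F x + F x * dirD (e k) χ x)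
    nlinarith
  have hbχ := contDiff_fderiv_apply hχ.1 hb
  have hbF := contDiff_fderiv_apply hF hb
  have h2 : ∫ x, (χ x * fderiv ℝ χ x (b x) * F x ^ 2 + χ x ^ 2 * F x * fderiv ℝ F x (b x)) ∂μ
      = 0 := by
    have := hdiv _ tsq
    have e : ∀ x, fderiv ℝ (fun x => (χ x * F x) * (χ x * F x)) x (b x)
        = 2 * (χ x * fderiv ℝ χ x (b x) * F x ^ 2 + χ x ^ 2 * F x * fderiv ℝ F x (b x)) := by
      intro x
      have e1 := dirD_mul tχF.1 tχF.1 (b x) x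
      have e2 := dirD_mul hχ.1 hF (b x) x
      unfold dirD at e1 e2
      rw [e1, e2]
      ring
    simp only [e, integral_const_mul] at this
    linarith
  have i0 : Integrable (fun x => χ x ^ 2 * m x * F x ^ 2) μ := by
    refine ((tsq.mul_smooth hm).integrable (μ := μ)).congr (.of_forall fun x => ?_)
    simp only; ring
  have i1 : ∀ k, Integrable (fun x => (χ x * (χ x * F x)) * dirD (e k) (dirD (e k) F) x) μ :=
    fun k => (tχ2F.mul_smooth (hD k)).integrable
  have i2 : ∀ k, Integrable (fun x => dirD (e k) χ x ^ 2 * F x ^ 2) μ := by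
    intro k
    have := ((hχ.dirD (e k)).mul_smooth (((hχ.dirD (e k)).1).mul (hF.mul hF))).integrable (μ := μ)
    refine this.congr (.of_forall fun x => ?_)
    simp only; ring
  have i3 : Integrable (fun x => χ x ^ 2 * F x * fderiv ℝ F x (b x)) μ := by
    refine ((tχ2F.mul_smooth hbF).integrable (μ := μ)).congr (.of_forall fun x => ?_)
    simp only; ring
  have i4 : Integrable (fun x => χ x * fderiv ℝ χ x (b x) * F x ^ 2) μ := by
    refine ((hχ.mul_smooth (hbχ.mul (hF.mul hF))).integrable (μ := μ)).congr
      (.of_forall fun x => ?_)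
    simp only; ring
  have e1 : ∫ x, (χ x * F x) * (χ x * driftExpr κ e b m F x) ∂μ =
      -κ * ∑ k, ∫ x, (χ x * (χ x * F x)) * dirD (e k) (dirD (e k) F) x ∂μ
      + ∫ x, χ x ^ 2 * F x * fderiv ℝ F x (b x) ∂μ + ∫ x, χ x ^ 2 * m x * F x ^ 2 ∂μ := by
    rw [← integral_finsetSum _ fun k _ => i1 k, ← integral_const_mul, ← integral_add, ← integral_add]
    · refine integral_congr_ae (.of_forall fun x => ?_)
      simp only [driftExpr, ← Finset.mul_sum]
      ring
    · exact ((integrable_finsetSum _ fun k _ => i1 k).const_mul _).add i3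
    · exact i0
    · exact (integrable_finsetSum _ fun k _ => i1 k).const_mul _
    · exact i3
  have e2 : ∫ x, (κ * ∑ k, dirD (e k) χ x ^ 2 + χ x * fderiv ℝ χ x (b x)) * F x ^ 2 ∂μ =
      κ * ∑ k, ∫ x, dirD (e k) χ x ^ 2 * F x ^ 2 ∂μ
        + ∫ x, χ x * fderiv ℝ χ x (b x) * F x ^ 2 ∂μ := by
    rw [← integral_finsetSum _ fun k _ => i2 k, ← integral_const_mul, ← integral_add]
    · refine integral_congr_ae (.of_forall fun x => ?_)
      simp only [← Finset.sum_mul]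
      ring
    · exact (integrable_finsetSum _ fun k _ => i2 k).const_mul _
    · exact i4
  rw [integral_add i4 i3] at h2
  rw [e1, e2]
  have := mul_le_mul_of_nonneg_left (Finset.sum_le_sum fun k (_ : k ∈ Finset.univ) => h1 k) hκ
  linarith

/-- The mollification of a weak solution solves the equation up to a commutator. -/
theorem driftExpr_mollify {κ : ℝ} (e : ι → E) {b : E → E} {m η f : E → ℝ}
    (hb : ContDiff ℝ ∞ b) (hm : ContDiff ℝ ∞ m) (hη : TestFn η)
    (hdiv : ∀ φ : E → ℝ, TestFn φ → ∫ x, fderiv ℝ φ x (b x) ∂μ = 0)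
    (hf : LocallyIntegrable f μ)
    (hweak : ∀ φ : E → ℝ, TestFn φ → ∫ x, f x * driftExpr κ e (fun y => -b y) m φ x ∂μ = 0)
    (x : E) :
    driftExpr κ e b m (mollify μ η f) x =
      ∫ t, (f (x - t) - f x) * fderiv ℝ η t (b x - b (x - t)) ∂μ
      + ∫ t, f (x - t) * ((m x - m (x - t)) * η t) ∂μ := by
  have tη := hη.comp_const_sub x
  have int : ∀ {ψ : E → ℝ}, TestFn ψ → Integrable (fun y => f y * ψ y) μ := fun h =>
    hf.integrable_smul_right_of_hasCompactSupport h.continuous h.2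
  have fd : ∀ y v, fderiv ℝ (fun y => η (x - y)) y v = -fderiv ℝ η (x - y) v := fun y v =>
    congrFun (dirD_comp_const_sub hη.1 x v) y
  have w := hweak _ tη
  have dd : ∀ k y, dirD (e k) (dirD (e k) fun y => η (x - y)) y
      = dirD (e k) (dirD (e k) η) (x - y) := by
    intro k y
    rw [dirD_comp_const_sub hη.1]
    rw [dirD_neg]
    have := congrFun (dirD_comp_const_sub (hη.1.dirD (e k)) x (e k)) y
    rw [this, neg_neg]
  simp only [driftExpr, dd, fd, map_neg, neg_neg] at w
  have hfdη : ContDiff ℝ ∞ (fderiv ℝ η) := hη.1.fderiv_right (m := ∞) (by simp)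
  have tbx : TestFn fun y => fderiv ℝ η (x - y) (b x) := (hη.dirD (b x)).comp_const_sub x
  have tby : TestFn fun y => fderiv ℝ η (x - y) (b y) := by
    refine ⟨(hfdη.comp (contDiff_const.sub contDiff_id)).clm_apply hb, ?_⟩
    refine HasCompactSupport.mono' ((hη.2.fderiv (𝕜 := ℝ)).comp_homeomorph (Homeomorph.subLeft x)) ?_
    refine fun y hy => subset_tsupport _ ?_
    simp only [Function.mem_support] at hy ⊢
    intro h0
    apply hy
    have h0' : fderiv ℝ η (x - y) = 0 := h0
    rw [h0']
    rfl
  have tD : TestFn fun y => -κ * ∑ k, dirD (e k) (dirD (e k) η) (x - y) :=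
    (TestFn.sum Finset.univ fun k => ((hη.dirD (e k)).dirD (e k)).comp_const_sub x).const_mul _
  have tm : TestFn fun y => m y * η (x - y) := tη.smooth_mul hm
  have tmx : TestFn fun y => m x * η (x - y) := tη.const_mul _
  have hL : driftExpr κ e b m (mollify μ η f) x
      = ∫ y, f y * (-κ * ∑ k, dirD (e k) (dirD (e k) η) (x - y) + fderiv ℝ η (x - y) (b x)
        + m x * η (x - y)) ∂μ := by
    unfold driftExpr
    rw [fderiv_mollify hη hf]
    simp only [dirD_mollify hη hf, dirD_mollify (hη.dirD _) hf]
    simp only [mul_add]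
    have s1 := integral_add ((int tD).add (int tbx)) (int tmx)
    have s2 := integral_add (int tD) (int tbx)
    simp only [Pi.add_apply] at s1
    rw [s1, s2]
    congr 1
    · congr 1
      simp only [mollify]
      rw [← integral_finsetSum _ fun k _ => int (((hη.dirD (e k)).dirD (e k)).comp_const_sub x),
        ← integral_const_mul]
      refine integral_congr_ae (.of_forall fun y => ?_)
      simp only [← Finset.mul_sum]; ring
    · rw [mollify, ← integral_const_mul]
      refine integral_congr_ae (.of_forall fun y => ?_)
      simp only; ring
  have hR : driftExpr κ e b m (mollify μ η f) x
      = ∫ y, f y * (fderiv ℝ η (x - y) (b x - b y)) ∂μ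
        + ∫ y, f y * ((m x - m y) * η (x - y)) ∂μ := by
    -- `w` is the weak equation tested with `y ↦ η(x - y)`; subtracting it cancels the second order
    -- terms and leaves only differences of coefficients.
    rw [hL, ← sub_zero (integral _ _), ← w, ← integral_sub, ← integral_add]
    · refine integral_congr_ae (.of_forall fun y => ?_)
      simp only [map_sub]; ring
    · refine (int (tbx.sub tby)).congr (.of_forall fun y => ?_)
      simp only [map_sub]
    · refine (int (tmx.sub tm)).congr (.of_forall fun y => ?_)
      simp only; ring
    · exact int ((tD.add tbx).add tmx)
    · exact int ((tD.add tby).add tm)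
  -- The commutator kernel has mean zero since `b` is divergence free. Hence `f(y)` may be replaced
  -- by `f(y) - f(x)`, and the oscillation of `f` enters instead of its size.
  have hz : ∫ y, fderiv ℝ η (x - y) (b x - b y) ∂μ = 0 := by
    simp only [map_sub]
    rw [integral_sub tbx.integrable tby.integrable]
    have z1 := hdiv _ tη
    simp only [fd, integral_neg, neg_eq_zero] at z1
    have z2 := integral_dirD (μ := μ) tη (b x)
    simp only [dirD_comp_const_sub hη.1, integral_neg, neg_eq_zero] at z2
    rw [z1, sub_zero]
    exact z2
  have hR1 : ∫ y, f y * (fderiv ℝ η (x - y) (b x - b y)) ∂μ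
      = ∫ y, (f y - f x) * (fderiv ℝ η (x - y) (b x - b y)) ∂μ := by
    simp only [sub_mul]
    rw [integral_sub, integral_const_mul, hz, mul_zero, sub_zero]
    · refine (int (tbx.sub tby)).congr (.of_forall fun y => ?_)
      simp only [map_sub]
    · refine ((tbx.sub tby).integrable.const_mul (f x)).congr (.of_forall fun y => ?_)
      simp only [map_sub]
  rw [hR, hR1]
  rw [← integral_sub_left_eq_self (fun y => (f y - f x) * (fderiv ℝ η (x - y) (b x - b y))) μ x,
    ← integral_sub_left_eq_self (fun y => f y * ((m x - m y) * η (x - y))) μ x]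
  simp only [sub_sub_cancel]

end Energy

/-! ### From smooth functions to weak solutions: the Friedrichs commutator. -/

section EnergyWeak

open Filter Topology

theorem tendsto_eLpNorm_two {α ι F : Type*} [MeasurableSpace α] {ν : Measure α}
    [NormedAddCommGroup F] {l : Filter ι} {G : ι → α → F}
    (h : Tendsto (fun n => ∫⁻ x, ‖G n x‖ₑ ^ 2 ∂ν) l (𝓝 0)) :
    Tendsto (fun n => eLpNorm (G n) 2 ν) l (𝓝 0) := by
  have h2 := (ENNReal.continuous_rpow_const (y := (1 / 2 : ℝ))).tendsto 0 |>.comp h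
  rw [ENNReal.zero_rpow_of_pos (by norm_num)] at h2
  refine h2.congr fun n => ?_
  rw [eLpNorm_eq_lintegral_rpow_enorm_toReal (by norm_num) (by norm_num)]
  simp

variable {E : Type*} [NormedAddCommGroup E] [NormedSpace ℝ E] [FiniteDimensional ℝ E]

theorem exists_lipschitz_on_ball {G : Type*} [NormedAddCommGroup G] [NormedSpace ℝ G] {b : E → G}
    (hb : ContDiff ℝ ∞ b) (R : ℝ) : ∃ L : ℝ, 0 ≤ L ∧ ∀ x ∈ Metric.closedBall (0 : E) R,
      ∀ y ∈ Metric.closedBall (0 : E) R, ‖b x - b y‖ ≤ L * ‖x - y‖ := by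
  obtain ⟨L, hL⟩ := (isCompact_closedBall (0 : E) R).exists_bound_of_continuousOn
    (hb.continuous_fderiv (by simp)).continuousOn
  refine ⟨max L 0, le_max_right _ _, fun x hx y hy => ?_⟩
  exact (convex_closedBall (0 : E) R).norm_image_sub_le_of_norm_fderiv_le (𝕜 := ℝ)
    (fun z _ => hb.differentiable_of_smooth z) (fun z hz => (hL z hz).trans (le_max_left _ _)) hy hx

variable [MeasurableSpace E] [BorelSpace E] {μ : Measure E} [μ.IsAddHaarMeasure]

/-- A kernel supported in the `ε`-ball and bounded by a multiple of its inverse volume acts on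
increments of `f` like a ball average. -/
theorem enorm_integral_kernel_le {f k : E → ℝ} {ε C : ℝ} (x : E) (hε : 0 < ε) (hC : 0 ≤ C)
    (h0 : ∀ t, ε < ‖t‖ → k t = 0)
    (hk : ∀ t, ‖t‖ ≤ ε → |k t| ≤ C * (μ.real (Metric.closedBall 0 ε))⁻¹) :
    ‖∫ t, (f (x - t) - f x) * k t ∂μ‖ₑ ≤ ENNReal.ofReal C * ballOscillation μ f ε x := by
  have hfin : μ (Metric.closedBall (0:E) ε) ≠ ⊤ := measure_closedBall_lt_top.ne
  have hpos : 0 < μ.real (Metric.closedBall (0:E) ε) :=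
    ENNReal.toReal_pos (Metric.measure_closedBall_pos μ 0 hε).ne' hfin
  have e1 : ENNReal.ofReal (C * (μ.real (Metric.closedBall (0:E) ε))⁻¹)
      = ENNReal.ofReal C * (μ (Metric.closedBall (0:E) ε))⁻¹ := by
    rw [ENNReal.ofReal_mul hC, ENNReal.ofReal_inv_of_pos hpos, Measure.real,
      ENNReal.ofReal_toReal hfin]
  calc ‖∫ t, (f (x - t) - f x) * k t ∂μ‖ₑ
      ≤ ∫⁻ t, ‖(f (x - t) - f x) * k t‖ₑ ∂μ := enorm_integral_le_lintegral_enorm _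
    _ ≤ ∫⁻ t, (Metric.closedBall (0:E) ε).indicator
          (fun t => ENNReal.ofReal (C * (μ.real (Metric.closedBall (0:E) ε))⁻¹)
            * ‖f (x - t) - f x‖ₑ) t ∂μ := by
        refine lintegral_mono fun t => ?_
        by_cases ht : ‖t‖ ≤ ε
        · rw [Set.indicator_of_mem (by simpa using ht), enorm_mul, mul_comm]
          gcongr
          rw [Real.enorm_eq_ofReal_abs]
          exact ENNReal.ofReal_le_ofReal (hk t ht)
        · rw [h0 t (not_le.mp ht)]
          simp
    _ = ENNReal.ofReal C * ballOscillation μ f ε x := by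
        rw [lintegral_indicator Metric.isClosed_closedBall.measurableSet,
          lintegral_const_mul' _ _ ENNReal.ofReal_ne_top, e1, ballOscillation, mul_assoc]

theorem integrable_translate_mul {f k : E → ℝ} (hf : LocallyIntegrable f μ) (hk : Continuous k)
    (hc : HasCompactSupport k) (x : E) : Integrable (fun t => f (x - t) * k t) μ := by
  have h : Integrable (fun y => f y * k (x - y)) μ :=
    hf.integrable_smul_right_of_hasCompactSupport (hk.comp (continuous_const.sub continuous_id))
      (hc.comp_homeomorph (Homeomorph.subLeft x))
  simpa using h.comp_sub_left x

theorem enorm_mollify_sub_le {f : E → ℝ} (hf : LocallyIntegrable f μ) {C ε : ℝ} (hC : 0 ≤ C)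
    (hb : ∀ x : E, |mollifier μ ε x| ≤ C * (μ.real (Metric.closedBall 0 ε))⁻¹) (hε : 0 < ε)
    (x : E) : ‖mollify μ (mollifier μ ε) f x - f x‖ₑ
      ≤ ENNReal.ofReal C * ballOscillation μ f ε x := by
  have t := testFn_mollifier (μ := μ) hε
  have e : mollify μ (mollifier μ ε) f x - f x
      = ∫ t, (f (x - t) - f x) * mollifier μ ε t ∂μ := by
    simp only [sub_mul]
    rw [integral_sub (integrable_translate_mul hf t.continuous t.2 x) (t.integrable.const_mul _),
      integral_const_mul, integral_mollifier hε, mul_one, mollify,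
      ← integral_sub_left_eq_self _ μ x]
    simp only [sub_sub_cancel]
  rw [e]
  exact enorm_integral_kernel_le x hε hC (fun t ht => mollifier_eq_zero hε ht) fun t _ => hb t

/-- The factor `ε⁻¹` lost on the derivative of the mollifier is regained from `b x - b (x - t) =
O(ε)`. In the zeroth order term `f (x - t)` is split into an increment and `f x`; the latter meets a
kernel whose integral is `O(ε)`. -/
theorem enorm_commutator_le {f : E → ℝ} (hf : LocallyIntegrable f μ) {b : E → E} {m : E → ℝ}
    (hm : Continuous m) {C ε L R : ℝ}
    (hC : 0 ≤ C) (hL : 0 ≤ L) (hε : 0 < ε) (hε1 : ε ≤ 1)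
    (hη : ∀ x : E, |mollifier μ ε x| ≤ C * (μ.real (Metric.closedBall 0 ε))⁻¹ ∧
      ‖fderiv ℝ (mollifier μ ε) x‖ ≤ C * (μ.real (Metric.closedBall 0 ε))⁻¹ * ε⁻¹)
    (hbL : ∀ x ∈ Metric.closedBall (0 : E) (R + 1),
      ∀ y ∈ Metric.closedBall (0 : E) (R + 1), ‖b x - b y‖ ≤ L * ‖x - y‖)
    (hmL : ∀ x ∈ Metric.closedBall (0 : E) (R + 1),
      ∀ y ∈ Metric.closedBall (0 : E) (R + 1), ‖m x - m y‖ ≤ L * ‖x - y‖)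
    {x : E} (hx : ‖x‖ ≤ R) :
    ‖∫ t, (f (x - t) - f x) * fderiv ℝ (mollifier μ ε) t (b x - b (x - t)) ∂μ
      + ∫ t, f (x - t) * ((m x - m (x - t)) * mollifier μ ε t) ∂μ‖ₑ
    ≤ ENNReal.ofReal (2 * (C * L)) * ballOscillation μ f ε x
      + ENNReal.ofReal (C * L * ε) * ‖f x‖ₑ := by
  have tη := testFn_mollifier (μ := μ) hε
  set v := μ.real (Metric.closedBall (0:E) ε) with hv
  have hfin : μ (Metric.closedBall (0:E) ε) ≠ ⊤ := measure_closedBall_lt_top.ne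
  have hpos : 0 < v :=
    ENNReal.toReal_pos (Metric.measure_closedBall_pos μ 0 hε).ne' hfin
  have hx1 : x ∈ Metric.closedBall (0 : E) (R + 1) := by
    rw [mem_closedBall_zero_iff]; linarith
  have hxt : ∀ t, ‖t‖ ≤ ε → x - t ∈ Metric.closedBall (0 : E) (R + 1) := fun t ht => by
    rw [mem_closedBall_zero_iff]; linarith [norm_sub_le x t]
  have k2b : ∀ t, ‖t‖ ≤ ε → |(m x - m (x - t)) * mollifier μ ε t| ≤ C * L * ε * v⁻¹ := by
    intro t ht
    rw [abs_mul]
    have h1 := hmL x hx1 _ (hxt t ht)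
    rw [sub_sub_cancel] at h1
    calc |m x - m (x - t)| * |mollifier μ ε t| ≤ (L * ε) * (C * v⁻¹) := by
          gcongr
          · exact h1.trans (by gcongr)
          · exact (hη t).1
      _ = _ := by ring
  have k20 : ∀ t, ε < ‖t‖ → (m x - m (x - t)) * mollifier μ ε t = 0 := fun t ht => by
    rw [mollifier_eq_zero hε ht, mul_zero]
  have k2c : Continuous fun t => (m x - m (x - t)) * mollifier μ ε t := by
    have := tη.continuous
    fun_prop
  have k2s : HasCompactSupport fun t => (m x - m (x - t)) * mollifier μ ε t :=
    tη.2.mul_left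
  have split : ∫ t, f (x - t) * ((m x - m (x - t)) * mollifier μ ε t) ∂μ
      = ∫ t, (f (x - t) - f x) * ((m x - m (x - t)) * mollifier μ ε t) ∂μ
        + f x * ∫ t, (m x - m (x - t)) * mollifier μ ε t ∂μ := by
    simp only [sub_mul (f _)]
    rw [integral_sub (integrable_translate_mul hf k2c k2s x)
      ((k2c.integrable_of_hasCompactSupport k2s).const_mul _), integral_const_mul]
    ring
  have b1 := enorm_integral_kernel_le (μ := μ) (f := f)
    (k := fun t => fderiv ℝ (mollifier μ ε) t (b x - b (x - t))) (C := C * L) x hε (by positivity)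
    (fun t ht => by rw [fderiv_mollifier_eq_zero hε ht]; rfl)
    (fun t ht => by
      have h1 := hbL x hx1 _ (hxt t ht)
      rw [sub_sub_cancel] at h1
      calc |fderiv ℝ (mollifier μ ε) t (b x - b (x - t))|
          ≤ ‖fderiv ℝ (mollifier μ ε) t‖ * ‖b x - b (x - t)‖ := by
            rw [← Real.norm_eq_abs]
            exact ContinuousLinearMap.le_opNorm _ _
        _ ≤ (C * v⁻¹ * ε⁻¹) * (L * ε) := by
          gcongr
          · exact (hη t).2
          · exact h1.trans (by gcongr)
        _ = C * L * v⁻¹ := by field_simp)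
  have b2 := enorm_integral_kernel_le (μ := μ) (f := f)
    (k := fun t => (m x - m (x - t)) * mollifier μ ε t) (C := C * L) x hε (by positivity) k20
    (fun t ht => (k2b t ht).trans (mul_le_mul_of_nonneg_right
      (mul_le_of_le_one_right (by positivity) hε1) (inv_nonneg.2 hpos.le)))
  have b3 : ‖∫ t, (m x - m (x - t)) * mollifier μ ε t ∂μ‖ ≤ C * L * ε := by
    rw [← setIntegral_eq_integral_of_forall_compl_eq_zero
      (s := Metric.closedBall (0 : E) ε) fun t ht => k20 t (by simpa using ht)]
    refine (norm_setIntegral_le_of_norm_le_const (C := C * L * ε * v⁻¹)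
      measure_closedBall_lt_top fun t ht => k2b t (by simpa using ht)).trans ?_
    rw [← hv, inv_mul_cancel_right₀ hpos.ne']
  have b3' : ‖∫ t, (m x - m (x - t)) * mollifier μ ε t ∂μ‖ₑ ≤ ENNReal.ofReal (C * L * ε) := by
    rw [← ofReal_norm]
    exact ENNReal.ofReal_le_ofReal b3
  rw [split, ← add_assoc]
  calc _ ≤ _ := (enorm_add_le _ _).trans (add_le_add_left (enorm_add_le _ _) _)
    _ ≤ (ENNReal.ofReal (C * L) * ballOscillation μ f ε x
          + ENNReal.ofReal (C * L) * ballOscillation μ f ε x)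
          + ‖f x‖ₑ * ENNReal.ofReal (C * L * ε) := by
        rw [enorm_mul]
        gcongr
    _ = _ := by
        rw [ENNReal.ofReal_mul (by norm_num : (0:ℝ) ≤ 2), ENNReal.ofReal_ofNat]
        ring

theorem ennreal_add_sq_le (a b : ℝ≥0∞) : (a + b) ^ 2 ≤ 2 * (a ^ 2 + b ^ 2) := by
  have := ENNReal.rpow_add_le_mul_rpow_add_rpow a b one_le_two
  norm_num at this
  exact this

/-- A common criterion: it applies both to the convergence of the mollifications and to the
vanishing of the commutator. -/
theorem tendsto_lintegral_sq_of_oscillation {f : E → ℝ} (hf : MemLp f 2 μ)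
    (hfm : StronglyMeasurable f) {ε : ℕ → ℝ} (hε : Tendsto ε atTop (𝓝[>] 0)) {G : ℕ → E → ℝ}
    {A A' : ℝ} (hG : ∀ n x, ‖G n x‖ₑ ≤ ENNReal.ofReal A * ballOscillation μ f (ε n) x
      + ENNReal.ofReal (A' * ε n) * ‖f x‖ₑ) :
    Tendsto (fun n => eLpNorm (G n) 2 μ) atTop (𝓝 0) := by
  refine tendsto_eLpNorm_two ?_
  have h1 := (tendsto_lintegral_oscillation_sq hf hfm).comp hε
  have hf2 : ∫⁻ x, ‖f x‖ₑ ^ 2 ∂μ ≠ ⊤ := by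
    have := lintegral_rpow_enorm_lt_top_of_eLpNorm_lt_top (by norm_num) (by norm_num) hf.2
    simpa using this.ne
  have h2 : Tendsto (fun n => ENNReal.ofReal (A' * ε n)) atTop (𝓝 0) := by
    rw [← ENNReal.ofReal_zero]
    refine ENNReal.tendsto_ofReal ?_
    simpa using (tendsto_nhds_of_tendsto_nhdsWithin hε).const_mul A'
  have key : ∀ n, ∫⁻ x, ‖G n x‖ₑ ^ 2 ∂μ ≤
      2 * (ENNReal.ofReal A ^ 2 * ∫⁻ x, ballOscillation μ f (ε n) x ^ 2 ∂μ)
      + 2 * (ENNReal.ofReal (A' * ε n) ^ 2 * ∫⁻ x, ‖f x‖ₑ ^ 2 ∂μ) := by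
    intro n
    have hm : Measurable fun x => ‖f x‖ₑ := hfm.measurable.enorm
    calc _ ≤ ∫⁻ x, (2 * (ENNReal.ofReal A ^ 2 * ballOscillation μ f (ε n) x ^ 2)
          + 2 * (ENNReal.ofReal (A' * ε n) ^ 2 * ‖f x‖ₑ ^ 2)) ∂μ := by
          refine lintegral_mono fun x => ?_
          refine (pow_le_pow_left' (hG n x) 2).trans ?_
          refine (ennreal_add_sq_le _ _).trans_eq ?_
          rw [mul_pow, mul_pow, mul_add]
      _ = _ := by
          rw [lintegral_add_right _ (((hm.pow_const 2).const_mul _).const_mul _),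
            lintegral_const_mul' _ _ (by simp), lintegral_const_mul' _ _ (by simp),
            lintegral_const_mul' _ _ (by simp), lintegral_const_mul' _ _ (by simp)]
  refine tendsto_of_tendsto_of_tendsto_of_le_of_le tendsto_const_nhds ?_ (fun _ => bot_le) key
  have l1 := ENNReal.Tendsto.const_mul (a := 2) (ENNReal.Tendsto.const_mul
    (a := ENNReal.ofReal A ^ 2) h1 (Or.inr (by simp))) (Or.inr (by simp))
  have l2 := ENNReal.Tendsto.const_mul (a := 2) (ENNReal.Tendsto.mul_const
    (b := ∫⁻ x, ‖f x‖ₑ ^ 2 ∂μ) (ENNReal.Tendsto.pow (n := 2) h2) (Or.inr hf2)) (Or.inr (by simp))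
  simpa using l1.add l2

variable {ι : Type*} [Fintype ι]

/-- Energy estimate for an `L²` distributional solution of `-κ ∑ D_k² f + D_b f + m f = 0` with a
divergence free drift `b`. -/
theorem energy_estimate_weak {κ : ℝ} (hκ : 0 ≤ κ) (e : ι → E) {b : E → E} {m f χ : E → ℝ}
    (hb : ContDiff ℝ ∞ b) (hm : ContDiff ℝ ∞ m)
    (hdiv : ∀ φ : E → ℝ, TestFn φ → ∫ x, fderiv ℝ φ x (b x) ∂μ = 0)
    (hf : MemLp f 2 μ)
    (hweak : ∀ φ : E → ℝ, TestFn φ → ∫ x, f x * driftExpr κ e (fun y => -b y) m φ x ∂μ = 0)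
    (hχ : TestFn χ) :
    ∫ x, χ x ^ 2 * m x * f x ^ 2 ∂μ ≤
      ∫ x, (κ * ∑ k, dirD (e k) χ x ^ 2 + χ x * fderiv ℝ χ x (b x)) * f x ^ 2 ∂μ := by
  -- Tonelli in the oscillation estimate needs a strongly measurable representative; hypotheses and
  -- conclusion depend only on the class of `f`.
  wlog hfm : StronglyMeasurable f generalizing f
  · obtain ⟨g, hg, hfg⟩ := hf.1
    have h := this (f := g) (hf.ae_eq hfg) (fun φ hφ => by
      rw [← hweak φ hφ]
      refine integral_congr_ae ?_
      filter_upwards [hfg] with x hx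
      rw [hx]) hg
    refine le_of_eq_of_le ?_ (h.trans_eq ?_)
    · refine integral_congr_ae ?_
      filter_upwards [hfg] with x hx
      rw [hx]
    · refine integral_congr_ae ?_
      filter_upwards [hfg] with x hx
      rw [hx]
  have hloc : LocallyIntegrable f μ := hf.locallyIntegrable (by norm_num)
  -- a sequence of scales
  let ε : ℕ → ℝ := fun n => 1 / (n + 1)
  have hε0 : ∀ n, 0 < ε n := fun n => by positivity
  have hε1 : ∀ n, ε n ≤ 1 := fun n => by
    refine (div_le_one (by positivity)).2 ?_
    linarith [(Nat.cast_nonneg n : (0:ℝ) ≤ n)]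
  have hε : Tendsto ε atTop (𝓝[>] 0) :=
    tendsto_nhdsWithin_iff.2 ⟨tendsto_one_div_add_atTop_nhds_zero_nat, .of_forall hε0⟩
  obtain ⟨C, hC, hη⟩ := exists_mollifier_bounds μ
  let F : ℕ → E → ℝ := fun n => mollify μ (mollifier μ (ε n)) f
  have hF : ∀ n, ContDiff ℝ ∞ (F n) := fun n => contDiff_mollify (testFn_mollifier (hε0 n)) hloc
  -- products of `F n` with test functions converge
  have prod : ∀ ψ : E → ℝ, TestFn ψ →
      Tendsto (fun n => eLpNorm ((fun x => ψ x * F n x) - fun x => ψ x * f x) 2 μ) atTop (𝓝 0) := by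
    intro ψ hψ
    obtain ⟨D, hD⟩ := hψ.2.exists_bound_of_continuous hψ.continuous
    have hD0 : 0 ≤ D := (norm_nonneg _).trans (hD 0)
    refine tendsto_lintegral_sq_of_oscillation hf hfm hε (A := D * C) (A' := 0) fun n x => ?_
    simp only [Pi.sub_apply, ← mul_sub, zero_mul, ENNReal.ofReal_zero, add_zero, enorm_mul]
    rw [ENNReal.ofReal_mul hD0, mul_assoc]
    gcongr
    · rw [← ofReal_norm]
      exact ENNReal.ofReal_le_ofReal (hD x)
    · exact enorm_mollify_sub_le hloc hC (fun x => (hη _ (hε0 n) x).1) (hε0 n) x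
  have mem : ∀ ψ : E → ℝ, TestFn ψ → MemLp (fun x => ψ x * f x) 2 μ := by
    intro ψ hψ
    obtain ⟨D, hD⟩ := hψ.2.exists_bound_of_continuous hψ.continuous
    exact hf.of_le_mul (c := D) (hψ.continuous.aestronglyMeasurable.mul hf.1) (.of_forall fun x => by
      rw [norm_mul]
      gcongr
      exact hD x)
  have memF : ∀ ψ : E → ℝ, TestFn ψ → ∀ n, MemLp (fun x => ψ x * F n x) 2 μ := fun ψ hψ n =>
    (hψ.mul_smooth (hF n)).memLp 2
  have lim : ∀ ψ ψ' : E → ℝ, TestFn ψ → TestFn ψ' →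
      Tendsto (fun n => ∫ x, (ψ x * F n x) * (ψ' x * F n x) ∂μ) atTop
        (𝓝 (∫ x, (ψ x * f x) * (ψ' x * f x) ∂μ)) := fun ψ ψ' h h' =>
    tendsto_integral_mul (mem ψ h) (mem ψ' h') (memF ψ h) (memF ψ' h') (prod ψ h) (prod ψ' h')
  -- the commutator tends to zero
  obtain ⟨R, hR⟩ := hχ.2.isBounded.subset_closedBall (0 : E)
  -- At scales `ε ≤ 1` the commutator at a point of the support of `χ` sees only points at distance
  -- at most one, hence the radius `R + 1`.
  obtain ⟨L₁, hL₁, hbL⟩ := exists_lipschitz_on_ball hb (R + 1)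
  obtain ⟨L₂, hL₂, hmL⟩ := exists_lipschitz_on_ball hm (R + 1)
  have comm : Tendsto (fun n => eLpNorm
      ((fun x => χ x * driftExpr κ e b m (F n) x) - fun _ => 0) 2 μ) atTop (𝓝 0) := by
    obtain ⟨D, hD⟩ := hχ.2.exists_bound_of_continuous hχ.continuous
    have hD0 : 0 ≤ D := (norm_nonneg _).trans (hD 0)
    refine tendsto_lintegral_sq_of_oscillation hf hfm hε (A := D * (2 * (C * max L₁ L₂)))
      (A' := D * (C * max L₁ L₂)) fun n x => ?_
    simp only [Pi.sub_apply, sub_zero]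
    by_cases hx : x ∈ tsupport χ
    · rw [driftExpr_mollify e hb hm (testFn_mollifier (hε0 n)) hdiv hloc hweak, enorm_mul]
      have h := enorm_commutator_le (μ := μ) (L := max L₁ L₂) hloc hm.continuous hC (le_max_of_le_left hL₁) (hε0 n)
        (hε1 n) (hη _ (hε0 n))
        (fun x hx y hy => (hbL x hx y hy).trans (by gcongr; exact le_max_left _ _))
        (fun x hx y hy => (hmL x hx y hy).trans (by gcongr; exact le_max_right _ _))
        (x := x) (by simpa using hR hx)
      have hDx : ‖χ x‖ₑ ≤ ENNReal.ofReal D := by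
        rw [← ofReal_norm]
        exact ENNReal.ofReal_le_ofReal (hD x)
      refine (mul_le_mul' hDx h).trans_eq ?_
      rw [mul_add, ENNReal.ofReal_mul hD0, mul_assoc D, ENNReal.ofReal_mul hD0]
      ring
    · rw [image_eq_zero_of_notMem_tsupport hx]
      simp
  have lim0 : Tendsto (fun n => ∫ x, (χ x * F n x) * (χ x * driftExpr κ e b m (F n) x) ∂μ) atTop
      (𝓝 (∫ x, (χ x * f x) * 0 ∂μ)) :=
    tendsto_integral_mul (mem χ hχ) MemLp.zero' (memF χ hχ)
      (fun n => (hχ.mul_smooth (contDiff_driftExpr hb hm (hF n))).memLp 2) (prod χ hχ) comm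
  simp only [mul_zero, integral_zero] at lim0
  -- the other terms
  have tb : TestFn fun x => fderiv ℝ χ x (b x) := by
    refine ⟨contDiff_fderiv_apply hχ.1 hb, HasCompactSupport.mono' (hχ.2.fderiv (𝕜 := ℝ)) ?_⟩
    refine fun y hy => subset_tsupport _ ?_
    simp only [Function.mem_support] at hy ⊢
    intro h0
    rw [h0] at hy
    exact hy rfl
  have limL : Tendsto (fun n => ∫ x, χ x ^ 2 * m x * F n x ^ 2 ∂μ) atTop
      (𝓝 (∫ x, χ x ^ 2 * m x * f x ^ 2 ∂μ)) := by
    have := lim χ (fun x => χ x * m x) hχ (hχ.mul_smooth hm)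
    convert! this using 4 <;> ring
  have expand : ∀ G : E → ℝ, (∀ ψ, TestFn ψ → MemLp (fun x => ψ x * G x) 2 μ) →
      ∫ x, (κ * ∑ k, dirD (e k) χ x ^ 2 + χ x * fderiv ℝ χ x (b x)) * G x ^ 2 ∂μ
      = κ * ∑ k, ∫ x, (dirD (e k) χ x * G x) * (dirD (e k) χ x * G x) ∂μ
        + ∫ x, (χ x * G x) * (fderiv ℝ χ x (b x) * G x) ∂μ := by
    intro G hG
    have i1 : ∀ k, Integrable (fun x => (dirD (e k) χ x * G x) * (dirD (e k) χ x * G x)) μ :=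
      fun k => (hG _ (hχ.dirD _)).integrable_mul (hG _ (hχ.dirD _))
    rw [← integral_finsetSum _ fun k _ => i1 k, ← integral_const_mul, ← integral_add]
    · refine integral_congr_ae (.of_forall fun x => ?_)
      simp only [add_mul, mul_assoc, Finset.sum_mul, Finset.mul_sum]
      congr 1
      · exact Finset.sum_congr rfl fun k _ => by ring
      · ring
    · exact (integrable_finsetSum _ fun k _ => i1 k).const_mul _
    · exact (hG _ hχ).integrable_mul (hG _ tb)
  have limR : Tendsto (fun n => ∫ x, (κ * ∑ k, dirD (e k) χ x ^ 2 + χ x * fderiv ℝ χ x (b x))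
      * F n x ^ 2 ∂μ) atTop (𝓝 (∫ x, (κ * ∑ k, dirD (e k) χ x ^ 2 + χ x * fderiv ℝ χ x (b x))
      * f x ^ 2 ∂μ)) := by
    rw [expand f mem]
    simp only [fun n => expand (F n) fun ψ hψ => memF ψ hψ n]
    exact ((tendsto_finsetSum _ fun k _ => lim _ _ (hχ.dirD _) (hχ.dirD _)).const_mul _).add
      (lim _ _ hχ tb)
  have := le_of_tendsto_of_tendsto' limL (lim0.add limR) fun n =>
    energy_estimate_smooth hκ e hb hm hdiv (hF n) hχ
  simpa using this

end EnergyWeak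

/-! ### Cutoff functions -/

section Cutoff

open Filter Topology

variable {E : Type*} [NormedAddCommGroup E] [NormedSpace ℝ E] [FiniteDimensional ℝ E]

/-- A smooth cutoff function, equal to one on the ball of radius `R`, supported in the ball of
radius `2 R`. -/
def cutoff (R : ℝ) (x : E) : ℝ :=
  (⟨1, 2, by norm_num, by norm_num⟩ : ContDiffBump (0 : E)) (R⁻¹ • x)

theorem testFn_cutoff {R : ℝ} (hR : 0 < R) : TestFn (cutoff R : E → ℝ) :=
  ⟨(ContDiffBump.contDiff _).comp (contDiff_const_smul _),
    (ContDiffBump.hasCompactSupport _).comp_smul (inv_ne_zero hR.ne')⟩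

theorem cutoff_nonneg (R : ℝ) (x : E) : 0 ≤ cutoff R x := ContDiffBump.nonneg _

theorem cutoff_le_one (R : ℝ) (x : E) : cutoff R x ≤ 1 := ContDiffBump.le_one _

theorem cutoff_eq_one {R : ℝ} (hR : 0 < R) {x : E} (hx : ‖x‖ ≤ R) : cutoff R x = 1 := by
  refine ContDiffBump.one_of_mem_closedBall _ ?_
  rw [mem_closedBall_zero_iff, norm_smul, norm_inv, Real.norm_of_nonneg hR.le, ← div_eq_inv_mul]
  exact (div_le_one hR).2 hx

theorem cutoff_eq_zero {R : ℝ} (hR : 0 < R) {x : E} (hx : 2 * R ≤ ‖x‖) : cutoff R x = 0 := by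
  refine ContDiffBump.zero_of_le_dist _ ?_
  rw [dist_zero_right, norm_smul, norm_inv, Real.norm_of_nonneg hR.le, ← div_eq_inv_mul]
  exact (le_div_iff₀ hR).2 hx

theorem tendsto_cutoff {R : ℕ → ℝ} (hR : Tendsto R atTop atTop) (x : E) :
    Tendsto (fun n => cutoff (R n) x) atTop (𝓝 1) := by
  refine tendsto_const_nhds.congr' ?_
  filter_upwards [hR.eventually_ge_atTop (max ‖x‖ 1)] with n hn
  exact (cutoff_eq_one (one_pos.trans_le ((le_max_right _ _).trans hn))
    ((le_max_left _ _).trans hn)).symm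

theorem exists_cutoff_bound (E : Type*) [NormedAddCommGroup E] [NormedSpace ℝ E]
    [FiniteDimensional ℝ E] : ∃ C : ℝ, 0 ≤ C ∧ ∀ R : ℝ, 0 < R → ∀ x v : E,
    |dirD v (cutoff R) x| ≤ C / R * ‖v‖ := by
  let f : ContDiffBump (0 : E) := ⟨1, 2, by norm_num, by norm_num⟩
  have hf : ContDiff ℝ ∞ f := f.contDiff
  obtain ⟨C, hC⟩ := (f.hasCompactSupport.fderiv (𝕜 := ℝ)).exists_bound_of_continuous
    (hf.continuous_fderiv (by simp))
  refine ⟨C, (norm_nonneg _).trans (hC 0), fun R hR x v => ?_⟩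
  have h1 : fderiv ℝ (cutoff R : E → ℝ) x = R⁻¹ • fderiv ℝ f (R⁻¹ • x) := fderiv_comp_smul _
  rw [dirD, h1, ← Real.norm_eq_abs]
  refine (ContinuousLinearMap.le_opNorm _ _).trans ?_
  rw [norm_smul, norm_inv, Real.norm_of_nonneg hR.le, div_eq_inv_mul]
  gcongr
  exact hC _

theorem ae_eq_zero_of_cutoff {α : Type*} [MeasurableSpace α] {ν : Measure α} {f : α → ℝ}
    (hf : MemLp f 2 ν) {χ : ℕ → α → ℝ} (hm : ∀ n, AEStronglyMeasurable (χ n) ν)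
    (h0 : ∀ n x, 0 ≤ χ n x) (h1 : ∀ n x, χ n x ≤ 1)
    (hlim : ∀ x, Tendsto (fun n => χ n x) atTop (𝓝 1)) {δ : ℕ → ℝ} (hδ : Tendsto δ atTop (𝓝 0))
    (h : ∀ n, ∫ x, χ n x ^ 2 * f x ^ 2 ∂ν ≤ δ n) : f =ᵐ[ν] 0 := by
  have hi : Integrable (fun x => f x ^ 2) ν := hf.integrable_sq
  have lim : Tendsto (fun n => ∫ x, χ n x ^ 2 * f x ^ 2 ∂ν) atTop (𝓝 (∫ x, f x ^ 2 ∂ν)) := by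
    refine tendsto_integral_of_dominated_convergence (fun x => f x ^ 2)
      (fun n => ((hm n).pow 2).mul hi.1) hi (fun n => .of_forall fun x => ?_)
      (.of_forall fun x => ?_)
    · rw [Real.norm_of_nonneg (by positivity)]
      exact mul_le_of_le_one_left (sq_nonneg _) (pow_le_one₀ (h0 n x) (h1 n x))
    · simpa using ((hlim x).pow 2).mul_const (f x ^ 2)
  have hle : ∫ x, f x ^ 2 ∂ν ≤ 0 := le_of_tendsto_of_tendsto' lim hδ h
  have hz := (integral_eq_zero_iff_of_nonneg (fun x => sq_nonneg (f x)) hi).1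
    (le_antisymm hle (integral_nonneg fun x => sq_nonneg _))
  filter_upwards [hz] with x hx
  simpa using hx

variable [MeasurableSpace E] [BorelSpace E] {μ : Measure E} [μ.IsAddHaarMeasure]

/-- The energy estimate with zero drift and a cutoff at scale `n + 1` bounds `‖χf‖²` by a multiple
of `(n + 1)⁻² ‖f‖²`. This is the uniqueness behind the essential self-adjointness of a Schrödinger
operator bounded below. -/
theorem weak_solution_eq_zero {ι : Type*} [Fintype ι] (e : ι → E) {m f : E → ℝ}
    (hm : ContDiff ℝ ∞ m) (h1 : ∀ x, 1 ≤ m x) (hf : MemLp f 2 μ)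
    (hweak : ∀ φ : E → ℝ, TestFn φ →
      ∫ x, f x * (-∑ k, dirD (e k) (dirD (e k) φ) x + m x * φ x) ∂μ = 0) : f =ᵐ[μ] 0 := by
  obtain ⟨C, hC, hcut⟩ := exists_cutoff_bound E
  have hi : Integrable (fun x => f x ^ 2) μ := hf.integrable_sq
  set A := ∑ k, (C * ‖e k‖) ^ 2
  have lim : Tendsto (fun n : ℕ => A * ((1 / ((n : ℝ) + 1)) ^ 2) * ∫ x, f x ^ 2 ∂μ) atTop (𝓝 0) := by
    have := ((tendsto_one_div_add_atTop_nhds_zero_nat (𝕜 := ℝ)).pow 2).const_mul A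
    simpa using this.mul_const (∫ x, f x ^ 2 ∂μ)
  have hR : Tendsto (fun n : ℕ => (n : ℝ) + 1) atTop atTop :=
    tendsto_atTop_add_const_right _ _ tendsto_natCast_atTop_atTop
  refine ae_eq_zero_of_cutoff hf (χ := fun n => cutoff ((n : ℝ) + 1))
    (fun n => (testFn_cutoff (by positivity)).continuous.aestronglyMeasurable)
    (fun n => cutoff_nonneg _) (fun n => cutoff_le_one _) (tendsto_cutoff hR) lim fun n => ?_
  have hp : (0 : ℝ) < n + 1 := by positivity
  have key := energy_estimate_weak (μ := μ) zero_le_one e (b := fun _ => 0) (χ := cutoff ((n : ℝ) + 1))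
    contDiff_const hm (by simp) hf (by simpa [driftExpr] using hweak) (testFn_cutoff hp)
  have tχ : TestFn (cutoff ((n : ℝ) + 1) : E → ℝ) := testFn_cutoff hp
  have bdd : ∀ ψ : E → ℝ, TestFn ψ → Integrable (fun x => ψ x * f x ^ 2) μ := fun ψ hψ => by
    obtain ⟨D, hD⟩ := hψ.2.exists_bound_of_continuous hψ.continuous
    exact hi.bdd_mul hψ.continuous.aestronglyMeasurable (.of_forall hD)
  refine le_trans (integral_mono ?_ ?_ fun x => ?_) (key.trans ?_)
  · simpa [sq] using bdd _ (tχ.mul_smooth tχ.1)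
  · simpa [sq, mul_assoc] using bdd _ (tχ.mul_smooth (tχ.1.mul hm))
  · simp only
    have := mul_le_mul_of_nonneg_left (h1 x) (sq_nonneg (cutoff ((n : ℝ) + 1) x * f x))
    nlinarith
  · rw [← integral_const_mul]
    refine integral_mono ?_ (hi.const_mul _) fun x => ?_
    · simp only [map_zero, mul_zero, add_zero, one_mul, sq]
      simpa [sq] using bdd _ (TestFn.sum Finset.univ fun k => (tχ.dirD (e k)).mul_smooth (tχ.1.dirD (e k)))
    · simp only [map_zero, mul_zero, add_zero, one_mul]
      gcongr
      rw [Finset.sum_mul]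
      refine Finset.sum_le_sum fun k _ => ?_
      rw [← mul_pow, ← sq_abs]
      refine pow_le_pow_left₀ (abs_nonneg _) ?_ 2
      refine (hcut _ hp x (e k)).trans_eq ?_
      ring

end Cutoff

/-! ### The Witten Laplacian -/

section Witten

variable {d : ℕ}

/-- Partial derivative of a real function of the position. -/
def pd (i : Fin d) (φ : EuclideanSpace ℝ (Fin d) → ℝ) : EuclideanSpace ℝ (Fin d) → ℝ :=
  dirD (EuclideanSpace.single i 1) φ

theorem ContDiff.pd {φ : EuclideanSpace ℝ (Fin d) → ℝ} (h : ContDiff ℝ ∞ φ) (i : Fin d) :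
    ContDiff ℝ ∞ (pd i φ) := h.dirD _

theorem TestFn.pd {φ : EuclideanSpace ℝ (Fin d) → ℝ} (h : TestFn φ) (i : Fin d) :
    TestFn (pd i φ) := h.dirD _

variable (b : ℝ) (V : EuclideanSpace ℝ (Fin d) → ℝ)

/-- `∂_i + b ∂_i V`. -/
def alpha (i : Fin d) (φ : EuclideanSpace ℝ (Fin d) → ℝ) (x : EuclideanSpace ℝ (Fin d)) : ℝ :=
  pd i φ x + b * pd i V x * φ x

/-- `-∂_i + b ∂_i V`. -/
def alphaStar (i : Fin d) (φ : EuclideanSpace ℝ (Fin d) → ℝ) (x : EuclideanSpace ℝ (Fin d)) : ℝ :=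
  -pd i φ x + b * pd i V x * φ x

/-- The Witten Laplacian. -/
def witten (φ : EuclideanSpace ℝ (Fin d) → ℝ) (x : EuclideanSpace ℝ (Fin d)) : ℝ :=
  ∑ i, alphaStar b V i (alpha b V i φ) x

/-- Bound of the second derivatives by the gradient. -/
def HessBound (C : ℝ) : Prop :=
  0 ≤ C ∧ ∀ i j x, |pd i (pd j V) x| ≤ C * √(1 + ∑ k, pd k V x ^ 2)

variable {b V}

theorem gradient_apply (i : Fin d) (q : EuclideanSpace ℝ (Fin d)) :
    (∇ V q) i = pd i V q := by
  have h : inner ℝ (∇ V q) (EuclideanSpace.single i (1 : ℝ)) = pd i V q := by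
    rw [gradient, InnerProductSpace.toDual_symm_apply]
    rfl
  rw [← h, EuclideanSpace.inner_single_right]
  simp

theorem norm_gradient_sq (q : EuclideanSpace ℝ (Fin d)) : ‖∇ V q‖ ^ 2 = ∑ k, pd k V q ^ 2 := by
  rw [EuclideanSpace.norm_sq_eq]
  simp [gradient_apply]

/-- The growth hypothesis at order two; summing the constants over all index pairs gives one
constant for the whole Hessian. -/
theorem WeaklyElliptic.hessBound (hV : ContDiff ℝ ∞ V) (h : WeaklyElliptic V) :
    ∃ C, HessBound V C := by
  choose C hC0 hC using h.1 2 (by norm_num)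
  refine ⟨∑ i, C i, Finset.sum_nonneg fun i _ => (hC0 i).le, fun i j x => ?_⟩
  have h1 := hC ![i, j] x
  rw [iteratedFDeriv_two_apply] at h1
  simp only [Matrix.cons_val_zero, Matrix.cons_val_one, norm_gradient_sq] at h1
  have hd : DifferentiableAt ℝ (fderiv ℝ V) x :=
    (hV.fderiv_right (m := ∞) (by simp)).differentiable_of_smooth x
  have e : pd i (pd j V) x = fderiv ℝ (fderiv ℝ V) x (EuclideanSpace.single i 1)
      (EuclideanSpace.single j 1) := by
    unfold pd dirD
    rw [fderiv_clm_apply hd (differentiableAt_const _)]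
    simp
  rw [e]
  refine h1.trans ?_
  gcongr
  exact Finset.single_le_sum (fun i _ => (hC0 i).le) (Finset.mem_univ _)

theorem contDiff_alpha (hV : ContDiff ℝ ∞ V) {φ : EuclideanSpace ℝ (Fin d) → ℝ}
    (hφ : ContDiff ℝ ∞ φ) (i : Fin d) : ContDiff ℝ ∞ (alpha b V i φ) :=
  (hφ.pd i).add ((contDiff_const.mul (hV.pd i)).mul hφ)

theorem contDiff_alphaStar (hV : ContDiff ℝ ∞ V) {φ : EuclideanSpace ℝ (Fin d) → ℝ}
    (hφ : ContDiff ℝ ∞ φ) (i : Fin d) : ContDiff ℝ ∞ (alphaStar b V i φ) :=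
  (hφ.pd i).neg.add ((contDiff_const.mul (hV.pd i)).mul hφ)

theorem testFn_alpha (hV : ContDiff ℝ ∞ V) {φ : EuclideanSpace ℝ (Fin d) → ℝ}
    (hφ : TestFn φ) (i : Fin d) : TestFn (alpha b V i φ) :=
  (hφ.pd i).add (hφ.smooth_mul (contDiff_const.mul (hV.pd i)))

theorem testFn_alphaStar (hV : ContDiff ℝ ∞ V) {φ : EuclideanSpace ℝ (Fin d) → ℝ}
    (hφ : TestFn φ) (i : Fin d) : TestFn (alphaStar b V i φ) :=
  (hφ.pd i).neg.add (hφ.smooth_mul (contDiff_const.mul (hV.pd i)))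

theorem testFn_witten (hV : ContDiff ℝ ∞ V) {φ : EuclideanSpace ℝ (Fin d) → ℝ}
    (hφ : TestFn φ) : TestFn (witten b V φ) :=
  TestFn.sum _ fun i => testFn_alphaStar hV (testFn_alpha hV hφ i) i

theorem pd_alpha (hV : ContDiff ℝ ∞ V) {φ : EuclideanSpace ℝ (Fin d) → ℝ} (hφ : ContDiff ℝ ∞ φ)
    (k i : Fin d) (x) : pd k (alpha b V i φ) x
      = pd k (pd i φ) x + b * pd i V x * pd k φ x + b * pd k (pd i V) x * φ x := by
  have h1 := dirD_add (hφ.pd i) ((contDiff_const.mul (hV.pd i)).mul hφ)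
    (EuclideanSpace.single k 1) x (φ := pd i φ) (ψ := fun x => (b * pd i V x) * φ x)
  have h2 := dirD_mul (contDiff_const.mul (hV.pd i)) hφ (EuclideanSpace.single k 1) x
    (φ := fun x => b * pd i V x)
  have h3 := dirD_const_mul (hV.pd i) b (EuclideanSpace.single k 1) x
  unfold pd at *
  unfold alpha pd
  rw [h1, h2, h3]
  ring

theorem pd_alphaStar (hV : ContDiff ℝ ∞ V) {φ : EuclideanSpace ℝ (Fin d) → ℝ}
    (hφ : ContDiff ℝ ∞ φ) (k i : Fin d) (x) : pd k (alphaStar b V i φ) x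
      = -pd k (pd i φ) x + b * pd i V x * pd k φ x + b * pd k (pd i V) x * φ x := by
  have h1 := dirD_add (hφ.pd i).neg ((contDiff_const.mul (hV.pd i)).mul hφ)
    (EuclideanSpace.single k 1) x (φ := fun x => -pd i φ x) (ψ := fun x => (b * pd i V x) * φ x)
  have h2 := dirD_mul (contDiff_const.mul (hV.pd i)) hφ (EuclideanSpace.single k 1) x
    (φ := fun x => b * pd i V x)
  have h3 := dirD_const_mul (hV.pd i) b (EuclideanSpace.single k 1) x
  have h4 := dirD_neg (pd i φ) (EuclideanSpace.single k 1) x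
  unfold pd at *
  unfold alphaStar pd
  rw [h1, h2, h3, h4]
  ring

theorem pd_comm {φ : EuclideanSpace ℝ (Fin d) → ℝ} (hφ : ContDiff ℝ ∞ φ) (i k : Fin d) (x) :
    pd i (pd k φ) x = pd k (pd i φ) x := dirD_comm hφ _ _ x

theorem alpha_comm (hV : ContDiff ℝ ∞ V) {φ : EuclideanSpace ℝ (Fin d) → ℝ}
    (hφ : ContDiff ℝ ∞ φ) (i k : Fin d) (x) :
    alpha b V k (alpha b V i φ) x = alpha b V i (alpha b V k φ) x := by
  have h1 := pd_alpha (b := b) hV hφ k i x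
  have h2 := pd_alpha (b := b) hV hφ i k x
  have h3 := pd_comm hφ i k x
  have h4 := pd_comm hV i k x
  change pd k (alpha b V i φ) x + b * pd k V x * alpha b V i φ x
    = pd i (alpha b V k φ) x + b * pd i V x * alpha b V k φ x
  rw [h1, h2, alpha, alpha, h3, h4]
  ring

/-- The only nontrivial commutator of the calculus, and the place where the Hessian of `V` enters.
-/
theorem alpha_alphaStar (hV : ContDiff ℝ ∞ V) {φ : EuclideanSpace ℝ (Fin d) → ℝ}
    (hφ : ContDiff ℝ ∞ φ) (i k : Fin d) (x) :
    alpha b V k (alphaStar b V i φ) x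
      = alphaStar b V i (alpha b V k φ) x + 2 * b * pd k (pd i V) x * φ x := by
  have h1 := pd_alphaStar (b := b) hV hφ k i x
  have h2 := pd_alpha (b := b) hV hφ i k x
  have h3 := pd_comm hφ i k x
  have h4 := pd_comm hV i k x
  change pd k (alphaStar b V i φ) x + b * pd k V x * alphaStar b V i φ x
    = -pd i (alpha b V k φ) x + b * pd i V x * alpha b V k φ x + 2 * b * pd k (pd i V) x * φ x
  rw [h1, h2, alpha, alphaStar, h3, h4]
  ring

theorem witten_eq (hV : ContDiff ℝ ∞ V) {φ : EuclideanSpace ℝ (Fin d) → ℝ}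
    (hφ : ContDiff ℝ ∞ φ) (x) : witten b V φ x
      = -∑ i, pd i (pd i φ) x + (∑ i, (b ^ 2 * pd i V x ^ 2 - b * pd i (pd i V) x)) * φ x := by
  unfold witten
  rw [Finset.sum_mul, ← Finset.sum_neg_distrib, ← Finset.sum_add_distrib]
  refine Finset.sum_congr rfl fun i _ => ?_
  rw [alphaStar, pd_alpha hV hφ, alpha]
  ring

theorem integral_mul_alpha (hV : ContDiff ℝ ∞ V) {φ ψ : EuclideanSpace ℝ (Fin d) → ℝ}
    (hφ : TestFn φ) (hψ : ContDiff ℝ ∞ ψ) (i : Fin d) :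
    ∫ x, φ x * alpha b V i ψ x = ∫ x, alphaStar b V i φ x * ψ x := by
  have h := integral_mul_dirD (μ := volume) hφ hψ (EuclideanSpace.single i 1)
  have hbV : ContDiff ℝ ∞ fun x => b * pd i V x * ψ x := (contDiff_const.mul (hV.pd i)).mul hψ
  have i1 : Integrable (fun x => φ x * pd i ψ x) := (hφ.mul_smooth (hψ.pd i)).integrable
  have i2 : Integrable (fun x => φ x * (b * pd i V x * ψ x)) := (hφ.mul_smooth hbV).integrable
  have i3 : Integrable (fun x => pd i φ x * ψ x) := ((hφ.pd i).mul_smooth hψ).integrable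
  have e1 : ∫ x, φ x * alpha b V i ψ x
      = (∫ x, φ x * pd i ψ x) + ∫ x, φ x * (b * pd i V x * ψ x) := by
    rw [← integral_add i1 i2]
    simp only [alpha, mul_add]
  have e2 : ∫ x, alphaStar b V i φ x * ψ x
      = (-∫ x, pd i φ x * ψ x) + ∫ x, φ x * (b * pd i V x * ψ x) := by
    rw [neg_add_eq_sub, ← integral_sub i2 i3]
    refine integral_congr_ae (.of_forall fun x => ?_)
    simp only [alphaStar]; ring
  rw [e1, e2]
  exact congrArg (· + _) h

end Witten

/-! ### Density criterion in `L²` -/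

section Density

open Filter Topology

variable {α 𝕜 : Type*} [MeasurableSpace α] {ν : Measure α} [RCLike 𝕜]

/-- A subspace of a Hilbert space with trivial annihilator is dense; the annihilator is taken for
the bilinear pairing, so that weak uniqueness theorems apply directly. -/
theorem exists_eLpNorm_sub_le_of_orthogonal {M : Submodule 𝕜 (α → 𝕜)}
    (hM : ∀ g ∈ M, MemLp g 2 ν)
    (h : ∀ f : α → 𝕜, MemLp f 2 ν → (∀ g ∈ M, ∫ x, f x * g x ∂ν = 0) → f =ᵐ[ν] 0)
    {u : α → 𝕜} (hu : MemLp u 2 ν) {δ : ℝ} (hδ : 0 < δ) :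
    ∃ g ∈ M, eLpNorm (g - u) 2 ν ≤ ENNReal.ofReal δ := by
  let N : Submodule 𝕜 (Lp 𝕜 2 ν) :=
    { carrier := {v | ∃ g ∈ M, v =ᵐ[ν] g}
      add_mem' := by
        rintro a b ⟨g, hg, h1⟩ ⟨g', hg', h2⟩
        exact ⟨g + g', M.add_mem hg hg', (Lp.coeFn_add a b).trans (h1.add h2)⟩
      zero_mem' := ⟨0, M.zero_mem, Lp.coeFn_zero 𝕜 2 ν⟩
      smul_mem' := by
        rintro c a ⟨g, hg, h1⟩
        exact ⟨c • g, M.smul_mem c hg, (Lp.coeFn_smul c a).trans (h1.const_smul c)⟩ }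
  have hN : Nᗮ = ⊥ := by
    rw [Submodule.eq_bot_iff]
    intro v hv
    have hv' : MemLp (star (v : α → 𝕜)) 2 ν := (Lp.memLp v).star
    have h0 := h _ hv' fun g hg => by
      have h1 := (Submodule.mem_orthogonal' N v).1 hv ((hM g hg).toLp g) ⟨g, hg, (hM g hg).coeFn_toLp⟩
      rw [L2.inner_def] at h1
      rw [← h1]
      refine integral_congr_ae ?_
      filter_upwards [(hM g hg).coeFn_toLp] with x hx
      rw [hx]
      simp [mul_comm]
    refine Lp.ext ?_
    filter_upwards [h0, Lp.coeFn_zero 𝕜 2 ν] with x hx h0x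
    rw [h0x]
    simpa using hx
  have hd : hu.toLp u ∈ N.topologicalClosure := by
    rw [Submodule.topologicalClosure_eq_top_iff.2 hN]
    trivial
  rw [← SetLike.mem_coe, Submodule.topologicalClosure_coe, Metric.mem_closure_iff] at hd
  obtain ⟨w, ⟨g, hg, hw⟩, hdist⟩ := hd δ hδ
  refine ⟨g, hg, ?_⟩
  have e : w = (hM g hg).toLp g := Lp.ext (hw.trans (hM g hg).coeFn_toLp.symm)
  rw [e, Lp.dist_edist, Lp.edist_toLp_toLp, eLpNorm_sub_comm] at hdist
  exact (ENNReal.le_ofReal_iff_toReal_le ((hM g hg).sub hu).eLpNorm_ne_top hδ.le).2 hdist.le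

end Density

/-! ### Elliptic estimates for the Witten Laplacian -/

section WittenEstimates

variable {d : ℕ} {b C : ℝ} {V : EuclideanSpace ℝ (Fin d) → ℝ}

/-- Adjointness of `α_k` and `α_k*` applied to `∂_k V ψ` and `ψ`, with the derivative of `ψ`
eliminated in favour of `α_k ψ` through `α_k + α_k* = 2b ∂_k V`. -/
theorem integral_sq_pd_mul (hV : ContDiff ℝ ∞ V) {ψ : EuclideanSpace ℝ (Fin d) → ℝ}
    (hψ : TestFn ψ) (k : Fin d) :
    ∫ x, (2 * b * pd k V x ^ 2 * ψ x ^ 2 - 2 * (pd k V x * ψ x * alpha b V k ψ x)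
      - pd k (pd k V) x * ψ x ^ 2) = 0 := by
  have hVk := hV.pd k
  have t1 : TestFn fun x => pd k V x * ψ x := hψ.smooth_mul hVk
  have h := integral_mul_alpha (b := b) hV t1 hψ.1 k
  have i1 : Integrable fun x => pd k V x * ψ x * alpha b V k ψ x :=
    (t1.mul_smooth (contDiff_alpha hV hψ.1 k)).integrable
  have i2 : Integrable fun x => alphaStar b V k (fun x => pd k V x * ψ x) x * ψ x :=
    ((testFn_alphaStar hV t1 k).mul_smooth hψ.1).integrable
  rw [← sub_eq_zero, ← integral_sub i1 i2] at h
  rw [← neg_eq_zero, ← integral_neg, ← h]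
  refine integral_congr_ae (.of_forall fun x => ?_)
  have e := dirD_mul hVk hψ.1 (EuclideanSpace.single k 1) x
  change pd k (fun x => pd k V x * ψ x) x = pd k V x * pd k ψ x + ψ x * pd k (pd k V) x at e
  simp only [alphaStar, alpha, e]
  ring

theorem abs_sum_pd_pd_le (hC : HessBound V C) (x : EuclideanSpace ℝ (Fin d)) :
    |∑ i, pd i (pd i V) x| ≤ d * C * √(1 + ∑ k, pd k V x ^ 2) := by
  refine (Finset.abs_sum_le_sum_abs _ _).trans
    ((Finset.sum_le_sum fun i _ => hC.2 i i x).trans_eq ?_)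
  simp [mul_assoc]

theorem TestFn.sq {E : Type*} [NormedAddCommGroup E] [NormedSpace ℝ E] {φ : E → ℝ}
    (h : TestFn φ) : TestFn fun x => φ x ^ 2 := by
  simpa only [pow_two] using h.mul_smooth h.1

theorem TestFn.integrable_sum {ι E : Type*} [Fintype ι] [NormedAddCommGroup E] [NormedSpace ℝ E]
    [MeasurableSpace E] [BorelSpace E] {μ : Measure E} [IsFiniteMeasureOnCompacts μ]
    {φ : ι → E → ℝ} (h : ∀ i, TestFn (φ i)) : Integrable (fun x => ∑ i, φ i x) μ :=
  (TestFn.sum Finset.univ h).integrable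

/-- The gradient is bounded relative to `alpha`. -/
theorem exists_gradient_bound (hb : 0 < b) (hV : ContDiff ℝ ∞ V) (hC : HessBound V C) :
    ∃ K : ℝ, 0 ≤ K ∧ ∀ ψ : EuclideanSpace ℝ (Fin d) → ℝ, TestFn ψ →
      ∫ x, (1 + ∑ k, pd k V x ^ 2) * ψ x ^ 2
        ≤ K * ((∑ k, ∫ x, alpha b V k ψ x ^ 2) + ∫ x, ψ x ^ 2) := by
  set D := d * C with hD
  have hD0 : 0 ≤ D := mul_nonneg (Nat.cast_nonneg _) hC.1
  -- Young turns the cross term of `integral_sq_pd_mul` into `b |∇V|² ψ² + b⁻¹ Σ (α_k ψ)²`, and `D g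
  -- ≤ (b/2) g² + D²/(2b)` absorbs the Laplacian of `V`. What is left is `(b/2) g² ψ²` on one side;
  -- multiplying by `2/b` produces the two coefficients. Adding the vanishing integral `hS` makes
  -- the claim a pointwise inequality.
  set K := max (2 / b * (1 / b)) (2 / b * (b + D ^ 2 / (2 * b))) with hK
  have hK1 : 2 / b * (1 / b) ≤ K := le_max_left _ _
  have hK2 : 2 / b * (b + D ^ 2 / (2 * b)) ≤ K := le_max_right _ _
  have hK0 : 0 ≤ K := le_trans (by positivity) hK1
  refine ⟨K, hK0, fun ψ hψ => ?_⟩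
  have tα := fun k => (testFn_alpha (b := b) hV hψ k).sq
  have tψ := hψ.sq
  have smg : ContDiff ℝ ∞ fun x => 1 + ∑ k, pd k V x ^ 2 :=
    contDiff_const.add (ContDiff.sum fun k _ => (hV.pd k).pow 2)
  have tX : ∀ k, TestFn fun x => 2 * b * pd k V x ^ 2 * ψ x ^ 2
      - 2 * (pd k V x * ψ x * alpha b V k ψ x) - pd k (pd k V) x * ψ x ^ 2 := fun k => by
    refine ((tψ.smooth_mul (contDiff_const.mul ((hV.pd k).pow 2))).sub ?_).sub
      (tψ.smooth_mul ((hV.pd k).pd k))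
    exact ((hψ.smooth_mul (hV.pd k)).mul_smooth (contDiff_alpha hV hψ.1 k)).const_mul 2
  have tS := TestFn.sum Finset.univ tα
  have hS : ∫ x, ∑ k, (2 * b * pd k V x ^ 2 * ψ x ^ 2
      - 2 * (pd k V x * ψ x * alpha b V k ψ x) - pd k (pd k V) x * ψ x ^ 2) = 0 := by
    rw [integral_finsetSum _ fun k _ => (tX k).integrable]
    exact Finset.sum_eq_zero fun k _ => integral_sq_pd_mul hV hψ k
  have rhs : K * ((∑ k, ∫ x, alpha b V k ψ x ^ 2) + ∫ x, ψ x ^ 2)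
      = ∫ x, (K * (∑ k, alpha b V k ψ x ^ 2 + ψ x ^ 2) + 2 / b * ∑ k, (2 * b * pd k V x ^ 2 * ψ x ^ 2
      - 2 * (pd k V x * ψ x * alpha b V k ψ x) - pd k (pd k V) x * ψ x ^ 2)) := by
    rw [integral_add, integral_const_mul, integral_const_mul, hS, integral_add tS.integrable
      tψ.integrable, integral_finsetSum _ fun k _ => (tα k).integrable]
    · ring
    · exact (tS.add tψ).integrable.const_mul K
    · exact (TestFn.sum Finset.univ tX).integrable.const_mul _
  rw [rhs]
  refine integral_mono (tψ.smooth_mul smg).integrable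
    (((tS.add tψ).const_mul K).add ((TestFn.sum Finset.univ tX).const_mul _)).integrable fun x => ?_
  simp only
  set g := √(1 + ∑ k, pd k V x ^ 2) with hg
  have hg2 : g ^ 2 = 1 + ∑ k, pd k V x ^ 2 := Real.sq_sqrt (by positivity)
  have hs := abs_le.1 (abs_sum_pd_pd_le hC x)
  rw [← hD, ← hg] at hs
  have h1 : ∑ k, (2 * b * pd k V x ^ 2 * ψ x ^ 2 - 2 * (pd k V x * ψ x * alpha b V k ψ x)
      - pd k (pd k V) x * ψ x ^ 2)
      ≥ b * (∑ k, pd k V x ^ 2) * ψ x ^ 2 - 1 / b * ∑ k, alpha b V k ψ x ^ 2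
        - (∑ k, pd k (pd k V) x) * ψ x ^ 2 := by
    rw [ge_iff_le, Finset.mul_sum, Finset.mul_sum, Finset.sum_mul, Finset.sum_mul,
      ← Finset.sum_sub_distrib, ← Finset.sum_sub_distrib]
    refine Finset.sum_le_sum fun k _ => ?_
    have : 0 ≤ 1 / b * (b * pd k V x * ψ x - alpha b V k ψ x) ^ 2 := by positivity
    have e : 1 / b * (b * pd k V x * ψ x - alpha b V k ψ x) ^ 2 = b * pd k V x ^ 2 * ψ x ^ 2
        - 2 * (pd k V x * ψ x * alpha b V k ψ x) + 1 / b * alpha b V k ψ x ^ 2 := by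
      field_simp
      ring
    rw [e] at this
    linarith
  have hS0 : 0 ≤ ∑ k, alpha b V k ψ x ^ 2 := Finset.sum_nonneg fun _ _ => sq_nonneg _
  have e2 := mul_le_mul_of_nonneg_left h1 (by positivity : 0 ≤ 2 / b)
  have e3 := mul_le_mul_of_nonneg_right hK1 hS0
  have e4 := mul_le_mul_of_nonneg_right hK2 (sq_nonneg (ψ x))
  have e5 : (∑ k, pd k (pd k V) x) * ψ x ^ 2 ≤ D * g * ψ x ^ 2 :=
    mul_le_mul_of_nonneg_right hs.2 (sq_nonneg _)
  have e6 : 0 ≤ 2 / b * (1 / (2 * b) * (b * g - D) ^ 2 * ψ x ^ 2) := by positivity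
  have e7 : 2 / b * (1 / (2 * b) * (b * g - D) ^ 2 * ψ x ^ 2)
      = g ^ 2 * ψ x ^ 2 - 2 / b * (D * g * ψ x ^ 2) + 2 / b * (D ^ 2 / (2 * b)) * ψ x ^ 2 := by
    field_simp
    ring
  have e8 : 2 / b * (b * (∑ k, pd k V x ^ 2) * ψ x ^ 2) = 2 * (g ^ 2 - 1) * ψ x ^ 2 := by
    rw [hg2]
    field_simp
    ring
  have e9 : 2 / b * (b + D ^ 2 / (2 * b)) * ψ x ^ 2
      = 2 * ψ x ^ 2 + 2 / b * (D ^ 2 / (2 * b)) * ψ x ^ 2 := by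
    field_simp
  have e10 := mul_le_mul_of_nonneg_left e5 (by positivity : 0 ≤ 2 / b)
  rw [← hg2]
  linarith

theorem integral_witten_mul (hV : ContDiff ℝ ∞ V) {φ : EuclideanSpace ℝ (Fin d) → ℝ}
    (hφ : TestFn φ) : ∫ x, witten b V φ x * φ x = ∑ i, ∫ x, alpha b V i φ x ^ 2 := by
  have tα := fun i => testFn_alpha (b := b) hV hφ i
  simp only [witten, Finset.sum_mul]
  rw [integral_finsetSum _ fun i _ => ((testFn_alphaStar hV (tα i) i).mul_smooth hφ.1).integrable]
  refine Finset.sum_congr rfl fun i _ => ?_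
  rw [← integral_mul_alpha hV (tα i) hφ.1]
  simp only [sq]

/-- A Bochner identity: in `⟨α_i* α_i φ, α_k* α_k φ⟩` move `α_k*` to the other factor and commute it
past `α_i*`; the commutator yields the Hessian term. -/
theorem integral_witten_sq (hV : ContDiff ℝ ∞ V) {φ : EuclideanSpace ℝ (Fin d) → ℝ}
    (hφ : TestFn φ) : ∫ x, witten b V φ x ^ 2
      = ∑ i, ∑ k, ((∫ x, alpha b V k (alpha b V i φ) x ^ 2)
        + 2 * b * ∫ x, pd k (pd i V) x * alpha b V i φ x * alpha b V k φ x) := by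
  have tα := fun i => testFn_alpha (b := b) hV hφ i
  have tαα := fun i k => testFn_alpha (b := b) hV (tα i) k
  have tsα := fun i => testFn_alphaStar (b := b) hV (tα i) i
  have e : ∀ x, witten b V φ x ^ 2 = ∑ i, ∑ k, alphaStar b V i (alpha b V i φ) x
      * alphaStar b V k (alpha b V k φ) x := fun x => by
    rw [witten, sq, Finset.sum_mul_sum]
  simp only [e]
  rw [integral_finsetSum _ fun i _ => TestFn.integrable_sum fun k => (tsα i).mul_smooth (tsα k).1]
  refine Finset.sum_congr rfl fun i _ => ?_
  rw [integral_finsetSum _ fun k _ => ((tsα i).mul_smooth (tsα k).1).integrable]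
  refine Finset.sum_congr rfl fun k _ => ?_
  have h1 := integral_mul_alpha (b := b) hV (tα k) (tsα i).1 k
  have h2 := integral_mul_alpha (b := b) hV (tαα i k) (tα k).1 i
  have i1 : Integrable fun x => alpha b V k φ x * alphaStar b V i (alpha b V k (alpha b V i φ)) x :=
    ((tα k).mul_smooth (testFn_alphaStar hV (tαα i k) i).1).integrable
  have i2 : Integrable fun x => pd k (pd i V) x * alpha b V i φ x * alpha b V k φ x :=
    (((tα i).smooth_mul ((hV.pd i).pd k)).mul_smooth (tα k).1).integrable
  calc _ = ∫ x, alphaStar b V k (alpha b V k φ) x * alphaStar b V i (alpha b V i φ) x := by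
        simp only [mul_comm]
    _ = ∫ x, (alpha b V k φ x * alphaStar b V i (alpha b V k (alpha b V i φ)) x
          + 2 * b * (pd k (pd i V) x * alpha b V i φ x * alpha b V k φ x)) := by
        rw [← h1]
        refine integral_congr_ae (.of_forall fun x => ?_)
        simp only [alpha_alphaStar hV (tα i).1 i k x]
        ring
    _ = _ := by
        rw [integral_add i1 (i2.const_mul _), integral_const_mul]
        congr 1
        rw [← (integral_congr_ae (.of_forall fun x => mul_comm _ _) :
          ∫ x, alphaStar b V i (alpha b V k (alpha b V i φ)) x * alpha b V k φ x = _), ← h2]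
        refine integral_congr_ae (.of_forall fun x => ?_)
        simp only
        rw [← alpha_comm hV hφ.1 i k x, sq]

/-- Elliptic regularity for the Witten Laplacian. -/
theorem exists_elliptic_bound (hb : 0 < b) (hV : ContDiff ℝ ∞ V) (hC : HessBound V C) :
    ∃ K : ℝ, 0 ≤ K ∧ ∀ φ : EuclideanSpace ℝ (Fin d) → ℝ, TestFn φ →
      ∑ i, ∑ k, ∫ x, alpha b V k (alpha b V i φ) x ^ 2
        ≤ K * ((∫ x, witten b V φ x ^ 2) + ∑ i, ∫ x, alpha b V i φ x ^ 2) := by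
  obtain ⟨K, hK, hgrad⟩ := exists_gradient_bound hb hV hC
  have hC0 := hC.1
  -- `2 b d C g ≤ δ g² + B` with `δ K = 1 / 2`
  set A := 2 * b * (d * C) with hA
  have hA0 : 0 ≤ A := by positivity
  set δ := 1 / (2 * (K + 1)) with hδ
  have hδ0 : 0 < δ := by positivity
  have hδK : δ * K ≤ 1 / 2 := by
    rw [hδ, div_mul_eq_mul_div, one_mul, div_le_iff₀ (by positivity)]
    linarith
  set B := A ^ 2 / (4 * δ)
  have hB0 : 0 ≤ B := by positivity
  refine ⟨2 * (1 + B + 1 / 2), by positivity, fun φ hφ => ?_⟩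
  have tα := fun i => testFn_alpha (b := b) hV hφ i
  have smg : ContDiff ℝ ∞ fun x => 1 + ∑ k, pd k V x ^ 2 :=
    contDiff_const.add (ContDiff.sum fun k _ => (hV.pd k).pow 2)
  have tVαα : ∀ i k, TestFn fun x => pd k (pd i V) x * alpha b V i φ x * alpha b V k φ x :=
    fun i k => ((tα i).smooth_mul ((hV.pd i).pd k)).mul_smooth (tα k).1
  have h := integral_witten_sq (b := b) hV hφ
  simp only [Finset.sum_add_distrib, ← Finset.mul_sum] at h
  set X := ∑ i, ∑ k, ∫ x, alpha b V k (alpha b V i φ) x ^ 2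
  set Y := ∑ i, ∫ x, alpha b V i φ x ^ 2 with hY
  have hY0 : 0 ≤ Y := Finset.sum_nonneg fun i _ => integral_nonneg fun x => sq_nonneg _
  have hW0 : 0 ≤ ∫ x, witten b V φ x ^ 2 := integral_nonneg fun x => sq_nonneg _
  have hcross : -(2 * b * ∑ i, ∑ k, ∫ x, pd k (pd i V) x * alpha b V i φ x * alpha b V k φ x)
      ≤ (δ * ∑ i, ∫ x, (1 + ∑ k, pd k V x ^ 2) * alpha b V i φ x ^ 2) + B * Y := by
    have e1 : -(2 * b * ∑ i, ∑ k, ∫ x, pd k (pd i V) x * alpha b V i φ x * alpha b V k φ x)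
        = ∫ x, -(2 * b) * ∑ i, ∑ k, pd k (pd i V) x * alpha b V i φ x * alpha b V k φ x := by
      rw [integral_const_mul, integral_finsetSum _ fun i _ => TestFn.integrable_sum fun k => tVαα i k,
        neg_mul]
      congr 2
      exact Finset.sum_congr rfl fun i _ => (integral_finsetSum _ fun k _ => (tVαα i k).integrable).symm
    have e2 : (δ * ∑ i, ∫ x, (1 + ∑ k, pd k V x ^ 2) * alpha b V i φ x ^ 2) + B * Y
        = ∫ x, (δ * ∑ i, (1 + ∑ k, pd k V x ^ 2) * alpha b V i φ x ^ 2
          + B * ∑ i, alpha b V i φ x ^ 2) := by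
      have t1 := fun i => ((tα i).sq).smooth_mul smg
      have t2 := fun i => (tα i).sq
      rw [integral_add ((TestFn.integrable_sum t1).const_mul _)
        ((TestFn.integrable_sum t2).const_mul _), integral_const_mul, integral_const_mul,
        integral_finsetSum _ fun i _ => (t1 i).integrable,
        integral_finsetSum _ fun i _ => (t2 i).integrable]
    rw [e1, e2]
    refine integral_mono ((TestFn.sum _ fun i => TestFn.sum _ fun k => tVαα i k).const_mul _).integrable
      (((TestFn.sum _ fun i => ((tα i).sq).smooth_mul smg).const_mul _).add
        ((TestFn.sum _ fun i => (tα i).sq).const_mul _)).integrable fun x => ?_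
    simp only
    set g := √(1 + ∑ k, pd k V x ^ 2) with hg
    have hg2 : g ^ 2 = 1 + ∑ k, pd k V x ^ 2 := Real.sq_sqrt (by positivity)
    set s := ∑ i, alpha b V i φ x ^ 2 with hs
    have hs0 : 0 ≤ s := Finset.sum_nonneg fun _ _ => sq_nonneg _
    have hsum : |∑ i, ∑ k, pd k (pd i V) x * alpha b V i φ x * alpha b V k φ x| ≤ d * C * g * s := by
      calc _ ≤ ∑ i, ∑ k, |pd k (pd i V) x * alpha b V i φ x * alpha b V k φ x| :=
            (Finset.abs_sum_le_sum_abs _ _).trans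
              (Finset.sum_le_sum fun i _ => Finset.abs_sum_le_sum_abs _ _)
        _ ≤ ∑ i, ∑ k, C * g * (1 / 2 * alpha b V i φ x ^ 2 + 1 / 2 * alpha b V k φ x ^ 2) := by
            refine Finset.sum_le_sum fun i _ => Finset.sum_le_sum fun k _ => ?_
            rw [mul_assoc, abs_mul]
            refine mul_le_mul (hC.2 k i x) ?_ (abs_nonneg _) (by positivity)
            rw [abs_le]
            constructor <;> nlinarith [sq_nonneg (alpha b V i φ x + alpha b V k φ x),
              sq_nonneg (alpha b V i φ x - alpha b V k φ x)]
        _ = d * C * g * s := by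
            simp only [← Finset.mul_sum, Finset.sum_add_distrib, Finset.sum_const, Finset.card_univ,
              Fintype.card_fin, nsmul_eq_mul, ← hs]
            ring
    have h1 : -(2 * b) * ∑ i, ∑ k, pd k (pd i V) x * alpha b V i φ x * alpha b V k φ x
        ≤ A * g * s := by
      have := mul_le_mul_of_nonneg_left (neg_le_of_abs_le hsum) (by positivity : 0 ≤ 2 * b)
      rw [hA]
      linarith
    refine h1.trans ?_
    rw [← Finset.mul_sum, ← hs, ← hg2]
    have h2 : 0 ≤ 1 / (4 * δ) * (2 * δ * g - A) ^ 2 * s := by positivity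
    have h3 : 1 / (4 * δ) * (2 * δ * g - A) ^ 2 * s
        = δ * (g ^ 2 * s) - A * g * s + A ^ 2 / (4 * δ) * s := by
      field_simp
      ring
    rw [h3] at h2
    linarith
  -- The gradient bound applied to each `α_i φ` reproduces `X` on the right. It comes with the
  -- factor `δ K ≤ 1/2`, so it can be absorbed on the left.
  have hgr : ∑ i, ∫ x, (1 + ∑ k, pd k V x ^ 2) * alpha b V i φ x ^ 2 ≤ K * (X + Y) := by
    refine (Finset.sum_le_sum fun i _ => hgrad _ (tα i)).trans_eq ?_
    rw [← Finset.mul_sum, Finset.sum_add_distrib]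
  have hX0 : 0 ≤ X := Finset.sum_nonneg fun i _ => Finset.sum_nonneg fun k _ =>
    integral_nonneg fun x => sq_nonneg _
  have h4 := mul_le_mul_of_nonneg_left hgr hδ0.le
  have h5 := mul_le_mul_of_nonneg_right hδK (add_nonneg hX0 hY0)
  have h6 := mul_nonneg hB0 hW0
  nlinarith

/-- The range of the shifted Witten Laplacian on test functions is dense. -/
theorem exists_witten_dense (hV : ContDiff ℝ ∞ V) (hC : HessBound V C) (b : ℝ) :
    ∃ l : ℝ, 1 ≤ l ∧ ∀ u : EuclideanSpace ℝ (Fin d) → ℝ, MemLp u 2 → ∀ δ : ℝ, 0 < δ →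
      ∃ φ, TestFn φ ∧
        eLpNorm ((fun x => l * φ x + witten b V φ x) - u) 2 ≤ ENNReal.ofReal δ := by
  set D := d * C with hD
  -- Completing the square in `√(1 + |∇V|²)` gives `b² |∇V|² - b ΔV ≥ -b² - D²/4`, so this shift
  -- makes the zeroth order coefficient of the Schrödinger form at least one.
  set l := 1 + b ^ 2 + D ^ 2 / 4 with hl
  refine ⟨l, by nlinarith [sq_nonneg b, sq_nonneg D], fun u hu δ hδ => ?_⟩
  have hlin : ∀ φ ψ : EuclideanSpace ℝ (Fin d) → ℝ, TestFn φ → TestFn ψ → ∀ c : ℝ, ∀ x,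
      witten b V (fun x => φ x + c * ψ x) x = witten b V φ x + c * witten b V ψ x := by
    intro φ ψ hφ hψ c x
    have p1 : ∀ i, pd i (fun x => φ x + c * ψ x) = fun x => pd i φ x + c * pd i ψ x := fun i => by
      funext y
      have h1 := dirD_add hφ.1 (contDiff_const.mul hψ.1) (EuclideanSpace.single i 1) y
        (ψ := fun x => c * ψ x)
      have h2 := dirD_const_mul hψ.1 c (EuclideanSpace.single i 1) y
      exact h1.trans (by rw [h2]; rfl)
    have p2 : ∀ i, pd i (fun x => pd i φ x + c * pd i ψ x)
        = fun x => pd i (pd i φ) x + c * pd i (pd i ψ) x := fun i => by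
      funext y
      have h1 := dirD_add (hφ.1.pd i) (contDiff_const.mul (hψ.1.pd i)) (EuclideanSpace.single i 1) y
        (ψ := fun x => c * pd i ψ x)
      have h2 := dirD_const_mul (hψ.1.pd i) c (EuclideanSpace.single i 1) y
      exact h1.trans (by rw [h2]; rfl)
    rw [witten_eq hV (hφ.add (hψ.const_mul c)).1, witten_eq hV hφ.1, witten_eq hV hψ.1]
    simp only [p1, p2, Finset.sum_add_distrib, ← Finset.mul_sum]
    ring
  let M : Submodule ℝ (EuclideanSpace ℝ (Fin d) → ℝ) :=
    { carrier := {g | ∃ φ, TestFn φ ∧ g = fun x => l * φ x + witten b V φ x}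
      add_mem' := by
        rintro _ _ ⟨φ, hφ, rfl⟩ ⟨ψ, hψ, rfl⟩
        refine ⟨fun x => φ x + 1 * ψ x, hφ.add (hψ.const_mul 1), ?_⟩
        funext x
        rw [hlin φ ψ hφ hψ]
        simp only [Pi.add_apply]
        ring
      zero_mem' := by
        refine ⟨fun _ => 0, TestFn.zero, ?_⟩
        funext x
        have := hlin _ _ TestFn.zero TestFn.zero (-1) x
        simp only [mul_zero, add_zero, neg_one_mul, add_neg_cancel] at this
        simp [this]
      smul_mem' := by
        rintro c _ ⟨ψ, hψ, rfl⟩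
        refine ⟨fun x => 0 + c * ψ x, TestFn.zero.add (hψ.const_mul c), ?_⟩
        have h0 : ∀ x, witten b V (fun _ => (0 : ℝ)) x = 0 := fun x => by
          have := hlin _ _ TestFn.zero TestFn.zero (-1) x
          simpa using this
        funext x
        rw [hlin _ ψ TestFn.zero hψ, h0]
        simp only [Pi.smul_apply, smul_eq_mul]
        ring }
  obtain ⟨g, ⟨φ, hφ, rfl⟩, h⟩ := exists_eLpNorm_sub_le_of_orthogonal (ν := volume) (M := M)
    (by
      rintro _ ⟨φ, hφ, rfl⟩
      exact ((hφ.const_mul l).add (testFn_witten hV hφ)).memLp 2)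
    (by
      intro f hf horth
      refine weak_solution_eq_zero (fun i : Fin d => EuclideanSpace.single i (1 : ℝ))
        (m := fun x => l + ∑ i, (b ^ 2 * pd i V x ^ 2 - b * pd i (pd i V) x)) ?_ ?_ hf ?_
      · exact contDiff_const.add (ContDiff.sum fun i _ => (contDiff_const.mul ((hV.pd i).pow 2)).sub
          (contDiff_const.mul ((hV.pd i).pd i)))
      · intro x
        have hs := abs_sum_pd_pd_le hC x
        set g := √(1 + ∑ k, pd k V x ^ 2) with hg
        have hg2 : g ^ 2 = 1 + ∑ k, pd k V x ^ 2 := Real.sq_sqrt (by positivity)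
        rw [Finset.sum_sub_distrib, ← Finset.mul_sum, ← Finset.mul_sum]
        have h1 : b * ∑ i, pd i (pd i V) x ≤ |b| * (D * g) := by
          refine (le_abs_self _).trans ?_
          rw [abs_mul]
          gcongr
        have h2 : 0 ≤ (|b| * g - D / 2) ^ 2 := sq_nonneg _
        have h3 : (|b| * g - D / 2) ^ 2 = b ^ 2 * g ^ 2 - |b| * (D * g) + D ^ 2 / 4 := by
          rw [← sq_abs b]; ring
        rw [h3, hg2] at h2
        linarith
      · intro φ hφ
        rw [← horth _ ⟨φ, hφ, rfl⟩]
        refine integral_congr_ae (.of_forall fun x => ?_)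
        simp only
        rw [witten_eq hV hφ.1]
        simp only [pd]
        ring) hu hδ
  exact ⟨φ, hφ, h⟩

end WittenEstimates

/-! ### Functions on products -/

section Product

variable {E₁ E₂ : Type*} [NormedAddCommGroup E₁] [NormedSpace ℝ E₁] [NormedAddCommGroup E₂]
  [NormedSpace ℝ E₂]

theorem ContDiff.prod_mul {f : E₁ → ℝ} {g : E₂ → ℝ} (hf : ContDiff ℝ ∞ f) (hg : ContDiff ℝ ∞ g) :
    ContDiff ℝ ∞ fun x : E₁ × E₂ => f x.1 * g x.2 :=
  (hf.comp contDiff_fst).mul (hg.comp contDiff_snd)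

theorem TestFn.prod_mul {f : E₁ → ℝ} {g : E₂ → ℝ} (hf : TestFn f) (hg : TestFn g) :
    TestFn fun x : E₁ × E₂ => f x.1 * g x.2 := by
  refine ⟨hf.1.prod_mul hg.1, HasCompactSupport.intro (hf.2.prod hg.2) fun x hx => ?_⟩
  by_contra h
  have h := mul_ne_zero_iff.1 h
  exact hx ⟨subset_tsupport _ h.1, subset_tsupport _ h.2⟩

theorem dirD_prod_mul {f : E₁ → ℝ} {g : E₂ → ℝ} (hf : ContDiff ℝ ∞ f) (hg : ContDiff ℝ ∞ g)
    (v x : E₁ × E₂) : dirD v (fun x : E₁ × E₂ => f x.1 * g x.2) x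
      = dirD v.1 f x.1 * g x.2 + f x.1 * dirD v.2 g x.2 := by
  have h1 : HasFDerivAt (fun x : E₁ × E₂ => f x.1) _ x :=
    (hf.differentiable_of_smooth x.1).hasFDerivAt.comp x hasFDerivAt_fst
  have h2 : HasFDerivAt (fun x : E₁ × E₂ => g x.2) _ x :=
    (hg.differentiable_of_smooth x.2).hasFDerivAt.comp x hasFDerivAt_snd
  have h3 : HasFDerivAt (fun x : E₁ × E₂ => f x.1 * g x.2) _ x := h1.mul h2
  unfold dirD
  rw [h3.fderiv]
  simp
  ring

theorem dirD_ofReal {E : Type*} [NormedAddCommGroup E] [NormedSpace ℝ E] {φ : E → ℝ}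
    (hφ : ContDiff ℝ ∞ φ) (e x : E) :
    dirD e (fun y => (φ y : ℂ)) x = ((dirD e φ x : ℝ) : ℂ) := by
  unfold dirD
  have h : HasFDerivAt (fun y => (φ y : ℂ)) (Complex.ofRealCLM.comp (fderiv ℝ φ x)) x :=
    Complex.ofRealCLM.hasFDerivAt.comp x (hφ.differentiable_of_smooth x).hasFDerivAt
  rw [h.fderiv]
  rfl

theorem ContDiff.ofReal {E : Type*} [NormedAddCommGroup E] [NormedSpace ℝ E] {φ : E → ℝ}
    (hφ : ContDiff ℝ ∞ φ) : ContDiff ℝ ∞ fun y => (φ y : ℂ) :=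
  Complex.ofRealCLM.contDiff.comp hφ

theorem TestFn.ofReal {E : Type*} [NormedAddCommGroup E] [NormedSpace ℝ E] {φ : E → ℝ}
    (hφ : TestFn φ) : TestFn fun y => (φ y : ℂ) :=
  ⟨hφ.1.ofReal, hφ.2.comp_left (g := fun t : ℝ => (t : ℂ)) Complex.ofReal_zero⟩

end Product

/-! ### Integration by parts with a single compactly supported factor. -/

section IntegrationByParts

variable {E 𝕜 : Type*} [NormedAddCommGroup E] [NormedSpace ℝ E] [RCLike 𝕜]
  [MeasurableSpace E] [BorelSpace E] {μ : Measure E}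

theorem integrable_mul_of_or [IsFiniteMeasureOnCompacts μ] {f g : E → 𝕜} (hf : ContDiff ℝ ∞ f)
    (hg : ContDiff ℝ ∞ g) (h : HasCompactSupport f ∨ HasCompactSupport g) :
    Integrable (fun x => f x * g x) μ := by
  rcases h with h | h
  · exact (TestFn.mul_smooth ⟨hf, h⟩ hg).integrable
  · exact (TestFn.smooth_mul ⟨hg, h⟩ hf).integrable

theorem integral_mul_dirD_of_or [FiniteDimensional ℝ E] [μ.IsAddHaarMeasure] {f g : E → 𝕜}
    (hf : ContDiff ℝ ∞ f) (hg : ContDiff ℝ ∞ g) (h : HasCompactSupport f ∨ HasCompactSupport g)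
    (e : E) : ∫ x, f x * dirD e g x ∂μ = -∫ x, dirD e f x * g x ∂μ := by
  rcases h with h | h
  · exact integral_mul_dirD ⟨hf, h⟩ hg e
  · exact integral_mul_dirD' hf ⟨hg, h⟩ e

end IntegrationByParts

/-! ### The Langevin operator and its formal adjoint -/

instance isAddHaarMeasure_phase {d : ℕ} : (volume : Measure (Phase d)).IsAddHaarMeasure :=
  Measure.prod.instIsAddHaarMeasure _ _

namespace LangevinSystem

variable {d : ℕ} (S : LangevinSystem d)

/-- Coordinate unit vectors of phase space. -/
def unitQ (i : Fin d) : Phase d := (EuclideanSpace.single i 1, 0)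

/-- Coordinate unit vectors of phase space. -/
def unitP (i : Fin d) : Phase d := (0, EuclideanSpace.single i 1)

theorem dq_eq (i : Fin d) (φ : Phase d → ℂ) : dq i φ = dirD (unitQ i) φ := rfl

theorem dp_eq (i : Fin d) (φ : Phase d → ℂ) : dp i φ = dirD (unitP i) φ := rfl

/-- The Hamiltonian vector field `-(p/μ)·∇_q + ∇V·∇_p`. -/
def transport (φ : Phase d → ℂ) (x : Phase d) : ℂ :=
  ∑ i, (-((x.2 i / S.mass : ℝ) : ℂ) * dq i φ x + ((pd i S.potential x.1 : ℝ) : ℂ) * dp i φ x)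

/-- The number operator. -/
def number (φ : Phase d → ℂ) (x : Phase d) : ℂ :=
  ∑ i, S.creation i (S.annihilation i φ) x

/-- The ratio of friction and inverse temperature. -/
def kap : ℝ := S.friction / S.invTemp

/-- The constant `β / 2μ`. -/
def cc : ℝ := S.invTemp / (2 * S.mass)

/-- The Langevin operator (`s = 1`) and its formal adjoint (`s = -1`). -/
def signedExpr (s : ℝ) (φ : Phase d → ℂ) (x : Phase d) : ℂ :=
  (s : ℂ) * S.transport φ x + (S.kap : ℂ) * S.number φ x

theorem kap_pos : 0 < S.kap := div_pos S.friction_pos S.invTemp_pos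

theorem cc_pos : 0 < S.cc := div_pos S.invTemp_pos (mul_pos two_pos S.mass_pos)

theorem flatKolmogorovExpr_eq (φ : Phase d → ℂ) :
    S.flatKolmogorovExpr φ = S.signedExpr 1 φ := by
  funext x
  simp only [flatKolmogorovExpr, signedExpr, transport, number, kap, gradient_apply,
    Finset.sum_add_distrib, Finset.mul_sum, Complex.ofReal_one, one_mul]

theorem contDiff_dq {φ : Phase d → ℂ} (hφ : ContDiff ℝ ∞ φ) (i : Fin d) :
    ContDiff ℝ ∞ (dq i φ) := ContDiff.dirD hφ _

theorem contDiff_coord (i : Fin d) : ContDiff ℝ ∞ fun x : Phase d => x.2 i :=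
  (EuclideanSpace.proj (𝕜 := ℝ) i).contDiff.comp contDiff_snd

theorem contDiff_mom (c : ℝ) (i : Fin d) : ContDiff ℝ ∞ fun x : Phase d => ((c * x.2 i : ℝ) : ℂ) :=
  (contDiff_const.mul (contDiff_coord i)).ofReal

theorem contDiff_force (i : Fin d) :
    ContDiff ℝ ∞ fun x : Phase d => ((pd i S.potential x.1 : ℝ) : ℂ) :=
  ((S.smooth.pd i).comp contDiff_fst).ofReal

theorem contDiff_creation {φ : Phase d → ℂ} (hφ : ContDiff ℝ ∞ φ) (i : Fin d) :
    ContDiff ℝ ∞ (S.creation i φ) :=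
  (contDiff_dp hφ i).neg.add ((contDiff_mom S.cc i).mul hφ)

theorem contDiff_number {φ : Phase d → ℂ} (hφ : ContDiff ℝ ∞ φ) : ContDiff ℝ ∞ (S.number φ) :=
  ContDiff.sum fun i _ => S.contDiff_creation (S.contDiff_annihilation hφ i) i

theorem contDiff_velocity (i : Fin d) :
    ContDiff ℝ ∞ fun x : Phase d => -((x.2 i / S.mass : ℝ) : ℂ) :=
  ((contDiff_coord i).div_const _).ofReal.neg

theorem contDiff_transport {φ : Phase d → ℂ} (hφ : ContDiff ℝ ∞ φ) :
    ContDiff ℝ ∞ (S.transport φ) :=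
  ContDiff.sum fun i _ => ((S.contDiff_velocity i).mul (contDiff_dq hφ i)).add
    ((S.contDiff_force i).mul (contDiff_dp hφ i))

theorem contDiff_signedExpr {φ : Phase d → ℂ} (hφ : ContDiff ℝ ∞ φ) (s : ℝ) :
    ContDiff ℝ ∞ (S.signedExpr s φ) :=
  (contDiff_const.mul (S.contDiff_transport hφ)).add (contDiff_const.mul (S.contDiff_number hφ))

theorem testFn_annihilation {φ : Phase d → ℂ} (hφ : TestFn φ) (i : Fin d) :
    TestFn (S.annihilation i φ) :=
  (hφ.dirD (unitP i)).add (hφ.smooth_mul (contDiff_mom S.cc i))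

theorem testFn_creation {φ : Phase d → ℂ} (hφ : TestFn φ) (i : Fin d) :
    TestFn (S.creation i φ) :=
  (hφ.dirD (unitP i)).neg.add (hφ.smooth_mul (contDiff_mom S.cc i))

theorem testFn_transport {φ : Phase d → ℂ} (hφ : TestFn φ) : TestFn (S.transport φ) :=
  TestFn.sum _ fun i => ((hφ.dirD (unitQ i)).smooth_mul (S.contDiff_velocity i)).add
    ((hφ.dirD (unitP i)).smooth_mul (S.contDiff_force i))

theorem testFn_signedExpr {φ : Phase d → ℂ} (hφ : TestFn φ) (s : ℝ) :
    TestFn (S.signedExpr s φ) :=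
  ((S.testFn_transport hφ).const_mul _).add
    ((TestFn.sum _ fun i => S.testFn_creation (S.testFn_annihilation hφ i) i).const_mul _)

section Adjoint

variable {ξ u : Phase d → ℂ}

theorem integral_mul_annihilation (hξ : ContDiff ℝ ∞ ξ) (hu : ContDiff ℝ ∞ u)
    (h : HasCompactSupport ξ ∨ HasCompactSupport u) (i : Fin d) :
    ∫ x, ξ x * S.annihilation i u x = ∫ x, S.creation i ξ x * u x := by
  have h1 := integral_mul_dirD_of_or (μ := volume) hξ hu h (unitP i)
  have hm := contDiff_mom S.cc i
  have hor : HasCompactSupport (dirD (unitP i) ξ) ∨ HasCompactSupport u :=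
    h.imp_left fun h => h.dirD _
  have hor' : HasCompactSupport ξ ∨ HasCompactSupport (dirD (unitP i) u) :=
    h.imp_right fun h => h.dirD _
  have hor2 : HasCompactSupport ξ ∨ HasCompactSupport fun x => ((S.cc * x.2 i : ℝ) : ℂ) * u x :=
    h.imp_right fun h => h.mul_left
  have i1 : Integrable fun x => ξ x * dp i u x := integrable_mul_of_or hξ (contDiff_dp hu i) hor'
  have i2 : Integrable fun x => ξ x * (((S.cc * x.2 i : ℝ) : ℂ) * u x) :=
    integrable_mul_of_or hξ (hm.mul hu) hor2
  have i3 : Integrable fun x => dp i ξ x * u x := integrable_mul_of_or (contDiff_dp hξ i) hu hor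
  have e1 : ∫ x, ξ x * S.annihilation i u x
      = (∫ x, ξ x * dp i u x) + ∫ x, ξ x * (((S.cc * x.2 i : ℝ) : ℂ) * u x) := by
    rw [← integral_add i1 i2]
    simp only [annihilation, mul_add, cc]
  have e2 : ∫ x, S.creation i ξ x * u x
      = (-∫ x, dp i ξ x * u x) + ∫ x, ξ x * (((S.cc * x.2 i : ℝ) : ℂ) * u x) := by
    rw [neg_add_eq_sub, ← integral_sub i2 i3]
    refine integral_congr_ae (.of_forall fun x => ?_)
    simp only [creation, cc]
    ring
  rw [e1, e2]
  exact congrArg (· + _) h1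

theorem integral_mul_creation (hξ : ContDiff ℝ ∞ ξ) (hu : ContDiff ℝ ∞ u)
    (h : HasCompactSupport ξ ∨ HasCompactSupport u) (i : Fin d) :
    ∫ x, ξ x * S.creation i u x = ∫ x, S.annihilation i ξ x * u x := by
  have := S.integral_mul_annihilation hu hξ h.symm i
  simp_rw [mul_comm (ξ _), mul_comm (S.annihilation i ξ _)]
  exact this.symm

theorem integral_mul_number (hξ : ContDiff ℝ ∞ ξ) (hu : TestFn u) :
    ∫ x, ξ x * S.number u x = ∫ x, S.number ξ x * u x := by
  have ha := fun i => S.testFn_annihilation hu i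
  simp only [number, Finset.mul_sum, Finset.sum_mul]
  rw [integral_finsetSum _ fun i _ => ((S.testFn_creation (ha i) i).smooth_mul hξ).integrable,
    integral_finsetSum _ fun i _ => (hu.smooth_mul
      (S.contDiff_creation (S.contDiff_annihilation hξ i) i)).integrable]
  refine Finset.sum_congr rfl fun i _ => ?_
  rw [S.integral_mul_creation hξ (ha i).1 (Or.inr (ha i).2),
    S.integral_mul_annihilation (S.contDiff_annihilation hξ i) hu.1 (Or.inr hu.2)]

theorem dq_mom (i : Fin d) (x : Phase d) :
    dq i (fun x : Phase d => -((x.2 i / S.mass : ℝ) : ℂ)) x = 0 := by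
  have h : HasFDerivAt (fun x : Phase d => x.2 i)
      ((EuclideanSpace.proj (𝕜 := ℝ) i).comp (ContinuousLinearMap.snd ℝ _ _)) x :=
    (EuclideanSpace.proj (𝕜 := ℝ) i).hasFDerivAt.comp x hasFDerivAt_snd
  have e := dirD_ofReal ((contDiff_coord i).div_const S.mass) (unitQ i) x
  have e2 : dirD (unitQ i) (fun x : Phase d => x.2 i / S.mass) x = 0 := by
    simp only [div_eq_mul_inv]
    unfold dirD
    rw [(h.mul_const _).fderiv]
    simp [unitQ]
  rw [dq_eq, dirD_neg, e, e2]
  simp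

theorem dp_force (i : Fin d) (x : Phase d) :
    dp i (fun x : Phase d => ((pd i S.potential x.1 : ℝ) : ℂ)) x = 0 := by
  have hf : ContDiff ℝ ∞ fun x : Phase d => pd i S.potential x.1 :=
    (S.smooth.pd i).comp contDiff_fst
  have h : HasFDerivAt (fun x : Phase d => pd i S.potential x.1) _ x :=
    ((S.smooth.pd i).differentiable_of_smooth x.1).hasFDerivAt.comp x hasFDerivAt_fst
  rw [dp_eq, dirD_ofReal hf]
  unfold dirD
  rw [h.fderiv]
  simp [unitP]

/-- The Hamiltonian vector field is divergence free: each coefficient is independent of the variable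
it differentiates (`dq_mom`, `dp_force`). -/
theorem integral_mul_transport (hξ : ContDiff ℝ ∞ ξ) (hu : TestFn u) :
    ∫ x, ξ x * S.transport u x = -∫ x, S.transport ξ x * u x := by
  have hv := S.contDiff_velocity
  have hf := S.contDiff_force
  have i1 := fun i => ((hu.dirD (unitQ i)).smooth_mul (hξ.mul (hv i))).integrable (μ := volume)
  have i2 := fun i => ((hu.dirD (unitP i)).smooth_mul (hξ.mul (hf i))).integrable (μ := volume)
  have i3 := fun i => (hu.smooth_mul ((hv i).mul (hξ.dirD (unitQ i)))).integrable (μ := volume)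
  have i4 := fun i => (hu.smooth_mul ((hf i).mul (hξ.dirD (unitP i)))).integrable (μ := volume)
  have e1 : ∀ x, ξ x * S.transport u x = ∑ i, (ξ x * -((x.2 i / S.mass : ℝ) : ℂ) * dirD (unitQ i) u x
      + ξ x * ((pd i S.potential x.1 : ℝ) : ℂ) * dirD (unitP i) u x) := fun x => by
    simp only [transport, Finset.mul_sum, dq_eq, dp_eq]
    exact Finset.sum_congr rfl fun i _ => by ring
  have e2 : ∀ x, S.transport ξ x * u x = ∑ i, (-((x.2 i / S.mass : ℝ) : ℂ) * dirD (unitQ i) ξ x * u x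
      + ((pd i S.potential x.1 : ℝ) : ℂ) * dirD (unitP i) ξ x * u x) := fun x => by
    simp only [transport, Finset.sum_mul, dq_eq, dp_eq]
    exact Finset.sum_congr rfl fun i _ => by ring
  simp only [e1, e2]
  have i12 : ∀ i, Integrable fun x : Phase d => ξ x * -((x.2 i / S.mass : ℝ) : ℂ) * dirD (unitQ i) u x
      + ξ x * ((pd i S.potential x.1 : ℝ) : ℂ) * dirD (unitP i) u x := fun i => (i1 i).add (i2 i)
  have i34 : ∀ i, Integrable fun x : Phase d => -((x.2 i / S.mass : ℝ) : ℂ) * dirD (unitQ i) ξ x * u x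
      + ((pd i S.potential x.1 : ℝ) : ℂ) * dirD (unitP i) ξ x * u x := fun i => (i3 i).add (i4 i)
  rw [integral_finsetSum _ fun i _ => i12 i, integral_finsetSum _ fun i _ => i34 i, ← Finset.sum_neg_distrib]
  refine Finset.sum_congr rfl fun i _ => ?_
  rw [integral_add (i1 i) (i2 i), integral_add (i3 i) (i4 i), neg_add]
  congr 1
  · have h := integral_mul_dirD' (μ := volume) (hξ.mul (hv i)) hu (unitQ i)
    rw [h]
    congr 1
    refine integral_congr_ae (.of_forall fun x => ?_)
    have h2 := dirD_mul hξ (hv i) (unitQ i) x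
    have h3 := S.dq_mom i x
    rw [dq_eq] at h3
    simp only [h2, h3]
    ring
  · have h := integral_mul_dirD' (μ := volume) (hξ.mul (hf i)) hu (unitP i)
    rw [h]
    congr 1
    refine integral_congr_ae (.of_forall fun x => ?_)
    have h2 := dirD_mul hξ (hf i) (unitP i) x
    have h3 := S.dp_force i x
    rw [dp_eq] at h3
    simp only [h2, h3]
    ring

/-- Integration by parts for the Langevin operator. -/
theorem integral_mul_signedExpr (hξ : ContDiff ℝ ∞ ξ) (hu : TestFn u) (s : ℝ) :
    ∫ x, ξ x * S.signedExpr s u x = ∫ x, S.signedExpr (-s) ξ x * u x := by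
  have i1 := ((S.testFn_transport hu).smooth_mul hξ).integrable (μ := volume)
  have i2 : Integrable fun x => ξ x * S.number u x :=
    ((TestFn.sum _ fun i => S.testFn_creation (S.testFn_annihilation hu i) i).smooth_mul
      hξ).integrable
  have i3 := (hu.smooth_mul (S.contDiff_transport hξ)).integrable (μ := volume)
  have i4 := (hu.smooth_mul (S.contDiff_number hξ)).integrable (μ := volume)
  have e1 : ∫ x, ξ x * S.signedExpr s u x
      = (s : ℂ) * (∫ x, ξ x * S.transport u x) + (S.kap : ℂ) * ∫ x, ξ x * S.number u x := by
    rw [← integral_const_mul, ← integral_const_mul, ← integral_add (i1.const_mul _) (i2.const_mul _)]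
    refine integral_congr_ae (.of_forall fun x => ?_)
    simp only [signedExpr]
    ring
  have e2 : ∫ x, S.signedExpr (-s) ξ x * u x
      = -(s : ℂ) * (∫ x, S.transport ξ x * u x) + (S.kap : ℂ) * ∫ x, S.number ξ x * u x := by
    rw [← integral_const_mul, ← integral_const_mul, ← integral_add (i3.const_mul _) (i4.const_mul _)]
    refine integral_congr_ae (.of_forall fun x => ?_)
    simp only [signedExpr, Complex.ofReal_neg]
    ring
  rw [e1, e2, S.integral_mul_transport hξ hu, S.integral_mul_number hξ hu]
  ring

end Adjoint

end LangevinSystem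

/-! ### Uniqueness of weak solutions of the Langevin equation -/

namespace LangevinSystem

open Filter Topology

variable {d : ℕ} (S : LangevinSystem d)

/-- The Hamiltonian vector field with the sign `-s`. -/
def drift (s : ℝ) (x : Phase d) : Phase d :=
  ((s * S.mass⁻¹) • x.2, (-s) • ∇ S.potential x.1)

/-- The zeroth order coefficient of the Langevin operator. -/
def massCoeff (l : ℝ) (x : Phase d) : ℝ :=
  S.kap * (S.cc ^ 2 * ‖x.2‖ ^ 2 - S.cc * d) + l

theorem contDiff_gradient {V : EuclideanSpace ℝ (Fin d) → ℝ} (hV : ContDiff ℝ ∞ V) :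
    ContDiff ℝ ∞ fun q => ∇ V q := by
  rw [contDiff_euclidean]
  intro i
  simp only [gradient_apply]
  exact hV.pd i

theorem contDiff_drift (s : ℝ) : ContDiff ℝ ∞ (S.drift s) := by
  have h1 : ContDiff ℝ ∞ fun x : Phase d => (s * S.mass⁻¹) • x.2 := contDiff_snd.const_smul _
  have h2 : ContDiff ℝ ∞ fun x : Phase d => (-s) • ∇ S.potential x.1 :=
    ((contDiff_gradient S.smooth).comp contDiff_fst).const_smul _
  exact h1.prodMk h2

theorem contDiff_massCoeff (l : ℝ) : ContDiff ℝ ∞ (S.massCoeff l) := by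
  have h : ContDiff ℝ ∞ fun x : Phase d => ‖x.2‖ ^ 2 := contDiff_snd.norm_sq ℝ
  unfold massCoeff
  fun_prop

theorem euclidean_eq_sum (v : EuclideanSpace ℝ (Fin d)) :
    v = ∑ i, v i • EuclideanSpace.single i (1 : ℝ) := by
  ext j
  simp [Pi.single_apply]

theorem dirD_phase {F : Type*} [NormedAddCommGroup F] [NormedSpace ℝ F] (φ : Phase d → F)
    (v w : EuclideanSpace ℝ (Fin d)) (x : Phase d) : fderiv ℝ φ x (v, w)
      = (∑ i, v i • dirD (unitQ i) φ x) + ∑ i, w i • dirD (unitP i) φ x := by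
  have e : (v, w) = (∑ i, v i • (unitQ i : Phase d)) + ∑ i, w i • (unitP i : Phase d) := by
    refine Prod.ext ?_ ?_
    · simp only [Prod.fst_add, Prod.fst_sum, Prod.smul_fst, unitQ, unitP, smul_zero,
        Finset.sum_const_zero, add_zero]
      exact euclidean_eq_sum v
    · simp only [Prod.snd_add, Prod.snd_sum, Prod.smul_snd, unitQ, unitP, smul_zero,
        Finset.sum_const_zero, zero_add]
      exact euclidean_eq_sum w
  rw [e]
  simp [dirD, map_sum]

theorem fderiv_drift (s : ℝ) (φ : Phase d → ℝ) (x : Phase d) :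
    fderiv ℝ φ x (S.drift s x) = -s * ∑ i, (-(x.2 i / S.mass) * dirD (unitQ i) φ x
      + pd i S.potential x.1 * dirD (unitP i) φ x) := by
  rw [drift, dirD_phase, ← Finset.sum_add_distrib, Finset.mul_sum]
  refine Finset.sum_congr rfl fun i _ => ?_
  simp only [PiLp.smul_apply, smul_eq_mul, gradient_apply]
  ring

theorem transport_ofReal {φ : Phase d → ℝ} (hφ : ContDiff ℝ ∞ φ) (x : Phase d) :
    S.transport (fun y => (φ y : ℂ)) x = ((∑ i, (-(x.2 i / S.mass) * dirD (unitQ i) φ x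
      + pd i S.potential x.1 * dirD (unitP i) φ x) : ℝ) : ℂ) := by
  simp only [transport, dq_eq, dp_eq, dirD_ofReal hφ]
  push_cast
  rfl

theorem dp_mom (i : Fin d) (x : Phase d) : dirD (unitP i) (fun x : Phase d => x.2 i) x = 1 := by
  have h : HasFDerivAt (fun x : Phase d => x.2 i) _ x :=
    (EuclideanSpace.proj (𝕜 := ℝ) i).hasFDerivAt.comp x hasFDerivAt_snd
  unfold dirD
  rw [h.fderiv]
  simp [unitP]

theorem dirD_annihilation {φ : Phase d → ℂ} (hφ : ContDiff ℝ ∞ φ) (i : Fin d) (x : Phase d) :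
    dp i (S.annihilation i φ) x = dp i (dp i φ) x + ((S.cc * x.2 i : ℝ) : ℂ) * dp i φ x
      + (S.cc : ℂ) * φ x := by
  have h1 := dirD_add (contDiff_dp hφ i) ((contDiff_mom S.cc i).mul hφ) (unitP i) x
  have h2 := dirD_mul (contDiff_mom S.cc i) hφ (unitP i) x
  have h3 := dirD_ofReal (contDiff_const.mul (contDiff_coord i)) (unitP i) x
    (φ := fun x : Phase d => S.cc * x.2 i)
  have h4 := dirD_const_mul (contDiff_coord i) S.cc (unitP i) x
  rw [dp_mom] at h4
  rw [h4] at h3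
  rw [h3] at h2
  rw [h2] at h1
  refine h1.trans ?_
  simp only [dp_eq, mul_one]
  ring

theorem number_eq {φ : Phase d → ℂ} (hφ : ContDiff ℝ ∞ φ) (x : Phase d) :
    S.number φ x = -∑ i, dp i (dp i φ) x
      + ((S.cc ^ 2 * ‖x.2‖ ^ 2 - S.cc * d : ℝ) : ℂ) * φ x := by
  have hn : ‖x.2‖ ^ 2 = ∑ i, x.2 i ^ 2 := by
    rw [EuclideanSpace.norm_sq_eq]
    simp
  have hd : (S.cc * d : ℝ) = ∑ _i : Fin d, S.cc := by simp [mul_comm]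
  rw [hn, hd, Finset.mul_sum, ← Finset.sum_sub_distrib, Complex.ofReal_sum, Finset.sum_mul,
    ← Finset.sum_neg_distrib, ← Finset.sum_add_distrib, number]
  refine Finset.sum_congr rfl fun i _ => ?_
  rw [creation, dirD_annihilation S hφ, annihilation]
  change _ + ((S.cc * x.2 i : ℝ) : ℂ) * (_ + ((S.cc * x.2 i : ℝ) : ℂ) * _) = _
  push_cast
  ring

/-- The coefficients are real, so the complex equation decouples into real and imaginary parts, each
in the form treated by `energy_estimate_weak`. -/
theorem signedExpr_ofReal {φ : Phase d → ℝ} (hφ : ContDiff ℝ ∞ φ) (s l : ℝ) (x : Phase d) :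
    S.signedExpr s (fun y => (φ y : ℂ)) x + (l : ℂ) * φ x
      = ((driftExpr S.kap unitP (fun y => -S.drift s y) (S.massCoeff l) φ x : ℝ) : ℂ) := by
  have h2 : ∀ i, dp i (dp i fun y => (φ y : ℂ)) x = ((dirD (unitP i) (dirD (unitP i) φ) x : ℝ) : ℂ) :=
    fun i => by
      have : dp i (fun y => (φ y : ℂ)) = fun y => ((dirD (unitP i) φ y : ℝ) : ℂ) :=
        funext fun y => dirD_ofReal hφ _ y
      rw [this, dp_eq, dirD_ofReal (hφ.dirD _)]
  rw [signedExpr, transport_ofReal S hφ, number_eq S hφ.ofReal, driftExpr, map_neg, fderiv_drift,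
    massCoeff]
  simp only [h2]
  push_cast
  ring

theorem integral_fderiv_drift (s : ℝ) {φ : Phase d → ℝ} (hφ : TestFn φ) :
    ∫ x, fderiv ℝ φ x (S.drift s x) = 0 := by
  have h := S.integral_mul_transport (ξ := fun _ => 1) contDiff_const hφ.ofReal
  have h1 : ∀ x, S.transport (fun _ : Phase d => (1 : ℂ)) x = 0 := fun x => by
    simp [transport, dq, dp]
  simp only [h1, one_mul, zero_mul, integral_zero, neg_zero, transport_ofReal S hφ.1] at h
  rw [integral_complex_ofReal] at h
  simp only [fderiv_drift]
  rw [integral_const_mul, Complex.ofReal_eq_zero.1 h, mul_zero]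

/-- The energy estimate with a product of cutoffs in `q` and in `p`. The zeroth order coefficient is
`L + κ c² |p|²`, with `L > 0` by the choice of `l`. The drift acting on the position cutoff costs
`|p|/k₁`, which the quadratic term absorbs; acting on the momentum cutoff it costs `|∇V|/k₂`, which
is small because `k₂` is chosen after the force on the support in `q`. -/
theorem real_eq_zero_of_weak (s : ℝ) {l : ℝ} (hl : S.kap * S.cc * d < l) {f : Phase d → ℝ}
    (hf : MemLp f 2) (hweak : ∀ φ : Phase d → ℝ, TestFn φ →
      ∫ x, f x * driftExpr S.kap unitP (fun y => -S.drift s y) (S.massCoeff l) φ x = 0) :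
    f =ᵐ[volume] 0 := by
  obtain ⟨C, hC, hcut⟩ := exists_cutoff_bound (EuclideanSpace ℝ (Fin d))
  have hi : Integrable (fun x => f x ^ 2) := hf.integrable_sq
  have hk := S.kap_pos
  have hc := S.cc_pos
  have hμ := S.mass_pos
  set L := l - S.kap * S.cc * d with hL
  have hL0 : 0 < L := sub_pos.2 hl
  -- the force on balls
  have hbd : ∀ n : ℕ, ∃ G : ℝ, 0 ≤ G ∧ ∀ q : EuclideanSpace ℝ (Fin d), ‖q‖ ≤ 2 * (n + 1) →
      ‖∇ S.potential q‖ ≤ G := fun n => by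
    obtain ⟨G, hG⟩ := (isCompact_closedBall (0 : EuclideanSpace ℝ (Fin d))
      (2 * (n + 1))).exists_bound_of_continuousOn (contDiff_gradient S.smooth).continuous.continuousOn
    exact ⟨max G 0, le_max_right _ _, fun q hq => (hG q (by simpa using hq)).trans (le_max_left _ _)⟩
  choose G hG0 hG using hbd
  let k₁ : ℕ → ℝ := fun n => n + 1
  -- The position cutoff is supported in `‖q‖ ≤ 2(n + 1)`, where the force is at most `G n`; with
  -- this scale `G n / k₂ n ≤ 1/(n + 1)`.
  let k₂ : ℕ → ℝ := fun n => (n + 1) * (1 + G n)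
  have hk1 : ∀ n, 0 < k₁ n := fun n => by positivity
  have hk2 : ∀ n, 0 < k₂ n := fun n => mul_pos (by positivity) (by linarith [hG0 n])
  have hle : ∀ n, k₁ n ≤ k₂ n := fun n => by
    have : 0 ≤ ((n : ℝ) + 1) * G n := mul_nonneg (by positivity) (hG0 n)
    change (n : ℝ) + 1 ≤ (n + 1) * (1 + G n)
    linarith
  have hk1t : Tendsto k₁ atTop atTop :=
    tendsto_atTop_add_const_right _ _ tendsto_natCast_atTop_atTop
  have hk2t : Tendsto k₂ atTop atTop := tendsto_atTop_mono hle hk1t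
  let χ : ℕ → Phase d → ℝ := fun n x => cutoff (k₁ n) x.1 * cutoff (k₂ n) x.2
  have tχ : ∀ n, TestFn (χ n) := fun n => (testFn_cutoff (hk1 n)).prod_mul (testFn_cutoff (hk2 n))
  -- The constant of Young's inequality `t r y ≤ a y² + (t²/4a) r²` with `a = κ c²`, `t = |s| C /
  -- μ`, `y = χ |p|` and `r = 1/(n + 1)`, used in `p3`.
  set B := (|s| * C / S.mass) ^ 2 / (4 * (S.kap * S.cc ^ 2)) with hB
  let δ : ℕ → ℝ := fun n => (S.kap * d * C ^ 2 * (1 / ((n : ℝ) + 1)) ^ 2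
    + |s| * C * (1 / ((n : ℝ) + 1)) + B * (1 / ((n : ℝ) + 1)) ^ 2) * (∫ x, f x ^ 2) / L
  have hδ : Tendsto δ atTop (𝓝 0) := by
    have h0 := tendsto_one_div_add_atTop_nhds_zero_nat (𝕜 := ℝ)
    have := (((((h0.pow 2).const_mul (S.kap * d * C ^ 2)).add (h0.const_mul (|s| * C))).add
      ((h0.pow 2).const_mul B)).mul_const (∫ x, f x ^ 2)).div_const L
    simpa only [zero_pow two_ne_zero, mul_zero, add_zero, zero_mul, zero_div] using this
  refine ae_eq_zero_of_cutoff hf (χ := χ) (fun n => (tχ n).continuous.aestronglyMeasurable)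
    (fun n x => mul_nonneg (cutoff_nonneg _ _) (cutoff_nonneg _ _))
    (fun n x => mul_le_one₀ (cutoff_le_one _ _) (cutoff_nonneg _ _) (cutoff_le_one _ _))
    (fun x => by simpa using (tendsto_cutoff hk1t x.1).mul (tendsto_cutoff hk2t x.2)) hδ fun n => ?_
  have bdd : ∀ ψ : Phase d → ℝ, TestFn ψ → Integrable (fun x => ψ x * f x ^ 2) := fun ψ hψ => by
    obtain ⟨D, hD⟩ := hψ.2.exists_bound_of_continuous hψ.continuous
    exact hi.bdd_mul hψ.continuous.aestronglyMeasurable (.of_forall hD)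
  have key := energy_estimate_weak (μ := volume) hk.le unitP (S.contDiff_drift s)
    (S.contDiff_massCoeff l) (fun φ hφ => S.integral_fderiv_drift s hφ) hf hweak (tχ n)
  have tb : TestFn fun x => fderiv ℝ (χ n) x (S.drift s x) := by
    refine ⟨contDiff_fderiv_apply (tχ n).1 (S.contDiff_drift s),
      HasCompactSupport.mono' ((tχ n).2.fderiv (𝕜 := ℝ)) ?_⟩
    refine fun y hy => subset_tsupport _ ?_
    simp only [Function.mem_support] at hy ⊢
    intro h0
    rw [h0] at hy
    exact hy rfl
  have tχ2 : TestFn fun x => χ n x ^ 2 := (tχ n).sq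
  have tleft := tχ2.mul_smooth (S.contDiff_massCoeff l)
  have tright : TestFn fun x => S.kap * ∑ k, dirD (unitP k) (χ n) x ^ 2
      + χ n x * fderiv ℝ (χ n) x (S.drift s x) :=
    ((TestFn.sum _ fun k => ((tχ n).dirD (unitP k)).sq).const_mul _).add ((tχ n).mul_smooth tb.1)
  rw [← sub_nonpos, ← integral_sub (bdd _ tleft) (bdd _ tright)] at key
  have i1 : Integrable fun x => χ n x ^ 2 * f x ^ 2 := bdd _ tχ2
  suffices hs : L * (∫ x, χ n x ^ 2 * f x ^ 2) ≤ (S.kap * d * C ^ 2 * (1 / ((n : ℝ) + 1)) ^ 2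
      + |s| * C * (1 / ((n : ℝ) + 1)) + B * (1 / ((n : ℝ) + 1)) ^ 2) * ∫ x, f x ^ 2 by
    rw [le_div_iff₀ hL0]
    linarith
  set A := S.kap * d * C ^ 2 * (1 / ((n : ℝ) + 1)) ^ 2
      + |s| * C * (1 / ((n : ℝ) + 1)) + B * (1 / ((n : ℝ) + 1)) ^ 2 with hA
  rw [← sub_nonpos, ← integral_const_mul, ← integral_const_mul,
    ← integral_sub (i1.const_mul L) (hi.const_mul A)]
  refine le_trans (integral_mono ((i1.const_mul L).sub (hi.const_mul A))
    ((bdd _ tleft).sub (bdd _ tright)) fun x => ?_) key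
  simp only [Pi.sub_apply]
  suffices hp : L * χ n x ^ 2 - A ≤ χ n x ^ 2 * S.massCoeff l x
      - (S.kap * ∑ k, dirD (unitP k) (χ n) x ^ 2 + χ n x * fderiv ℝ (χ n) x (S.drift s x)) by
    have := mul_le_mul_of_nonneg_right hp (sq_nonneg (f x))
    linarith
  have hu0 : 0 ≤ cutoff (k₁ n) x.1 := cutoff_nonneg _ _
  have hu1 : cutoff (k₁ n) x.1 ≤ 1 := cutoff_le_one _ _
  have hw0 : 0 ≤ cutoff (k₂ n) x.2 := cutoff_nonneg _ _
  have hw1 : cutoff (k₂ n) x.2 ≤ 1 := cutoff_le_one _ _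
  have hk1' : k₁ n = (n : ℝ) + 1 := rfl
  have hn0 : (0 : ℝ) < 1 / ((n : ℝ) + 1) := by positivity
  set u := cutoff (k₁ n) x.1 with hu
  set w := cutoff (k₂ n) x.2 with hw
  have hχx : χ n x = u * w := rfl
  have hχ0 : 0 ≤ χ n x := mul_nonneg hu0 hw0
  have hχ1 : χ n x ≤ 1 := mul_le_one₀ hu1 hw0 hw1
  have hCk2 : C / k₂ n ≤ C * (1 / ((n : ℝ) + 1)) := by
    rw [mul_one_div]
    gcongr
    exact hle n
  have dχ : ∀ v : Phase d, dirD v (χ n) x = dirD v.1 (cutoff (k₁ n)) x.1 * w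
      + u * dirD v.2 (cutoff (k₂ n)) x.2 :=
    fun v => dirD_prod_mul (testFn_cutoff (hk1 n)).1 (testFn_cutoff (hk2 n)).1 v x
  have p1 : ∑ k, dirD (unitP k) (χ n) x ^ 2 ≤ d * (C * (1 / ((n : ℝ) + 1))) ^ 2 := by
    have : ∀ k ∈ (Finset.univ : Finset (Fin d)),
        dirD (unitP k) (χ n) x ^ 2 ≤ (C * (1 / ((n : ℝ) + 1))) ^ 2 := fun k _ => by
      rw [dχ, ← sq_abs]
      refine pow_le_pow_left₀ (abs_nonneg _) ?_ 2
      have h0 : dirD (unitP k : Phase d).1 (cutoff (k₁ n)) x.1 = 0 := by simp [unitP, dirD]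
      rw [h0, zero_mul, zero_add, abs_mul, abs_of_nonneg hu0]
      have h1 := hcut _ (hk2 n) x.2 (unitP k : Phase d).2
      have h2 : ‖(unitP k : Phase d).2‖ = 1 := by simp [unitP]
      rw [h2, mul_one] at h1
      calc u * |dirD (unitP k : Phase d).2 (cutoff (k₂ n)) x.2| ≤ 1 * (C / k₂ n) := by gcongr
        _ ≤ _ := by rw [one_mul]; exact hCk2
    refine (Finset.sum_le_sum this).trans_eq ?_
    simp
  have p2 : χ n x * fderiv ℝ (χ n) x (S.drift s x)
      ≤ |s| * C / S.mass * (1 / ((n : ℝ) + 1)) * (χ n x * ‖x.2‖) + |s| * C * (1 / ((n : ℝ) + 1)) := by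
    have e := dχ (S.drift s x)
    unfold dirD at e
    rw [e, mul_add]
    refine add_le_add ?_ ?_
    · have h1 := hcut _ (hk1 n) x.1 (S.drift s x).1
      have h2 : ‖(S.drift s x).1‖ = |s| / S.mass * ‖x.2‖ := by
        rw [drift, norm_smul, norm_mul, norm_inv, Real.norm_of_nonneg hμ.le, Real.norm_eq_abs,
          div_eq_mul_inv]
      rw [h2, hk1'] at h1
      have h3 := le_of_abs_le h1
      unfold dirD at h3
      calc χ n x * (fderiv ℝ (cutoff (k₁ n)) x.1 (S.drift s x).1 * w)
          ≤ χ n x * ((C / (n + 1) * (|s| / S.mass * ‖x.2‖)) * 1) := by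
            refine mul_le_mul_of_nonneg_left ?_ hχ0
            exact mul_le_mul h3 hw1 hw0 (by positivity)
        _ = _ := by ring
    · by_cases hq : ‖x.1‖ ≤ 2 * ((n : ℝ) + 1)
      · have h1 := hcut _ (hk2 n) x.2 (S.drift s x).2
        have h2 : ‖(S.drift s x).2‖ ≤ |s| * G n := by
          rw [drift, norm_smul, Real.norm_eq_abs, abs_neg]
          gcongr
          exact hG n _ hq
        have h3 := le_of_abs_le h1
        unfold dirD at h3
        have h4 : C / k₂ n * ‖(S.drift s x).2‖ ≤ |s| * C * (1 / ((n : ℝ) + 1)) := by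
          have hGn : G n / (1 + G n) ≤ 1 := (div_le_one (by linarith [hG0 n])).2 (by linarith)
          calc C / k₂ n * ‖(S.drift s x).2‖ ≤ C / k₂ n * (|s| * G n) := by
                have := hk2 n
                gcongr
            _ = |s| * C * (1 / ((n : ℝ) + 1)) * (G n / (1 + G n)) := by
                have := hG0 n
                change C / (((n : ℝ) + 1) * (1 + G n)) * (|s| * G n) = _
                field_simp
            _ ≤ |s| * C * (1 / ((n : ℝ) + 1)) * 1 := by gcongr
            _ = _ := mul_one _
        have h5 := h3.trans h4
        calc χ n x * (u * fderiv ℝ (cutoff (k₂ n)) x.2 (S.drift s x).2)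
            = (χ n x * u) * fderiv ℝ (cutoff (k₂ n)) x.2 (S.drift s x).2 := by ring
          _ ≤ (χ n x * u) * (|s| * C * (1 / ((n : ℝ) + 1))) := by gcongr
          _ ≤ 1 * (|s| * C * (1 / ((n : ℝ) + 1))) := by
              gcongr
              exact mul_le_one₀ hχ1 hu0 hu1
          _ = _ := one_mul _
      · have h0 : u = 0 := cutoff_eq_zero (hk1 n) (not_le.1 hq).le
        rw [h0, zero_mul, mul_zero]
        positivity
  have p3 : |s| * C / S.mass * (1 / ((n : ℝ) + 1)) * (χ n x * ‖x.2‖)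
      ≤ S.kap * S.cc ^ 2 * (χ n x * ‖x.2‖) ^ 2 + B * (1 / ((n : ℝ) + 1)) ^ 2 := by
    set t := |s| * C / S.mass
    set y := χ n x * ‖x.2‖
    set r := 1 / ((n : ℝ) + 1)
    set a := S.kap * S.cc ^ 2 with ha
    have ha0 : 0 < a := by positivity
    have h1 : 0 ≤ 1 / (4 * a) * (2 * a * y - t * r) ^ 2 := by positivity
    have h2 : 1 / (4 * a) * (2 * a * y - t * r) ^ 2 = a * y ^ 2 - t * r * y + B * r ^ 2 := by
      rw [hB]
      field_simp
      ring
    rw [h2] at h1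
    linarith
  have p4 := mul_le_mul_of_nonneg_left p1 hk.le
  have e5 : χ n x ^ 2 * S.massCoeff l x = L * χ n x ^ 2
      + S.kap * S.cc ^ 2 * (χ n x * ‖x.2‖) ^ 2 := by
    rw [massCoeff, hL]
    ring
  rw [e5, hA]
  have e6 : S.kap * (d * (C * (1 / ((n : ℝ) + 1))) ^ 2)
      = S.kap * d * C ^ 2 * (1 / ((n : ℝ) + 1)) ^ 2 := by ring
  rw [e6] at p4
  linarith

/-- Uniqueness of `L²` weak solutions of the shifted Langevin equation. -/
theorem eq_zero_of_weak (s : ℝ) {l : ℝ} (hl : S.kap * S.cc * d < l) {u : Phase d → ℂ}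
    (hu : MemLp u 2)
    (hweak : ∀ ψ : Phase d → ℂ, TestFn ψ → ∫ x, u x * (S.signedExpr s ψ x + l * ψ x) = 0) :
    u =ᵐ[volume] 0 := by
  have hi : ∀ φ : Phase d → ℝ, TestFn φ → Integrable fun x =>
      u x * ((driftExpr S.kap unitP (fun y => -S.drift s y) (S.massCoeff l) φ x : ℝ) : ℂ) := by
    intro φ hφ
    have ht : TestFn fun x => S.signedExpr s (fun y => (φ y : ℂ)) x + (l : ℂ) * φ x :=
      (S.testFn_signedExpr hφ.ofReal s).add (hφ.ofReal.const_mul _)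
    have := hu.integrable_mul (ht.memLp (μ := volume) 2)
    refine this.congr (.of_forall fun x => ?_)
    simp only [Pi.mul_apply, S.signedExpr_ofReal hφ.1]
  have hw : ∀ φ : Phase d → ℝ, TestFn φ → ∫ x, u x *
      ((driftExpr S.kap unitP (fun y => -S.drift s y) (S.massCoeff l) φ x : ℝ) : ℂ) = 0 := by
    intro φ hφ
    rw [← hweak _ hφ.ofReal]
    simp only [S.signedExpr_ofReal hφ.1]
  have hre := S.real_eq_zero_of_weak s hl hu.re fun φ hφ => by
    have := congrArg Complex.re (hw φ hφ)
    rw [← Complex.reCLM_apply, ← Complex.reCLM.integral_comp_comm (hi φ hφ)] at this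
    simpa using this
  have him := S.real_eq_zero_of_weak s hl hu.im fun φ hφ => by
    have := congrArg Complex.im (hw φ hφ)
    rw [← Complex.imCLM_apply, ← Complex.imCLM.integral_comp_comm (hi φ hφ)] at this
    simpa using this
  filter_upwards [hre, him] with x h1 h2
  exact Complex.ext h1 h2

end LangevinSystem

/-! ### Perturbation of accretive operators -/

section Perturbation

open Filter Topology

variable {H : Type*} [NormedAddCommGroup H] [InnerProductSpace ℂ H]

/-- The bounded inverse of a surjective operator that is bounded below. -/
theorem exists_bounded_inverse {D : Submodule ℂ H} (L : D →ₗ[ℂ] H) {c : ℝ} (hc : 0 < c)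
    (hs : ∀ f, ∃ u, L u = f) (hb : ∀ u : D, c * ‖(u : H)‖ ≤ ‖L u‖) :
    ∃ R : H →L[ℂ] H, ‖R‖ ≤ c⁻¹ ∧ (∀ f, ∃ h : R f ∈ D, L ⟨R f, h⟩ = f) ∧ ∀ u : D, R (L u) = u := by
  have hinj : Function.Injective L := by
    rw [injective_iff_map_eq_zero]
    intro u hu
    have := hb u
    rw [hu, norm_zero] at this
    have h0 : ‖(u : H)‖ = 0 := le_antisymm (nonpos_of_mul_nonpos_right this hc) (norm_nonneg _)
    exact Subtype.ext (norm_eq_zero.1 h0)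
  let e := LinearEquiv.ofBijective L ⟨hinj, hs⟩
  have he : ∀ f, L (e.symm f) = f := fun f => e.apply_symm_apply f
  let R := (D.subtype ∘ₗ e.symm.toLinearMap).mkContinuous c⁻¹ fun f => by
    have := hb (e.symm f)
    rw [he] at this
    rw [inv_mul_eq_div, le_div_iff₀ hc, mul_comm]
    exact this
  refine ⟨R, LinearMap.mkContinuous_norm_le _ (inv_nonneg.2 hc.le) _, fun f => ?_, fun u => ?_⟩
  · exact ⟨(e.symm f).2, he f⟩
  · exact congrArg Subtype.val (e.symm_apply_apply u)

/-- Small bounded perturbations preserve surjectivity of operators that are bounded below. -/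
theorem surjective_perturb [CompleteSpace H] {D : Submodule ℂ H} (L : D →ₗ[ℂ] H) {c : ℝ} (hc : 0 < c)
    (hs : ∀ f, ∃ u, L u = f) (hb : ∀ u : D, c * ‖(u : H)‖ ≤ ‖L u‖) (K : H →L[ℂ] H) (hK : ‖K‖ < c)
    (f : H) : ∃ u : D, L u + K u = f := by
  obtain ⟨R, hR, h1, h2⟩ := exists_bounded_inverse L hc hs hb
  have hn : ‖-(K * R)‖ < 1 := by
    rw [norm_neg]
    calc ‖K * R‖ ≤ ‖K‖ * ‖R‖ := norm_mul_le _ _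
      _ ≤ ‖K‖ * c⁻¹ := by gcongr
      _ < c * c⁻¹ := by gcongr
      _ = 1 := mul_inv_cancel₀ hc.ne'
  have hmul : (1 - -(K * R)) * ∑' n : ℕ, (-(K * R)) ^ n = 1 := mul_neg_geom_series _ hn
  set N := ∑' n : ℕ, (-(K * R)) ^ n
  have h3 : N f + K (R (N f)) = f := by
    have := congrArg (fun A : H →L[ℂ] H => A f) hmul
    simpa [sub_neg_eq_add, add_mul] using this
  obtain ⟨h, hh⟩ := h1 (N f)
  exact ⟨⟨R (N f), h⟩, by rw [hh]; exact h3⟩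

theorem le_norm_add_smul_of_accretive {u f : H} (h : 0 ≤ (inner ℂ u f).re) (l : ℝ) :
    l * ‖u‖ ≤ ‖f + (l : ℂ) • u‖ := by
  rcases eq_or_ne u 0 with rfl | hu
  · simp
  have hu0 : 0 < ‖u‖ := norm_pos_iff.2 hu
  have h1 : (inner ℂ u (f + (l : ℂ) • u)).re = (inner ℂ u f).re + l * ‖u‖ ^ 2 := by
    rw [inner_add_right, inner_smul_right, inner_self_eq_norm_sq_to_K, Complex.add_re,
      Complex.re_ofReal_mul]
    norm_cast
  have h2 : (inner ℂ u (f + (l : ℂ) • u)).re ≤ ‖u‖ * ‖f + (l : ℂ) • u‖ :=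
    (Complex.re_le_norm _).trans (norm_inner_le_norm _ _)
  refine le_of_mul_le_mul_left ?_ hu0
  nlinarith

/-- A closed accretive graph `Γ` has range `H` after a shift as soon as the range is dense. -/
theorem exists_of_accretive [CompleteSpace H] {Γ : Submodule ℂ (H × H)} (hΓ : IsClosed (Γ : Set (H × H)))
    (hacc : ∀ x ∈ Γ, 0 ≤ (inner ℂ x.1 x.2).re) {l : ℝ} (hl : 0 < l)
    (hd : ∀ v : H, (∀ x ∈ Γ, inner ℂ v (x.2 + (l : ℂ) • x.1) = 0) → v = 0) (f : H) :
    ∃ x ∈ Γ, x.2 + (l : ℂ) • x.1 = f := by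
  let Φ : (H × H) →L[ℂ] H := ContinuousLinearMap.snd ℂ H H + (l : ℂ) • ContinuousLinearMap.fst ℂ H H
  let N : Submodule ℂ H := Γ.map (Φ : (H × H) →ₗ[ℂ] H)
  have hΦ : ∀ x, Φ x = x.2 + (l : ℂ) • x.1 := fun x => rfl
  have hN : Nᗮ = ⊥ := by
    rw [Submodule.eq_bot_iff]
    intro v hv
    exact hd v fun x hx => (Submodule.mem_orthogonal' N v).1 hv _ ⟨x, hx, rfl⟩
  have hmem : f ∈ N.topologicalClosure := by
    rw [Submodule.topologicalClosure_eq_top_iff.2 hN]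
    trivial
  rw [← SetLike.mem_coe, Submodule.topologicalClosure_coe, mem_closure_iff_seq_limit] at hmem
  obtain ⟨g, hg, hlim⟩ := hmem
  choose x hx hxg using hg
  have hxg' : ∀ n, (x n).2 + (l : ℂ) • (x n).1 = g n := hxg
  -- Accretivity bounds `l` times the distance of first components by the distance of the images, so
  -- the first components are Cauchy and closedness of `Γ` identifies the limit.
  have hc : CauchySeq fun n => (x n).1 := by
    have hgc := hlim.cauchySeq
    rw [Metric.cauchySeq_iff'] at hgc ⊢
    intro ε hε
    obtain ⟨n, hn⟩ := hgc (l * ε) (mul_pos hl hε)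
    refine ⟨n, fun m hm => ?_⟩
    have h1 := hn m hm
    have h2 := le_norm_add_smul_of_accretive (hacc _ (Γ.sub_mem (hx m) (hx n))) l
    have e : (x m - x n).2 + (l : ℂ) • (x m - x n).1 = g m - g n := by
      rw [← hxg', ← hxg', Prod.snd_sub, Prod.fst_sub, smul_sub]
      abel
    rw [e, ← dist_eq_norm] at h2
    rw [dist_eq_norm]
    exact lt_of_mul_lt_mul_left (h2.trans_lt h1) hl.le
  obtain ⟨u, hu⟩ := cauchySeq_tendsto_of_complete hc
  have h2 : Tendsto (fun n => (x n).2) atTop (𝓝 (f - (l : ℂ) • u)) := by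
    have : (fun n => (x n).2) = fun n => g n - (l : ℂ) • (x n).1 := by
      funext n
      rw [← hxg']
      abel
    rw [this]
    exact hlim.sub (hu.const_smul _)
  exact ⟨(u, f - (l : ℂ) • u), hΓ.mem_of_tendsto (hu.prodMk_nhds h2) (.of_forall hx), by simp⟩

end Perturbation

/-! ### The spectrum of an orthogonally projected accretive operator -/

section Sandwich

open Filter Topology

variable {H : Type*} [NormedAddCommGroup H] [InnerProductSpace ℂ H]

theorem mem_pmapResolventSet_of_bound {B : H →ₗ.[ℂ] H} {z : ℂ} {c : ℝ} (hc : 0 < c)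
    (hs : ∀ f, ∃ u : B.domain, B u - z • (u : H) = f)
    (hb : ∀ u : B.domain, c * ‖(u : H)‖ ≤ ‖B u - z • (u : H)‖) : z ∈ pmapResolventSet B := by
  obtain ⟨R, -, h1, h2⟩ := exists_bounded_inverse (B.toFun - z • B.domain.subtype) hc hs hb
  exact ⟨R, h1, h2⟩

/-- Points of the imaginary axis at which an accretive operator is bounded below belong to the
resolvent set if the operator is surjective after large shifts. -/
theorem mem_pmapResolventSet_of_accretive [CompleteSpace H] {B : H →ₗ.[ℂ] H}
    (hacc : ∀ u : B.domain, 0 ≤ (inner ℂ (u : H) (B u)).re) {l₀ : ℝ}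
    (hs : ∀ l : ℝ, l₀ < l → ∀ f, ∃ u : B.domain, B u + (l : ℂ) • (u : H) = f)
    {z : ℂ} (hz : z.re = 0) {c : ℝ} (hc : 0 < c)
    (hb : ∀ u : B.domain, c * ‖(u : H)‖ ≤ ‖B u - z • (u : H)‖) : z ∈ pmapResolventSet B := by
  refine mem_pmapResolventSet_of_bound hc (fun f => ?_) hb
  -- At `z - ε` the lower bound is still `c - ε = 2ε`, so a perturbation of norm at most `ε` leads
  -- back to `z`. At `z - ε` itself surjectivity comes from accretivity.
  set ε := c / 3 with hε
  have hε0 : 0 < ε := by positivity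
  -- surjectivity at `z - ε`
  have h1 : ∀ f, ∃ u : B.domain, B u - (z - ε) • (u : H) = f := by
    intro f
    -- `B + l` is bounded below by `l`, so the shift from `-l` to `z - ε` must be shorter than `l`.
    -- As `z` is imaginary, `|z - ε + l|² = (l - ε)² + |z|²`, which is below `l²` for such `l`.
    set l := max l₀ ((‖z‖ ^ 2 + ε ^ 2) / ε) + 1 with hl
    have hl1 : l₀ < l := lt_of_le_of_lt (le_max_left _ _) (lt_add_one _)
    have hl2 : (‖z‖ ^ 2 + ε ^ 2) / ε < l := lt_of_le_of_lt (le_max_right _ _) (lt_add_one _)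
    have hl0 : 0 < l := lt_of_le_of_lt (by positivity) hl2
    have hlt : ‖-((z - ε) + (l : ℂ))‖ < l := by
      rw [norm_neg]
      refine lt_of_pow_lt_pow_left₀ 2 hl0.le ?_
      rw [div_lt_iff₀ hε0] at hl2
      rw [Complex.sq_norm, Complex.normSq_apply] at hl2 ⊢
      simp only [Complex.add_re, Complex.sub_re, Complex.ofReal_re, Complex.add_im, Complex.sub_im,
        Complex.ofReal_im, hz] at hl2 ⊢
      nlinarith
    have hK : ‖(-((z - ε) + (l : ℂ))) • (1 : H →L[ℂ] H)‖ < l := by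
      refine lt_of_le_of_lt ?_ hlt
      rw [norm_smul]
      exact mul_le_of_le_one_right (norm_nonneg _) ContinuousLinearMap.norm_id_le
    obtain ⟨u, hu⟩ := surjective_perturb (B.toFun + (l : ℂ) • B.domain.subtype) hl0 (hs l hl1)
      (fun u => le_norm_add_smul_of_accretive (hacc u) l) _ hK f
    refine ⟨u, ?_⟩
    rw [← hu]
    change _ = (B u + (l : ℂ) • (u : H)) + (-((z - ε) + (l : ℂ))) • (u : H)
    module
  have h2 : ∀ u : B.domain, (c - ε) * ‖(u : H)‖ ≤ ‖B u - (z - ε) • (u : H)‖ := fun u => by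
    have e : B u - z • (u : H) = (B u - (z - ε) • (u : H)) - (ε : ℂ) • (u : H) := by module
    have h3 := norm_sub_le (B u - (z - ε) • (u : H)) ((ε : ℂ) • (u : H))
    rw [← e, norm_smul, Complex.norm_real, Real.norm_of_nonneg hε0.le] at h3
    have := hb u
    linarith
  have hK : ‖(-(ε : ℂ)) • (1 : H →L[ℂ] H)‖ < c - ε := by
    have : ‖(-(ε : ℂ)) • (1 : H →L[ℂ] H)‖ ≤ ε := by
      rw [norm_smul, norm_neg, Complex.norm_real, Real.norm_of_nonneg hε0.le]
      exact mul_le_of_le_one_right hε0.le ContinuousLinearMap.norm_id_le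
    linarith
  obtain ⟨u, hu⟩ := surjective_perturb (B.toFun - (z - ε) • B.domain.subtype) (by linarith) h1 h2 _ hK f
  refine ⟨u, ?_⟩
  rw [← hu]
  change _ = (B u - (z - ε) • (u : H)) + (-(ε : ℂ)) • (u : H)
  module

/-- The spectrum of `Q T Q` for an accretive operator `T` and the projection `Q` along a unit vector
in `D(T) ∩ D(T*)`. -/
theorem mem_pmapResolventSet_sandwich [CompleteSpace H] {T : H →ₗ.[ℂ] H}
    (hacc : ∀ u : T.domain, 0 ≤ (inner ℂ (u : H) (T u)).re) {l₀ : ℝ}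
    (hs : ∀ l : ℝ, l₀ < l → ∀ f, ∃ u : T.domain, T u + (l : ℂ) • (u : H) = f)
    {v w : H} (hv1 : ‖v‖ = 1) (hv : v ∈ T.domain)
    (hw : ∀ u : T.domain, inner ℂ v (T u) = inner ℂ w (u : H)) {Q : H →L[ℂ] H}
    (hQ : ∀ u, Q u = u - inner ℂ v u • v) {z : ℂ} (hz : z.re = 0) (hz0 : z ≠ 0)
    (hlim : ∀ (u : ℕ → T.domain) (a : ℕ → ℂ) (C : ℝ), (∀ n, ‖(u n : H)‖ ≤ 1) → (∀ n, ‖a n‖ ≤ C) →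
      (∀ n, inner ℂ v (u n : H) = 0) →
      Tendsto (fun n => T (u n) - z • (u n : H) - a n • v) atTop (𝓝 0) →
      Tendsto (fun n => (u n : H)) atTop (𝓝 0)) :
    z ∈ pmapResolventSet (pmapSandwich Q T) := by
  have hvv : inner ℂ v v = (1 : ℂ) := by
    rw [inner_self_eq_norm_sq_to_K, hv1]
    simp
  have hQv : ∀ u, inner ℂ v (Q u) = 0 := fun u => by
    rw [hQ, inner_sub_right, inner_smul_right, hvv, mul_one, sub_self]
  have hQsymm : ∀ u u', inner ℂ (Q u) u' = inner ℂ u (Q u') := fun u u' => by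
    rw [hQ, hQ, inner_sub_left, inner_sub_right, inner_smul_left, inner_smul_right,
      inner_conj_symm, mul_comm]
  set B := pmapSandwich Q T with hB
  have hBapp : ∀ u : B.domain, B u = Q (T ⟨Q u, u.2⟩) := fun u => rfl
  have hQle : ∀ u, ‖Q u‖ ≤ ‖u‖ := fun u => by
    have h1 : inner ℂ (Q u) (Q u) = inner ℂ (Q u) u := by
      have h2 : inner ℂ (Q u) v = (0 : ℂ) := by rw [← inner_conj_symm, hQv, map_zero]
      conv_lhs => rw [hQ u, inner_sub_right, inner_smul_right, ← hQ u, h2, mul_zero, sub_zero]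
    have h3 : ‖Q u‖ ^ 2 ≤ ‖Q u‖ * ‖u‖ := by
      calc ‖Q u‖ ^ 2 = ‖inner ℂ (Q u) (Q u)‖ := by
            rw [inner_self_eq_norm_sq_to_K]
            simp
        _ ≤ _ := by rw [h1]; exact norm_inner_le_norm _ _
    rcases eq_or_ne (‖Q u‖) 0 with h0 | h0
    · rw [h0]; exact norm_nonneg _
    · have : 0 < ‖Q u‖ := lt_of_le_of_ne (norm_nonneg _) h0.symm
      nlinarith
  have hBacc : ∀ u : B.domain, 0 ≤ (inner ℂ (u : H) (B u)).re := fun u => by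
    rw [hBapp, ← hQsymm]
    exact hacc ⟨Q u, u.2⟩
  -- On `D(T)` one has `QTQu = Tu - ⟨v, Tu⟩ v - ⟨v, u⟩ QTv`, and `⟨v, Tu⟩ = ⟨w, u⟩` is bounded
  -- because `v` is in the domain of the adjoint. So `QTQ` is a finite rank perturbation of `T`.
  let K : H →L[ℂ] H := -((innerSL ℂ w).smulRight v) - (innerSL ℂ v).smulRight (Q (T ⟨v, hv⟩))
  have hdom : ∀ u : T.domain, (u : H) ∈ B.domain := fun u => by
    change Q u ∈ T.domain
    rw [hQ]
    exact T.domain.sub_mem u.2 (T.domain.smul_mem _ hv)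
  have hBK : ∀ u : T.domain, B ⟨u, hdom u⟩ = T u + K u := fun u => by
    have e : (⟨Q u, hdom u⟩ : T.domain) = u - inner ℂ v (u : H) • ⟨v, hv⟩ := Subtype.ext (hQ u)
    rw [hBapp]
    change Q (T ⟨Q u, hdom u⟩) = T u + (-(inner ℂ w (u : H) • v) - inner ℂ v (u : H) • Q (T ⟨v, hv⟩))
    rw [e, LinearPMap.map_sub, LinearPMap.map_smul, map_sub, map_smul, hQ (T u), hw]
    abel
  have hBs : ∀ l : ℝ, max l₀ ‖K‖ < l → ∀ f, ∃ u : B.domain, B u + (l : ℂ) • (u : H) = f := by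
    intro l hl f
    have hl1 := (le_max_left _ _).trans_lt hl
    have hl2 := (le_max_right _ _).trans_lt hl
    have hl0 : 0 < l := (norm_nonneg K).trans_lt hl2
    obtain ⟨u, hu⟩ := surjective_perturb (T.toFun + (l : ℂ) • T.domain.subtype) hl0 (hs l hl1)
      (fun u => le_norm_add_smul_of_accretive (hacc u) l) _ hl2 f
    refine ⟨⟨u, hdom u⟩, ?_⟩
    rw [hBK, ← hu]
    change _ = (T u + (l : ℂ) • (u : H)) + K u
    abel
  suffices hb : ∃ c : ℝ, 0 < c ∧ ∀ u : B.domain, c * ‖(u : H)‖ ≤ ‖B u - z • (u : H)‖ by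
    obtain ⟨c, hc, hb⟩ := hb
    exact mem_pmapResolventSet_of_accretive hBacc hBs hz hc hb
  -- Failure of the lower bound produces a Weyl sequence of unit vectors.
  by_contra! hcon
  have hcon' : ∀ n : ℕ, ∃ u : B.domain, ‖(u : H)‖ = 1 ∧ ‖B u - z • (u : H)‖ ≤ 1 / ((n : ℝ) + 1) := by
    intro n
    obtain ⟨u, hu⟩ := hcon (1 / ((n : ℝ) + 1)) (by positivity)
    have hu0 : ‖(u : H)‖ ≠ 0 := by
      intro h0
      have : (u : H) = 0 := norm_eq_zero.1 h0
      rw [h0, mul_zero] at hu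
      exact absurd hu (not_lt.2 (norm_nonneg _))
    have hpos : 0 < ‖(u : H)‖ := lt_of_le_of_ne (norm_nonneg _) hu0.symm
    refine ⟨((‖(u : H)‖⁻¹ : ℝ) : ℂ) • u, ?_, ?_⟩
    · rw [Submodule.coe_smul, norm_smul, Complex.norm_real, norm_inv, norm_norm, inv_mul_cancel₀ hu0]
    · have e : B (((‖(u : H)‖⁻¹ : ℝ) : ℂ) • u) - z • ((((‖(u : H)‖⁻¹ : ℝ) : ℂ) • u : B.domain) : H)
          = ((‖(u : H)‖⁻¹ : ℝ) : ℂ) • (B u - z • (u : H)) := by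
        rw [LinearPMap.map_smul, Submodule.coe_smul]
        module
      rw [e, norm_smul, Complex.norm_real, norm_inv, norm_norm, inv_mul_le_iff₀ hpos, mul_comm]
      exact hu.le
  choose u hu1 hu2 using hcon'
  have hres : Tendsto (fun n => B (u n) - z • (u n : H)) atTop (𝓝 0) :=
    squeeze_zero_norm hu2 tendsto_one_div_add_atTop_nhds_zero_nat
  -- The range of `Q` is orthogonal to `v`, so pairing the residual with `v` leaves `-z ⟨v, u_n⟩`;
  -- dividing by `z` uses that `z` is not zero.
  have hvu : Tendsto (fun n => inner ℂ v (u n : H)) atTop (𝓝 (0 : ℂ)) := by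
    have h1 : Tendsto (fun n => inner ℂ v (B (u n) - z • (u n : H))) atTop (𝓝 (inner ℂ v (0 : H))) :=
      (continuous_const.inner continuous_id).continuousAt.tendsto.comp hres
    have h2 : ∀ n, inner ℂ v (u n : H) = -z⁻¹ * inner ℂ v (B (u n) - z • (u n : H)) := fun n => by
      rw [inner_sub_right, hBapp, hQv, inner_smul_right]
      field_simp
      ring
    simp only [h2]
    rw [inner_zero_right] at h1
    simpa using h1.const_mul (-z⁻¹)
  have hvus : Tendsto (fun n => inner ℂ v (u n : H) • v) atTop (𝓝 0) := by
    simpa using hvu.smul_const v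
  -- `TQu - zQu - ⟨w, Qu⟩ v` equals `(B - z) u + z ⟨v, u⟩ v`, and both terms tend to zero along the
  -- sequence.
  have hQu := hlim (fun n => ⟨Q (u n), (u n).2⟩) (fun n => inner ℂ w (Q (u n))) ‖w‖
    (fun n => (hQle _).trans (hu1 n).le)
    (fun n => by
      refine (norm_inner_le_norm _ _).trans ?_
      exact mul_le_of_le_one_right (norm_nonneg _) ((hQle _).trans (hu1 n).le))
    (fun n => hQv _) (by
      have h3 := hres.add (hvus.const_smul z)
      rw [smul_zero, add_zero] at h3
      refine h3.congr fun n => ?_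
      have h4 := hw ⟨Q (u n), (u n).2⟩
      change _ = T ⟨Q (u n), (u n).2⟩ - z • Q (u n) - inner ℂ w (Q (u n)) • v
      have h7 : z • Q (u n : H) = z • (u n : H) - z • inner ℂ v (u n : H) • v := by
        rw [hQ, smul_sub]
      rw [← h4, hBapp, hQ (T _), h7]
      abel)
  have hu0 : Tendsto (fun n => (u n : H)) atTop (𝓝 0) := by
    have h5 := hQu.add hvus
    rw [add_zero] at h5
    refine h5.congr fun n => ?_
    change Q (u n) + _ = _
    rw [hQ, sub_add_cancel]
  have h6 := hu0.norm
  simp only [hu1, norm_zero] at h6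
  exact one_ne_zero (tendsto_nhds_unique tendsto_const_nhds h6)

end Sandwich

/-! ### The minimal realization -/

section Realization

open Filter Topology ComplexConjugate

variable {d : ℕ}

theorem exists_testFn_seq {ν : Measure (Phase d)} {A : (Phase d → ℂ) → Phase d → ℂ}
    {hA : LinearOnSmooth A} {x : Lp ℂ 2 ν × Lp ℂ 2 ν}
    (hx : x ∈ (testGraph ν A hA).topologicalClosure) :
    ∃ φ : ℕ → Phase d → ℂ, (∀ n, TestFn (φ n)) ∧
      Tendsto (fun n => eLpNorm (φ n - ⇑x.1) 2 ν) atTop (𝓝 0) ∧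
      Tendsto (fun n => eLpNorm (A (φ n) - ⇑x.2) 2 ν) atTop (𝓝 0) := by
  rw [← SetLike.mem_coe, Submodule.topologicalClosure_coe, mem_closure_iff_seq_limit] at hx
  obtain ⟨y, hy, hlim⟩ := hx
  choose φ hφ h1 h2 using hy
  refine ⟨φ, hφ, ?_, ?_⟩
  · have h3 := (Lp.tendsto_Lp_iff_tendsto_eLpNorm' _ _).1 ((continuous_fst.tendsto x).comp hlim)
    refine h3.congr fun n => eLpNorm_congr_ae ?_
    exact (h1 n).sub (ae_eq_refl _)
  · have h3 := (Lp.tendsto_Lp_iff_tendsto_eLpNorm' _ _).1 ((continuous_snd.tendsto x).comp hlim)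
    refine h3.congr fun n => eLpNorm_congr_ae ?_
    exact (h2 n).sub (ae_eq_refl _)

theorem TestFn.conj {E : Type*} [NormedAddCommGroup E] [NormedSpace ℝ E] {φ : E → ℂ}
    (hφ : TestFn φ) : TestFn fun x => conj (φ x) :=
  ⟨Complex.conjCLE.contDiff.comp hφ.1, hφ.2.comp_left (map_zero _)⟩

theorem dirD_conj {E : Type*} [NormedAddCommGroup E] [NormedSpace ℝ E] {φ : E → ℂ}
    (hφ : ContDiff ℝ ∞ φ) (e x : E) : dirD e (fun y => conj (φ y)) x = conj (dirD e φ x) := by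
  have h : HasFDerivAt (fun y => conj (φ y)) (Complex.conjCLE.toContinuousLinearMap.comp (fderiv ℝ φ x)) x :=
    Complex.conjCLE.toContinuousLinearMap.hasFDerivAt.comp x (hφ.differentiable_of_smooth x).hasFDerivAt
  unfold dirD
  rw [h.fderiv]
  rfl

theorem integral_mul_testFn_eq_zero {E : Type*} [NormedAddCommGroup E] [NormedSpace ℝ E]
    [FiniteDimensional ℝ E] [MeasurableSpace E] [BorelSpace E] {μ : Measure E}
    [IsLocallyFiniteMeasure μ] {f : E → ℂ} (hf : LocallyIntegrable f μ)
    (h : ∀ ψ : E → ℂ, TestFn ψ → ∫ x, f x * ψ x ∂μ = 0) : f =ᵐ[μ] 0 := by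
  refine ae_eq_zero_of_integral_contDiff_smul_eq_zero hf fun g hg1 hg2 => ?_
  rw [← h _ (TestFn.ofReal ⟨hg1, hg2⟩)]
  refine integral_congr_ae (.of_forall fun x => ?_)
  simp [mul_comm]

end Realization

/-! ### The closed Langevin operator: accretivity, surjectivity after a shift, weak characterization
of the domain. -/

namespace LangevinSystem

open Filter Topology ComplexConjugate

variable {d : ℕ} (S : LangevinSystem d)

theorem annihilation_conj {φ : Phase d → ℂ} (hφ : ContDiff ℝ ∞ φ) (i : Fin d) (x : Phase d) :
    S.annihilation i (fun y => conj (φ y)) x = conj (S.annihilation i φ x) := by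
  simp only [annihilation, dp_eq, dirD_conj hφ, map_add, map_mul, Complex.conj_ofReal]

theorem transport_conj {φ : Phase d → ℂ} (hφ : ContDiff ℝ ∞ φ) (x : Phase d) :
    S.transport (fun y => conj (φ y)) x = conj (S.transport φ x) := by
  simp only [transport, dp_eq, dq_eq, dirD_conj hφ, map_sum, map_add, map_mul, map_neg,
    Complex.conj_ofReal]

/-- The energy identity. -/
theorem re_integral_conj_mul_signedExpr {φ : Phase d → ℂ} (hφ : TestFn φ) (s : ℝ) :
    (∫ x, conj (φ x) * S.signedExpr s φ x).re
      = S.kap * ∑ i, ∫ x, ‖S.annihilation i φ x‖ ^ 2 := by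
  have hc := hφ.conj
  have ha := fun i => S.testFn_annihilation hφ i
  have i1 := ((S.testFn_transport hφ).smooth_mul hc.1).integrable (μ := volume)
  have i2 : ∀ i, Integrable fun x => conj (φ x) * S.creation i (S.annihilation i φ) x := fun i =>
    ((S.testFn_creation (ha i) i).smooth_mul hc.1).integrable
  have e1 : ∫ x, conj (φ x) * S.signedExpr s φ x = (s : ℂ) * (∫ x, conj (φ x) * S.transport φ x)
      + (S.kap : ℂ) * ∑ i, ∫ x, conj (φ x) * S.creation i (S.annihilation i φ) x := by
    rw [← integral_finsetSum _ fun i _ => i2 i, ← integral_const_mul, ← integral_const_mul,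
      ← integral_add (i1.const_mul _) ((integrable_finsetSum _ fun i _ => i2 i).const_mul _)]
    refine integral_congr_ae (.of_forall fun x => ?_)
    simp only [signedExpr, number, ← Finset.mul_sum]
    ring
  -- The transport is antisymmetric and commutes with conjugation, so this pairing equals minus its
  -- own conjugate.
  have e2 : (∫ x, conj (φ x) * S.transport φ x).re = 0 := by
    have h := S.integral_mul_transport hc.1 hφ
    simp only [S.transport_conj hφ.1] at h
    have h2 : ∫ x, conj (S.transport φ x) * φ x = conj (∫ x, conj (φ x) * S.transport φ x) := by
      rw [← integral_conj]
      refine integral_congr_ae (.of_forall fun x => ?_)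
      simp [mul_comm]
    rw [h2] at h
    have h3 := congrArg Complex.re h
    simp only [Complex.neg_re, Complex.conj_re] at h3
    linarith
  have e3 : ∀ i, ∫ x, conj (φ x) * S.creation i (S.annihilation i φ) x
      = ((∫ x, ‖S.annihilation i φ x‖ ^ 2 : ℝ) : ℂ) := fun i => by
    rw [S.integral_mul_creation hc.1 (ha i).1 (Or.inr (ha i).2), ← integral_complex_ofReal]
    refine integral_congr_ae (.of_forall fun x => ?_)
    simp only [S.annihilation_conj hφ.1]
    rw [Complex.conj_mul']
    push_cast
    rfl
  rw [e1, Complex.add_re, Complex.re_ofReal_mul, e2, mul_zero, zero_add, Complex.re_ofReal_mul]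
  simp only [e3, ← Complex.ofReal_sum, Complex.ofReal_re]

/-- The graph of the Langevin operator in the flat space. -/
def flatGraph : Submodule ℂ
    (Lp ℂ 2 (volume : Measure (Phase d)) × Lp ℂ 2 (volume : Measure (Phase d))) :=
  (testGraph volume S.flatKolmogorovExpr S.flatKolmogorovExpr_linear).topologicalClosure

theorem isClosed_flatGraph : IsClosed (S.flatGraph : Set
    (Lp ℂ 2 (volume : Measure (Phase d)) × Lp ℂ 2 (volume : Measure (Phase d)))) :=
  Submodule.isClosed_topologicalClosure _

theorem exists_seq_of_mem_flatGraph
    {x : Lp ℂ 2 (volume : Measure (Phase d)) × Lp ℂ 2 (volume : Measure (Phase d))}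
    (hx : x ∈ S.flatGraph) : ∃ φ : ℕ → Phase d → ℂ, (∀ n, TestFn (φ n)) ∧
      Tendsto (fun n => eLpNorm (φ n - ⇑x.1) 2) atTop (𝓝 0) ∧
      Tendsto (fun n => eLpNorm (S.signedExpr 1 (φ n) - ⇑x.2) 2) atTop (𝓝 0) := by
  simpa only [flatKolmogorovExpr_eq] using exists_testFn_seq hx

theorem toLp_mem_flatGraph {φ : Phase d → ℂ} (hφ : TestFn φ) :
    ((hφ.memLp 2).toLp φ, ((S.testFn_signedExpr hφ 1).memLp 2).toLp (S.signedExpr 1 φ))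
      ∈ S.flatGraph := by
  refine Submodule.le_topologicalClosure _ ⟨φ, hφ, MemLp.coeFn_toLp (hφ.memLp 2), ?_⟩
  rw [flatKolmogorovExpr_eq]
  exact MemLp.coeFn_toLp ((S.testFn_signedExpr hφ 1).memLp 2)

/-- Smooth `ξ` without compact support are admitted, since only the approximants of `x` need it:
such `ξ` belongs to the domain of the adjoint once `ξ` and its image are square integrable. -/
theorem integral_mul_snd_of_mem_flatGraph
    {x : Lp ℂ 2 (volume : Measure (Phase d)) × Lp ℂ 2 (volume : Measure (Phase d))}
    (hx : x ∈ S.flatGraph) {ξ : Phase d → ℂ} (hξ : ContDiff ℝ ∞ ξ) (h2 : MemLp ξ 2)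
    (h3 : MemLp (S.signedExpr (-1) ξ) 2) :
    ∫ y, ξ y * x.2 y = ∫ y, S.signedExpr (-1) ξ y * x.1 y := by
  obtain ⟨φ, hφ, t1, t2⟩ := S.exists_seq_of_mem_flatGraph hx
  have c0 : ∀ g : Phase d → ℂ, Tendsto (fun _ : ℕ => eLpNorm (g - g) 2) atTop (𝓝 0) := fun g => by
    simp
  have l1 := tendsto_integral_mul h2 (Lp.memLp x.2) (fun _ => h2)
    (fun n => (S.testFn_signedExpr (hφ n) 1).memLp 2) (c0 _) t2
  have l2 := tendsto_integral_mul h3 (Lp.memLp x.1) (fun _ => h3)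
    (fun n => (hφ n).memLp 2) (c0 _) t1
  refine tendsto_nhds_unique l1 (l2.congr fun n => ?_)
  exact (S.integral_mul_signedExpr hξ (hφ n) 1).symm

theorem re_inner_nonneg_of_mem_flatGraph
    {x : Lp ℂ 2 (volume : Measure (Phase d)) × Lp ℂ 2 (volume : Measure (Phase d))}
    (hx : x ∈ S.flatGraph) : 0 ≤ (inner ℂ x.1 x.2).re := by
  have hcl : IsClosed {x : Lp ℂ 2 (volume : Measure (Phase d)) × Lp ℂ 2 (volume : Measure (Phase d)) |
      0 ≤ (inner ℂ x.1 x.2).re} :=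
    isClosed_le continuous_const (Complex.continuous_re.comp (continuous_fst.inner continuous_snd))
  refine closure_minimal ?_ hcl hx
  rintro y ⟨φ, hφ, h1, h2⟩
  have e : inner ℂ y.1 y.2 = ∫ x, conj (φ x) * S.signedExpr 1 φ x := by
    rw [L2.inner_def]
    refine integral_congr_ae ?_
    filter_upwards [h1, h2] with x h1 h2
    rw [h1, h2, flatKolmogorovExpr_eq]
    simp [mul_comm]
  change 0 ≤ (inner ℂ y.1 y.2).re
  rw [e, S.re_integral_conj_mul_signedExpr hφ]
  exact mul_nonneg S.kap_pos.le (Finset.sum_nonneg fun i _ => integral_nonneg fun x => by positivity)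

/-- A vector orthogonal to the range of the shifted operator is, after conjugation, an `L²` weak
solution of the adjoint equation, hence zero. -/
theorem exists_mem_flatGraph_add {l : ℝ} (hl : S.kap * S.cc * d < l)
    (f : Lp ℂ 2 (volume : Measure (Phase d))) : ∃ x ∈ S.flatGraph, x.2 + (l : ℂ) • x.1 = f := by
  have hl0 : 0 < l := lt_of_le_of_lt (mul_nonneg (mul_nonneg S.kap_pos.le S.cc_pos.le)
    (Nat.cast_nonneg d)) hl
  refine exists_of_accretive S.isClosed_flatGraph
    (fun x hx => S.re_inner_nonneg_of_mem_flatGraph hx) hl0 (fun v hv => ?_) f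
  have h0 := S.eq_zero_of_weak 1 hl (u := star (v : Phase d → ℂ)) (Lp.memLp v).star fun ψ hψ => by
    have h1 := hv _ (S.toLp_mem_flatGraph hψ)
    rw [L2.inner_def] at h1
    rw [← h1]
    refine integral_congr_ae ?_
    have m1 := hψ.memLp (μ := (volume : Measure (Phase d))) 2
    have m2 := (S.testFn_signedExpr hψ 1).memLp (μ := (volume : Measure (Phase d))) 2
    filter_upwards [Lp.coeFn_add (m2.toLp _) ((l : ℂ) • m1.toLp _), m1.coeFn_toLp, m2.coeFn_toLp,
      Lp.coeFn_smul (l : ℂ) (m1.toLp _)] with x a1 a2 a3 a4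
    rw [a1, Pi.add_apply, a4, a3, Pi.smul_apply, a2]
    simp [mul_comm]
  refine Lp.ext ?_
  filter_upwards [h0, Lp.coeFn_zero ℂ 2 (volume : Measure (Phase d))] with x hx h0x
  rw [h0x]
  simpa using hx

/-- Square integrable weak solutions belong to the graph of the closed operator. -/
theorem mem_flatGraph_of_weak {u f : Lp ℂ 2 (volume : Measure (Phase d))}
    (h : ∀ ψ : Phase d → ℂ, TestFn ψ → ∫ x, f x * ψ x = ∫ x, u x * S.signedExpr (-1) ψ x) :
    (u, f) ∈ S.flatGraph := by
  set l := S.kap * S.cc * d + 1 with hl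
  have hl1 : S.kap * S.cc * d < l := lt_add_one _
  -- Solve `(K̃ + l) y = f + l u` inside the graph. Then `y - u` is a weak solution of the
  -- homogeneous shifted equation, so `y = u`.
  obtain ⟨y, hy, hyf⟩ := S.exists_mem_flatGraph_add hl1 (f + (l : ℂ) • u)
  have key := S.eq_zero_of_weak (-1) hl1 (u := ((y.1 - u : Lp ℂ 2 (volume : Measure (Phase d))) :
      Phase d → ℂ)) (Lp.memLp _) fun ψ hψ => by
    have tA := S.testFn_signedExpr hψ (-1)
    have m1 := hψ.memLp (μ := (volume : Measure (Phase d))) 2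
    have m2 := tA.memLp (μ := (volume : Measure (Phase d))) 2
    have h1 := S.integral_mul_snd_of_mem_flatGraph hy hψ.1 m1 m2
    have h2 := h ψ hψ
    have ia : ∀ w : Lp ℂ 2 (volume : Measure (Phase d)), Integrable fun x => w x * ψ x :=
      fun w => (Lp.memLp w).integrable_mul m1
    have ib : ∀ w : Lp ℂ 2 (volume : Measure (Phase d)), Integrable fun x =>
      w x * S.signedExpr (-1) ψ x := fun w => (Lp.memLp w).integrable_mul m2
    simp_rw [mul_comm (ψ _), mul_comm (S.signedExpr (-1) ψ _)] at h1
    have e1 : ∫ x, (y.1 - u : Lp ℂ 2 (volume : Measure (Phase d))) x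
          * (S.signedExpr (-1) ψ x + (l : ℂ) * ψ x)
        = ((∫ x, y.1 x * S.signedExpr (-1) ψ x) - ∫ x, u x * S.signedExpr (-1) ψ x)
          + (l : ℂ) * ((∫ x, y.1 x * ψ x) - ∫ x, u x * ψ x) := by
      have ic : Integrable fun x => y.1 x * S.signedExpr (-1) ψ x - u x * S.signedExpr (-1) ψ x :=
        (ib _).sub (ib _)
      have id : Integrable fun x => y.1 x * ψ x - u x * ψ x := (ia _).sub (ia _)
      rw [← integral_sub (ib _) (ib _), ← integral_sub (ia _) (ia _), ← integral_const_mul,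
        ← integral_add ic (id.const_mul _)]
      refine integral_congr_ae ?_
      filter_upwards [Lp.coeFn_sub y.1 u] with x hx
      rw [hx, Pi.sub_apply]
      ring
    have e2 : (∫ x, y.2 x * ψ x) + (l : ℂ) * ∫ x, y.1 x * ψ x
        = (∫ x, f x * ψ x) + (l : ℂ) * ∫ x, u x * ψ x := by
      rw [← integral_const_mul, ← integral_const_mul, ← integral_add (ia _) ((ia _).const_mul _),
        ← integral_add (ia _) ((ia _).const_mul _)]
      refine integral_congr_ae ?_
      have hae : (y.2 + (l : ℂ) • y.1 : Lp ℂ 2 (volume : Measure (Phase d))) =ᵐ[volume]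
        (f + (l : ℂ) • u : Lp ℂ 2 (volume : Measure (Phase d))) := by rw [hyf]
      filter_upwards [hae, Lp.coeFn_add y.2 ((l : ℂ) • y.1), Lp.coeFn_add f ((l : ℂ) • u),
        Lp.coeFn_smul (l : ℂ) y.1, Lp.coeFn_smul (l : ℂ) u] with x b1 b2 b3 b4 b5
      rw [b2, b3, Pi.add_apply, Pi.add_apply, b4, b5, Pi.smul_apply, Pi.smul_apply] at b1
      simp only [smul_eq_mul] at b1
      linear_combination ψ x * b1
    rw [e1, ← h1, ← h2]
    linear_combination e2
  have hu : y.1 = u := by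
    rw [← sub_eq_zero]
    exact Lp.ext (key.trans (Lp.coeFn_zero ℂ 2 volume).symm)
  rw [hu] at hyf
  have hf : y.2 = f := add_right_cancel hyf
  rw [← hu, ← hf]
  exact hy

/-- Closability, from the formal adjoint on test functions. It is needed for
`Submodule.toLinearPMap` to return an operator whose graph is the given subspace. -/
theorem flatGraph_snd_eq_zero
    (x : Lp ℂ 2 (volume : Measure (Phase d)) × Lp ℂ 2 (volume : Measure (Phase d)))
    (hx : x ∈ S.flatGraph) (h0 : x.1 = 0) : x.2 = 0 := by
  have h := integral_mul_testFn_eq_zero (f := x.2)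
    ((Lp.memLp x.2).locallyIntegrable (by norm_num)) fun ψ hψ => by
      have h1 := S.integral_mul_snd_of_mem_flatGraph hx hψ.1 (hψ.memLp 2)
        ((S.testFn_signedExpr hψ (-1)).memLp 2)
      simp_rw [mul_comm (ψ _)] at h1
      rw [h1]
      refine integral_eq_zero_of_ae ?_
      rw [h0]
      filter_upwards [Lp.coeFn_zero ℂ 2 (volume : Measure (Phase d))] with y hy
      rw [hy]
      simp
  exact Lp.ext (h.trans (Lp.coeFn_zero ℂ 2 volume).symm)

theorem graph_flatKolmogorov : S.flatKolmogorov.graph = S.flatGraph :=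
  Submodule.toLinearPMap_graph_eq _ S.flatGraph_snd_eq_zero

theorem flatKolmogorov_mem (u : S.flatKolmogorov.domain) :
    ((u : Lp ℂ 2 (volume : Measure (Phase d))), S.flatKolmogorov u) ∈ S.flatGraph := by
  rw [← graph_flatKolmogorov]
  exact LinearPMap.mem_graph _ u

theorem exists_flatKolmogorov_eq {u f : Lp ℂ 2 (volume : Measure (Phase d))}
    (h : (u, f) ∈ S.flatGraph) : ∃ hu : u ∈ S.flatKolmogorov.domain, S.flatKolmogorov ⟨u, hu⟩ = f := by
  rw [← graph_flatKolmogorov, LinearPMap.mem_graph_iff] at h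
  obtain ⟨⟨y, hy⟩, h1, h2⟩ := h
  obtain rfl : y = u := h1
  exact ⟨hy, h2⟩

end LangevinSystem

/-! ### Functions with vanishing weak gradient -/

section LTwo

open Filter Topology

variable {α ι F : Type*} [MeasurableSpace α] {ν : Measure α} [NormedAddCommGroup F]

theorem eLpNorm_two_sq_eq {f : α → F} (hf : MemLp f 2 ν) :
    eLpNorm f 2 ν ^ 2 = ENNReal.ofReal (∫ x, ‖f x‖ ^ 2 ∂ν) := by
  rw [ofReal_integral_eq_lintegral_ofReal ((memLp_two_iff_integrable_sq_norm hf.1).1 hf)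
    (.of_forall fun x => by positivity), eLpNorm_eq_lintegral_rpow_enorm_toReal (by norm_num)
    (by norm_num), ← ENNReal.rpow_natCast, ← ENNReal.rpow_mul]
  simp only [ENNReal.toReal_ofNat, ENNReal.rpow_ofNat, Nat.cast_ofNat]
  norm_num

theorem tendsto_eLpNorm_two_iff {l : Filter ι} {G : ι → α → F} (hG : ∀ n, MemLp (G n) 2 ν) :
    Tendsto (fun n => eLpNorm (G n) 2 ν) l (𝓝 0) ↔
      Tendsto (fun n => ∫ x, ‖G n x‖ ^ 2 ∂ν) l (𝓝 0) := by
  have e : ∀ n, ∫ x, ‖G n x‖ ^ 2 ∂ν = (eLpNorm (G n) 2 ν ^ 2).toReal := fun n => by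
    rw [eLpNorm_two_sq_eq (hG n), ENNReal.toReal_ofReal (integral_nonneg fun x => by positivity)]
  constructor
  · intro h
    simp only [e]
    have h2 := (ENNReal.continuous_pow 2).tendsto 0 |>.comp h
    rw [zero_pow two_ne_zero] at h2
    exact (ENNReal.tendsto_toReal ENNReal.zero_ne_top).comp h2
  · intro h
    refine tendsto_eLpNorm_two ?_
    have h2 := ENNReal.tendsto_ofReal h
    rw [ENNReal.ofReal_zero] at h2
    refine h2.congr fun n => ?_
    rw [ofReal_integral_eq_lintegral_ofReal ((memLp_two_iff_integrable_sq_norm (hG n).1).1 (hG n))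
      (.of_forall fun x => by positivity)]
    refine lintegral_congr fun x => ?_
    rw [ENNReal.ofReal_pow (norm_nonneg _), ofReal_norm]

end LTwo

section WeakGradient

open Filter Topology

variable {E : Type*} [NormedAddCommGroup E] [NormedSpace ℝ E] [FiniteDimensional ℝ E]
  [MeasurableSpace E] [BorelSpace E] {μ : Measure E} [μ.IsAddHaarMeasure]

/-- The mollifications have zero gradient, hence are constant, and they converge to `f` almost
everywhere by Lebesgue differentiation. -/
theorem exists_ae_eq_const_of_weak_gradient {f : E → ℝ} (hf : LocallyIntegrable f μ)
    (h : ∀ (e : E) (η : E → ℝ), TestFn η → ∫ x, f x * dirD e η x ∂μ = 0) :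
    ∃ c : ℝ, f =ᵐ[μ] fun _ => c := by
  let φ : ℕ → ContDiffBump (0 : E) := fun n =>
    ⟨1 / ((n : ℝ) + 1), 2 * (1 / ((n : ℝ) + 1)), by positivity, by
      have : (0 : ℝ) < 1 / ((n : ℝ) + 1) := by positivity
      linarith⟩
  have hφ : Tendsto (fun n => (φ n).rOut) atTop (𝓝 0) := by
    simpa only [mul_zero] using (tendsto_one_div_add_atTop_nhds_zero_nat (𝕜 := ℝ)).const_mul 2
  have hae := ContDiffBump.ae_convolution_tendsto_right_of_locallyIntegrable (μ := μ) (φ := φ) (K := 2)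
    hφ (.of_forall fun n => le_refl _) hf
  have t : ∀ n, TestFn ((φ n).normed μ) := fun n =>
    ⟨(φ n).contDiff_normed, (φ n).hasCompactSupport_normed⟩
  have hc : ∀ n x, mollify μ ((φ n).normed μ) f x = mollify μ ((φ n).normed μ) f 0 := fun n x => by
    refine is_const_of_fderiv_eq_zero (𝕜 := ℝ)
      ((contDiff_mollify (t n) hf).differentiable (by simp)) (fun y => ?_) x 0
    ext e
    rw [fderiv_mollify (t n) hf]
    have h1 := h e _ ((t n).comp_const_sub y)
    simp only [dirD_comp_const_sub (t n).1, mul_neg, integral_neg, neg_eq_zero] at h1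
    exact h1
  have hae' : ∀ᵐ x ∂μ, Tendsto (fun n => mollify μ ((φ n).normed μ) f 0) atTop (𝓝 (f x)) := by
    filter_upwards [hae] with x hx
    refine hx.congr fun n => ?_
    rw [← hc n x, mollify, convolution_eq_swap]
    simp [mul_comm]
  obtain ⟨x₀, hx₀⟩ := hae'.exists
  exact ⟨f x₀, hae'.mono fun x hx => tendsto_nhds_unique hx hx₀⟩

end WeakGradient

/-! ### The kernel of the Langevin operator -/

namespace LangevinSystem

open Filter Topology ComplexConjugate

variable {d : ℕ} (S : LangevinSystem d)

/-- Half of the inverse temperature. -/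
def bb : ℝ := S.invTemp / 2

/-- The inverse square root of the Boltzmann factor. -/
def boost (x : Phase d) : ℝ := Real.exp (S.invTemp * S.energy x / 2)

theorem contDiff_energy : ContDiff ℝ ∞ S.energy :=
  ((contDiff_snd.norm_sq ℝ).div_const _).add (S.smooth.comp contDiff_fst)

theorem contDiff_boost : ContDiff ℝ ∞ S.boost :=
  Real.contDiff_exp.comp ((contDiff_const.mul S.contDiff_energy).div_const _)

theorem boost_pos (x : Phase d) : 0 < S.boost x := Real.exp_pos _

theorem hasFDerivAt_norm_sq_snd (x : Phase d) : HasFDerivAt (fun x : Phase d => ‖x.2‖ ^ 2)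
    ((2 • innerSL ℝ x.2).comp (ContinuousLinearMap.snd ℝ _ _)) x :=
  (hasStrictFDerivAt_norm_sq x.2).hasFDerivAt.comp x hasFDerivAt_snd

theorem dirD_boost (v x : Phase d) : dirD v S.boost x
    = S.boost x * (S.cc * inner ℝ x.2 v.2 + S.bb * fderiv ℝ S.potential x.1 v.1) := by
  have h1 : HasFDerivAt (fun x : Phase d => S.potential x.1) _ x :=
    (S.smooth.differentiable_of_smooth x.1).hasFDerivAt.comp x hasFDerivAt_fst
  have h2 := (((hasFDerivAt_norm_sq_snd x).mul_const (2 * S.mass)⁻¹).add h1).const_mul S.bb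
  have h3 := h2.exp
  have e : S.boost = fun x => Real.exp (S.bb * (‖x.2‖ ^ 2 * (2 * S.mass)⁻¹ + S.potential x.1)) := by
    funext y
    simp only [boost, energy, hamiltonian, bb]
    congr 1
    ring
  have e2 := h3.congr_of_eventuallyEq (.of_forall fun y => congrFun e y)
  unfold dirD
  rw [e2.fderiv]
  have := S.mass_pos.ne'
  simp only [e, cc, bb]
  simp
  field_simp

theorem dirD_boost_unitP (i : Fin d) (x : Phase d) :
    dirD (unitP i) S.boost x = S.boost x * (S.cc * x.2 i) := by
  rw [dirD_boost]
  simp [unitP, EuclideanSpace.inner_single_right]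

theorem dirD_boost_unitQ (i : Fin d) (x : Phase d) :
    dirD (unitQ i) S.boost x = S.boost x * (S.bb * pd i S.potential x.1) := by
  rw [dirD_boost]
  simp [unitQ, pd, dirD]

/-- Multiplication by `e^{βH/2}` turns the annihilation operator into a plain derivative. This is
why kernel elements become functions with vanishing gradient. -/
theorem dp_boost_mul {φ : Phase d → ℂ} (hφ : ContDiff ℝ ∞ φ) (i : Fin d) (x : Phase d) :
    dp i (fun y => (S.boost y : ℂ) * φ y) x = (S.boost x : ℂ) * S.annihilation i φ x := by
  rw [dp_eq, dirD_mul S.contDiff_boost.ofReal hφ, dirD_ofReal S.contDiff_boost, dirD_boost_unitP,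
    annihilation, dp_eq, cc]
  push_cast
  ring

theorem dq_boost_mul {φ : Phase d → ℂ} (hφ : ContDiff ℝ ∞ φ) (i : Fin d) (x : Phase d) :
    dq i (fun y => (S.boost y : ℂ) * φ y) x
      = (S.boost x : ℂ) * (dq i φ x + ((S.bb * pd i S.potential x.1 : ℝ) : ℂ) * φ x) := by
  rw [dq_eq, dirD_mul S.contDiff_boost.ofReal hφ, dirD_ofReal S.contDiff_boost, dirD_boost_unitQ,
    dq_eq]
  push_cast
  ring

theorem creation_boost_mul {φ : Phase d → ℂ} (hφ : ContDiff ℝ ∞ φ) (i : Fin d) (x : Phase d) :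
    S.creation i (fun y => (S.boost y : ℂ) * φ y) x = -(S.boost x : ℂ) * dp i φ x := by
  rw [creation, dp_boost_mul S hφ, annihilation]
  ring

theorem cc_eq : S.cc = S.bb / S.mass := by
  have := S.mass_pos.ne'
  rw [cc, bb]
  field_simp

/-- The energy is conserved by the Hamiltonian flow, so any function of it passes through the
transport. -/
theorem transport_boost_mul {φ : Phase d → ℂ} (hφ : ContDiff ℝ ∞ φ) (x : Phase d) :
    S.transport (fun y => (S.boost y : ℂ) * φ y) x = (S.boost x : ℂ) * S.transport φ x := by
  rw [transport, transport, Finset.mul_sum]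
  refine Finset.sum_congr rfl fun i _ => ?_
  rw [dp_boost_mul S hφ, dq_boost_mul S hφ, annihilation]
  have e : S.invTemp / (2 * S.mass) = S.bb / S.mass := S.cc_eq
  rw [e]
  have := S.mass_pos.ne'
  push_cast
  ring

theorem dirD_velocity (i k : Fin d) (x : Phase d) :
    dp i (fun x : Phase d => -((x.2 k / S.mass : ℝ) : ℂ)) x
      = if k = i then -((S.mass⁻¹ : ℝ) : ℂ) else 0 := by
  have h : HasFDerivAt (fun x : Phase d => x.2 k)
      ((EuclideanSpace.proj (𝕜 := ℝ) k).comp (ContinuousLinearMap.snd ℝ _ _)) x :=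
    (EuclideanSpace.proj (𝕜 := ℝ) k).hasFDerivAt.comp x hasFDerivAt_snd
  have e := dirD_ofReal ((contDiff_coord k).div_const S.mass) (unitP i) x
  have e2 : dirD (unitP i) (fun x : Phase d => x.2 k / S.mass) x = if k = i then S.mass⁻¹ else 0 := by
    simp only [div_eq_mul_inv]
    unfold dirD
    rw [(h.mul_const _).fderiv]
    simp [unitP]
  rw [dp_eq, dirD_neg, e, e2]
  split_ifs <;> simp

/-- The Hörmander bracket `[∂_{p_i}, X] = -μ⁻¹ ∂_{q_i}`, through which position derivatives are
recovered from momentum derivatives and the transport. -/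
theorem dp_transport {φ : Phase d → ℂ} (hφ : ContDiff ℝ ∞ φ) (i : Fin d) (x : Phase d) :
    dp i (S.transport φ) x = S.transport (dp i φ) x - ((S.mass⁻¹ : ℝ) : ℂ) * dq i φ x := by
  have h1 := dirD_sum Finset.univ (fun k => ((S.contDiff_velocity k).mul (contDiff_dq hφ k)).add
    ((S.contDiff_force k).mul (contDiff_dp hφ k))) (unitP i) x
  have h2 : ∀ k, dirD (unitP i) (fun x => -((x.2 k / S.mass : ℝ) : ℂ) * dq k φ x
      + ((pd k S.potential x.1 : ℝ) : ℂ) * dp k φ x) x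
      = (if k = i then -((S.mass⁻¹ : ℝ) : ℂ) * dq k φ x else 0)
        + (-((x.2 k / S.mass : ℝ) : ℂ) * dq k (dp i φ) x
          + ((pd k S.potential x.1 : ℝ) : ℂ) * dp k (dp i φ) x) := fun k => by
    have a1 := dirD_add ((S.contDiff_velocity k).mul (contDiff_dq hφ k))
      ((S.contDiff_force k).mul (contDiff_dp hφ k)) (unitP i) x
    have a2 := dirD_mul (S.contDiff_velocity k) (contDiff_dq hφ k) (unitP i) x
    have a3 := dirD_mul (S.contDiff_force k) (contDiff_dp hφ k) (unitP i) x
    have a4 := S.dirD_velocity i k x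
    have a5 : dirD (unitP i) (fun x : Phase d => ((pd k S.potential x.1 : ℝ) : ℂ)) x = 0 := by
      have hf : ContDiff ℝ ∞ fun x : Phase d => pd k S.potential x.1 :=
        (S.smooth.pd k).comp contDiff_fst
      have h : HasFDerivAt (fun x : Phase d => pd k S.potential x.1) _ x :=
        ((S.smooth.pd k).differentiable_of_smooth x.1).hasFDerivAt.comp x hasFDerivAt_fst
      rw [dirD_ofReal hf]
      unfold dirD
      rw [h.fderiv]
      simp [unitP]
    have a6 := dirD_comm hφ (unitP i) (unitQ k) x
    have a7 := dirD_comm hφ (unitP i) (unitP k) x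
    rw [dp_eq] at a4
    simp only [dp_eq, dq_eq] at *
    refine a1.trans ?_
    rw [a2, a3, a4, a5, a6, a7]
    split_ifs <;> ring
  refine h1.trans ?_
  simp only [h2]
  rw [Finset.sum_add_distrib, Finset.sum_ite_eq' Finset.univ i, if_pos (Finset.mem_univ _), transport]
  ring

/-- Elements of the kernel are multiples of the square root of the Boltzmann factor. -/
theorem exists_ae_eq_of_mem_kernel {u : Lp ℂ 2 (volume : Measure (Phase d))}
    (hu : (u, 0) ∈ S.flatGraph) : ∃ c : ℂ, (fun x => (S.boost x : ℂ) * u x) =ᵐ[volume] fun _ => c := by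
  obtain ⟨φ, hφ, t1, t2⟩ := S.exists_seq_of_mem_flatGraph hu
  have m1 := fun n => (hφ n).memLp (μ := (volume : Measure (Phase d))) 2
  have mA := fun n => (S.testFn_signedExpr (hφ n) 1).memLp (μ := (volume : Measure (Phase d))) 2
  have ma := fun n i => (S.testFn_annihilation (hφ n) i).memLp (μ := (volume : Measure (Phase d))) 2
  have c0 : ∀ g : Phase d → ℂ, Tendsto (fun _ : ℕ => eLpNorm (g - g) 2) atTop (𝓝 0) := fun g => by
    simp
  have hz : ∀ g : Phase d → ℂ, ∫ x, g x * (0 : Lp ℂ 2 (volume : Measure (Phase d))) x = 0 := fun g => by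
    refine integral_eq_zero_of_ae ?_
    filter_upwards [Lp.coeFn_zero ℂ 2 (volume : Measure (Phase d))] with y hy
    rw [hy]
    simp
  have hz2 : ∀ g : Phase d → ℂ, MemLp g 2 →
      Tendsto (fun n => ∫ x, g x * S.signedExpr 1 (φ n) x) atTop (𝓝 0) := fun g hg => by
    have := tendsto_integral_mul hg (Lp.memLp (0 : Lp ℂ 2 (volume : Measure (Phase d))))
      (fun _ => hg) mA (c0 _) t2
    rwa [hz] at this
  have hlim : ∀ g : Phase d → ℂ, MemLp g 2 →
      Tendsto (fun n => ∫ x, g x * φ n x) atTop (𝓝 (∫ x, g x * u x)) := fun g hg =>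
    tendsto_integral_mul hg (Lp.memLp u) (fun _ => hg) m1 (c0 _) t1
  -- dissipation
  have hen : Tendsto (fun n => S.kap * ∑ i, ∫ x, ‖S.annihilation i (φ n) x‖ ^ 2) atTop (𝓝 0) := by
    have t1' : Tendsto (fun n => eLpNorm ((fun x => conj (φ n x)) - fun x => conj (u x)) 2) atTop
        (𝓝 0) := by
      refine t1.congr fun n => ?_
      refine eLpNorm_congr_norm_ae (.of_forall fun x => ?_)
      simp only [Pi.sub_apply, ← map_sub, RCLike.norm_conj]
    have h1 := tendsto_integral_mul (Lp.memLp u).star (Lp.memLp (0 : Lp ℂ 2 (volume : Measure (Phase d))))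
      (fun n => (m1 n).star) mA t1' t2
    rw [hz] at h1
    have h2 := (Complex.continuous_re.tendsto 0).comp h1
    exact h2.congr fun n => S.re_integral_conj_mul_signedExpr (hφ n) 1
  have hai : ∀ i, Tendsto (fun n => eLpNorm (S.annihilation i (φ n) - 0) 2) atTop (𝓝 0) := fun i => by
    have h1 := hen.const_mul S.kap⁻¹
    simp only [inv_mul_cancel_left₀ S.kap_pos.ne', mul_zero] at h1
    have h2 : Tendsto (fun n => ∫ x, ‖S.annihilation i (φ n) x‖ ^ 2) atTop (𝓝 0) :=
      squeeze_zero (fun n => integral_nonneg fun x => by positivity)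
        (fun n => Finset.single_le_sum (f := fun i => ∫ x, ‖S.annihilation i (φ n) x‖ ^ 2)
          (fun j _ => integral_nonneg fun x => by positivity) (Finset.mem_univ i)) h1
    simp only [sub_zero]
    exact (tendsto_eLpNorm_two_iff fun n => ma n i).2 h2
  have hann : ∀ i, ∀ g : Phase d → ℂ, MemLp g 2 →
      Tendsto (fun n => ∫ x, g x * S.annihilation i (φ n) x) atTop (𝓝 0) := fun i g hg => by
    have := tendsto_integral_mul hg MemLp.zero (fun _ => hg) (fun n => ma n i) (c0 _) (hai i)
    simpa using this
  -- Each `a_i φ_n` tends to zero while `φ_n` tends to `u`, so `a_i u = 0` weakly.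
  have w1 : ∀ i, ∀ ψ : Phase d → ℂ, TestFn ψ → ∫ x, S.creation i ψ x * u x = 0 := fun i ψ hψ => by
    refine tendsto_nhds_unique (hlim _ ((S.testFn_creation hψ i).memLp 2))
      ((hann i ψ (hψ.memLp 2)).congr fun n => ?_)
    exact S.integral_mul_annihilation hψ.1 (hφ n).1 (Or.inr (hφ n).2) i
  -- `A φ_n` and its dissipative part both vanish in the limit when tested, so the transport part
  -- does too.
  have w2 : ∀ ψ : Phase d → ℂ, TestFn ψ → ∫ x, S.transport ψ x * u x = 0 := fun ψ hψ => by
    have h1 := hlim _ ((S.testFn_transport hψ).memLp 2)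
    have ha := fun i => S.testFn_annihilation hψ i
    have h2 : Tendsto (fun n => (S.kap : ℂ) * (∑ i, ∫ x, S.annihilation i ψ x * S.annihilation i (φ n) x)
        - ∫ x, ψ x * S.signedExpr 1 (φ n) x) atTop (𝓝 0) := by
      have h3 := ((tendsto_finsetSum Finset.univ fun i _ => hann i _ ((ha i).memLp 2)).const_mul
        (S.kap : ℂ)).sub (hz2 ψ (hψ.memLp 2))
      simpa using h3
    refine tendsto_nhds_unique h1 (h2.congr fun n => ?_)
    have e0 := S.integral_mul_transport hψ.1 (hφ n)
    have i1 := ((S.testFn_transport (hφ n)).smooth_mul hψ.1).integrable (μ := volume)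
    have i2 : ∀ i, Integrable fun x => ψ x * S.creation i (S.annihilation i (φ n)) x := fun i =>
      ((S.testFn_creation (S.testFn_annihilation (hφ n) i) i).smooth_mul hψ.1).integrable
    have e1 : ∫ x, ψ x * S.signedExpr 1 (φ n) x = (∫ x, ψ x * S.transport (φ n) x)
        + (S.kap : ℂ) * ∑ i, ∫ x, ψ x * S.creation i (S.annihilation i (φ n)) x := by
      rw [← integral_finsetSum _ fun i _ => i2 i, ← integral_const_mul,
        ← integral_add i1 ((integrable_finsetSum _ fun i _ => i2 i).const_mul _)]
      refine integral_congr_ae (.of_forall fun x => ?_)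
      simp only [signedExpr, number, ← Finset.mul_sum, Complex.ofReal_one]
      ring
    have e2 : ∀ i, ∫ x, ψ x * S.creation i (S.annihilation i (φ n)) x
        = ∫ x, S.annihilation i ψ x * S.annihilation i (φ n) x := fun i =>
      S.integral_mul_creation hψ.1 (S.testFn_annihilation (hφ n) i).1 (Or.inl hψ.2) i
    rw [e1, e0]
    simp only [e2]
    ring
  set F : Phase d → ℂ := fun x => (S.boost x : ℂ) * u x with hF
  have w3 : ∀ i, ∀ ψ : Phase d → ℂ, TestFn ψ → ∫ x, F x * dp i ψ x = 0 := fun i ψ hψ => by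
    have := w1 i _ (hψ.smooth_mul S.contDiff_boost.ofReal)
    simp only [S.creation_boost_mul hψ.1] at this
    rw [← neg_eq_zero, ← this, ← integral_neg]
    refine integral_congr_ae (.of_forall fun x => ?_)
    simp only [hF]
    ring
  have w4 : ∀ ψ : Phase d → ℂ, TestFn ψ → ∫ x, F x * S.transport ψ x = 0 := fun ψ hψ => by
    have := w2 _ (hψ.smooth_mul S.contDiff_boost.ofReal)
    simp only [S.transport_boost_mul hψ.1] at this
    rw [← this]
    refine integral_congr_ae (.of_forall fun x => ?_)
    simp only [hF]
    ring
  have hFloc : LocallyIntegrable F := by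
    have hu1 : LocallyIntegrable (u : Phase d → ℂ) := (Lp.memLp u).locallyIntegrable (by norm_num)
    have hb : Continuous fun x => (S.boost x : ℂ) := S.contDiff_boost.ofReal.continuous
    rw [locallyIntegrable_iff] at hu1 ⊢
    intro k hk
    exact (hu1 k hk).continuousOn_mul hb.continuousOn hk
  have iF : ∀ ψ : Phase d → ℂ, TestFn ψ → Integrable fun x => F x * ψ x := fun ψ hψ => by
    have h1 := (Lp.memLp u).integrable_mul ((hψ.smooth_mul S.contDiff_boost.ofReal).memLp
      (μ := (volume : Measure (Phase d))) 2)
    refine h1.congr (.of_forall fun x => ?_)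
    simp only [hF, Pi.mul_apply]
    ring
  -- `F` is weakly annihilated by `∂_{p_i}` and by the transport, hence by their bracket, which is a
  -- nonzero multiple of `∂_{q_i}`.
  have w5 : ∀ i, ∀ ψ : Phase d → ℂ, TestFn ψ → ∫ x, F x * dq i ψ x = 0 := fun i ψ hψ => by
    have h1 := w3 i _ (S.testFn_transport hψ)
    have h2 := w4 _ (hψ.dirD (unitP i))
    simp only [S.dp_transport hψ.1, mul_sub] at h1
    have j1 := iF _ (S.testFn_transport (hψ.dirD (unitP i)))
    have j2 := iF _ ((hψ.dirD (unitQ i)).const_mul ((S.mass⁻¹ : ℝ) : ℂ))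
    have h3 : (∫ x, F x * S.transport (dirD (unitP i) ψ) x)
        - ∫ x, F x * (((S.mass⁻¹ : ℝ) : ℂ) * dirD (unitQ i) ψ x) = 0 := by
      rw [← integral_sub j1 j2]
      exact h1
    rw [h2, zero_sub, neg_eq_zero] at h3
    simp only [mul_left_comm (F _)] at h3
    rw [integral_const_mul] at h3
    refine (mul_eq_zero.1 h3).resolve_left ?_
    exact_mod_cast (inv_pos.2 S.mass_pos).ne'
  have w6 : ∀ (e : Phase d) (η : Phase d → ℝ), TestFn η → ∫ x, F x * ((dirD e η x : ℝ) : ℂ) = 0 := by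
    intro e η hη
    have h1 : ∀ x, F x * ((dirD e η x : ℝ) : ℂ)
        = (∑ i, ((e.1 i : ℝ) : ℂ) * (F x * dq i (fun y => (η y : ℂ)) x))
          + ∑ i, ((e.2 i : ℝ) : ℂ) * (F x * dp i (fun y => (η y : ℂ)) x) := fun x => by
      have h2 := dirD_phase η e.1 e.2 x
      have h3 : dirD e η x = _ := h2
      rw [h3]
      simp only [dq_eq, dp_eq, dirD_ofReal hη.1]
      simp only [smul_eq_mul]
      push_cast
      rw [mul_add, Finset.mul_sum, Finset.mul_sum]
      congr 1 <;> exact Finset.sum_congr rfl fun i _ => by ring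
    simp only [h1]
    have j1 : ∀ i, Integrable fun x => ((e.1 i : ℝ) : ℂ) * (F x * dq i (fun y => (η y : ℂ)) x) :=
      fun i => (iF _ (hη.ofReal.dirD (unitQ i))).const_mul ((e.1 i : ℝ) : ℂ)
    have j2 : ∀ i, Integrable fun x => ((e.2 i : ℝ) : ℂ) * (F x * dp i (fun y => (η y : ℂ)) x) :=
      fun i => (iF _ (hη.ofReal.dirD (unitP i))).const_mul ((e.2 i : ℝ) : ℂ)
    rw [integral_add (integrable_finsetSum _ fun i _ => j1 i) (integrable_finsetSum _ fun i _ => j2 i),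
      integral_finsetSum _ fun i _ => j1 i, integral_finsetSum _ fun i _ => j2 i]
    simp only [integral_const_mul, w5 _ _ hη.ofReal, w3 _ _ hη.ofReal, mul_zero,
      Finset.sum_const_zero, add_zero]
  have hFre : LocallyIntegrable fun x => (F x).re := fun x => by
    obtain ⟨s, hs, h⟩ := hFloc x
    exact ⟨s, hs, Complex.reCLM.integrable_comp h⟩
  have hFim : LocallyIntegrable fun x => (F x).im := fun x => by
    obtain ⟨s, hs, h⟩ := hFloc x
    exact ⟨s, hs, Complex.imCLM.integrable_comp h⟩
  have hre := exists_ae_eq_const_of_weak_gradient (μ := (volume : Measure (Phase d)))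
    (f := fun x => (F x).re) hFre fun e η hη => by
      have h1 := congrArg Complex.re (w6 e η hη)
      rw [← Complex.reCLM_apply, ← Complex.reCLM.integral_comp_comm (iF _ (hη.dirD e).ofReal)] at h1
      simpa using h1
  have him := exists_ae_eq_const_of_weak_gradient (μ := (volume : Measure (Phase d)))
    (f := fun x => (F x).im) hFim fun e η hη => by
      have h1 := congrArg Complex.im (w6 e η hη)
      rw [← Complex.imCLM_apply, ← Complex.imCLM.integral_comp_comm (iF _ (hη.dirD e).ofReal)] at h1
      simpa using h1
  obtain ⟨a, ha⟩ := hre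
  obtain ⟨b, hb⟩ := him
  refine ⟨⟨a, b⟩, ?_⟩
  filter_upwards [ha, hb] with x h1 h2
  exact Complex.ext h1 h2

end LangevinSystem

/-! ### The unitary equivalence of the two operators -/

namespace LangevinSystem

open Filter Topology ComplexConjugate

variable {d : ℕ} (S : LangevinSystem d)

theorem mem_pmapKer {H : Type*} [NormedAddCommGroup H] [InnerProductSpace ℂ H] (T : H →ₗ.[ℂ] H)
    (u : H) : u ∈ pmapKer T ↔ ∃ h : u ∈ T.domain, T ⟨u, h⟩ = 0 := by
  simp only [pmapKer, Submodule.mem_map, LinearMap.mem_ker]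
  constructor
  · rintro ⟨⟨y, hy⟩, h1, rfl⟩
    exact ⟨hy, h1⟩
  · rintro ⟨h, h1⟩
    exact ⟨⟨u, h⟩, h1, rfl⟩

theorem sum_smul_mem_graph {H : Type*} [NormedAddCommGroup H] [InnerProductSpace ℂ H]
    {Γ : Submodule ℂ (H × H)} {m : ℕ} {w v : Fin m → H} (h : ∀ i, (w i, v i) ∈ Γ) (a : Fin m → ℂ) :
    (∑ i, a i • w i, ∑ i, a i • v i) ∈ Γ := by
  have h1 := Submodule.sum_mem Γ (t := Finset.univ) fun i _ => Γ.smul_mem (a i) (h i)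
  have e : ∑ i, a i • (w i, v i) = (∑ i, a i • w i, ∑ i, a i • v i) := by
    refine Prod.ext ?_ ?_
    · simp [Prod.fst_sum]
    · simp [Prod.snd_sum]
  rwa [e] at h1

theorem weight_eq (x : Phase d) : S.weight x = √S.partition * S.boost x := rfl

theorem weight_pos (x : Phase d) : 0 < S.weight x :=
  mul_pos (Real.sqrt_pos.mpr S.partition_pos) (S.boost_pos x)

theorem gibbs_ac : S.gibbs ≪ volume := withDensity_absolutelyContinuous _ _

theorem density_pos (x : Phase d) : 0 < S.density x := div_pos (Real.exp_pos _) S.partition_pos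

theorem volume_ac : (volume : Measure (Phase d)) ≪ S.gibbs :=
  withDensity_ac' (((S.continuous_energy.const_mul _).rexp.div_const _).measurable) S.density_pos

theorem measurable_density : Measurable S.density :=
  ((S.continuous_energy.const_mul _).rexp.div_const _).measurable

theorem memLp_weight_mul (y : Lp ℂ 2 (volume : Measure (Phase d))) :
    MemLp (fun x => (S.weight x : ℂ) * y x) 2 S.gibbs :=
  ⟨(Complex.continuous_ofReal.comp
    (S.contDiff_boost.continuous.const_mul (√S.partition))).aestronglyMeasurable.mul
    ((Lp.aestronglyMeasurable y).mono_ac S.gibbs_ac), by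
    rw [gibbs, eLpNorm_weight S.measurable_density S.density_mul_weight]
    exact Lp.eLpNorm_lt_top y⟩

theorem coeFn_U (y : Lp ℂ 2 (volume : Measure (Phase d))) :
    S.U y =ᵐ[S.gibbs] fun x => (S.weight x : ℂ) * y x :=
  MemLp.coeFn_toLp (S.memLp_weight_mul y)

theorem coeFn_U_symm (y : Lp ℂ 2 S.gibbs) :
    S.U.symm y =ᵐ[volume] fun x => ((S.weight x : ℂ))⁻¹ * y x := by
  have h := S.coeFn_U (S.U.symm y)
  rw [LinearIsometryEquiv.apply_symm_apply] at h
  filter_upwards [S.volume_ac.ae_le h] with x hx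
  rw [hx, inv_mul_cancel_left₀ (Complex.ofReal_ne_zero.2 (S.weight_pos x).ne')]

/-- The intertwining relation `K e^{βH/2} = e^{βH/2} K̃` on smooth functions, checked coordinate by
coordinate: the `∇V` contributions of the two transport terms cancel against each other. -/
theorem kolmogorovExpr_boost_mul {φ : Phase d → ℂ} (hφ : ContDiff ℝ ∞ φ) (x : Phase d) :
    S.kolmogorovExpr (fun y => (S.boost y : ℂ) * φ y) x
      = (S.boost x : ℂ) * S.flatKolmogorovExpr φ x := by
  have e1 : ∀ i, dp i (fun y => (S.boost y : ℂ) * φ y)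
      = fun y => (S.boost y : ℂ) * S.annihilation i φ y := fun i =>
    funext fun y => S.dp_boost_mul hφ i y
  rw [kolmogorovExpr, flatKolmogorovExpr, Finset.mul_sum]
  refine Finset.sum_congr rfl fun i _ => ?_
  rw [e1, dp_boost_mul S (S.contDiff_annihilation hφ i), dq_boost_mul S hφ, gradient_apply, creation]
  generalize hA : S.annihilation i φ = a
  have e2 : dp i φ x = a x - ((S.invTemp / (2 * S.mass) * x.2 i : ℝ) : ℂ) * φ x := by
    rw [← hA, annihilation]
    ring
  rw [e2, annihilation]
  have h1 : (S.mass : ℂ) ≠ 0 := Complex.ofReal_ne_zero.2 S.mass_pos.ne'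
  have h2 : (S.invTemp : ℂ) ≠ 0 := Complex.ofReal_ne_zero.2 S.invTemp_pos.ne'
  simp only [bb]
  push_cast
  field_simp
  ring

/-- Dividing by a smooth positive weight preserves test functions, so `U⁻¹` maps the core of `K`
into that of `K̃`, and the closures follow by continuity. This inclusion transports the `w_j`, and
it also shows that the closure defining `K` is a graph. -/
theorem U_symm_mem_flatGraph {y z : Lp ℂ 2 S.gibbs}
    (h : (y, z) ∈ (testGraph S.gibbs S.kolmogorovExpr S.kolmogorovExpr_linear).topologicalClosure) :
    (S.U.symm y, S.U.symm z) ∈ S.flatGraph := by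
  have hcl : IsClosed {x : Lp ℂ 2 S.gibbs × Lp ℂ 2 S.gibbs |
      (S.U.symm x.1, S.U.symm x.2) ∈ S.flatGraph} :=
    S.isClosed_flatGraph.preimage
      ((S.U.symm.continuous.comp continuous_fst).prodMk (S.U.symm.continuous.comp continuous_snd))
  refine closure_minimal ?_ hcl h
  rintro ⟨y, z⟩ ⟨φ, hφ, h1, h2⟩
  have hw : ContDiff ℝ ∞ fun x => (S.boost x : ℂ)⁻¹ := by
    refine S.contDiff_boost.ofReal.inv fun x => ?_
    exact Complex.ofReal_ne_zero.2 (S.boost_pos x).ne'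
  set c : ℂ := ((√S.partition : ℝ) : ℂ)⁻¹ with hc
  set ψ : Phase d → ℂ := fun x => (S.boost x : ℂ)⁻¹ * φ x with hψ
  have tψ : TestFn ψ := TestFn.smooth_mul hφ hw
  have eφ : φ = fun x => (S.boost x : ℂ) * ψ x := by
    funext x
    rw [hψ, mul_inv_cancel_left₀ (Complex.ofReal_ne_zero.2 (S.boost_pos x).ne')]
  have tcψ : TestFn (c • ψ) := tψ.const_mul c
  refine Submodule.le_topologicalClosure _ ⟨c • ψ, tcψ, ?_, ?_⟩
  · refine (S.coeFn_U_symm y).trans ?_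
    filter_upwards [S.volume_ac.ae_le h1] with x hx
    rw [hx, weight_eq]
    simp only [Pi.smul_apply, smul_eq_mul, hψ, hc]
    push_cast
    rw [mul_inv, mul_assoc]
  · refine (S.coeFn_U_symm z).trans ?_
    rw [S.flatKolmogorovExpr_linear.2 c ψ tψ.1]
    filter_upwards [S.volume_ac.ae_le h2] with x hx
    rw [hx, weight_eq, eφ, S.kolmogorovExpr_boost_mul tψ.1]
    simp only [Pi.smul_apply, smul_eq_mul, hc]
    push_cast
    rw [mul_inv, mul_assoc, inv_mul_cancel_left₀ (Complex.ofReal_ne_zero.2 (S.boost_pos x).ne')]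

theorem graph_kolmogorov : S.kolmogorov.graph
    = (testGraph S.gibbs S.kolmogorovExpr S.kolmogorovExpr_linear).topologicalClosure := by
  refine Submodule.toLinearPMap_graph_eq _ fun x hx h0 => ?_
  have h1 := S.flatGraph_snd_eq_zero _ (S.U_symm_mem_flatGraph (y := x.1) (z := x.2) hx)
    (by simp [h0])
  simpa using h1

theorem mem_pmapKer_flatKolmogorov (u : Lp ℂ 2 (volume : Measure (Phase d))) :
    u ∈ pmapKer S.flatKolmogorov ↔ (u, 0) ∈ S.flatGraph := by
  rw [mem_pmapKer]
  refine ⟨fun ⟨h, h0⟩ => ?_, fun h => S.exists_flatKolmogorov_eq h⟩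
  rw [← h0]
  exact S.flatKolmogorov_mem ⟨u, h⟩

theorem U_symm_mem_of_kolmogorov (w : S.kolmogorov.domain) :
    (S.U.symm w, S.U.symm (S.kolmogorov w)) ∈ S.flatGraph := by
  refine S.U_symm_mem_flatGraph ?_
  rw [← graph_kolmogorov]
  exact LinearPMap.mem_graph _ w

/-- Functions of zero mean are orthogonal to the kernel. -/
theorem inner_kernel_eq_zero {v : Lp ℂ 2 S.gibbs} (hv : ∫ x, v x ∂S.gibbs = 0)
    {u : Lp ℂ 2 (volume : Measure (Phase d))} (hu : (u, 0) ∈ S.flatGraph) :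
    inner ℂ v (S.U u) = 0 := by
  obtain ⟨c, hc⟩ := S.exists_ae_eq_of_mem_kernel hu
  rw [L2.inner_def]
  have e : ∫ x, inner ℂ (v x) (S.U u x) ∂S.gibbs
      = ∫ x, (((√S.partition : ℝ) : ℂ) * c) * conj (v x) ∂S.gibbs := by
    refine integral_congr_ae ?_
    filter_upwards [S.coeFn_U u, S.gibbs_ac.ae_le hc] with x h1 h2
    rw [h1, weight_eq, Complex.ofReal_mul, mul_assoc, h2]
    simp
  rw [e, integral_const_mul, integral_conj, hv, map_zero, mul_zero]

theorem moriProjection_apply {H : Type*} [NormedAddCommGroup H] [InnerProductSpace ℂ H] {m : ℕ}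
    (v : Fin m → H) (u : H) : moriProjection v u = ∑ i, inner ℂ (v i) u • v i := by
  simp [moriProjection]

theorem flatten_apply (A : Lp ℂ 2 S.gibbs →L[ℂ] Lp ℂ 2 S.gibbs)
    (u : Lp ℂ 2 (volume : Measure (Phase d))) : S.flatten A u = S.U.symm (A (S.U u)) := rfl

theorem flatten_one_sub_apply (A : Lp ℂ 2 S.gibbs →L[ℂ] Lp ℂ 2 S.gibbs)
    (u : Lp ℂ 2 (volume : Measure (Phase d))) : S.flatten (1 - A) u = u - S.flatten A u := by
  simp [flatten_apply]

theorem mem_pmapKer_orthogonalGenerator (P : Lp ℂ 2 S.gibbs →L[ℂ] Lp ℂ 2 S.gibbs)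
    (u : Lp ℂ 2 (volume : Measure (Phase d))) : u ∈ pmapKer (S.orthogonalGenerator P) ↔
      ∃ y f, S.flatten (1 - P) u = y ∧ (y, f) ∈ S.flatGraph ∧ S.flatten (1 - P) f = 0 := by
  rw [mem_pmapKer]
  constructor
  · rintro ⟨h, h0⟩
    exact ⟨_, _, rfl, S.flatKolmogorov_mem ⟨S.flatten (1 - P) u, h⟩, h0⟩
  · rintro ⟨y, f, rfl, h, h0⟩
    obtain ⟨hy, rfl⟩ := S.exists_flatKolmogorov_eq h
    exact ⟨hy, h0⟩

/-- The kernel of the orthogonally projected generator. -/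
theorem pmapKer_orthogonalGenerator {m : ℕ} {v w : Fin m → Lp ℂ 2 S.gibbs} (hv : Orthonormal ℂ v)
    (hmean : ∀ i, ∫ x, v i x ∂S.gibbs = 0) (horth : ∀ i j, inner ℂ (w j) (v i) = 0)
    (hw : ∀ j, ∃ h : w j ∈ S.kolmogorov.domain, S.kolmogorov ⟨w j, h⟩ = v j) :
    pmapKer (S.orthogonalGenerator (moriProjection v)) =
      pmapKer S.flatKolmogorov ⊔ LinearMap.range (S.flatten (moriProjection v)).toLinearMap ⊔
        Submodule.span ℂ (Set.range fun j => S.U.symm (w j)) := by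
  obtain ⟨P, hP⟩ : ∃ P, P = moriProjection v := ⟨_, rfl⟩
  rw [← hP]
  have hPa : ∀ u, P u = ∑ i, inner ℂ (v i) u • v i := fun u => by rw [hP, moriProjection_apply]
  have hPv : ∀ j, P (v j) = v j := fun j => by
    rw [hP, moriProjection_apply, Finset.sum_eq_single j]
    · rw [orthonormal_iff_ite.1 hv, if_pos rfl, one_smul]
    · intro i _ hij
      rw [orthonormal_iff_ite.1 hv, if_neg hij, zero_smul]
    · simp
  have hPw : ∀ j, P (w j) = 0 := fun j => by
    rw [hPa]
    refine Finset.sum_eq_zero fun i _ => ?_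
    rw [← inner_conj_symm, horth, map_zero, zero_smul]
  have hPP : ∀ u, P (P u) = P u := fun u => by
    conv_lhs => rw [hPa u, map_sum]
    simp only [map_smul, hPv]
    rw [hPa]
  have hPker : ∀ u, (u, 0) ∈ S.flatGraph → P (S.U u) = 0 := fun u hu => by
    rw [hPa]
    exact Finset.sum_eq_zero fun i _ => by rw [S.inner_kernel_eq_zero (hmean i) hu, zero_smul]
  have hKw : ∀ j, (S.U.symm (w j), S.U.symm (v j)) ∈ S.flatGraph := fun j => by
    obtain ⟨h, h1⟩ := hw j
    rw [← h1]
    exact S.U_symm_mem_of_kolmogorov ⟨w j, h⟩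
  have hfix : ∀ u, P (S.U u) = 0 → S.flatten (1 - P) u = u := fun u hu => by
    rw [flatten_one_sub_apply, flatten_apply, hu, map_zero, sub_zero]
  refine le_antisymm (fun u hu => ?_) (sup_le (sup_le ?_ ?_) ?_)
  · obtain ⟨y, f, hy, hyf, h0⟩ := (S.mem_pmapKer_orthogonalGenerator P u).1 hu
    -- `f = K̃(Q̃u)` is fixed by `P̃`, hence a combination of the `v_i = K w_i`. Subtracting the
    -- same combination of the `w_i` from `Q̃u` leaves an element of the kernel of `K̃`.
    have h1 : f = S.flatten P f := by
      rwa [flatten_one_sub_apply, sub_eq_zero] at h0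
    obtain ⟨a, ha⟩ : ∃ a : Fin m → ℂ, S.flatten P f = ∑ i, a i • S.U.symm (v i) := by
      refine ⟨fun i => inner ℂ (v i) (S.U f), ?_⟩
      rw [flatten_apply, hPa, map_sum]
      simp only [map_smul]
    obtain ⟨z, hz⟩ : ∃ z, z = ∑ i, a i • S.U.symm (w i) := ⟨_, rfl⟩
    have hzf : (z, f) ∈ S.flatGraph := by
      rw [h1, ha, hz]
      exact sum_smul_mem_graph hKw a
    have e : u = (y - z) + S.flatten P u + z := by
      rw [← hy, flatten_one_sub_apply]
      abel
    rw [e]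
    refine Submodule.add_mem_sup (Submodule.add_mem_sup ?_ ⟨u, rfl⟩) ?_
    · rw [mem_pmapKer_flatKolmogorov]
      have := S.flatGraph.sub_mem hyf hzf
      rwa [Prod.mk_sub_mk, sub_self] at this
    · rw [hz]
      exact Submodule.sum_mem _ fun i _ => Submodule.smul_mem _ _ (Submodule.subset_span ⟨i, rfl⟩)
  · intro u hu
    rw [mem_pmapKer_flatKolmogorov] at hu
    exact (S.mem_pmapKer_orthogonalGenerator P u).2 ⟨u, 0, hfix u (hPker u hu), hu, map_zero _⟩
  · rintro _ ⟨u, rfl⟩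
    refine (S.mem_pmapKer_orthogonalGenerator P _).2 ⟨0, 0, ?_, S.flatGraph.zero_mem, map_zero _⟩
    change S.flatten (1 - P) (S.flatten P u) = 0
    rw [flatten_one_sub_apply]
    simp only [flatten_apply, LinearIsometryEquiv.apply_symm_apply, hPP, sub_self]
  · rw [Submodule.span_le]
    rintro _ ⟨j, rfl⟩
    refine (S.mem_pmapKer_orthogonalGenerator P _).2 ⟨S.U.symm (w j), S.U.symm (v j), hfix _ ?_,
      hKw j, ?_⟩
    · rw [LinearIsometryEquiv.apply_symm_apply, hPw]
    · rw [flatten_one_sub_apply, flatten_apply, LinearIsometryEquiv.apply_symm_apply, hPv, sub_self]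

end LangevinSystem

/-! ### The Gaussian Poincaré inequality -/

section Poincare

open Filter Topology

theorem enorm_integral_sq_le {α F : Type*} [MeasurableSpace α] {ν : Measure α} [NormedAddCommGroup F]
    [NormedSpace ℝ F] {f : α → F} (hf : AEStronglyMeasurable f ν) :
    ‖∫ x, f x ∂ν‖ₑ ^ 2 ≤ ν Set.univ * ∫⁻ x, ‖f x‖ₑ ^ 2 ∂ν := by
  have h1 : ‖∫ x, f x ∂ν‖ₑ ≤ ∫⁻ x, ‖f x‖ₑ ∂ν := enorm_integral_le_lintegral_enorm f
  have h2 := ENNReal.lintegral_mul_le_Lp_mul_Lq ν (p := 2) (q := 2) (by norm_num [Real.holderConjugate_iff])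
    (f := fun _ => 1) (g := fun x => ‖f x‖ₑ) aemeasurable_const hf.enorm
  simp only [Pi.mul_apply, one_mul, lintegral_const, ENNReal.rpow_ofNat] at h2
  have h3 := pow_le_pow_left₀ (zero_le (a := ‖∫ x, f x ∂ν‖ₑ)) (h1.trans h2) 2
  refine h3.trans_eq ?_
  have hs : ∀ t : ℝ≥0∞, (t ^ (1 / 2 : ℝ)) ^ 2 = t := fun t => by
    rw [← ENNReal.rpow_natCast, ← ENNReal.rpow_mul]
    norm_num
  rw [mul_pow, hs, hs, one_pow, one_mul]

variable {E : Type*} [NormedAddCommGroup E] [InnerProductSpace ℝ E]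

/-- Rotation by the angle `θ` in the plane spanned by two copies of `E`. -/
def pairRotation (E : Type*) [NormedAddCommGroup E] [InnerProductSpace ℝ E] (θ : ℝ) :
    (E × E) →ₗ[ℝ] (E × E) :=
  (Real.cos θ • LinearMap.fst ℝ E E + Real.sin θ • LinearMap.snd ℝ E E).prod
    (-(Real.sin θ) • LinearMap.fst ℝ E E + Real.cos θ • LinearMap.snd ℝ E E)

theorem pairRotation_apply (θ : ℝ) (z : E × E) : pairRotation E θ z
    = (Real.cos θ • z.1 + Real.sin θ • z.2, -(Real.sin θ) • z.1 + Real.cos θ • z.2) := rfl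

theorem pairRotation_comp (θ : ℝ) : pairRotation E θ ∘ₗ pairRotation E (-θ) = LinearMap.id := by
  refine LinearMap.ext fun z => ?_
  have h := Real.sin_sq_add_cos_sq θ
  simp only [LinearMap.comp_apply, pairRotation_apply, LinearMap.id_apply, Real.cos_neg, Real.sin_neg]
  refine Prod.ext ?_ ?_
  · have e : ∀ v : E, v = (Real.sin θ ^ 2 + Real.cos θ ^ 2) • v := fun v => by rw [h, one_smul]
    conv_rhs => rw [e z.1]
    module
  · have e : ∀ v : E, v = (Real.sin θ ^ 2 + Real.cos θ ^ 2) • v := fun v => by rw [h, one_smul]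
    conv_rhs => rw [e z.2]
    module

theorem norm_sq_pairRotation (θ : ℝ) (z : E × E) :
    ‖(pairRotation E θ z).1‖ ^ 2 + ‖(pairRotation E θ z).2‖ ^ 2 = ‖z.1‖ ^ 2 + ‖z.2‖ ^ 2 := by
  have h := Real.sin_sq_add_cos_sq θ
  rw [pairRotation_apply, norm_add_sq_real, norm_add_sq_real]
  simp only [norm_smul, inner_smul_left, inner_smul_right, mul_pow, Real.norm_eq_abs, sq_abs,
    RCLike.conj_to_real, abs_neg]
  linear_combination (‖z.1‖ ^ 2 + ‖z.2‖ ^ 2) * h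

/-- Maurey–Pisier path: the first component of the rotated pair runs from `z.1` at angle `0` to
`z.2` at angle `π/2`, and its velocity is the second component. Integrate the derivative along it
and apply Cauchy–Schwarz in the angle. -/
theorem enorm_sub_sq_le_pairRotation {F : E → ℂ} (hF : ContDiff ℝ ∞ F) (z : E × E) :
    ‖F z.1 - F z.2‖ₑ ^ 2 ≤ ENNReal.ofReal (Real.pi / 2) * ∫⁻ θ in Set.Ioc 0 (Real.pi / 2),
      ‖fderiv ℝ F (pairRotation E θ z).1 (pairRotation E θ z).2‖ₑ ^ 2 := by
  have hd : ∀ θ, HasDerivAt (fun θ => F (pairRotation E θ z).1)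
      (fderiv ℝ F (pairRotation E θ z).1 (pairRotation E θ z).2) θ := fun θ => by
    have h1 : HasDerivAt (fun θ => (pairRotation E θ z).1) (pairRotation E θ z).2 θ := by
      simp only [pairRotation_apply]
      exact ((Real.hasDerivAt_cos θ).smul_const z.1).add ((Real.hasDerivAt_sin θ).smul_const z.2)
    exact ((hF.differentiable_of_smooth _).hasFDerivAt).comp_hasDerivAt θ h1
  have hcont : Continuous fun θ => fderiv ℝ F (pairRotation E θ z).1 (pairRotation E θ z).2 := by
    have h1 : Continuous fun θ => (pairRotation E θ z).1 := by
      simp only [pairRotation_apply]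
      fun_prop
    have h2 : Continuous fun θ => (pairRotation E θ z).2 := by
      simp only [pairRotation_apply]
      fun_prop
    exact ((hF.continuous_fderiv (by simp)).comp h1).clm_apply h2
  have hftc := intervalIntegral.integral_eq_sub_of_hasDerivAt (a := 0) (b := Real.pi / 2)
    (fun θ _ => hd θ) (hcont.intervalIntegrable _ _)
  rw [intervalIntegral.integral_of_le (by positivity)] at hftc
  have e : F z.1 - F z.2 = -(F (pairRotation E (Real.pi / 2) z).1 - F (pairRotation E 0 z).1) := by
    simp [pairRotation_apply]
  rw [e, enorm_neg, ← hftc]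
  refine (enorm_integral_sq_le hcont.aestronglyMeasurable).trans_eq ?_
  congr 1
  simp

/-- Conjugation by the swap of the two copies turns `θ` into `-θ`, so a rotation and its inverse
have the same determinant. -/
theorem abs_det_pairRotation (θ : ℝ) : |LinearMap.det (pairRotation E θ)| = 1 := by
  let s : (E × E) ≃ₗ[ℝ] (E × E) := LinearEquiv.prodComm ℝ E E
  have h1 : (s : (E × E) →ₗ[ℝ] (E × E)) ∘ₗ pairRotation E θ ∘ₗ (s.symm : (E × E) →ₗ[ℝ] (E × E))
      = pairRotation E (-θ) := by
    refine LinearMap.ext fun z => ?_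
    refine Prod.ext ?_ ?_
    · simp [s, pairRotation_apply, add_comm]
    · simp [s, pairRotation_apply, add_comm]
  have h2 := LinearMap.det_conj (pairRotation E θ) s
  rw [h1] at h2
  have h3 := congrArg LinearMap.det (pairRotation_comp (E := E) θ)
  rw [LinearMap.det_comp, h2, LinearMap.det_id, ← sq] at h3
  exact (pow_eq_one_iff_of_nonneg (abs_nonneg _) two_ne_zero).1 (by rw [sq_abs, h3])

variable [FiniteDimensional ℝ E] [MeasurableSpace E] [BorelSpace E]

theorem measurePreserving_pairRotation (θ : ℝ) :
    MeasurePreserving (pairRotation E θ) ((volume : Measure E).prod volume) (volume.prod volume) := by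
  have h := abs_det_pairRotation (E := E) θ
  have h0 : LinearMap.det (pairRotation E θ) ≠ 0 := fun h0 => by simp [h0] at h
  refine ⟨(LinearMap.continuous_of_finiteDimensional _).measurable, ?_⟩
  rw [Measure.map_linearMap_addHaar_eq_smul_addHaar _ h0, abs_inv, h]
  simp

/-- The Gaussian measure with density `e^{-a|x|²}`. -/
def gaussMeasure (E : Type*) [NormedAddCommGroup E] [InnerProductSpace ℝ E] [FiniteDimensional ℝ E]
    [MeasurableSpace E] [BorelSpace E] (a : ℝ) : Measure E :=
  volume.withDensity fun x => ENNReal.ofReal (Real.exp (-a * ‖x‖ ^ 2))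

theorem measurable_gauss {E' : Type*} [NormedAddCommGroup E'] [MeasurableSpace E'] [BorelSpace E']
    (a : ℝ) : Measurable fun x : E' => ENNReal.ofReal (Real.exp (-a * ‖x‖ ^ 2)) := by fun_prop

instance sfinite_gaussMeasure (a : ℝ) : SFinite (gaussMeasure E a) := by
  unfold gaussMeasure
  infer_instance

/-- Rotations preserve both Lebesgue measure and `‖z.1‖² + ‖z.2‖²`, hence the product of two equal
Gaussians; the rotated point and its velocity are again independent. -/
theorem lintegral_pairRotation {a : ℝ} (θ : ℝ) {f : E × E → ℝ≥0∞} (hf : Measurable f) :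
    ∫⁻ z, f (pairRotation E θ z) ∂((gaussMeasure E a).prod (gaussMeasure E a))
      = ∫⁻ z, f z ∂((gaussMeasure E a).prod (gaussMeasure E a)) := by
  have hR : Measurable (pairRotation E θ) := (measurePreserving_pairRotation θ).measurable
  have hw : Measurable fun z : E × E => ENNReal.ofReal (Real.exp (-a * ‖z.1‖ ^ 2))
      * ENNReal.ofReal (Real.exp (-a * ‖z.2‖ ^ 2)) := by fun_prop
  have e : ∀ z : E × E, ENNReal.ofReal (Real.exp (-a * ‖z.1‖ ^ 2))
      * ENNReal.ofReal (Real.exp (-a * ‖z.2‖ ^ 2))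
      = ENNReal.ofReal (Real.exp (-a * (‖z.1‖ ^ 2 + ‖z.2‖ ^ 2))) := fun z => by
    rw [← ENNReal.ofReal_mul (Real.exp_pos _).le, ← Real.exp_add]
    ring_nf
  have hfR : Measurable fun z => f (pairRotation E θ z) := hf.comp hR
  unfold gaussMeasure
  rw [prod_withDensity (measurable_gauss a) (measurable_gauss a),
    lintegral_withDensity_eq_lintegral_mul _ hw hfR,
    lintegral_withDensity_eq_lintegral_mul _ hw hf]
  rw [← (measurePreserving_pairRotation (E := E) θ).lintegral_comp (hw.mul hf)]
  refine lintegral_congr fun z => ?_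
  simp only [Pi.mul_apply, e, norm_sq_pairRotation]

theorem lintegral_enorm_sub_sq_le (a : ℝ) {F : E → ℂ} (hF : ContDiff ℝ ∞ F) :
    ∫⁻ z : E × E, ‖F z.1 - F z.2‖ₑ ^ 2 ∂((gaussMeasure E a).prod (gaussMeasure E a))
      ≤ ENNReal.ofReal (Real.pi / 2) ^ 2 * ∫⁻ z : E × E, ‖fderiv ℝ F z.1 z.2‖ₑ ^ 2
        ∂((gaussMeasure E a).prod (gaussMeasure E a)) := by
  have hc0 : Measurable fun z : E × E => ‖fderiv ℝ F z.1 z.2‖ₑ ^ 2 :=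
    ((((hF.continuous_fderiv (by simp)).comp continuous_fst).clm_apply
      continuous_snd).enorm).measurable.pow_const 2
  have hR : Continuous fun x : (E × E) × ℝ => pairRotation E x.2 x.1 := by
    simp only [pairRotation_apply]
    fun_prop
  calc _ ≤ ∫⁻ z : E × E, ENNReal.ofReal (Real.pi / 2) * (∫⁻ θ in Set.Ioc 0 (Real.pi / 2),
        ‖fderiv ℝ F (pairRotation E θ z).1 (pairRotation E θ z).2‖ₑ ^ 2)
        ∂((gaussMeasure E a).prod (gaussMeasure E a)) :=
        lintegral_mono fun z => enorm_sub_sq_le_pairRotation hF z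
    _ = ENNReal.ofReal (Real.pi / 2) * ∫⁻ θ in Set.Ioc 0 (Real.pi / 2), ∫⁻ z : E × E,
        ‖fderiv ℝ F (pairRotation E θ z).1 (pairRotation E θ z).2‖ₑ ^ 2
        ∂((gaussMeasure E a).prod (gaussMeasure E a)) := by
        rw [lintegral_const_mul' _ _ ENNReal.ofReal_ne_top, lintegral_lintegral_swap]
        exact (hc0.comp hR.measurable).aemeasurable
    _ = _ := by
        have : ∀ θ, ∫⁻ z : E × E, ‖fderiv ℝ F (pairRotation E θ z).1 (pairRotation E θ z).2‖ₑ ^ 2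
            ∂((gaussMeasure E a).prod (gaussMeasure E a)) = _ := fun θ =>
          lintegral_pairRotation θ hc0
        simp only [this, lintegral_const]
        rw [sq, mul_assoc, mul_comm (∫⁻ z : E × E, _ ∂_)]
        simp

/-- The Gaussian Poincaré inequality, with an unspecified constant. -/
theorem exists_gauss_poincare {a : ℝ} (hfin : gaussMeasure E a Set.univ ≠ ⊤)
    (hmom : ∫⁻ y, ‖y‖ₑ ^ 2 ∂(gaussMeasure E a) ≠ ⊤) :
    ∃ K : ℝ≥0∞, K ≠ ⊤ ∧ ∀ F : E → ℂ, TestFn F →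
      ∫⁻ x, ‖((gaussMeasure E a).real Set.univ : ℂ) * F x - ∫ y, F y ∂(gaussMeasure E a)‖ₑ ^ 2
        ∂(gaussMeasure E a) ≤ K * ∫⁻ x, ‖fderiv ℝ F x‖ₑ ^ 2 ∂(gaussMeasure E a) := by
  set ν := gaussMeasure E a with hν
  have : IsFiniteMeasure ν := ⟨hfin.lt_top⟩
  refine ⟨ν Set.univ * (ENNReal.ofReal (Real.pi / 2) ^ 2 * ∫⁻ y, ‖y‖ₑ ^ 2 ∂ν),
    ENNReal.mul_ne_top hfin (ENNReal.mul_ne_top (by finiteness) hmom), fun F hF => ?_⟩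
  -- The Gaussian is not normalized, so its total mass multiplies `F x`; the deviation from the mean
  -- is then an average of `F x - F y`.
  have e : ∀ x, (ν.real Set.univ : ℂ) * F x - ∫ y, F y ∂ν = ∫ y, (F x - F y) ∂ν := fun x => by
    rw [integral_sub (integrable_const _) hF.integrable, integral_const]
    simp
  simp only [e]
  calc _ ≤ ∫⁻ x, ν Set.univ * ∫⁻ y, ‖F x - F y‖ₑ ^ 2 ∂ν ∂ν :=
        lintegral_mono fun x => enorm_integral_sq_le
          (continuous_const.sub hF.continuous).aestronglyMeasurable
    _ = ν Set.univ * ∫⁻ z : E × E, ‖F z.1 - F z.2‖ₑ ^ 2 ∂(ν.prod ν) := by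
        rw [lintegral_const_mul' _ _ hfin, lintegral_prod]
        have := hF.continuous
        fun_prop
    _ ≤ ν Set.univ * (ENNReal.ofReal (Real.pi / 2) ^ 2 *
          ∫⁻ z : E × E, ‖fderiv ℝ F z.1 z.2‖ₑ ^ 2 ∂(ν.prod ν)) := by
        gcongr
        exact lintegral_enorm_sub_sq_le a hF.1
    _ ≤ ν Set.univ * (ENNReal.ofReal (Real.pi / 2) ^ 2 *
          ∫⁻ z : E × E, ‖fderiv ℝ F z.1‖ₑ ^ 2 * ‖z.2‖ₑ ^ 2 ∂(ν.prod ν)) := by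
        gcongr with z
        rw [← mul_pow]
        gcongr
        exact (fderiv ℝ F z.1).le_opENorm z.2
    _ = _ := by
        have hm : Measurable fun x => ‖fderiv ℝ F x‖ₑ ^ 2 :=
          ((hF.1.continuous_fderiv (by simp)).enorm).measurable.pow_const 2
        have h2 : AEMeasurable (fun y : E => ‖y‖ₑ ^ 2) ν := by fun_prop
        rw [lintegral_prod_mul hm.aemeasurable h2]
        ring

end Poincare

/-! ### Gaussian integrals -/

section Gaussian

variable {d : ℕ}

theorem integrable_gauss {a : ℝ} (ha : 0 < a) :
    Integrable fun p : EuclideanSpace ℝ (Fin d) => Real.exp (-a * ‖p‖ ^ 2) := by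
  by_contra h
  have h1 := GaussianFourier.integral_rexp_neg_mul_sq_norm (V := EuclideanSpace ℝ (Fin d)) ha
  rw [integral_undef h] at h1
  have : 0 < (Real.pi / a) ^ (Module.finrank ℝ (EuclideanSpace ℝ (Fin d)) / 2 : ℝ) := by positivity
  exact this.ne h1

theorem integrable_norm_sq_mul_gauss {a : ℝ} (ha : 0 < a) :
    Integrable fun p : EuclideanSpace ℝ (Fin d) => ‖p‖ ^ 2 * Real.exp (-a * ‖p‖ ^ 2) := by
  refine ((integrable_gauss (d := d) (half_pos ha)).const_mul (2 / a)).mono'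
    (by fun_prop) (.of_forall fun p => ?_)
  rw [Real.norm_of_nonneg (by positivity)]
  have h1 : a / 2 * ‖p‖ ^ 2 ≤ Real.exp (a / 2 * ‖p‖ ^ 2) := by
    linarith [Real.add_one_le_exp (a / 2 * ‖p‖ ^ 2)]
  have h2 : Real.exp (-(a / 2) * ‖p‖ ^ 2) = Real.exp (a / 2 * ‖p‖ ^ 2) * Real.exp (-a * ‖p‖ ^ 2) := by
    rw [← Real.exp_add]
    ring_nf
  rw [h2]
  have h3 := mul_le_mul_of_nonneg_right h1 (Real.exp_pos (-a * ‖p‖ ^ 2)).le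
  have h4 : ‖p‖ ^ 2 * Real.exp (-a * ‖p‖ ^ 2)
      = 2 / a * (a / 2 * ‖p‖ ^ 2 * Real.exp (-a * ‖p‖ ^ 2)) := by
    field_simp
  rw [h4]
  gcongr

theorem gaussMeasure_univ_ne_top {a : ℝ} (ha : 0 < a) :
    gaussMeasure (EuclideanSpace ℝ (Fin d)) a Set.univ ≠ ⊤ := by
  rw [gaussMeasure, withDensity_apply _ MeasurableSet.univ, Measure.restrict_univ,
    ← ofReal_integral_eq_lintegral_ofReal (integrable_gauss ha) (.of_forall fun p => (Real.exp_pos _).le)]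
  exact ENNReal.ofReal_ne_top

theorem lintegral_gaussMeasure {a : ℝ} {f : EuclideanSpace ℝ (Fin d) → ℝ≥0∞} (hf : Measurable f) :
    ∫⁻ p, f p ∂(gaussMeasure (EuclideanSpace ℝ (Fin d)) a)
      = ∫⁻ p, ENNReal.ofReal (Real.exp (-a * ‖p‖ ^ 2)) * f p :=
  lintegral_withDensity_eq_lintegral_mul _ (measurable_gauss a) hf

theorem lintegral_norm_sq_gaussMeasure_ne_top {a : ℝ} (ha : 0 < a) :
    ∫⁻ p, ‖p‖ₑ ^ 2 ∂(gaussMeasure (EuclideanSpace ℝ (Fin d)) a) ≠ ⊤ := by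
  have e : ∀ p : EuclideanSpace ℝ (Fin d), ENNReal.ofReal (Real.exp (-a * ‖p‖ ^ 2)) * ‖p‖ₑ ^ 2
      = ENNReal.ofReal (‖p‖ ^ 2 * Real.exp (-a * ‖p‖ ^ 2)) := fun p => by
    rw [ENNReal.ofReal_mul (by positivity), ENNReal.ofReal_pow (norm_nonneg _), ofReal_norm, mul_comm]
  rw [lintegral_gaussMeasure (by fun_prop)]
  simp only [e]
  rw [← ofReal_integral_eq_lintegral_ofReal (integrable_norm_sq_mul_gauss ha)
    (.of_forall fun p => by positivity)]
  exact ENNReal.ofReal_ne_top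

theorem sq_coord_le (p : EuclideanSpace ℝ (Fin d)) (i : Fin d) : p i ^ 2 ≤ ‖p‖ ^ 2 := by
  rw [← sq_abs, ← Real.norm_eq_abs]
  exact pow_le_pow_left₀ (norm_nonneg _) (PiLp.norm_apply_le p i) 2

end Gaussian

/-! ### The Gaussian ground state in momentum and the spectral gap of the number operator. -/

namespace LangevinSystem

variable {d : ℕ} (S : LangevinSystem d)

/-- The Gaussian ground state in the momentum variable. -/
def ground (p : EuclideanSpace ℝ (Fin d)) : ℝ := Real.exp (-(S.cc / 2) * ‖p‖ ^ 2)

theorem contDiff_ground : ContDiff ℝ ∞ S.ground :=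
  Real.contDiff_exp.comp (contDiff_const.mul (contDiff_norm_sq ℝ))

theorem ground_pos (p : EuclideanSpace ℝ (Fin d)) : 0 < S.ground p := Real.exp_pos _

theorem ground_sq (p : EuclideanSpace ℝ (Fin d)) : S.ground p ^ 2 = Real.exp (-S.cc * ‖p‖ ^ 2) := by
  rw [ground, sq, ← Real.exp_add]
  ring_nf

theorem dirD_ground (i : Fin d) (p : EuclideanSpace ℝ (Fin d)) :
    dirD (EuclideanSpace.single i 1) S.ground p = -(S.cc * p i) * S.ground p := by
  have h := ((hasStrictFDerivAt_norm_sq p).hasFDerivAt.const_mul (-(S.cc / 2))).exp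
  have h2 : HasFDerivAt S.ground _ p := h
  unfold dirD
  rw [h2.fderiv]
  simp [EuclideanSpace.inner_single_right, ground]
  ring

theorem integrable_ground_sq : Integrable fun p => S.ground p ^ 2 := by
  simp only [ground_sq]
  exact integrable_gauss S.cc_pos

theorem memLp_ground : MemLp S.ground 2 :=
  (memLp_two_iff_integrable_sq S.contDiff_ground.continuous.aestronglyMeasurable).2
    S.integrable_ground_sq

theorem integrable_coord_sq_ground_sq (i : Fin d) : Integrable fun p => (p i * S.ground p) ^ 2 := by
  refine (integrable_norm_sq_mul_gauss (d := d) S.cc_pos).mono' ?_ (.of_forall fun p => ?_)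
  · have := S.contDiff_ground.continuous
    fun_prop
  · rw [Real.norm_of_nonneg (by positivity), mul_pow, ground_sq]
    exact mul_le_mul_of_nonneg_right (sq_coord_le p i) (Real.exp_pos _).le

theorem memLp_coord_ground (i : Fin d) : MemLp (fun p => p i * S.ground p) 2 := by
  refine (memLp_two_iff_integrable_sq ?_).2 (S.integrable_coord_sq_ground_sq i)
  have := S.contDiff_ground.continuous
  exact Continuous.aestronglyMeasurable (by fun_prop)

theorem integral_coord_ground_sq (i : Fin d) : ∫ p, p i * S.ground p * S.ground p = 0 := by
  have h := integral_neg_eq_self (fun p => p i * S.ground p * S.ground p)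
    (volume : Measure (EuclideanSpace ℝ (Fin d)))
  have e : ∀ p : EuclideanSpace ℝ (Fin d), (-p) i * S.ground (-p) * S.ground (-p)
      = -(p i * S.ground p * S.ground p) := fun p => by
    simp [ground]
  simp only [e, integral_neg] at h
  linarith

/-- The normalization constant of the Gaussian. -/
def gmass : ℝ := ∫ p, S.ground p ^ 2

theorem gmass_pos : 0 < S.gmass := by
  have h := GaussianFourier.integral_rexp_neg_mul_sq_norm (V := EuclideanSpace ℝ (Fin d)) S.cc_pos
  unfold gmass
  simp only [ground_sq]
  rw [h]
  have := S.cc_pos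
  positivity

/-- Integration by parts with `∂_i (g²) = -2c p_i g²`; the variance `1/(2c) = μ/β` is the reason for
the factor `√(β/μ)` in the unit vector. -/
theorem integral_coord_sq_ground_sq (i : Fin d) :
    ∫ p, (p i * S.ground p) ^ 2 = (2 * S.cc)⁻¹ * S.gmass := by
  have hc := S.cc_pos.ne'
  have hcoord : ContDiff ℝ ∞ fun p : EuclideanSpace ℝ (Fin d) => p i :=
    (EuclideanSpace.proj (𝕜 := ℝ) i).contDiff
  have hD : ∀ p, fderiv ℝ (fun p : EuclideanSpace ℝ (Fin d) => p i) p (EuclideanSpace.single i 1) = 1 :=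
    fun p => by
      have h : HasFDerivAt (fun p : EuclideanSpace ℝ (Fin d) => p i) _ p :=
        (EuclideanSpace.proj (𝕜 := ℝ) i).hasFDerivAt
      rw [h.fderiv]
      simp
  have hG : ∀ p, fderiv ℝ (fun p => S.ground p ^ 2) p (EuclideanSpace.single i 1)
      = -(2 * S.cc) * (p i * S.ground p ^ 2) := fun p => by
    have h := dirD_mul S.contDiff_ground S.contDiff_ground (EuclideanSpace.single i 1) p
    rw [dirD_ground] at h
    simp only [sq]
    refine h.trans ?_
    ring
  have hsq : ∀ p : EuclideanSpace ℝ (Fin d), p i * (p i * S.ground p ^ 2) = (p i * S.ground p) ^ 2 :=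
    fun p => by ring
  have i1 : Integrable fun p : EuclideanSpace ℝ (Fin d) => p i * S.ground p ^ 2 := by
    refine ((S.memLp_coord_ground i).integrable_mul S.memLp_ground).congr (.of_forall fun p => ?_)
    simp only [Pi.mul_apply]
    ring
  have key := integral_mul_fderiv_eq_neg_fderiv_mul_of_integrable
    (μ := (volume : Measure (EuclideanSpace ℝ (Fin d)))) (f := fun p => p i)
    (g := fun p => S.ground p ^ 2) (v := EuclideanSpace.single i 1)
    (by simp only [hD, one_mul]; exact S.integrable_ground_sq)
    (by
      simp only [hG, mul_left_comm _ (-(2 * S.cc)), hsq]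
      exact (S.integrable_coord_sq_ground_sq i).const_mul _)
    i1 (fun p _ => hcoord.differentiable_of_smooth p)
    (fun p _ => (S.contDiff_ground.pow 2).differentiable_of_smooth p)
  simp only [hD, hG, one_mul, mul_left_comm _ (-(2 * S.cc)), hsq] at key
  rw [integral_const_mul] at key
  have e : S.gmass = ∫ p, S.ground p ^ 2 := rfl
  rw [e, eq_inv_mul_iff_mul_eq₀ (mul_ne_zero two_ne_zero hc)]
  linarith

/-- The momentum average against the Gaussian ground state. -/
def average (u : Phase d → ℂ) (q : EuclideanSpace ℝ (Fin d)) : ℂ :=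
  ∫ p, u (q, p) * (S.ground p : ℂ)

theorem _root_.TestFn.slice {u : Phase d → ℂ} (hu : TestFn u) (q : EuclideanSpace ℝ (Fin d)) :
    TestFn fun p => u (q, p) := by
  refine ⟨hu.1.comp (contDiff_const.prodMk contDiff_id), ?_⟩
  refine HasCompactSupport.intro (hu.2.isCompact.image continuous_snd) fun p hp => ?_
  by_contra h
  exact hp ⟨(q, p), subset_tsupport _ h, rfl⟩

theorem fderiv_slice {u : Phase d → ℂ} (hu : ContDiff ℝ ∞ u) (q p : EuclideanSpace ℝ (Fin d))
    (i : Fin d) : dirD (EuclideanSpace.single i 1) (fun p => u (q, p)) p = dp i u (q, p) := by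
  have h : HasFDerivAt (fun p => u (q, p)) _ p :=
    (hu.differentiable_of_smooth (q, p)).hasFDerivAt.comp p
      ((hasFDerivAt_const q p).prodMk (hasFDerivAt_id p))
  unfold dirD
  rw [h.fderiv]
  simp [dp]

theorem enorm_fderiv_sq_le {F : EuclideanSpace ℝ (Fin d) → ℂ} (p : EuclideanSpace ℝ (Fin d)) :
    ‖fderiv ℝ F p‖ₑ ^ 2 ≤ ∑ i, ‖dirD (EuclideanSpace.single i 1) F p‖ₑ ^ 2 := by
  have h : ‖fderiv ℝ F p‖ ≤ √(∑ i, ‖dirD (EuclideanSpace.single i 1) F p‖ ^ 2) := by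
    refine ContinuousLinearMap.opNorm_le_bound _ (Real.sqrt_nonneg _) fun y => ?_
    have e : fderiv ℝ F p y = ∑ i, y i • dirD (EuclideanSpace.single i 1) F p := by
      conv_lhs => rw [euclidean_eq_sum y]
      simp [dirD, map_sum]
    rw [e, EuclideanSpace.norm_eq, ← Real.sqrt_mul (by positivity)]
    refine Real.le_sqrt_of_sq_le ?_
    calc _ ≤ (∑ i, ‖dirD (EuclideanSpace.single i 1) F p‖ * ‖y i‖) ^ 2 := by
          gcongr
          refine (norm_sum_le _ _).trans (Finset.sum_le_sum fun i _ => ?_)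
          rw [norm_smul, mul_comm]
      _ ≤ _ := Finset.sum_mul_sq_le_sq_mul_sq _ _ _
  have h2 : ‖fderiv ℝ F p‖ ^ 2 ≤ ∑ i, ‖dirD (EuclideanSpace.single i 1) F p‖ ^ 2 :=
    (Real.le_sqrt (norm_nonneg _) (by positivity)).1 h
  have h3 := ENNReal.ofReal_le_ofReal h2
  rw [ENNReal.ofReal_pow (norm_nonneg _), ofReal_norm,
    ENNReal.ofReal_sum_of_nonneg fun i _ => by positivity] at h3
  simpa only [ENNReal.ofReal_pow (norm_nonneg _), ofReal_norm] using h3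

/-- The spectral gap of the number operator. -/
theorem exists_number_gap : ∃ K : ℝ≥0∞, K ≠ ⊤ ∧ ∀ u : Phase d → ℂ, TestFn u →
    ∫⁻ x : Phase d, ‖(S.gmass : ℂ) * u x - S.average u x.1 * (S.ground x.2 : ℂ)‖ₑ ^ 2
      ≤ K * ∑ i, ∫⁻ x, ‖S.annihilation i u x‖ₑ ^ 2 := by
  obtain ⟨K, hK, hP⟩ := exists_gauss_poincare (E := EuclideanSpace ℝ (Fin d))
    (gaussMeasure_univ_ne_top S.cc_pos) (lintegral_norm_sq_gaussMeasure_ne_top S.cc_pos)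
  refine ⟨K, hK, fun u hu => ?_⟩
  have hg := S.contDiff_ground
  have hginv : ContDiff ℝ ∞ fun p => ((S.ground p : ℂ))⁻¹ :=
    hg.ofReal.inv fun p => Complex.ofReal_ne_zero.2 (S.ground_pos p).ne'
  have hg0 : ∀ p, (S.ground p : ℂ) ≠ 0 := fun p => Complex.ofReal_ne_zero.2 (S.ground_pos p).ne'
  set ν := gaussMeasure (EuclideanSpace ℝ (Fin d)) S.cc with hν
  have hdens : ∀ p, ENNReal.ofReal (Real.exp (-S.cc * ‖p‖ ^ 2)) = ‖(S.ground p : ℂ)‖ₑ ^ 2 := fun p => by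
    rw [← ground_sq, ENNReal.ofReal_pow (S.ground_pos p).le, ← ofReal_norm, Complex.norm_real,
      Real.norm_of_nonneg (S.ground_pos p).le]
  have hmass : ν.real Set.univ = S.gmass := by
    rw [hν, gaussMeasure, Measure.real, withDensity_apply _ MeasurableSet.univ, Measure.restrict_univ,
      ← ofReal_integral_eq_lintegral_ofReal (integrable_gauss S.cc_pos)
        (.of_forall fun p => (Real.exp_pos _).le), ENNReal.toReal_ofReal
        (integral_nonneg fun p => (Real.exp_pos _).le), gmass]
    simp only [ground_sq]
  have hslice : ∀ q, ∫⁻ p, ‖(S.gmass : ℂ) * u (q, p) - S.average u q * (S.ground p : ℂ)‖ₑ ^ 2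
      ≤ K * ∑ i, ∫⁻ p, ‖S.annihilation i u (q, p)‖ₑ ^ 2 := fun q => by
    -- Ground state representation on a momentum slice: for `F = u/g` one has `a_i u = g ∂_i F`, and
    -- `g²` is the density of the Gaussian measure, so the Poincaré inequality for `F` is the gap
    -- for `u`.
    have tF : TestFn fun p => ((S.ground p : ℂ))⁻¹ * u (q, p) := (hu.slice q).smooth_mul hginv
    have h := hP _ tF
    have hav : ∫ y, ((S.ground y : ℂ))⁻¹ * u (q, y) ∂ν = S.average u q := by
      rw [hν, gaussMeasure, integral_withDensity_eq_integral_toReal_smul (measurable_gauss _)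
        (.of_forall fun p => ENNReal.ofReal_lt_top), average]
      refine integral_congr_ae (.of_forall fun p => ?_)
      have hr : (ENNReal.ofReal (Real.exp (-S.cc * ‖p‖ ^ 2))).toReal = S.ground p ^ 2 := by
        rw [ENNReal.toReal_ofReal (Real.exp_pos _).le, ground_sq]
      simp only [hr]
      rw [Complex.real_smul]
      push_cast
      field_simp [hg0 p]
    have hcF : Continuous fun p => ((S.ground p : ℂ))⁻¹ * u (q, p) := tF.continuous
    have m1 : Measurable fun p => ‖(S.gmass : ℂ) * (((S.ground p : ℂ))⁻¹ * u (q, p))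
        - S.average u q‖ₑ ^ 2 :=
      ((continuous_const.mul hcF).sub continuous_const).enorm.measurable.pow_const 2
    rw [hmass, hav, hν, lintegral_gaussMeasure m1,
      lintegral_gaussMeasure ((tF.1.continuous_fderiv (by simp)).enorm.measurable.pow_const 2)] at h
    refine le_trans (lintegral_mono fun p => ?_) (h.trans ?_)
    · rw [hdens, ← mul_pow, ← enorm_mul]
      apply le_of_eq
      congr 2
      field_simp [hg0 p]
    · gcongr
      rw [← lintegral_finsetSum' _ fun i _ => ?_]
      swap
      · exact ((S.contDiff_annihilation hu.1 i).continuous.comp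
          (continuous_const.prodMk continuous_id)).enorm.measurable.pow_const 2 |>.aemeasurable
      refine lintegral_mono fun p => ?_
      refine (mul_le_mul_right (enorm_fderiv_sq_le p) _).trans ?_
      rw [Finset.mul_sum]
      refine Finset.sum_le_sum fun i _ => ?_
      rw [hdens, ← mul_pow, ← enorm_mul]
      apply le_of_eq
      congr 2
      have e1 := dirD_mul (hu.slice q).1 tF.1 (EuclideanSpace.single i 1) p
      have e2 : (fun p => (S.ground p : ℂ) * (((S.ground p : ℂ))⁻¹ * u (q, p))) = fun p => u (q, p) := by
        funext p
        rw [mul_inv_cancel_left₀ (hg0 p)]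
      have e3 := dirD_mul hg.ofReal tF.1 (EuclideanSpace.single i 1) p
      rw [e2, fderiv_slice hu.1, dirD_ofReal hg, dirD_ground] at e3
      rw [annihilation, e3]
      have hcc : S.invTemp / (2 * S.mass) = S.cc := rfl
      rw [hcc]
      push_cast
      field_simp [hg0 p]
      ring
  have hm : ∀ i, Measurable fun x => ‖S.annihilation i u x‖ₑ ^ 2 := fun i =>
    (S.contDiff_annihilation hu.1 i).continuous.enorm.measurable.pow_const 2
  have e1 : ∀ i, ∫⁻ x, ‖S.annihilation i u x‖ₑ ^ 2 = ∫⁻ q, ∫⁻ p, ‖S.annihilation i u (q, p)‖ₑ ^ 2 :=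
    fun i => lintegral_prod _ (hm i).aemeasurable
  refine (lintegral_prod_le _).trans ((lintegral_mono hslice).trans_eq ?_)
  rw [lintegral_const_mul' _ _ hK, lintegral_finsetSum _ fun i _ => (hm i).lintegral_prod_right']
  simp only [e1]

end LangevinSystem

/-! ### The Langevin operator on products -/

/-- Products of a function of the position and a function of the momentum. -/
def tens {d : ℕ} (f g : EuclideanSpace ℝ (Fin d) → ℝ) (x : Phase d) : ℂ := ((f x.1 * g x.2 : ℝ) : ℂ)

theorem contDiff_tens {d : ℕ} {f g : EuclideanSpace ℝ (Fin d) → ℝ} (hf : ContDiff ℝ ∞ f)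
    (hg : ContDiff ℝ ∞ g) : ContDiff ℝ ∞ (tens f g) := (hf.prod_mul hg).ofReal

namespace LangevinSystem

variable {d : ℕ} (S : LangevinSystem d)

theorem dq_tens {f g : EuclideanSpace ℝ (Fin d) → ℝ} (hf : ContDiff ℝ ∞ f)
    (hg : ContDiff ℝ ∞ g) (i : Fin d) (x : Phase d) : dq i (tens f g) x = tens (pd i f) g x := by
  have h := dirD_prod_mul hf hg (unitQ i) x
  have h2 := dirD_ofReal (hf.prod_mul hg) (unitQ i) x
  rw [h] at h2
  refine h2.trans ?_
  simp [tens, unitQ, pd, dirD]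

theorem dp_tens {f g : EuclideanSpace ℝ (Fin d) → ℝ} (hf : ContDiff ℝ ∞ f)
    (hg : ContDiff ℝ ∞ g) (i : Fin d) (x : Phase d) : dp i (tens f g) x = tens f (pd i g) x := by
  have h := dirD_prod_mul hf hg (unitP i) x
  have h2 := dirD_ofReal (hf.prod_mul hg) (unitP i) x
  rw [h] at h2
  refine h2.trans ?_
  simp [tens, unitP, pd, dirD]

theorem contDiff_coordE (i : Fin d) : ContDiff ℝ ∞ fun p : EuclideanSpace ℝ (Fin d) => p i :=
  (EuclideanSpace.proj (𝕜 := ℝ) i).contDiff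

/-- The first excited states of the number operator. -/
def excited (i : Fin d) (p : EuclideanSpace ℝ (Fin d)) : ℝ := p i * S.ground p

theorem contDiff_excited (i : Fin d) : ContDiff ℝ ∞ (S.excited i) :=
  (contDiff_coordE i).mul S.contDiff_ground

theorem pd_ground (k : Fin d) (p : EuclideanSpace ℝ (Fin d)) :
    pd k S.ground p = -(S.cc * p k) * S.ground p := S.dirD_ground k p

theorem pd_excited (i k : Fin d) (p : EuclideanSpace ℝ (Fin d)) :
    pd k (S.excited i) p = (if i = k then 1 else 0) * S.ground p - S.cc * p k * S.excited i p := by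
  have h := dirD_mul (contDiff_coordE i) S.contDiff_ground (EuclideanSpace.single k 1) p
  have h2 : dirD (EuclideanSpace.single k 1) (fun p : EuclideanSpace ℝ (Fin d) => p i) p
      = if i = k then 1 else 0 := by
    have h : HasFDerivAt (fun p : EuclideanSpace ℝ (Fin d) => p i) _ p :=
      (EuclideanSpace.proj (𝕜 := ℝ) i).hasFDerivAt
    unfold dirD
    rw [h.fderiv]
    simp
  rw [h2, dirD_ground] at h
  refine h.trans ?_
  rw [excited]
  ring

theorem annihilation_tens_ground {f : EuclideanSpace ℝ (Fin d) → ℝ} (hf : ContDiff ℝ ∞ f)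
    (k : Fin d) : S.annihilation k (tens f S.ground) = fun _ => 0 := by
  funext x
  rw [annihilation, dp_tens hf S.contDiff_ground, tens, tens, pd_ground]
  have hcc : S.invTemp / (2 * S.mass) = S.cc := rfl
  rw [hcc]
  push_cast
  ring

theorem annihilation_tens_excited {f : EuclideanSpace ℝ (Fin d) → ℝ} (hf : ContDiff ℝ ∞ f)
    (i k : Fin d) : S.annihilation k (tens f (S.excited i))
      = if i = k then tens f S.ground else fun _ => 0 := by
  funext x
  rw [annihilation, dp_tens hf (S.contDiff_excited i), tens, tens, pd_excited]
  have hcc : S.invTemp / (2 * S.mass) = S.cc := rfl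
  rw [hcc]
  split_ifs
  · simp only [tens]
    push_cast
    ring
  · push_cast
    ring

theorem creation_tens {f g : EuclideanSpace ℝ (Fin d) → ℝ} (hf : ContDiff ℝ ∞ f)
    (hg : ContDiff ℝ ∞ g) (k : Fin d) (x : Phase d) : S.creation k (tens f g) x
      = ((f x.1 * (-pd k g x.2 + S.cc * x.2 k * g x.2) : ℝ) : ℂ) := by
  rw [creation, dp_tens hf hg, tens, tens]
  have hcc : S.invTemp / (2 * S.mass) = S.cc := rfl
  rw [hcc]
  push_cast
  ring

theorem creation_zero (k : Fin d) (x : Phase d) : S.creation k (fun _ => 0) x = 0 := by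
  simp [creation, dp]

theorem number_tens_ground {f : EuclideanSpace ℝ (Fin d) → ℝ} (hf : ContDiff ℝ ∞ f) (x : Phase d) :
    S.number (tens f S.ground) x = 0 := by
  simp only [number, S.annihilation_tens_ground hf, creation_zero, Finset.sum_const_zero]

theorem number_tens_excited {f : EuclideanSpace ℝ (Fin d) → ℝ} (hf : ContDiff ℝ ∞ f) (i : Fin d)
    (x : Phase d) : S.number (tens f (S.excited i)) x = (2 * S.cc : ℂ) * tens f (S.excited i) x := by
  rw [number, Finset.sum_eq_single i]
  · rw [S.annihilation_tens_excited hf, if_pos rfl, S.creation_tens hf S.contDiff_ground, pd_ground,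
      tens, excited]
    push_cast
    ring
  · intro k _ hk
    rw [S.annihilation_tens_excited hf, if_neg hk.symm, creation_zero]
  · simp

theorem transport_tens {f g : EuclideanSpace ℝ (Fin d) → ℝ} (hf : ContDiff ℝ ∞ f)
    (hg : ContDiff ℝ ∞ g) (x : Phase d) : S.transport (tens f g) x
      = ((∑ i, (-(x.2 i / S.mass) * (pd i f x.1 * g x.2)
        + pd i S.potential x.1 * (f x.1 * pd i g x.2)) : ℝ) : ℂ) := by
  simp only [transport, dq_tens hf hg, dp_tens hf hg, tens]
  push_cast
  rfl

theorem invTemp_eq : S.invTemp = 2 * S.bb := by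
  rw [bb]
  ring

/-- In ladder form the transport is `-β⁻¹ Σ (a_i* α_i - α_i* a_i)`; the ground state is killed by
every `a_i`, so only the creation part survives. -/
theorem transport_tens_ground {f : EuclideanSpace ℝ (Fin d) → ℝ} (hf : ContDiff ℝ ∞ f)
    (x : Phase d) : S.transport (tens f S.ground) x
      = -((S.invTemp⁻¹ : ℝ) : ℂ) * ∑ i, S.creation i (tens (alpha S.bb S.potential i f) S.ground) x := by
  have hc := fun i => S.creation_tens (contDiff_alpha (b := S.bb) S.smooth hf i) S.contDiff_ground i x
  simp only [hc, S.transport_tens hf S.contDiff_ground]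
  rw [← Complex.ofReal_sum, ← Complex.ofReal_neg, ← Complex.ofReal_mul, Finset.mul_sum]
  congr 1
  refine Finset.sum_congr rfl fun i _ => ?_
  have hμ := S.mass_pos.ne'
  have hβ := S.invTemp_pos.ne'
  rw [pd_ground, alpha, cc, bb]
  field_simp
  ring

theorem transport_tens_excited {f : EuclideanSpace ℝ (Fin d) → ℝ} (hf : ContDiff ℝ ∞ f)
    (i : Fin d) (x : Phase d) : S.transport (tens f (S.excited i)) x
      = -((S.invTemp⁻¹ : ℝ) : ℂ) * ((∑ k, S.creation k (tens (alpha S.bb S.potential k f)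
          (S.excited i)) x) - tens (alphaStar S.bb S.potential i f) S.ground x) := by
  have hc := fun k => S.creation_tens (contDiff_alpha (b := S.bb) S.smooth hf k) (S.contDiff_excited i) k x
  have hα : tens (alphaStar S.bb S.potential i f) S.ground x
      = ((∑ k, if i = k then alphaStar S.bb S.potential k f x.1 * S.ground x.2 else 0 : ℝ) : ℂ) := by
    rw [Finset.sum_ite_eq Finset.univ i, if_pos (Finset.mem_univ _), tens]
  rw [hα]
  simp only [hc, S.transport_tens hf (S.contDiff_excited i)]
  rw [← Complex.ofReal_sum, ← Complex.ofReal_sub, ← Complex.ofReal_neg, ← Complex.ofReal_mul,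
    ← Finset.sum_sub_distrib, Finset.mul_sum]
  congr 1
  refine Finset.sum_congr rfl fun k _ => ?_
  have hμ := S.mass_pos.ne'
  have hβ := S.invTemp_pos.ne'
  rw [pd_excited, alpha, alphaStar, cc, bb]
  split_ifs with hik
  · subst hik
    rw [excited]
    field_simp
    ring
  · field_simp
    ring

section Pairing

variable {u : Phase d → ℂ} {f : EuclideanSpace ℝ (Fin d) → ℝ}

theorem integrable_tens_mul {g : EuclideanSpace ℝ (Fin d) → ℝ} (hf : ContDiff ℝ ∞ f)
    (hg : ContDiff ℝ ∞ g) (hu : TestFn u) : Integrable fun x => tens f g x * u x :=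
  (hu.smooth_mul (contDiff_tens hf hg)).integrable

theorem integrable_creation_tens_mul {g : EuclideanSpace ℝ (Fin d) → ℝ} (hf : ContDiff ℝ ∞ f)
    (hg : ContDiff ℝ ∞ g) (hu : TestFn u) (k : Fin d) :
    Integrable fun x => S.creation k (tens f g) x * u x :=
  (hu.smooth_mul (S.contDiff_creation (contDiff_tens hf hg) k)).integrable

/-- The formal adjoint maps `f g` to `β⁻¹ Σ a_i* (α_i f g)`. Moving the creation operator over, the
pairing sees `u` only through `a_i u`, which tends to zero along quasimodes. -/
theorem integral_tens_ground_mul_signedExpr (hf : ContDiff ℝ ∞ f) (hu : TestFn u) :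
    ∫ x, tens f S.ground x * S.signedExpr 1 u x = ((S.invTemp⁻¹ : ℝ) : ℂ) *
      ∑ i, ∫ x, tens (alpha S.bb S.potential i f) S.ground x * S.annihilation i u x := by
  have hα := fun i => contDiff_alpha (b := S.bb) S.smooth hf i
  have hg := S.contDiff_ground
  rw [S.integral_mul_signedExpr (contDiff_tens hf hg) hu]
  simp only [fun i => S.integral_mul_annihilation (contDiff_tens (hα i) hg) hu.1 (Or.inr hu.2) i]
  rw [← integral_finsetSum _ fun i _ => S.integrable_creation_tens_mul (hα i) hg hu i,
    ← integral_const_mul]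
  refine integral_congr_ae (.of_forall fun x => ?_)
  simp only [signedExpr, S.number_tens_ground hf, S.transport_tens_ground hf, ← Finset.sum_mul]
  push_cast
  ring

/-- Besides the eigenvalue of the number operator and terms in `a_k u`, lowering the excited state
produces `α_i* f` against the ground state. Taking `f = α_i φ` and summing over `i` makes the Witten
Laplacian of `φ` appear. -/
theorem integral_tens_excited_mul_signedExpr (hf : ContDiff ℝ ∞ f) (hu : TestFn u) (i : Fin d) :
    ∫ x, tens f (S.excited i) x * S.signedExpr 1 u x
      = ((2 * S.cc * S.kap : ℝ) : ℂ) * (∫ x, tens f (S.excited i) x * u x)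
        + ((S.invTemp⁻¹ : ℝ) : ℂ) * ((∑ k, ∫ x, tens (alpha S.bb S.potential k f) (S.excited i) x
            * S.annihilation k u x)
          - ∫ x, tens (alphaStar S.bb S.potential i f) S.ground x * u x) := by
  have hα := fun k => contDiff_alpha (b := S.bb) S.smooth hf k
  have hg := S.contDiff_ground
  have he := S.contDiff_excited i
  have i1 := integrable_tens_mul hf he hu
  have i2 := fun k => S.integrable_creation_tens_mul (hα k) he hu k
  have i3 := integrable_tens_mul (contDiff_alphaStar (b := S.bb) S.smooth hf i) hg hu
  have i4 : Integrable fun x => (∑ k, S.creation k (tens (alpha S.bb S.potential k f) (S.excited i)) x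
      * u x) - tens (alphaStar S.bb S.potential i f) S.ground x * u x :=
    (integrable_finsetSum _ fun k _ => i2 k).sub i3
  rw [S.integral_mul_signedExpr (contDiff_tens hf he) hu]
  simp only [fun k => S.integral_mul_annihilation (contDiff_tens (hα k) he) hu.1 (Or.inr hu.2) k]
  rw [← integral_finsetSum _ fun k _ => i2 k, ← integral_sub (integrable_finsetSum _ fun k _ => i2 k) i3,
    ← integral_const_mul, ← integral_const_mul,
    ← integral_add (i1.const_mul _) (i4.const_mul _)]
  refine integral_congr_ae (.of_forall fun x => ?_)
  simp only [signedExpr, S.number_tens_excited hf, S.transport_tens_excited hf, ← Finset.sum_mul]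
  push_cast
  ring

end Pairing

end LangevinSystem

/-! ### The normalized momentum -/

theorem norm_toLp_sq {α 𝕜 : Type*} [MeasurableSpace α] {ν : Measure α} [RCLike 𝕜] {f : α → 𝕜}
    (hf : MemLp f 2 ν) : ‖hf.toLp f‖ ^ 2 = ∫ x, ‖f x‖ ^ 2 ∂ν := by
  rw [Lp.norm_toLp, ← ENNReal.toReal_pow, eLpNorm_two_sq_eq hf,
    ENNReal.toReal_ofReal (integral_nonneg fun x => sq_nonneg _)]

section TensLp

open Filter Topology

variable {d : ℕ} {f g : EuclideanSpace ℝ (Fin d) → ℝ}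

theorem integrable_prod_sq (hf : MemLp f 2) (hg : MemLp g 2) :
    Integrable fun x : Phase d => (f x.1 * g x.2) ^ 2 := by
  simp only [mul_pow]
  exact hf.integrable_sq.mul_prod hg.integrable_sq

theorem memLp_tens (hf : MemLp f 2) (hg : MemLp g 2) : MemLp (tens f g) 2 := by
  have hm : AEStronglyMeasurable (fun x : Phase d => f x.1 * g x.2) volume :=
    hf.1.comp_fst.mul hg.1.comp_snd
  exact ((memLp_two_iff_integrable_sq hm).mpr (integrable_prod_sq hf hg)).ofReal

theorem integral_norm_tens_sq (f g : EuclideanSpace ℝ (Fin d) → ℝ) :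
    ∫ x, ‖tens f g x‖ ^ 2 = (∫ q, f q ^ 2) * ∫ p, g p ^ 2 := by
  have h := integral_prod_mul (μ := (volume : Measure (EuclideanSpace ℝ (Fin d))))
    (ν := (volume : Measure (EuclideanSpace ℝ (Fin d)))) (fun q => f q ^ 2) fun p => g p ^ 2
  rw [← h]
  refine integral_congr_ae (.of_forall fun x => ?_)
  simp only [tens, Complex.norm_real, Real.norm_eq_abs, sq_abs, mul_pow]

end TensLp

namespace LangevinSystem

open Filter Topology

variable {d : ℕ} (S : LangevinSystem d)

/-- The square root of the (unnormalized) Boltzmann weight of the position. -/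
def boltz (q : EuclideanSpace ℝ (Fin d)) : ℝ := Real.exp (-S.bb * S.potential q)

theorem boltz_pos (q : EuclideanSpace ℝ (Fin d)) : 0 < S.boltz q := Real.exp_pos _

theorem contDiff_boltz : ContDiff ℝ ∞ S.boltz := (contDiff_const.mul S.smooth).exp

theorem exp_neg_energy (x : Phase d) :
    Real.exp (-S.invTemp * S.energy x) = S.boltz x.1 ^ 2 * S.ground x.2 ^ 2 := by
  have hμ := S.mass_pos.ne'
  rw [ground_sq, boltz, ← Real.exp_nat_mul, ← Real.exp_add, energy, hamiltonian, cc, bb]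
  congr 1
  push_cast
  field_simp
  ring

theorem boost_mul (x : Phase d) : S.boost x * (S.boltz x.1 * S.ground x.2) = 1 := by
  have h : Real.exp (-S.invTemp * S.energy x) * S.boost x ^ 2 = 1 := by
    rw [boost, ← Real.exp_nat_mul, ← Real.exp_add, Real.exp_eq_one_iff]
    push_cast
    ring
  rw [exp_neg_energy] at h
  have h2 : (S.boost x * (S.boltz x.1 * S.ground x.2)) ^ 2 = 1 := by rw [← h]; ring
  have h3 : 0 < S.boost x * (S.boltz x.1 * S.ground x.2) :=
    mul_pos (S.boost_pos x) (mul_pos (S.boltz_pos _) (S.ground_pos _))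
  exact (pow_eq_one_iff_of_nonneg h3.le (by norm_num)).mp h2

/-- By Fubini almost every momentum slice of the Gibbs weight is integrable, and on a slice the
Gaussian factor is a positive constant. -/
theorem integrable_boltz_sq : Integrable fun q => S.boltz q ^ 2 := by
  have h : Integrable fun x : Phase d => S.boltz x.1 ^ 2 * S.ground x.2 ^ 2 :=
    S.integrable_gibbs.congr (.of_forall S.exp_neg_energy)
  obtain ⟨p, hp⟩ := h.prod_left_ae.exists
  refine (hp.mul_const (S.ground p ^ 2)⁻¹).congr (.of_forall fun q => ?_)
  exact mul_inv_cancel_right₀ (pow_pos (S.ground_pos p) 2).ne' _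

theorem memLp_boltz : MemLp S.boltz 2 :=
  (memLp_two_iff_integrable_sq S.contDiff_boltz.continuous.aestronglyMeasurable).mpr
    S.integrable_boltz_sq

theorem partition_eq : S.partition = (∫ q, S.boltz q ^ 2) * S.gmass := by
  rw [partition, gmass, ← integral_prod_mul]
  exact integral_congr_ae (.of_forall S.exp_neg_energy)

theorem pd_boltz (i : Fin d) (q : EuclideanSpace ℝ (Fin d)) :
    pd i S.boltz q = -S.bb * pd i S.potential q * S.boltz q := by
  have h := ((S.smooth.differentiable_of_smooth q).hasFDerivAt.const_mul (-S.bb)).exp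
  have h' : HasFDerivAt S.boltz _ q := h
  rw [pd, dirD, h'.fderiv]
  simp only [boltz, pd, dirD, smul_apply, smul_eq_mul]
  ring

theorem alpha_boltz (i : Fin d) : alpha S.bb S.potential i S.boltz = fun _ => 0 := by
  funext q
  rw [alpha, pd_boltz]
  ring

theorem alphaStar_boltz (i : Fin d) : alphaStar S.bb S.potential i S.boltz
    = fun q => S.invTemp * (pd i S.potential q * S.boltz q) := by
  funext q
  rw [alphaStar, pd_boltz, invTemp_eq]
  ring

theorem bb_pos : 0 < S.bb := half_pos S.invTemp_pos

/-- `α_k` annihilates `e^{-βV/2}`, so on its truncations `α_k` gives only the derivative of the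
cutoff, bounded uniformly in `n`; the gradient bound does the rest. -/
theorem exists_integral_gradient_boltz_cutoff_le (hV : WeaklyElliptic S.potential) :
    ∃ K : ℝ, ∀ (n : ℕ) (i : Fin d), ∫ q, (pd i S.potential q * (cutoff ((n : ℝ) + 1) q * S.boltz q)) ^ 2 ≤ K := by
  obtain ⟨C, hC⟩ := hV.hessBound S.smooth
  obtain ⟨K, hK, h⟩ := exists_gradient_bound S.bb_pos S.smooth hC
  obtain ⟨D, hD, hχ⟩ := exists_cutoff_bound (EuclideanSpace ℝ (Fin d))
  refine ⟨K * ((∑ _k : Fin d, D ^ 2 * ∫ q, S.boltz q ^ 2) + ∫ q, S.boltz q ^ 2), fun n i => ?_⟩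
  have hn : (0 : ℝ) < (n : ℝ) + 1 := by positivity
  have ht := testFn_cutoff (E := EuclideanSpace ℝ (Fin d)) hn
  have hψ : TestFn fun q => cutoff ((n : ℝ) + 1) q * S.boltz q := ht.mul_smooth S.contDiff_boltz
  have hα : ∀ k q, alpha S.bb S.potential k (fun q => cutoff ((n : ℝ) + 1) q * S.boltz q) q
      = pd k (cutoff ((n : ℝ) + 1)) q * S.boltz q := by
    intro k q
    have h1 := dirD_mul ht.1 S.contDiff_boltz (EuclideanSpace.single k 1) q
    have h2 := S.pd_boltz k q
    rw [pd] at h2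
    rw [alpha, pd, h1, h2]
    simp only [pd]
    ring
  have hpd : ∀ k, ContDiff ℝ ∞ (pd k S.potential) := fun k => S.smooth.pd k
  refine le_trans ?_ ((h _ hψ).trans (mul_le_mul_of_nonneg_left (add_le_add
    (Finset.sum_le_sum fun k _ => ?_) ?_) hK))
  · refine integral_mono (hψ.smooth_mul (hpd i)).sq.integrable
      (hψ.sq.smooth_mul (contDiff_const.add (ContDiff.sum fun k _ => (hpd k).pow 2))).integrable
      fun q => ?_
    have h3 : pd i S.potential q ^ 2 ≤ ∑ k, pd k S.potential q ^ 2 :=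
      Finset.single_le_sum (f := fun k => pd k S.potential q ^ 2) (fun k _ => sq_nonneg _)
        (Finset.mem_univ i)
    simp only [mul_pow]
    exact mul_le_mul_of_nonneg_right (by linarith) (by positivity)
  · rw [← integral_const_mul]
    refine integral_mono (testFn_alpha S.smooth hψ k).sq.integrable
      (S.integrable_boltz_sq.const_mul _) fun q => ?_
    simp only [hα, mul_pow]
    refine mul_le_mul_of_nonneg_right ?_ (sq_nonneg _)
    have h4 := hχ _ hn q (EuclideanSpace.single k 1)
    rw [PiLp.norm_single, norm_one, mul_one] at h4
    change |pd k (cutoff ((n : ℝ) + 1)) q| ≤ _ at h4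
    have h5 : D / ((n : ℝ) + 1) ≤ D := div_le_self hD (by linarith [n.cast_nonneg (α := ℝ)])
    exact sq_le_sq' (by linarith [(abs_le.mp h4).1]) ((abs_le.mp h4).2.trans h5)
  · refine integral_mono hψ.sq.integrable S.integrable_boltz_sq fun q => ?_
    simp only [mul_pow]
    exact mul_le_of_le_one_left (sq_nonneg _)
      (pow_le_one₀ (cutoff_nonneg _ _) (cutoff_le_one _ _))

/-- Fatou's lemma along the truncations. This integrability puts the momentum in the domains of the
operator and of its adjoint. -/
theorem memLp_gradient_boltz (hV : WeaklyElliptic S.potential) (i : Fin d) :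
    MemLp (fun q => pd i S.potential q * S.boltz q) 2 := by
  obtain ⟨K, hK⟩ := S.exists_integral_gradient_boltz_cutoff_le hV
  have hs : ContDiff ℝ ∞ (pd i S.potential) := S.smooth.pd i
  have hc : Continuous fun q => pd i S.potential q * S.boltz q :=
    (hs.mul S.contDiff_boltz).continuous
  rw [memLp_two_iff_integrable_sq hc.aestronglyMeasurable]
  refine ⟨(hc.pow 2).aestronglyMeasurable, ?_⟩
  have hlim : Tendsto (fun n : ℕ => (n : ℝ) + 1) atTop atTop :=
    tendsto_atTop_add_const_right _ _ tendsto_natCast_atTop_atTop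
  have hn : ∀ n : ℕ, (0 : ℝ) < (n : ℝ) + 1 := fun n => by positivity
  have ht : ∀ n : ℕ, TestFn fun q => (pd i S.potential q * (cutoff ((n : ℝ) + 1) q * S.boltz q)) ^ 2 :=
    fun n => (((testFn_cutoff (hn n)).mul_smooth S.contDiff_boltz).smooth_mul hs).sq
  rw [hasFiniteIntegral_iff_ofReal (.of_forall fun q => sq_nonneg _)]
  have e : ∀ q, liminf (fun n : ℕ => ENNReal.ofReal
      ((pd i S.potential q * (cutoff ((n : ℝ) + 1) q * S.boltz q)) ^ 2)) atTop
      = ENNReal.ofReal ((pd i S.potential q * S.boltz q) ^ 2) := by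
    intro q
    refine Tendsto.liminf_eq (ENNReal.tendsto_ofReal ?_)
    have h := (((tendsto_cutoff hlim q).mul_const (S.boltz q)).const_mul (pd i S.potential q)).pow 2
    rwa [one_mul] at h
  simp only [← e]
  refine (lintegral_liminf_le fun n => (ht n).continuous.measurable.ennreal_ofReal).trans_lt
    (lt_of_le_of_lt (b := ENNReal.ofReal K) ?_ ENNReal.ofReal_lt_top)
  refine liminf_le_of_le (by isBoundedDefault) fun b hb => ?_
  obtain ⟨n, h⟩ := hb.exists
  refine h.trans ?_
  rw [← ofReal_integral_eq_lintegral_ofReal (ht n).integrable (.of_forall fun q => sq_nonneg _)]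
  exact ENNReal.ofReal_le_ofReal (hK n i)

/-- The function `p_j e^{-βH/2}`. -/
def momentumState (j : Fin d) : Phase d → ℂ := tens S.boltz (S.excited j)

theorem contDiff_momentumState (j : Fin d) : ContDiff ℝ ∞ (S.momentumState j) :=
  contDiff_tens S.contDiff_boltz (S.contDiff_excited j)

theorem memLp_momentumState (j : Fin d) : MemLp (S.momentumState j) 2 :=
  memLp_tens S.memLp_boltz (S.memLp_coord_ground j)

theorem conj_momentumState (j : Fin d) (x : Phase d) :
    starRingEnd ℂ (S.momentumState j x) = S.momentumState j x := Complex.conj_ofReal _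

/-- Since `α_k` annihilates `e^{-βV/2}`, only the eigenvalue `2cκ` of the number part and the
lowering term `β⁻¹ α_j*` contribute. -/
theorem signedExpr_momentumState (j : Fin d) (s : ℝ) (x : Phase d) :
    S.signedExpr s (S.momentumState j) x = ((2 * S.cc * S.kap : ℝ) : ℂ) * S.momentumState j x
      + (s : ℂ) * tens (fun q => pd j S.potential q * S.boltz q) S.ground x := by
  have hβ := S.invTemp_pos.ne'
  have h0 : ∀ k, S.creation k (tens (fun _ => 0) (S.excited j)) x = 0 := by
    intro k
    have : tens (fun _ => 0) (S.excited j) = fun _ => (0 : ℂ) := by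
      funext y
      simp [tens]
    rw [this, creation_zero]
  rw [signedExpr, momentumState, S.number_tens_excited S.contDiff_boltz,
    S.transport_tens_excited S.contDiff_boltz, alphaStar_boltz]
  simp only [alpha_boltz, h0, Finset.sum_const_zero, tens]
  have h1 : (S.invTemp : ℂ) ≠ 0 := Complex.ofReal_ne_zero.mpr hβ
  push_cast
  field_simp
  ring

theorem memLp_signedExpr_momentumState (hV : WeaklyElliptic S.potential) (j : Fin d) (s : ℝ) :
    MemLp (S.signedExpr s (S.momentumState j)) 2 := by
  refine (((S.memLp_momentumState j).const_mul ((2 * S.cc * S.kap : ℝ) : ℂ)).add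
    ((memLp_tens (S.memLp_gradient_boltz hV j) S.memLp_ground).const_mul (s : ℂ))).congr_norm
    (S.contDiff_signedExpr (S.contDiff_momentumState j) s).continuous.aestronglyMeasurable
    (.of_forall fun x => ?_)
  rw [signedExpr_momentumState]
  rfl

/-- The momentum state is not compactly supported; membership in the minimal graph follows from the
weak characterization of the domain. -/
theorem momentumState_mem_flatGraph (hV : WeaklyElliptic S.potential) (j : Fin d) :
    ((S.memLp_momentumState j).toLp (S.momentumState j),
      (S.memLp_signedExpr_momentumState hV j 1).toLp _) ∈ S.flatGraph := by
  refine S.mem_flatGraph_of_weak fun ψ hψ => ?_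
  have h := S.integral_mul_signedExpr (S.contDiff_momentumState j) hψ (-1)
  rw [neg_neg] at h
  have e1 := (S.memLp_signedExpr_momentumState hV j 1).coeFn_toLp.mul (ae_eq_refl ψ)
  have e2 := (S.memLp_momentumState j).coeFn_toLp.mul (ae_eq_refl (S.signedExpr (-1) ψ))
  exact (integral_congr_ae e1).trans (h.symm.trans (integral_congr_ae e2).symm)

theorem inner_momentumState_of_mem_flatGraph (hV : WeaklyElliptic S.potential) (j : Fin d)
    {x : Lp ℂ 2 (volume : Measure (Phase d)) × Lp ℂ 2 (volume : Measure (Phase d))}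
    (hx : x ∈ S.flatGraph) : inner ℂ ((S.memLp_momentumState j).toLp (S.momentumState j)) x.2
      = inner ℂ ((S.memLp_signedExpr_momentumState hV j (-1)).toLp _) x.1 := by
  have h := S.integral_mul_snd_of_mem_flatGraph hx (S.contDiff_momentumState j)
    (S.memLp_momentumState j) (S.memLp_signedExpr_momentumState hV j (-1))
  rw [L2.inner_def, L2.inner_def]
  refine Eq.trans ?_ (h.trans ?_)
  · refine integral_congr_ae ?_
    filter_upwards [(S.memLp_momentumState j).coeFn_toLp] with y hy
    rw [hy, RCLike.inner_apply, conj_momentumState, mul_comm]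
  · refine integral_congr_ae ?_
    filter_upwards [(S.memLp_signedExpr_momentumState hV j (-1)).coeFn_toLp] with y hy
    have hc : starRingEnd ℂ (S.signedExpr (-1) (S.momentumState j) y)
        = S.signedExpr (-1) (S.momentumState j) y := by
      rw [signedExpr_momentumState, map_add, map_mul, map_mul, conj_momentumState,
        Complex.conj_ofReal, Complex.conj_ofReal, tens, Complex.conj_ofReal]
    rw [hy, RCLike.inner_apply, hc, mul_comm]

/-- The normalization constant of `momentumState`. -/
def momentumScale : ℝ := √(S.invTemp / S.mass) / √S.partition

theorem norm_momentumState_sq (j : Fin d) :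
    ‖(S.memLp_momentumState j).toLp (S.momentumState j)‖ ^ 2 = S.mass / S.invTemp * S.partition := by
  have h1 : ∫ x, ‖S.momentumState j x‖ ^ 2 = S.mass / S.invTemp * S.partition := by
    rw [momentumState, integral_norm_tens_sq, partition_eq]
    have h2 : ∫ p, S.excited j p ^ 2 = (2 * S.cc)⁻¹ * S.gmass := S.integral_coord_sq_ground_sq j
    have hμ := S.mass_pos.ne'
    have hβ := S.invTemp_pos.ne'
    rw [h2, cc]
    field_simp
  rw [norm_toLp_sq, h1]

theorem norm_smul_momentumState (j : Fin d) :
    ‖(S.momentumScale : ℂ) • (S.memLp_momentumState j).toLp (S.momentumState j)‖ = 1 := by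
  have hμ := S.mass_pos
  have hβ := S.invTemp_pos
  have hZ := S.partition_pos
  refine (pow_eq_one_iff_of_nonneg (norm_nonneg _) two_ne_zero).mp ?_
  rw [norm_smul, mul_pow, norm_momentumState_sq, Complex.norm_real, Real.norm_eq_abs, sq_abs,
    momentumScale, div_pow, Real.sq_sqrt (by positivity), Real.sq_sqrt hZ.le]
  field_simp

theorem U_momentumState_ae_eq (j : Fin d) :
    S.U ((S.momentumScale : ℂ) • (S.memLp_momentumState j).toLp (S.momentumState j))
      =ᵐ[S.gibbs] fun x => ((√(S.invTemp / S.mass) * x.2 j : ℝ) : ℂ) := by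
  have hZ := Real.sqrt_pos.mpr S.partition_pos
  filter_upwards [S.coeFn_U ((S.momentumScale : ℂ) • (S.memLp_momentumState j).toLp _),
    S.gibbs_ac.ae_le (Lp.coeFn_smul (S.momentumScale : ℂ) ((S.memLp_momentumState j).toLp _)),
    S.gibbs_ac.ae_le (S.memLp_momentumState j).coeFn_toLp] with x h1 h2 h3
  rw [h1, h2, Pi.smul_apply, h3, smul_eq_mul, momentumState, tens, weight_eq, momentumScale,
    excited, ← Complex.ofReal_mul, ← Complex.ofReal_mul]
  congr 1
  have h4 := S.boost_mul x
  field_simp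
  linear_combination (√(S.invTemp / S.mass) * x.2 j) * h4

end LangevinSystem

/-! ### Bounded and null sequences in `L²` -/

section Sequences

open Filter Topology

variable {α 𝕜 : Type*} [MeasurableSpace α] {ν : Measure α} [RCLike 𝕜]

/-- Sequences which are bounded in `L²`. -/
def L2Bdd (ν : Measure α) (f : ℕ → α → 𝕜) : Prop :=
  (∀ n, MemLp (f n) 2 ν) ∧ ∃ B : ℝ, ∀ n, ∫ x, ‖f n x‖ ^ 2 ∂ν ≤ B

/-- Sequences which tend to zero in `L²`. -/
def L2Null (ν : Measure α) (f : ℕ → α → 𝕜) : Prop :=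
  (∀ n, MemLp (f n) 2 ν) ∧ Tendsto (fun n => ∫ x, ‖f n x‖ ^ 2 ∂ν) atTop (𝓝 0)

theorem norm_integral_mul_le {f g : α → 𝕜} (hf : MemLp f 2 ν) (hg : MemLp g 2 ν) :
    ‖∫ x, f x * g x ∂ν‖ ≤ √(∫ x, ‖f x‖ ^ 2 ∂ν) * √(∫ x, ‖g x‖ ^ 2 ∂ν) := by
  have h : ∀ {f : α → 𝕜} (hf : MemLp f 2 ν), ‖hf.toLp f‖ = √(∫ x, ‖f x‖ ^ 2 ∂ν) := by
    intro f hf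
    rw [← Real.sqrt_sq (norm_nonneg (hf.toLp f)), norm_toLp_sq]
  have e : ∫ x, ‖f x‖ ^ 2 ∂ν = ∫ x, ‖(star f) x‖ ^ 2 ∂ν := by simp
  rw [integral_mul_eq_inner hf hg, e, ← h hf.star, ← h hg]
  exact norm_inner_le_norm _ _

theorem integral_norm_add_sq_le {f g : α → 𝕜} (hf : MemLp f 2 ν) (hg : MemLp g 2 ν) :
    ∫ x, ‖f x + g x‖ ^ 2 ∂ν ≤ 2 * (∫ x, ‖f x‖ ^ 2 ∂ν) + 2 * ∫ x, ‖g x‖ ^ 2 ∂ν := by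
  have hf2 := (memLp_two_iff_integrable_sq_norm hf.1).mp hf
  have hg2 := (memLp_two_iff_integrable_sq_norm hg.1).mp hg
  rw [← integral_const_mul, ← integral_const_mul,
    ← integral_add (hf2.const_mul 2) (hg2.const_mul 2)]
  refine integral_mono ((memLp_two_iff_integrable_sq_norm (hf.add hg).1).mp (hf.add hg))
    ((hf2.const_mul 2).add (hg2.const_mul 2)) fun x => ?_
  have h := norm_add_le (f x) (g x)
  have h2 : ‖f x + g x‖ ^ 2 ≤ (‖f x‖ + ‖g x‖) ^ 2 := pow_le_pow_left₀ (norm_nonneg _) h 2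
  simp only
  nlinarith [sq_nonneg (‖f x‖ - ‖g x‖)]

variable {f g : ℕ → α → 𝕜}

theorem L2Null.bdd (h : L2Null ν f) : L2Bdd ν f := by
  obtain ⟨B, hB⟩ := h.2.bddAbove_range
  exact ⟨h.1, B, fun n => hB ⟨n, rfl⟩⟩

theorem L2Bdd.add (hf : L2Bdd ν f) (hg : L2Bdd ν g) : L2Bdd ν fun n x => f n x + g n x := by
  obtain ⟨hf, A, hA⟩ := hf
  obtain ⟨hg, B, hB⟩ := hg
  refine ⟨fun n => (hf n).add (hg n), 2 * A + 2 * B, fun n => ?_⟩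
  linarith [integral_norm_add_sq_le (hf n) (hg n), hA n, hB n]

theorem L2Null.add (hf : L2Null ν f) (hg : L2Null ν g) : L2Null ν fun n x => f n x + g n x := by
  refine ⟨fun n => (hf.1 n).add (hg.1 n), ?_⟩
  refine squeeze_zero (fun n => integral_nonneg fun x => sq_nonneg _)
    (fun n => integral_norm_add_sq_le (hf.1 n) (hg.1 n)) ?_
  simpa using (hf.2.const_mul 2).add (hg.2.const_mul 2)

theorem L2Bdd.const_mul (hf : L2Bdd ν f) {a : ℕ → 𝕜} {C : ℝ} (ha : ∀ n, ‖a n‖ ≤ C) :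
    L2Bdd ν fun n x => a n * f n x := by
  obtain ⟨hf, A, hA⟩ := hf
  refine ⟨fun n => (hf n).const_mul _, C ^ 2 * A, fun n => ?_⟩
  simp only [norm_mul, mul_pow, integral_const_mul]
  exact mul_le_mul (pow_le_pow_left₀ (norm_nonneg _) (ha n) 2) (hA n)
    (integral_nonneg fun x => sq_nonneg _) (sq_nonneg _)

theorem L2Null.const_mul (hf : L2Null ν f) (a : 𝕜) : L2Null ν fun n x => a * f n x := by
  refine ⟨fun n => (hf.1 n).const_mul _, ?_⟩
  simp only [norm_mul, mul_pow, integral_const_mul]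
  simpa using hf.2.const_mul (‖a‖ ^ 2)

theorem L2Bdd.of_le (hf : ∀ n, MemLp (f n) 2 ν) (hg : L2Bdd ν g) {C : ℝ} (hC : 0 ≤ C)
    (h : ∀ n, ∫ x, ‖f n x‖ ^ 2 ∂ν ≤ C * ∫ x, ‖g n x‖ ^ 2 ∂ν) : L2Bdd ν f := by
  obtain ⟨-, B, hB⟩ := hg
  exact ⟨hf, C * B, fun n => (h n).trans (mul_le_mul_of_nonneg_left (hB n) hC)⟩

theorem L2Bdd.tendsto_integral_mul (hf : L2Bdd ν f) (hg : L2Null ν g) :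
    Tendsto (fun n => ∫ x, f n x * g n x ∂ν) atTop (𝓝 0) := by
  obtain ⟨hf, B, hB⟩ := hf
  refine squeeze_zero_norm (fun n => (norm_integral_mul_le (hf n) (hg.1 n)).trans
    (mul_le_mul_of_nonneg_right (Real.sqrt_le_sqrt (hB n)) (Real.sqrt_nonneg _))) ?_
  have h := ((Real.continuous_sqrt.tendsto 0).comp hg.2).const_mul √B
  rwa [Real.sqrt_zero, mul_zero] at h

theorem L2Null.tendsto_integral_mul (hf : L2Null ν f) (hg : L2Bdd ν g) :
    Tendsto (fun n => ∫ x, f n x * g n x ∂ν) atTop (𝓝 0) := by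
  simpa only [mul_comm] using hg.tendsto_integral_mul hf

end Sequences

section SequencesTens

variable {d : ℕ} {f : ℕ → EuclideanSpace ℝ (Fin d) → ℝ} {g : EuclideanSpace ℝ (Fin d) → ℝ}

theorem L2Bdd.tens (hf : L2Bdd volume f) (hg : MemLp g 2) :
    L2Bdd volume fun n => tens (f n) g := by
  obtain ⟨hf, B, hB⟩ := hf
  refine ⟨fun n => memLp_tens (hf n) hg, B * ∫ p, g p ^ 2, fun n => ?_⟩
  rw [integral_norm_tens_sq]
  refine mul_le_mul_of_nonneg_right ?_ (integral_nonneg fun x => sq_nonneg _)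
  simpa using hB n

theorem L2Null.tens (hf : L2Null volume f) (hg : MemLp g 2) :
    L2Null volume fun n => tens (f n) g := by
  refine ⟨fun n => memLp_tens (hf.1 n) hg, ?_⟩
  simp only [integral_norm_tens_sq]
  simpa using hf.2.mul_const (∫ p, g p ^ 2)

end SequencesTens

/-! ### Momentum averages of test functions. -/

namespace LangevinSystem

variable {d : ℕ} (S : LangevinSystem d)

theorem re_integral_tens_ground_mul {f : EuclideanSpace ℝ (Fin d) → ℝ} (hf : ContDiff ℝ ∞ f)
    {u : Phase d → ℂ} (hu : TestFn u) : (∫ x, tens f S.ground x * u x).re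
      = ∫ q, f q * (S.average u q).re := by
  have hi := integrable_tens_mul hf S.contDiff_ground hu
  have h1 : ∫ x, tens f S.ground x * u x = ∫ q, (f q : ℂ) * S.average u q := by
    refine (integral_prod (μ := (volume : Measure (EuclideanSpace ℝ (Fin d))))
      (ν := (volume : Measure (EuclideanSpace ℝ (Fin d)))) _ hi).trans ?_
    refine integral_congr_ae (.of_forall fun q => ?_)
    simp only [average, tens]
    rw [← integral_const_mul]
    refine integral_congr_ae (.of_forall fun p => ?_)
    simp only
    push_cast
    ring
  have h2 : Integrable fun q => (f q : ℂ) * S.average u q := by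
    refine hi.integral_prod_left.congr (.of_forall fun q => ?_)
    simp only [average, tens]
    rw [← integral_const_mul]
    refine integral_congr_ae (.of_forall fun p => ?_)
    simp only
    push_cast
    ring
  rw [h1]
  refine (integral_re h2).symm.trans (integral_congr_ae (.of_forall fun q => ?_))
  simp

theorem norm_average_sq_le {u : Phase d → ℂ} (hu : TestFn u) (q : EuclideanSpace ℝ (Fin d)) :
    ‖S.average u q‖ ^ 2 ≤ S.gmass * ∫ p, ‖u (q, p)‖ ^ 2 := by
  have h := norm_integral_mul_le ((hu.slice q).memLp (μ := volume) 2) (S.memLp_ground.ofReal (K := ℂ))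
  have h2 := pow_le_pow_left₀ (norm_nonneg _) h 2
  rw [mul_pow, Real.sq_sqrt (integral_nonneg fun x => sq_nonneg _),
    Real.sq_sqrt (integral_nonneg fun x => sq_nonneg _), mul_comm] at h2
  have e : ∫ p, ‖((S.ground p : ℝ) : ℂ)‖ ^ 2 = S.gmass := by
    simp only [Complex.norm_real, Real.norm_eq_abs, sq_abs]
    rfl
  rw [← e]
  exact h2

theorem aestronglyMeasurable_average {u : Phase d → ℂ} (hu : TestFn u) :
    AEStronglyMeasurable (S.average u) volume := by
  have h : StronglyMeasurable fun x : Phase d => u x * ((S.ground x.2 : ℝ) : ℂ) :=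
    (hu.continuous.mul (Complex.continuous_ofReal.comp
      (S.contDiff_ground.continuous.comp continuous_snd))).stronglyMeasurable
  exact h.integral_prod_right.aestronglyMeasurable

theorem integrable_norm_sq_slice {u : Phase d → ℂ} (hu : TestFn u) :
    Integrable (fun q => ∫ p, ‖u (q, p)‖ ^ 2) ∧
      ∫ q, ∫ p, ‖u (q, p)‖ ^ 2 = ∫ x, ‖u x‖ ^ 2 := by
  have h : Integrable (fun x : Phase d => ‖u x‖ ^ 2)
      ((volume : Measure (EuclideanSpace ℝ (Fin d))).prod volume) :=
    (memLp_two_iff_integrable_sq_norm hu.continuous.aestronglyMeasurable).mp (hu.memLp 2)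
  exact ⟨h.integral_prod_left, (integral_prod _ h).symm⟩

theorem memLp_average {u : Phase d → ℂ} (hu : TestFn u) : MemLp (S.average u) 2 := by
  rw [memLp_two_iff_integrable_sq_norm (S.aestronglyMeasurable_average hu)]
  refine ((integrable_norm_sq_slice hu).1.const_mul S.gmass).mono'
    ((S.aestronglyMeasurable_average hu).norm.pow 2) (.of_forall fun q => ?_)
  rw [Real.norm_of_nonneg (sq_nonneg _)]
  exact S.norm_average_sq_le hu q

theorem integral_norm_average_sq_le {u : Phase d → ℂ} (hu : TestFn u) :
    ∫ q, ‖S.average u q‖ ^ 2 ≤ S.gmass * ∫ x, ‖u x‖ ^ 2 := by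
  rw [← (integrable_norm_sq_slice hu).2, ← integral_const_mul]
  exact integral_mono
    ((memLp_two_iff_integrable_sq_norm (S.aestronglyMeasurable_average hu)).mp (S.memLp_average hu))
    ((integrable_norm_sq_slice hu).1.const_mul _) (S.norm_average_sq_le hu)

end LangevinSystem

/-! ### Approximate eigenfunctions -/

section Aux

open Filter Topology

variable {d : ℕ}

theorem lintegral_enorm_sq_eq {α F : Type*} [MeasurableSpace α] {ν : Measure α}
    [NormedAddCommGroup F] {f : α → F} (hf : MemLp f 2 ν) :
    ∫⁻ x, ‖f x‖ₑ ^ 2 ∂ν = ENNReal.ofReal (∫ x, ‖f x‖ ^ 2 ∂ν) := by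
  rw [ofReal_integral_eq_lintegral_ofReal ((memLp_two_iff_integrable_sq_norm hf.1).mp hf)
    (.of_forall fun x => sq_nonneg _)]
  refine lintegral_congr fun x => ?_
  rw [← ofReal_norm, ENNReal.ofReal_pow (norm_nonneg _)]

theorem memLp_mul_prod {w : EuclideanSpace ℝ (Fin d) → ℂ} {g : EuclideanSpace ℝ (Fin d) → ℝ}
    (hw : MemLp w 2) (hg : MemLp g 2) : MemLp (fun x : Phase d => w x.1 * ((g x.2 : ℝ) : ℂ)) 2 := by
  refine (memLp_tens hw.norm hg).congr_norm
    (hw.1.comp_fst.mul (Complex.continuous_ofReal.comp_aestronglyMeasurable hg.1).comp_snd)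
    (.of_forall fun x => ?_)
  simp [tens]

theorem integral_norm_mul_prod_sq (w : EuclideanSpace ℝ (Fin d) → ℂ)
    (g : EuclideanSpace ℝ (Fin d) → ℝ) :
    ∫ x : Phase d, ‖w x.1 * ((g x.2 : ℝ) : ℂ)‖ ^ 2 = (∫ q, ‖w q‖ ^ 2) * ∫ p, g p ^ 2 := by
  rw [← integral_norm_tens_sq (fun q => ‖w q‖) g]
  refine integral_congr_ae (.of_forall fun x => ?_)
  simp [tens]

end Aux

namespace LangevinSystem

open Filter Topology
open scoped ComplexConjugate

variable {d : ℕ} (S : LangevinSystem d)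

theorem exists_integral_number_gap : ∃ K : ℝ, ∀ u : Phase d → ℂ, TestFn u →
    ∫ x : Phase d, ‖(S.gmass : ℂ) * u x - S.average u x.1 * (S.ground x.2 : ℂ)‖ ^ 2
      ≤ K * ∑ i, ∫ x, ‖S.annihilation i u x‖ ^ 2 := by
  obtain ⟨K, hK, h⟩ := S.exists_number_gap
  refine ⟨K.toReal, fun u hu => ?_⟩
  have hs : 0 ≤ ∑ i, ∫ x, ‖S.annihilation i u x‖ ^ 2 :=
    Finset.sum_nonneg fun i _ => integral_nonneg fun x => sq_nonneg _
  have hD : MemLp (fun x : Phase d => (S.gmass : ℂ) * u x - S.average u x.1 * (S.ground x.2 : ℂ)) 2 :=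
    ((hu.memLp 2).const_mul _).sub (memLp_mul_prod (S.memLp_average hu) S.memLp_ground)
  have h1 := h u hu
  simp only [fun i => lintegral_enorm_sq_eq ((S.testFn_annihilation hu i).memLp (μ := volume) 2)] at h1
  rw [lintegral_enorm_sq_eq hD, ← ENNReal.ofReal_sum_of_nonneg
    (fun i _ => integral_nonneg fun x => sq_nonneg _), ← ENNReal.ofReal_toReal hK,
    ← ENNReal.ofReal_mul ENNReal.toReal_nonneg] at h1
  exact (ENNReal.ofReal_le_ofReal_iff (by positivity)).mp h1

/-- Sequences of test functions which solve `A u = z u + a v` approximately, for the normalized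
momentum `v`, and are approximately orthogonal to `v`. -/
structure Quasimode (j : Fin d) (z : ℂ) (u : ℕ → Phase d → ℂ) (a : ℕ → ℂ) : Prop where
  test : ∀ n, TestFn (u n)
  bdd : L2Bdd volume u
  coeff : ∃ C, ∀ n, ‖a n‖ ≤ C
  null : L2Null volume fun n x =>
    S.signedExpr 1 (u n) x - z * u n x - a n * S.momentumState j x
  orth : Tendsto (fun n => ∫ x, S.momentumState j x * u n x) atTop (𝓝 0)

namespace Quasimode

variable {S} {j : Fin d} {z : ℂ} {u : ℕ → Phase d → ℂ} {a : ℕ → ℂ}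

/-- Used with the factor `-i`, which reduces imaginary parts of the momentum average to real parts.
-/
theorem const_mul (h : S.Quasimode j z u a) (w : ℂ) :
    S.Quasimode j z (fun n x => w * u n x) fun n => w * a n := by
  obtain ⟨C, hC⟩ := h.coeff
  refine ⟨fun n => (h.test n).const_mul w, h.bdd.const_mul (C := ‖w‖) fun _ => le_rfl,
    ⟨‖w‖ * C, fun n => ?_⟩, ?_, ?_⟩
  · rw [norm_mul]
    exact mul_le_mul_of_nonneg_left (hC n) (norm_nonneg _)
  · have e : ∀ n x, S.signedExpr 1 (fun y => w * u n y) x = w * S.signedExpr 1 (u n) x := by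
      intro n x
      have := congrFun (S.flatKolmogorovExpr_linear.2 w (u n) (h.test n).1) x
      rw [flatKolmogorovExpr_eq, flatKolmogorovExpr_eq] at this
      exact this
    convert h.null.const_mul w using 3 with n x
    rw [e]
    ring
  · have := h.orth.const_mul w
    simp only [← integral_const_mul, mul_zero] at this
    refine this.congr fun n => integral_congr_ae (.of_forall fun x => ?_)
    simp only
    ring

theorem bdd_const (j : Fin d) : L2Bdd volume fun _ : ℕ => S.momentumState j :=
  ⟨fun _ => S.memLp_momentumState j, _, fun _ => le_rfl⟩

theorem bdd_signedExpr (h : S.Quasimode j z u a) :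
    L2Bdd volume fun n => S.signedExpr 1 (u n) := by
  obtain ⟨C, hC⟩ := h.coeff
  convert (h.null.bdd.add (h.bdd.const_mul (a := fun _ => z) (C := ‖z‖) fun _ => le_rfl)).add
    ((bdd_const j).const_mul hC) using 3 with n x
  ring

theorem tendsto_pairing (h : S.Quasimode j z u a) {f : ℕ → Phase d → ℂ} (hf : L2Bdd volume f) :
    Tendsto (fun n => (∫ x, f n x * S.signedExpr 1 (u n) x) - z * (∫ x, f n x * u n x)
      - a n * ∫ x, f n x * S.momentumState j x) atTop (𝓝 0) := by
  refine (hf.tendsto_integral_mul h.null).congr fun n => ?_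
  have i1 : Integrable fun x => f n x * S.signedExpr 1 (u n) x :=
    (hf.1 n).integrable_mul ((S.testFn_signedExpr (h.test n) 1).memLp (μ := volume) 2)
  have i2 : Integrable fun x => f n x * u n x := (hf.1 n).integrable_mul ((h.test n).memLp (μ := volume) 2)
  have i3 : Integrable fun x => f n x * S.momentumState j x :=
    (hf.1 n).integrable_mul (S.memLp_momentumState j)
  rw [← integral_const_mul, ← integral_const_mul]
  have i4 : Integrable fun x => f n x * S.signedExpr 1 (u n) x - z * (f n x * u n x) :=
    i1.sub (i2.const_mul z)
  rw [← integral_sub i1 (i2.const_mul z),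
    ← integral_sub i4 (i3.const_mul (a n))]
  refine integral_congr_ae (.of_forall fun x => ?_)
  simp only
  ring

theorem tendsto_coeff_mul (h : S.Quasimode j z u a) {b : ℕ → ℂ} (hb : Tendsto b atTop (𝓝 0)) :
    Tendsto (fun n => a n * b n) atTop (𝓝 0) := by
  obtain ⟨C, hC⟩ := h.coeff
  refine squeeze_zero_norm (a := fun n => C * ‖b n‖) (fun n => ?_) ?_
  · rw [norm_mul]
    exact mul_le_mul_of_nonneg_right (hC n) (norm_nonneg _)
  · simpa using hb.norm.const_mul C

theorem bdd_conj (h : S.Quasimode j z u a) : L2Bdd volume fun n x => conj (u n x) := by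
  refine L2Bdd.of_le (fun n => (h.test n).conj.memLp 2) h.bdd zero_le_one fun n => ?_
  simp

/-- Pair the approximate equation with the conjugate of `u n` and take real parts: the term in `z`
is imaginary, the momentum term vanishes by asymptotic orthogonality, and the energy identity leaves
the dissipation. -/
theorem tendsto_sum_annihilation (h : S.Quasimode j z u a) (hz : z.re = 0) :
    Tendsto (fun n => ∑ i, ∫ x, ‖S.annihilation i (u n) x‖ ^ 2) atTop (𝓝 0) := by
  have h1 := h.tendsto_pairing h.bdd_conj
  have h2 : Tendsto (fun n => a n * ∫ x, conj (u n x) * S.momentumState j x) atTop (𝓝 0) := by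
    refine h.tendsto_coeff_mul ?_
    have := (Complex.continuous_conj.tendsto 0).comp h.orth
    rw [map_zero] at this
    refine this.congr fun n => ?_
    rw [Function.comp_apply, ← integral_conj]
    refine integral_congr_ae (.of_forall fun x => ?_)
    simp only [map_mul, conj_momentumState]
    ring
  have h0 := h1.add h2
  rw [add_zero] at h0
  have h3 := (Complex.continuous_re.tendsto 0).comp h0
  have h4 := h3.const_mul S.kap⁻¹
  simp only [Complex.zero_re, mul_zero] at h4
  refine h4.congr fun n => ?_
  have e : (z * ∫ x, conj (u n x) * u n x).re = 0 := by
    have : ∫ x, conj (u n x) * u n x = ((∫ x, ‖u n x‖ ^ 2 : ℝ) : ℂ) := by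
      rw [← integral_complex_ofReal]
      refine integral_congr_ae (.of_forall fun x => ?_)
      simp only [Complex.conj_mul', Complex.ofReal_pow]
    rw [this, Complex.mul_re, hz, Complex.ofReal_im]
    ring
  rw [Function.comp_apply, sub_add_cancel, Complex.sub_re, e, sub_zero,
    S.re_integral_conj_mul_signedExpr (h.test n) 1, inv_mul_cancel_left₀ S.kap_pos.ne']

theorem null_annihilation (h : S.Quasimode j z u a) (hz : z.re = 0) (i : Fin d) :
    L2Null volume fun n => S.annihilation i (u n) :=
  ⟨fun n => (S.testFn_annihilation (h.test n) i).memLp 2,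
    squeeze_zero (fun _ => integral_nonneg fun _ => sq_nonneg _)
      (fun n => Finset.single_le_sum (f := fun i => ∫ x, ‖S.annihilation i (u n) x‖ ^ 2)
        (fun _ _ => integral_nonneg fun _ => sq_nonneg _) (Finset.mem_univ i))
      (h.tendsto_sum_annihilation hz)⟩

/-- By the spectral gap, vanishing dissipation forces the modes onto the ground state in momentum;
only their averages remain to be controlled. -/
theorem null_sub_average (h : S.Quasimode j z u a) (hz : z.re = 0) :
    L2Null volume fun n x => (S.gmass : ℂ) * u n x - S.average (u n) x.1 * (S.ground x.2 : ℂ) := by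
  obtain ⟨K, hK⟩ := S.exists_integral_number_gap
  refine ⟨fun n => (((h.test n).memLp 2).const_mul _).sub
    (memLp_mul_prod (S.memLp_average (h.test n)) S.memLp_ground), ?_⟩
  refine squeeze_zero (fun n => integral_nonneg fun x => sq_nonneg _) (fun n => hK _ (h.test n)) ?_
  simpa using (h.tendsto_sum_annihilation hz).const_mul K

theorem bdd_re_average (h : S.Quasimode j z u a) :
    L2Bdd volume fun n q => (S.average (u n) q).re := by
  obtain ⟨-, B, hB⟩ := h.bdd
  refine ⟨fun n => (S.memLp_average (h.test n)).re, S.gmass * B, fun n => ?_⟩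
  refine le_trans ?_ ((S.integral_norm_average_sq_le (h.test n)).trans
    (mul_le_mul_of_nonneg_left (hB n) S.gmass_pos.le))
  refine integral_mono ((memLp_two_iff_integrable_sq_norm
    (S.memLp_average (h.test n)).re.1).mp (S.memLp_average (h.test n)).re)
    ((memLp_two_iff_integrable_sq_norm (S.memLp_average (h.test n)).1).mp
      (S.memLp_average (h.test n))) fun q => ?_
  exact pow_le_pow_left₀ (norm_nonneg _) (Complex.abs_re_le_norm _) 2

end Quasimode

end LangevinSystem

/-! ### Approximate eigenfunctions are null sequences -/

theorem l2Bdd_of_testFn {d : ℕ} {f : ℕ → EuclideanSpace ℝ (Fin d) → ℝ} (hf : ∀ n, TestFn (f n))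
    {B : ℝ} (h : ∀ n, ∫ q, f n q ^ 2 ≤ B) : L2Bdd volume f :=
  ⟨fun n => (hf n).memLp 2, B, fun n => by simpa using h n⟩

/-! ### Energy bounds for the shifted Witten Laplacian. -/

section Resolvent

variable {d : ℕ} {b : ℝ} {V : EuclideanSpace ℝ (Fin d) → ℝ}

theorem integral_add_witten_mul (hV : ContDiff ℝ ∞ V) {φ : EuclideanSpace ℝ (Fin d) → ℝ}
    (hφ : TestFn φ) (l : ℝ) : ∫ q, (l * φ q + witten b V φ q) * φ q
      = l * (∫ q, φ q ^ 2) + ∑ i, ∫ q, alpha b V i φ q ^ 2 := by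
  rw [← integral_witten_mul hV hφ, ← integral_const_mul,
    ← integral_add (hφ.sq.const_mul l).integrable ((testFn_witten hV hφ).mul_smooth hφ.1).integrable]
  refine integral_congr_ae (.of_forall fun q => ?_)
  simp only
  ring

theorem sum_integral_alpha_sq_nonneg (b : ℝ) (V φ : EuclideanSpace ℝ (Fin d) → ℝ) :
    0 ≤ ∑ i, ∫ q, alpha b V i φ q ^ 2 :=
  Finset.sum_nonneg fun _ _ => integral_nonneg fun _ => sq_nonneg _

/-- Pair `(l + Σ α_i* α_i) φ` with `φ` and use Young's inequality, the term `φ²/2` being absorbed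
because `l ≥ 1`. -/
theorem integral_sq_add_sum_alpha_le (hV : ContDiff ℝ ∞ V) {φ : EuclideanSpace ℝ (Fin d) → ℝ}
    (hφ : TestFn φ) {l : ℝ} (hl : 1 ≤ l) :
    (∫ q, φ q ^ 2) + ∑ i, ∫ q, alpha b V i φ q ^ 2
      ≤ ∫ q, (l * φ q + witten b V φ q) ^ 2 := by
  have hs : TestFn fun q => l * φ q + witten b V φ q :=
    (hφ.const_mul l).add (testFn_witten hV hφ)
  have h1 := integral_add_witten_mul (b := b) hV hφ l
  have h2 : ∫ q, (l * φ q + witten b V φ q) * φ q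
      ≤ ∫ q, (2⁻¹ * (l * φ q + witten b V φ q) ^ 2 + 2⁻¹ * φ q ^ 2) := by
    refine integral_mono (hs.mul_smooth hφ.1).integrable
      ((hs.sq.const_mul _).add (hφ.sq.const_mul _)).integrable fun q => ?_
    simp only
    nlinarith [sq_nonneg (l * φ q + witten b V φ q - φ q)]
  rw [integral_add (hs.sq.const_mul _).integrable (hφ.sq.const_mul _).integrable,
    integral_const_mul, integral_const_mul] at h2
  have h3 : 0 ≤ ∫ q, φ q ^ 2 := integral_nonneg fun _ => sq_nonneg _
  have h4 := sum_integral_alpha_sq_nonneg b V φ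
  nlinarith

end Resolvent

namespace LangevinSystem.Quasimode

open Filter Topology

variable {d : ℕ} {S : LangevinSystem d} {j : Fin d} {z : ℂ} {u : ℕ → Phase d → ℂ} {a : ℕ → ℂ}

/-- Solving the resolvent equation only approximately, but with test functions, keeps every later
integration by parts elementary. -/
theorem exists_potentials (h : S.Quasimode j z u a) (hV : WeaklyElliptic S.potential) :
    ∃ l : ℝ, 1 ≤ l ∧ ∃ φ : ℕ → EuclideanSpace ℝ (Fin d) → ℝ, (∀ n, TestFn (φ n)) ∧
      L2Null volume fun n q =>
        l * φ n q + witten S.bb S.potential (φ n) q - (S.average (u n) q).re := by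
  obtain ⟨C, hC⟩ := hV.hessBound S.smooth
  obtain ⟨l, hl, hd⟩ := exists_witten_dense S.smooth hC S.bb
  have hk := h.bdd_re_average.1
  choose φ hφ hle using fun n : ℕ => hd _ (hk n) (1 / ((n : ℝ) + 1)) (by positivity)
  have hm : ∀ n, MemLp (fun q => l * φ n q + witten S.bb S.potential (φ n) q
      - (S.average (u n) q).re) 2 := fun n =>
    ((((hφ n).const_mul l).add (testFn_witten S.smooth (hφ n))).memLp 2).sub (hk n)
  refine ⟨l, hl, φ, hφ, hm, (tendsto_eLpNorm_two_iff hm).mp ?_⟩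
  refine tendsto_of_tendsto_of_tendsto_of_le_of_le tendsto_const_nhds ?_ (fun _ => zero_le) hle
  have := ENNReal.tendsto_ofReal tendsto_one_div_add_atTop_nhds_zero_nat
  rwa [ENNReal.ofReal_zero] at this

variable {l : ℝ} {φ : ℕ → EuclideanSpace ℝ (Fin d) → ℝ}

theorem bdd_resolvent (h : S.Quasimode j z u a) (hn : L2Null volume fun n q =>
      l * φ n q + witten S.bb S.potential (φ n) q - (S.average (u n) q).re) :
    L2Bdd volume fun n q => l * φ n q + witten S.bb S.potential (φ n) q := by
  simpa using hn.bdd.add h.bdd_re_average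

/-- Zeroth and first order bounds come from the energy identity, second order ones from elliptic
regularity after writing the Witten Laplacian as `(l φ + Wφ) - l φ`. -/
theorem exists_potential_bounds (hV : WeaklyElliptic S.potential) (hl : 1 ≤ l)
    (hφ : ∀ n, TestFn (φ n))
    (hs : L2Bdd volume fun n q => l * φ n q + witten S.bb S.potential (φ n) q) :
    L2Bdd volume φ ∧ (∀ i, L2Bdd volume fun n => alpha S.bb S.potential i (φ n)) ∧
      ∀ i k, L2Bdd volume fun n =>
        alpha S.bb S.potential k (alpha S.bb S.potential i (φ n)) := by
  obtain ⟨C, hC⟩ := hV.hessBound S.smooth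
  obtain ⟨K, hK, he⟩ := exists_elliptic_bound S.bb_pos S.smooth hC
  have hW := fun n => testFn_witten (b := S.bb) S.smooth (hφ n)
  have hα := fun n i => testFn_alpha (b := S.bb) S.smooth (hφ n) i
  obtain ⟨-, B, hB⟩ := hs
  simp only [Real.norm_eq_abs, sq_abs] at hB
  have h1 := fun n => (integral_sq_add_sum_alpha_le (b := S.bb) S.smooth (hφ n) hl).trans (hB n)
  have h2 := fun n => sum_integral_alpha_sq_nonneg S.bb S.potential (φ n)
  have h3 : ∀ n, 0 ≤ ∫ q, φ n q ^ 2 := fun n => integral_nonneg fun _ => sq_nonneg _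
  have h4 : ∀ n, ∫ q, witten S.bb S.potential (φ n) q ^ 2 ≤ 2 * B + 2 * l ^ 2 * B := by
    intro n
    have h5 : ∫ q, witten S.bb S.potential (φ n) q ^ 2
        ≤ ∫ q, (2 * (l * φ n q + witten S.bb S.potential (φ n) q) ^ 2 + 2 * l ^ 2 * φ n q ^ 2) := by
      refine integral_mono (hW n).sq.integrable
        (((((hφ n).const_mul l).add (hW n)).sq.const_mul _).add ((hφ n).sq.const_mul _)).integrable
        fun q => ?_
      simp only
      nlinarith [sq_nonneg (2 * l * φ n q + witten S.bb S.potential (φ n) q)]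
    rw [integral_add ((((hφ n).const_mul l).add (hW n)).sq.const_mul _).integrable
      ((hφ n).sq.const_mul _).integrable, integral_const_mul, integral_const_mul] at h5
    refine h5.trans (add_le_add (mul_le_mul_of_nonneg_left (hB n) two_pos.le)
      (mul_le_mul_of_nonneg_left ?_ (by positivity)))
    linarith [h1 n, h2 n]
  refine ⟨l2Bdd_of_testFn hφ (B := B) fun n => by linarith [h1 n, h2 n], fun i =>
    l2Bdd_of_testFn (fun n => hα n i) (B := B) fun n => ?_, fun i k =>
    l2Bdd_of_testFn (fun n => testFn_alpha S.smooth (hα n i) k)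
      (B := K * ((2 * B + 2 * l ^ 2 * B) + B)) fun n => ?_⟩
  · have := Finset.single_le_sum (f := fun i => ∫ q, alpha S.bb S.potential i (φ n) q ^ 2)
      (fun i _ => integral_nonneg fun _ => sq_nonneg _) (Finset.mem_univ i)
    linarith [h1 n, h3 n]
  · refine le_trans ?_ ((he _ (hφ n)).trans (mul_le_mul_of_nonneg_left
      (add_le_add (h4 n) (by linarith [h1 n, h3 n])) hK))
    refine le_trans ?_ (Finset.single_le_sum (f := fun i => ∑ k, ∫ q, alpha S.bb S.potential k
      (alpha S.bb S.potential i (φ n)) q ^ 2) (fun i _ => Finset.sum_nonneg fun k _ =>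
        integral_nonneg fun _ => sq_nonneg _) (Finset.mem_univ i))
    exact Finset.single_le_sum (f := fun k => ∫ q, alpha S.bb S.potential k
      (alpha S.bb S.potential i (φ n)) q ^ 2) (fun k _ => integral_nonneg fun _ => sq_nonneg _)
      (Finset.mem_univ k)

/-- The momentum is odd against an even Gaussian. This removes the unknown multiplier `a n` when
testing with ground states. -/
theorem integral_tens_ground_mul_momentumState (f : EuclideanSpace ℝ (Fin d) → ℝ) (j : Fin d) :
    ∫ x, tens f S.ground x * S.momentumState j x = 0 := by
  have h1 := integral_prod_mul (μ := (volume : Measure (EuclideanSpace ℝ (Fin d))))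
    (ν := (volume : Measure (EuclideanSpace ℝ (Fin d)))) (fun q => f q * S.boltz q)
    fun p => p j * S.ground p * S.ground p
  rw [S.integral_coord_ground_sq, mul_zero] at h1
  have e : ∀ x : Phase d, tens f S.ground x * S.momentumState j x
      = ((f x.1 * S.boltz x.1 * (x.2 j * S.ground x.2 * S.ground x.2) : ℝ) : ℂ) := by
    intro x
    simp only [momentumState, tens, excited]
    push_cast
    ring
  simp only [e, integral_complex_ofReal]
  exact Complex.ofReal_eq_zero.mpr h1

/-- Testing the approximate equation with `φ_n g` gives `z ⟨φ_n g, u_n⟩ ≈ β⁻¹ Σ ⟨α_i φ_n g, a_i u_n⟩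
→ 0`, and `z` can be divided out. -/
theorem tendsto_integral_tens_ground (h : S.Quasimode j z u a) (hz : z.re = 0) (hz0 : z ≠ 0)
    (hφ : ∀ n, TestFn (φ n)) (hb : L2Bdd volume φ)
    (hα : ∀ i, L2Bdd volume fun n => alpha S.bb S.potential i (φ n)) :
    Tendsto (fun n => ∫ x, tens (φ n) S.ground x * u n x) atTop (𝓝 0) := by
  have h1 := h.tendsto_pairing (hb.tens S.memLp_ground)
  simp only [integral_tens_ground_mul_momentumState, mul_zero, sub_zero,
    fun n => S.integral_tens_ground_mul_signedExpr (hφ n).1 (h.test n)] at h1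
  have h2 := (tendsto_finsetSum Finset.univ fun i _ => ((hα i).tens S.memLp_ground).tendsto_integral_mul
    (h.null_annihilation hz i)).const_mul ((S.invTemp⁻¹ : ℝ) : ℂ)
  have h3 := (h2.sub h1).const_mul z⁻¹
  simp only [Finset.sum_const_zero, mul_zero, sub_zero, sub_sub_cancel,
    inv_mul_cancel_left₀ hz0] at h3
  exact h3

/-- Test with `α_i φ_n p_i g`, which tends to zero in `L²` while `A u_n` stays bounded. In the
expansion the terms in `a_k u_n` vanish because the second order `α_k α_i φ_n` are bounded, so the
lowering term must vanish as well. -/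
theorem tendsto_integral_alphaStar (h : S.Quasimode j z u a) (hz : z.re = 0)
    (hφ : ∀ n, TestFn (φ n)) (hn : ∀ i, L2Null volume fun n => alpha S.bb S.potential i (φ n))
    (hα : ∀ i k, L2Bdd volume fun n => alpha S.bb S.potential k (alpha S.bb S.potential i (φ n)))
    (i : Fin d) :
    Tendsto (fun n => ∫ x, tens (alphaStar S.bb S.potential i (alpha S.bb S.potential i (φ n)))
      S.ground x * u n x) atTop (𝓝 0) := by
  have h1 := ((hn i).tens (S.memLp_coord_ground i)).tendsto_integral_mul h.bdd_signedExpr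
  have h2 := (((hn i).tens (S.memLp_coord_ground i)).tendsto_integral_mul h.bdd).const_mul
    ((2 * S.cc * S.kap : ℝ) : ℂ)
  have h3 := tendsto_finsetSum Finset.univ fun k _ =>
    ((hα i k).tens (S.memLp_coord_ground i)).tendsto_integral_mul (h.null_annihilation hz k)
  have h4 := h3.sub ((h1.sub h2).const_mul (S.invTemp : ℂ))
  simp only [Finset.sum_const_zero, mul_zero, sub_zero] at h4
  refine h4.congr fun n => ?_
  have e := S.integral_tens_excited_mul_signedExpr
    (contDiff_alpha (b := S.bb) S.smooth (hφ n).1 i) (h.test n) i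
  have hβ : (S.invTemp : ℂ) ≠ 0 := Complex.ofReal_ne_zero.mpr S.invTemp_pos.ne'
  change _ - (S.invTemp : ℂ) * ((∫ x, tens (alpha S.bb S.potential i (φ n)) (S.excited i) x
    * S.signedExpr 1 (u n) x) - ((2 * S.cc * S.kap : ℝ) : ℂ) * ∫ x, tens
      (alpha S.bb S.potential i (φ n)) (S.excited i) x * u n x) = _
  rw [e, add_sub_cancel_left, Complex.ofReal_inv, mul_inv_cancel_left₀ hβ]
  exact sub_sub_cancel _ _

/-- With `k_n` the real average and `s_n = l φ_n + Wφ_n ≈ k_n`, the first test gives `⟨φ_n, k_n⟩ →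
0` and so `α_i φ_n → 0`; the second then gives `⟨Wφ_n, k_n⟩ → 0`; together `‖k_n‖² ≈ ⟨s_n, k_n⟩ →
0`. -/
theorem tendsto_re_average (h : S.Quasimode j z u a) (hV : WeaklyElliptic S.potential)
    (hz : z.re = 0) (hz0 : z ≠ 0) : L2Null volume fun n q => (S.average (u n) q).re := by
  obtain ⟨l, hl, φ, hφ, hn⟩ := h.exists_potentials hV
  have hs := h.bdd_resolvent hn
  obtain ⟨hb, hα, hαα⟩ := exists_potential_bounds hV hl hφ hs
  have hsm := S.smooth
  have hW := fun n => testFn_witten (b := S.bb) hsm (hφ n)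
  have hst := fun n => ((hφ n).const_mul l).add (hW n)
  have hk := h.bdd_re_average
  have h1 : Tendsto (fun n => ∫ q, φ n q * (S.average (u n) q).re) atTop (𝓝 0) := by
    have := (Complex.continuous_re.tendsto 0).comp
      (h.tendsto_integral_tens_ground hz hz0 hφ hb hα)
    exact this.congr fun n => S.re_integral_tens_ground_mul (hφ n).1 (h.test n)
  -- The form of the shifted Witten Laplacian at `φ_n` is `⟨φ_n, s_n⟩ = ⟨φ_n, s_n - k_n⟩ + ⟨φ_n,
  -- k_n⟩`.
  have h2 : Tendsto (fun n => l * (∫ q, φ n q ^ 2)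
      + ∑ i, ∫ q, alpha S.bb S.potential i (φ n) q ^ 2) atTop (𝓝 0) := by
    have h3 := (hb.tendsto_integral_mul hn).add h1
    rw [add_zero] at h3
    refine h3.congr fun n => ?_
    have i1 : Integrable fun q => φ n q * (S.average (u n) q).re := (hb.1 n).integrable_mul (hk.1 n)
    have i2 : Integrable fun q => φ n q * (l * φ n q + witten S.bb S.potential (φ n) q
      - (S.average (u n) q).re) := (hb.1 n).integrable_mul (hn.1 n)
    rw [← integral_add_witten_mul hsm (hφ n), ← integral_add i2 i1]
    refine integral_congr_ae (.of_forall fun q => ?_)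
    simp only
    ring
  have hnull : ∀ i, L2Null volume fun n => alpha S.bb S.potential i (φ n) := fun i => by
    refine ⟨(hα i).1, squeeze_zero (fun _ => integral_nonneg fun _ => sq_nonneg _) (fun n => ?_) h2⟩
    have h4 := Finset.single_le_sum (f := fun i => ∫ q, alpha S.bb S.potential i (φ n) q ^ 2)
      (fun i _ => integral_nonneg fun _ => sq_nonneg _) (Finset.mem_univ i)
    have h5 : 0 ≤ ∫ q, φ n q ^ 2 := integral_nonneg fun _ => sq_nonneg _
    simp only [Real.norm_eq_abs, sq_abs] at h4 ⊢
    nlinarith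
  have h6 : Tendsto (fun n => ∫ q, witten S.bb S.potential (φ n) q * (S.average (u n) q).re) atTop
      (𝓝 0) := by
    have h7 := tendsto_finsetSum Finset.univ fun i _ => (Complex.continuous_re.tendsto 0).comp
      (h.tendsto_integral_alphaStar hz hφ hnull hαα i)
    simp only [Complex.zero_re, Finset.sum_const_zero] at h7
    refine h7.congr fun n => ?_
    have ht : ∀ i, TestFn (alphaStar S.bb S.potential i (alpha S.bb S.potential i (φ n))) :=
      fun i => testFn_alphaStar hsm (testFn_alpha hsm (hφ n) i) i
    have i1 : ∀ i ∈ Finset.univ, Integrable fun q => alphaStar S.bb S.potential i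
        (alpha S.bb S.potential i (φ n)) q * (S.average (u n) q).re :=
      fun i _ => ((ht i).memLp 2).integrable_mul (hk.1 n)
    simp only [Function.comp_apply, fun i => S.re_integral_tens_ground_mul (ht i).1 (h.test n)]
    rw [← integral_finsetSum _ i1]
    simp only [witten, Finset.sum_mul]
  refine ⟨hk.1, ?_⟩
  -- `‖k_n‖² = l ⟨φ_n, k_n⟩ + ⟨Wφ_n, k_n⟩ - ⟨s_n - k_n, k_n⟩`.
  have h8 := ((h1.const_mul l).add h6).sub (hn.tendsto_integral_mul hk)
  simp only [mul_zero, add_zero, sub_zero] at h8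
  refine h8.congr fun n => ?_
  have i1 : Integrable fun q => φ n q * (S.average (u n) q).re := (hb.1 n).integrable_mul (hk.1 n)
  have i2 : Integrable fun q => witten S.bb S.potential (φ n) q * (S.average (u n) q).re :=
    ((hW n).memLp 2).integrable_mul (hk.1 n)
  have i3 : Integrable fun q => l * (φ n q * (S.average (u n) q).re)
      + witten S.bb S.potential (φ n) q * (S.average (u n) q).re := (i1.const_mul l).add i2
  have i4 : Integrable fun q => (l * φ n q + witten S.bb S.potential (φ n) q
      - (S.average (u n) q).re) * (S.average (u n) q).re := (hn.1 n).integrable_mul (hk.1 n)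
  rw [← integral_const_mul, ← integral_add (i1.const_mul l) i2, ← integral_sub i3 i4]
  refine integral_congr_ae (.of_forall fun q => ?_)
  simp only [Real.norm_eq_abs, sq_abs]
  ring

theorem null_average (h : S.Quasimode j z u a) (hV : WeaklyElliptic S.potential)
    (hz : z.re = 0) (hz0 : z ≠ 0) : L2Null volume fun n => S.average (u n) := by
  have h1 := (h.tendsto_re_average hV hz hz0).2
  have h2 := ((h.const_mul (-Complex.I)).tendsto_re_average hV hz hz0).2
  have hm := fun n => S.memLp_average (h.test n)
  have e : ∀ n q, (S.average (fun x => -Complex.I * u n x) q).re = (S.average (u n) q).im := by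
    intro n q
    have : S.average (fun x => -Complex.I * u n x) q = -Complex.I * S.average (u n) q := by
      simp only [average, ← integral_const_mul, mul_assoc]
    rw [this]
    simp
  refine ⟨hm, ?_⟩
  have h3 := h1.add h2
  rw [add_zero] at h3
  refine h3.congr fun n => ?_
  simp only [e]
  have i1 : Integrable fun q => ‖(S.average (u n) q).re‖ ^ 2 :=
    (memLp_two_iff_integrable_sq_norm (hm n).re.1).mp (hm n).re
  have i2 : Integrable fun q => ‖(S.average (u n) q).im‖ ^ 2 :=
    (memLp_two_iff_integrable_sq_norm (hm n).im.1).mp (hm n).im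
  rw [← integral_add i1 i2]
  refine integral_congr_ae (.of_forall fun q => ?_)
  simp only [Real.norm_eq_abs, sq_abs, Complex.sq_norm, Complex.normSq_apply]
  ring

theorem null_modes (h : S.Quasimode j z u a) (hV : WeaklyElliptic S.potential)
    (hz : z.re = 0) (hz0 : z ≠ 0) : L2Null volume u := by
  have h1 := h.null_average hV hz hz0
  have h2 : L2Null volume fun n (x : Phase d) => S.average (u n) x.1 * (S.ground x.2 : ℂ) := by
    refine ⟨fun n => memLp_mul_prod (h1.1 n) S.memLp_ground, ?_⟩
    simp only [integral_norm_mul_prod_sq]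
    simpa using h1.2.mul_const (∫ p, S.ground p ^ 2)
  have h3 := ((h.null_sub_average hz).add h2).const_mul (S.gmass : ℂ)⁻¹
  simpa only [sub_add_cancel, inv_mul_cancel_left₀ (Complex.ofReal_ne_zero.mpr S.gmass_pos.ne')]
    using h3

end LangevinSystem.Quasimode

/-! ### The spectrum of the orthogonal generator -/

section Lp

open Filter Topology

theorem tendsto_toLp_iff {α 𝕜 : Type*} [MeasurableSpace α] {ν : Measure α} [RCLike 𝕜]
    {f : ℕ → α → 𝕜} (hf : ∀ n, MemLp (f n) 2 ν) :
    Tendsto (fun n => (hf n).toLp (f n)) atTop (𝓝 0) ↔ L2Null ν f := by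
  have h : L2Null ν f ↔ Tendsto (fun n => ‖(hf n).toLp (f n)‖ ^ 2) atTop (𝓝 0) := by
    simp only [norm_toLp_sq, L2Null, hf, implies_true, true_and]
  rw [h, tendsto_zero_iff_norm_tendsto_zero]
  refine ⟨fun h => by simpa using h.pow 2, fun h => ?_⟩
  have := (Real.continuous_sqrt.tendsto 0).comp h
  rw [Real.sqrt_zero] at this
  exact this.congr fun n => Real.sqrt_sq (norm_nonneg _)

end Lp

namespace LangevinSystem

open Filter Topology

variable {d : ℕ} (S : LangevinSystem d)

/-- The normalized momentum, in the flat space. -/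
def unitMomentum (j : Fin d) : Lp ℂ 2 (volume : Measure (Phase d)) :=
  (S.momentumScale : ℂ) • (S.memLp_momentumState j).toLp (S.momentumState j)

theorem momentumScale_pos : 0 < S.momentumScale :=
  div_pos (Real.sqrt_pos.mpr (div_pos S.invTemp_pos S.mass_pos))
    (Real.sqrt_pos.mpr S.partition_pos)

theorem exists_testFn_near {x : Lp ℂ 2 (volume : Measure (Phase d)) × Lp ℂ 2 (volume : Measure (Phase d))}
    (hx : x ∈ S.flatGraph) {δ : ℝ} (hδ : 0 < δ) :
    ∃ (φ : Phase d → ℂ) (hφ : TestFn φ), ‖(hφ.memLp (μ := volume) 2).toLp φ - x.1‖ ≤ δ ∧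
      ‖((S.testFn_signedExpr hφ 1).memLp (μ := volume) 2).toLp _ - x.2‖ ≤ δ := by
  obtain ⟨φ, hφ, h1, h2⟩ := S.exists_seq_of_mem_flatGraph hx
  have hδ' : (0 : ℝ≥0∞) < ENNReal.ofReal δ := ENNReal.ofReal_pos.mpr hδ
  obtain ⟨n, hn1, hn2⟩ := ((h1.eventually_lt_const hδ').and (h2.eventually_lt_const hδ')).exists
  have e : ∀ {f : Phase d → ℂ} (hf : MemLp f 2 volume) (y : Lp ℂ 2 (volume : Measure (Phase d))),
      eLpNorm (f - ⇑y) 2 volume < ENNReal.ofReal δ → ‖hf.toLp f - y‖ ≤ δ := by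
    intro f hf y h
    rw [Lp.norm_def]
    refine ENNReal.toReal_le_of_le_ofReal hδ.le (le_of_eq_of_le ?_ h.le)
    refine eLpNorm_congr_ae ?_
    filter_upwards [Lp.coeFn_sub (hf.toLp f) y, hf.coeFn_toLp] with x h1 h2
    rw [h1, Pi.sub_apply, h2, Pi.sub_apply]
  exact ⟨φ n, hφ n, e _ _ hn1, e _ _ hn2⟩

theorem tendsto_zero_of_approximate_eigenvectors (hV : WeaklyElliptic S.potential) (j : Fin d)
    {z : ℂ} (hz : z.re = 0) (hz0 : z ≠ 0) (u : ℕ → S.flatKolmogorov.domain) (a : ℕ → ℂ) (C : ℝ)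
    (hu : ∀ n, ‖u n‖ ≤ 1) (ha : ∀ n, ‖a n‖ ≤ C)
    (horth : ∀ n, inner ℂ (S.unitMomentum j) (u n : Lp ℂ 2 (volume : Measure (Phase d))) = 0)
    (hlim : Tendsto (fun n => S.flatKolmogorov (u n) - z • (u n : Lp ℂ 2 (volume : Measure (Phase d)))
      - a n • S.unitMomentum j) atTop (𝓝 0)) :
    Tendsto (fun n => (u n : Lp ℂ 2 (volume : Measure (Phase d)))) atTop (𝓝 0) := by
  -- Domain elements are replaced by test functions at graph distance `1/(n + 1)`, which changes
  -- neither the approximate equation nor the limit.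
  choose φ hφ h1 h2 using fun n : ℕ => S.exists_testFn_near (S.flatKolmogorov_mem (u n))
    (δ := 1 / ((n : ℝ) + 1)) (by positivity)
  have h1' := squeeze_zero_norm h1 tendsto_one_div_add_atTop_nhds_zero_nat
  have h2' := squeeze_zero_norm h2 tendsto_one_div_add_atTop_nhds_zero_nat
  have hm := fun n => (hφ n).memLp (μ := volume) 2
  have hA := fun n => (S.testFn_signedExpr (hφ n) 1).memLp (μ := volume) 2
  have hq : S.Quasimode j z φ fun n => a n * S.momentumScale := by
    -- The bound `4` is the square of `‖φ_n‖ ≤ ‖u_n‖ + 1/(n + 1) ≤ 2`.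
    refine ⟨hφ, ⟨hm, 4, fun n => ?_⟩, ⟨C * ‖(S.momentumScale : ℂ)‖, fun n => ?_⟩, ?_, ?_⟩
    · rw [← norm_toLp_sq (hm n)]
      have h3 : ‖(hm n).toLp (φ n)‖ ≤ 2 := by
        have h4 := norm_le_norm_sub_add ((hm n).toLp (φ n)) (u n : Lp ℂ 2 (volume : Measure (Phase d)))
        have h5 : 1 / ((n : ℝ) + 1) ≤ 1 := by
          rw [div_le_one (by positivity)]
          linarith [n.cast_nonneg (α := ℝ)]
        have h6 : ‖(u n : Lp ℂ 2 (volume : Measure (Phase d)))‖ ≤ 1 := hu n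
        have h7 := h1 n
        simp only at h7
        linarith
      nlinarith [norm_nonneg ((hm n).toLp (φ n))]
    · rw [norm_mul]
      exact mul_le_mul_of_nonneg_right (ha n) (norm_nonneg _)
    · have hr : ∀ n, MemLp (fun x => S.signedExpr 1 (φ n) x - z * φ n x
          - a n * S.momentumScale * S.momentumState j x) 2 := fun n =>
        ((hA n).sub ((hm n).const_mul z)).sub ((S.memLp_momentumState j).const_mul _)
      refine (tendsto_toLp_iff hr).mp ?_
      have h3 := (hlim.add h2').sub (h1'.const_smul z)
      simp only [add_zero, smul_zero, sub_zero] at h3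
      refine h3.congr fun n => ?_
      have e : (hr n).toLp _ = (hA n).toLp _ - z • (hm n).toLp _
          - (a n * S.momentumScale) • (S.memLp_momentumState j).toLp (S.momentumState j) := rfl
      rw [e, unitMomentum, smul_smul, smul_sub]
      abel
    · have hc : (S.momentumScale : ℂ) ≠ 0 := Complex.ofReal_ne_zero.mpr S.momentumScale_pos.ne'
      have h3 : Tendsto (fun n => inner ℂ (S.unitMomentum j) ((hm n).toLp (φ n)
          - (u n : Lp ℂ 2 (volume : Measure (Phase d))))) atTop (𝓝 0) := by
        have := (innerSL ℂ (S.unitMomentum j)).continuous.tendsto 0 |>.comp h1'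
        rwa [map_zero] at this
      have h4 := h3.const_mul (S.momentumScale : ℂ)⁻¹
      rw [mul_zero] at h4
      refine h4.congr fun n => ?_
      rw [inner_sub_right, horth, sub_zero, unitMomentum, inner_smul_left, Complex.conj_ofReal,
        inv_mul_cancel_left₀ hc, L2.inner_def]
      refine integral_congr_ae ?_
      filter_upwards [(S.memLp_momentumState j).coeFn_toLp, (hm n).coeFn_toLp] with x h5 h6
      rw [h5, h6, RCLike.inner_apply, conj_momentumState, mul_comm]
  have h3 := ((tendsto_toLp_iff hm).mpr (hq.null_modes hV hz hz0)).sub h1'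
  rw [sub_zero] at h3
  exact h3.congr fun n => sub_sub_cancel _ _

/-- Specializes `mem_pmapResolventSet_sandwich` to the unit momentum: the vector `w` is the image of
the momentum state under the formal adjoint, and `l₀ = κ c d` is the threshold above which weak
solutions are unique. -/
theorem pmapSpectrum_orthogonalGenerator_subset (hV : WeaklyElliptic S.potential) (j : Fin d) :
    pmapSpectrum (S.orthogonalGenerator (moriProjection fun _ : Fin 1 => S.U (S.unitMomentum j))) ∩
      {z : ℂ | z.re = 0} ⊆ {0} := by
  rintro z ⟨hz, hre⟩
  by_contra h0
  refine hz ?_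
  have hmem := S.momentumState_mem_flatGraph hV j
  obtain ⟨hdom, -⟩ := S.exists_flatKolmogorov_eq (S.flatGraph.smul_mem (S.momentumScale : ℂ) hmem)
  refine mem_pmapResolventSet_sandwich (v := S.unitMomentum j)
    (w := (S.momentumScale : ℂ) • (S.memLp_signedExpr_momentumState hV j (-1)).toLp _)
    (l₀ := S.kap * S.cc * d)
    (fun u => S.re_inner_nonneg_of_mem_flatGraph (S.flatKolmogorov_mem u)) (fun l hl f => ?_)
    (S.norm_smul_momentumState j) hdom (fun u => ?_) (fun u => ?_) hre h0
    (S.tendsto_zero_of_approximate_eigenvectors hV j hre h0)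
  · obtain ⟨x, hx, he⟩ := S.exists_mem_flatGraph_add hl f
    obtain ⟨hu, hT⟩ := S.exists_flatKolmogorov_eq hx
    exact ⟨⟨x.1, hu⟩, by rw [hT, he]⟩
  · rw [unitMomentum, inner_smul_left, inner_smul_left,
      S.inner_momentumState_of_mem_flatGraph hV j (S.flatKolmogorov_mem u)]
  · rw [flatten_one_sub_apply, flatten_apply, moriProjection_apply, Fin.sum_univ_one, map_smul,
      LinearIsometryEquiv.symm_apply_apply, LinearIsometryEquiv.inner_map_map]

end LangevinSystem

end

theorem mainTheorem7 {d : ℕ} (S : LangevinSystem d) (hV : WeaklyElliptic S.potential) :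
    (∀ (m : ℕ) (v w : Fin m → Lp ℂ 2 S.gibbs),
      Orthonormal ℂ v →
      (∀ i, ∫ x, v i x ∂S.gibbs = 0) →
      (∀ i j, inner ℂ (w j) (v i) = 0) →
      (∀ j, ∃ h : w j ∈ S.kolmogorov.domain, S.kolmogorov ⟨w j, h⟩ = v j) →
      pmapKer (S.orthogonalGenerator (moriProjection v)) =
        pmapKer S.flatKolmogorov ⊔
          LinearMap.range (S.flatten (moriProjection v)).toLinearMap ⊔
          Submodule.span ℂ (Set.range fun j => S.U.symm (w j))) ∧
    (∀ j : Fin d, ∃ v : Lp ℂ 2 S.gibbs,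
      (v =ᵐ[S.gibbs] fun x => ((√(S.invTemp / S.mass) * x.2 j : ℝ) : ℂ)) ∧
      ‖v‖ = 1 ∧
      pmapSpectrum (S.orthogonalGenerator (moriProjection fun _ : Fin 1 => v)) ∩
        {z : ℂ | z.re = 0} ⊆ {0}) := by
  refine ⟨fun m v w hv hmean horth hw => S.pmapKer_orthogonalGenerator hv hmean horth hw,
    fun j => ⟨S.U (S.unitMomentum j), S.U_momentumState_ae_eq j, ?_,
      S.pmapSpectrum_orthogonalGenerator_subset hV j⟩⟩
  rw [LinearIsometryEquiv.norm_map]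
  exact S.norm_smul_momentumState j
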